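/- Fix $s\in\mathbb N$, a non-constant polynomial $f:\mathbb R^s\to\mathbb R$ and a probability measure $\rho$ on $\mathbb R$, none of which depends on $d$. For $d\ge s$ and $W_*\in\mathbb R^{d\times s}$ with $W_*^{\mathsf T}W_*=I_s$, let $z$ be uniform on the unit sphere $\mathbb S^{d-1}$, let $x=\sqrt d\,z$, and let $y=f(W_*^{\mathsf T}x)+\varepsilon$ with $\varepsilon\sim\rho$ independent of $z$. A strict subframe of $W_*$ is a matrix $U\in\mathbb R^{d\times k}$ with orthonormal columns (possibly $k=0$) whose column span is a proper subspace of that of $W_*$. For such $U$ let $U_\perp\in\mathbb R^{d\times(d-k)}$ be an orthonormal basis of the orthogonal complement of its span, and put $d_U=d-k$, $$r_U=U^{\mathsf T}z,\qquad z_U=\frac{U_\perp^{\mathsf T}z}{\sqrt{1-\|r_U\|^2}}\in\mathbb S^{d_U-1},\qquad y_U=(y,r_U),$$ $$\xi_{U,2}(y_U)=\mathbb E\big[\mathcal H_{d_U,2}(z_U)\,\big|\,y_U\big],\qquad \mathcal H_{D,2}(z)=\sqrt{\tfrac{D(D+2)}2}\,\Big(zz^{\mathsf T}-\tfrac1D I_D\Big),\qquad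 \|\xi_{U,2}\|_{L^2}^2=\mathbb E\|\xi_{U,2}(y_U)\|_{\mathsf F}^2 .$$ Assume that the problem is well posed: for all large $d$, all $W_*$ and every strict subframe $U$ of $W_*$, the variables $y_U$ and $z_U$ are not independent. For matrices $U,V$ with orthonormal columns write $\mathrm{dist}(U,V)=\|UU^{\mathsf T}-VV^{\mathsf T}\|_{\rm op}$. **(i)** There are constants $0<c\le C<\infty$ (depending only on $s,f,\rho$) such that for all sufficiently large $d$, all $W_*$ and all strict subframes $U$ of $W_*$, $\ c\le\|\xi_{U,2}\|_{L^2}^2\le C$. **(ii)** Consequently, degree-2 iterative harmonic unfolding recovers $W_*$ with $n\asymp d$ samples and runtime $\asymp d^2\log d$, in the following sense. *Algorithm.* Let $0=\sigma_0<\sigma_1<\dots<\sigma_T=s$ and, for each $t<T$, let $K_t(y,y')=\sum_{a\le m}\mathcal T_{t,a}(y)\mathcal T_{t,a}(y')$ be a kernel on $\mathbb R\times\mathbb R^{\sigma_t}$. Start from the empty frame $\widehat U_{\le 0}$. At step $t<T$, given $\widehat U=\widehat U_{\le t}\in\mathbb R^{d\times\sigma_t}$, take a fresh batch of $n$ i.i.d.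 samples $(y_i,z_i)$, compute $\hat y_i=(y_i,\widehat U^{\mathsf T}z_i)$ and $\hat z_i=\widehat U_\perp^{\mathsf T}z_i/\sqrt{1-\|\widehat U^{\mathsf T}z_i\|^2}$, let $V$ consist of orthonormal eigenvectors for the $\sigma_{t+1}-\sigma_t$ largest eigenvalues of $$\widehat M=\frac1{n^2}\sum_{i,j=1}^nK_t(\hat y_i,\hat y_j)\,\mathcal H_{d-\sigma_t,2}(\hat z_i)\,\mathcal H_{d-\sigma_t,2}(\hat z_j)^{\mathsf T},$$ let $X$ consist of orthonormal eigenvectors for the $\sigma_{t+1}-\sigma_t$ largest eigenvalues of $VV^{\mathsf T}$, and set $\widehat U_{\le t+1}=[\widehat U,\ \widehat U_\perp X]$. The output is $\widehat W=\widehat U_{\le T}$. *Implementation.* Replace the eigenvector computation in each step by $\lceil\kappa\log d\rceil$ rounds of subspace power iteration (multiplication by $\widehat M$ through the factorization of $K_t$ into features, then Gram–Schmidt), started from vectors with independent standard Gaussian entries projected onto the orthogonal complement of the current frame. The runtime is the total number of elementary operations: arithmetic operations on reals, square roots, and evaluations of a feature $\mathcal T_{t,a}$. *Claim.* For all $\delta,A>0$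 there are $T\le s$, ranks $0=\sigma_0<\dots<\sigma_T=s$, integers $m$ and $N\ge1$, and constants $B,\kappa,c,c_1,C_1$ with $\kappa,c,c_1>0$ such that for every sufficiently large $d$ there are features, not depending on $W_*$, for which every $K_t$ is measurable, bounded in absolute value by $B$, and invariant under $((y,r),(y',r'))\mapsto((y,Qr),(y',Qr'))$ for orthogonal $Q$, and with $n=Nd$ samples per step the following holds for every $W_*$: (a) outside an event of probability at most $\exp(-d^{c})$ the algorithm can be run and every possible output (whatever eigenvectors and bases are chosen) satisfies $\mathrm{dist}(\widehat W,W_*)\le\delta$; (b) the output of the implementation satisfies $\mathrm{dist}(\widehat W,W_*)\le\delta$ with probability at least $1-d^{-A}$ over the samples and the independent starting vectors; (c) the runtime of the implementation is, for every input, between $c_1d^2\log d$ and $C_1d^2\log d$. -/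

import Mathlib

open MeasureTheory ProbabilityTheory Matrix Filter

noncomputable section

namespace SphericalMIM

/-- Vectors of `ℝ^d`, with their coordinates. Lengths are always Euclidean and are written out
through `⬝ᵥ`; the sup norm of the function space is never used. -/
abbrev Vec (d : ℕ) := Fin d → ℝ

/-- The uniform probability measure `τ_d` on the unit sphere of `ℝ^d`, as a measure on `ℝ^d`:
the normalized surface measure of the Euclidean unit sphere. -/
def sphereUniform (d : ℕ) : Measure (Vec d) :=
  ((volume : Measure (EuclideanSpace ℝ (Fin d))).toSphere Set.univ)⁻¹ •
    ((volume : Measure (EuclideanSpace ℝ (Fin d))).toSphere).map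
      (fun z : Metric.sphere (0 : EuclideanSpace ℝ (Fin d)) 1 =>
        WithLp.ofLp (z : EuclideanSpace ℝ (Fin d)))

/-- `U` is an orthonormal `k`-frame of `ℝ^d`. -/
def IsFrame {d k : ℕ} (U : Matrix (Fin d) (Fin k) ℝ) : Prop :=
  Uᵀ * U = 1

/-- `Up` is an orthonormal basis of the orthogonal complement of the span of the frame `U`. -/
def IsComplement {d k : ℕ} (U : Matrix (Fin d) (Fin k) ℝ) (Up : Matrix (Fin d) (Fin (d - k)) ℝ) :
    Prop :=
  IsFrame Up ∧ Uᵀ * Up = 0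

/-- `U` is a strict subframe of `W`: a frame whose column span is a proper subspace of the
column span of `W`. The empty frame is allowed. -/
def IsStrictSubframe {d k s : ℕ} (U : Matrix (Fin d) (Fin k) ℝ) (W : Matrix (Fin d) (Fin s) ℝ) :
    Prop :=
  IsFrame U ∧ LinearMap.range U.mulVecLin < LinearMap.range W.mulVecLin

/-- Operator norm distance between the orthogonal projections onto the spans of two frames. -/
def frameDist {d k l : ℕ} (U : Matrix (Fin d) (Fin k) ℝ) (V : Matrix (Fin d) (Fin l) ℝ) : ℝ :=
  ‖Matrix.toEuclideanCLM (n := Fin d) (𝕜 := ℝ) (U * Uᵀ - V * Vᵀ)‖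

/-! ### The model -/

/-- The spherical multi-index model with link `ν` and support `W`: the law of `(y, z)` where
`z` is uniform on the sphere and `y` given `z` has law `ν (Wᵀ z)`. -/
def model {Y : Type*} [MeasurableSpace Y] {d s : ℕ} (ν : Kernel (Vec s) Y)
    (W : Matrix (Fin d) (Fin s) ℝ) : Measure (Y × Vec d) :=
  ((sphereUniform d) ⊗ₘ (ν.comap (fun z : Vec d => Wᵀ *ᵥ z)
    (Continuous.measurable (by fun_prop)))).map Prod.swap

/-- The link of `y = f (Wᵀ x) + ε` with `x = √d • z`, where `ε` has law `ρ` and is independent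
of `z`: at `t = Wᵀ z` it is the law of `f (√d • t) + ε`. -/
def polyLink (d : ℕ) {s : ℕ} (f : MvPolynomial (Fin s) ℝ) (ρ : Measure ℝ) : Kernel (Vec s) ℝ :=
  ((Kernel.deterministic id measurable_id) ×ₖ (Kernel.const (Vec s) ρ)).map
    (fun p : Vec s × ℝ => MvPolynomial.eval (Real.sqrt d • p.1) f + p.2)

/-- The law of `(y, z)` in the polynomial model. -/
abbrev polyModel {d s : ℕ} (f : MvPolynomial (Fin s) ℝ) (ρ : Measure ℝ)
    (W : Matrix (Fin d) (Fin s) ℝ) : Measure (ℝ × Vec d) :=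
  model (polyLink d f ρ) W

/-! ### Reduced models and their second harmonic coefficient -/

/-- The response `y_U = (y, r_U)` of the reduced model, with `r_U = Uᵀ z`. -/
def reducedResponse {Y : Type*} {d k : ℕ} (U : Matrix (Fin d) (Fin k) ℝ) (p : Y × Vec d) :
    Y × Vec k :=
  (p.1, Uᵀ *ᵥ p.2)

/-- The input `z_U = U_⊥ᵀ z / √(1 - ‖Uᵀ z‖²)` of the reduced model. -/
def reducedInput {Y : Type*} {d k : ℕ} (U : Matrix (Fin d) (Fin k) ℝ)
    (Up : Matrix (Fin d) (Fin (d - k)) ℝ) (p : Y × Vec d) : Vec (d - k) :=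
  (Real.sqrt (1 - (Uᵀ *ᵥ p.2) ⬝ᵥ (Uᵀ *ᵥ p.2)))⁻¹ • (Upᵀ *ᵥ p.2)

/-- The degree two harmonic tensor on the unit sphere of `ℝ^D`, namely
`κ_{D,2} √N_{D,2} P_tf (z ⊗ z) = √(D (D + 2) / 2) (z zᵀ - I / D)`; here `κ_{D,2}² = D / (D - 1)` and
`N_{D,2} = (D + 2) (D - 1) / 2` is the dimension of the space of degree two harmonics. -/
def harmonicTwo {D : ℕ} (z : Vec D) : Matrix (Fin D) (Fin D) ℝ :=
  Real.sqrt ((D : ℝ) * (D + 2) / 2) • (vecMulVec z z - (1 / (D : ℝ)) • (1 : Matrix (Fin D) (Fin D) ℝ))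

/-- The second harmonic coefficient `ξ_{U,2}(y_U) = E[H_2(z_U) | y_U]` of the reduced model, as a
random matrix on the probability space of `(y, z)`. -/
def xiTwo {Y : Type*} [MeasurableSpace Y] {d k : ℕ} (μ : Measure (Y × Vec d))
    (U : Matrix (Fin d) (Fin k) ℝ) (Up : Matrix (Fin d) (Fin (d - k)) ℝ) (p : Y × Vec d) :
    Matrix (Fin (d - k)) (Fin (d - k)) ℝ :=
  fun i j =>
    (μ[fun p' : Y × Vec d => harmonicTwo (reducedInput U Up p') i j |
      MeasurableSpace.comap (reducedResponse (Y := Y) U) inferInstance]) p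

/-- `‖ξ_{U,2}‖²_{L²}`, the expected squared Frobenius norm. -/
def xiTwoNormSq {Y : Type*} [MeasurableSpace Y] {d k : ℕ} (μ : Measure (Y × Vec d))
    (U : Matrix (Fin d) (Fin k) ℝ) (Up : Matrix (Fin d) (Fin (d - k)) ℝ) : ℝ :=
  ∫ p, ∑ i, ∑ j, (xiTwo μ U Up p i j) ^ 2 ∂μ

/-! ### Degree two iterative unfolding

After `t` steps a frame with `σ t` columns has been recovered. The step uses the finite rank kernel
`K_t(y, y') = ∑ a, feat t a y * feat t a y'` on the responses `y = (y, r)` of the reduced model. -/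

/-- The kernel with the given features. -/
def featureKernel {m k : ℕ} (feat : Fin m → ℝ → Vec k → ℝ) (p p' : ℝ × Vec k) : ℝ :=
  ∑ a, feat a p.1 p.2 * feat a p'.1 p'.2

/-- The features are measurable and the kernel is bounded by `B` and invariant under
simultaneous rotation of the coordinates `r = Uᵀ z` of the recovered directions, so that it
coincides with its average over the orthogonal group. -/
def IsAdmissible {m k : ℕ} (B : ℝ) (feat : Fin m → ℝ → Vec k → ℝ) : Prop :=
  (∀ a, Measurable (fun p : ℝ × Vec k => feat a p.1 p.2)) ∧
  (∀ p p', |featureKernel feat p p'| ≤ B) ∧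
  ∀ Q ∈ Matrix.orthogonalGroup (Fin k) ℝ, ∀ y r y' r',
    featureKernel feat (y, Q *ᵥ r) (y', Q *ᵥ r') = featureKernel feat (y, r) (y', r')

/-- The empirical matrix `n⁻² ∑_{i,j} K(y_i, y_j) H_2(z_i) H_2(z_j)ᵀ` (unfolding shape `(1,1)`). -/
def empiricalMatrix {m k n D : ℕ} (feat : Fin m → ℝ → Vec k → ℝ) (y : Fin n → ℝ × Vec k)
    (z : Fin n → Vec D) : Matrix (Fin D) (Fin D) ℝ :=
  (1 / (n : ℝ) ^ 2) • ∑ i, ∑ j,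
    featureKernel feat (y i) (y j) • (harmonicTwo (z i) * (harmonicTwo (z j))ᵀ)

/-- The columns of `V` are orthonormal eigenvectors of the symmetric matrix `M` for its
`p` largest eigenvalues. -/
def IsTopEigenframe {D p : ℕ} (M : Matrix (Fin D) (Fin D) ℝ) (V : Matrix (Fin D) (Fin p) ℝ) :
    Prop :=
  IsFrame V ∧ ∃ eig : Fin p → ℝ, (∀ j, M *ᵥ (Vᵀ j) = eig j • Vᵀ j) ∧
    ∀ x : Vec D, Vᵀ *ᵥ x = 0 → ∀ j, x ⬝ᵥ (M *ᵥ x) ≤ eig j * (x ⬝ᵥ x)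

/-- Append the vectors `X` to the vectors `U`. -/
def extend {d k k' : ℕ} (U : Fin k → Vec d) (X : Fin (k' - k) → Vec d) : Fin k' → Vec d :=
  fun j => if h : j.val < k then U ⟨j.val, h⟩ else X ⟨j.val - k, by omega⟩

/-- One step of the algorithm from the current frame `U` to the next frame `U'`: take the top
eigenvectors `V` of the empirical matrix of the reduced samples, contract them to `V Vᵀ`, take its
top eigenvectors `X`, and append the lifted vectors `U_⊥ X`. -/
def IsUnfoldingStep {m d n k k' : ℕ} (feat : Fin m → ℝ → Vec k → ℝ) (data : Fin n → ℝ × Vec d)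
    (U : Matrix (Fin d) (Fin k) ℝ) (U' : Matrix (Fin d) (Fin k') ℝ) : Prop :=
  ∃ (Up : Matrix (Fin d) (Fin (d - k)) ℝ) (V X : Matrix (Fin (d - k)) (Fin (k' - k)) ℝ),
    IsComplement U Up ∧
    IsTopEigenframe (empiricalMatrix feat (fun i => reducedResponse U (data i))
      (fun i => reducedInput U Up (data i))) V ∧
    IsTopEigenframe (V * Vᵀ) X ∧
    U'ᵀ = extend Uᵀ (Up * X)ᵀ

/-- `U 0, …, U T` is a run of the multi-step algorithm, with a fresh batch of samples at each
step; the output of the run is `U T`. -/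
def IsUnfoldingRun {m d n T : ℕ} {σ : ℕ → ℕ} (feat : (t : ℕ) → Fin m → ℝ → Vec (σ t) → ℝ)
    (data : Fin T → Fin n → ℝ × Vec d) (U : (t : ℕ) → Matrix (Fin d) (Fin (σ t)) ℝ) : Prop :=
  ∀ t : Fin T, IsUnfoldingStep (feat t) (data t) (U t) (U (t + 1))

/-- The law of `T` independent batches of `n` independent samples of the law `μ`. -/
def dataLaw {d : ℕ} (T n : ℕ) (μ : Measure (ℝ × Vec d)) :
    Measure (Fin T → Fin n → ℝ × Vec d) :=
  Measure.pi fun _ => Measure.pi fun _ => μ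

/-! ### An implementation with a step count

Programs over real numbers that count elementary operations: each arithmetic operation, square root
and evaluation of one kernel feature costs one step. The features take a number of real arguments
that does not grow with `d`. -/

/-- A value computed with a given number of elementary operations. -/
structure Timed (α : Type) where
  val : α
  cost : ℕ

namespace Timed

/-- Sequential composition adds the costs. -/
instance : Monad Timed where
  pure a := ⟨a, 0⟩
  bind x g := ⟨(g x.val).val, x.cost + (g x.val).cost⟩

def add (x y : ℝ) : Timed ℝ := ⟨x + y, 1⟩
def sub (x y : ℝ) : Timed ℝ := ⟨x - y, 1⟩
def mul (x y : ℝ) : Timed ℝ := ⟨x * y, 1⟩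
def div (x y : ℝ) : Timed ℝ := ⟨x / y, 1⟩
def sqrt (x : ℝ) : Timed ℝ := ⟨Real.sqrt x, 1⟩

/-- Evaluation of one kernel feature. -/
def feature {k : ℕ} (g : ℝ → Vec k → ℝ) (y : ℝ) (r : Vec k) : Timed ℝ := ⟨g y r, 1⟩

/-- Compute the entries of an array one after the other. -/
def array {α : Type} {n : ℕ} (g : Fin n → Timed α) : Timed (Fin n → α) :=
  ⟨fun i => (g i).val, ∑ i, (g i).cost⟩

/-- Compute `n` numbers and add them up, with `n` additions. -/
def sum {n : ℕ} (g : Fin n → Timed ℝ) : Timed ℝ :=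
  ⟨∑ i, (g i).val, ∑ i, (g i).cost + n⟩

/-- Repeat a program `q` times. -/
def iterate {α : Type} (g : α → Timed α) : ℕ → α → Timed α
  | 0, x => pure x
  | q + 1, x => do
      let x' ← iterate g q x
      g x'

def dot {d : ℕ} (u v : Vec d) : Timed ℝ := sum fun i => mul (u i) (v i)

/-- `v - ∑_j ⟨Q_j, v⟩ Q_j`. -/
def projectOut {d k : ℕ} (Q : Fin k → Vec d) (v : Vec d) : Timed (Vec d) := do
  let a ← array fun j => dot (Q j) v
  array fun i => do
    let b ← sum fun j => mul (a j) (Q j i)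
    sub (v i) b

/-- `v / ‖v‖₂`. -/
def normalize {d : ℕ} (v : Vec d) : Timed (Vec d) := do
  let a ← dot v v
  let b ← sqrt a
  array fun i => div (v i) b

/-- Gram–Schmidt orthonormalization. -/
def gramSchmidt {d : ℕ} : (p : ℕ) → (Fin p → Vec d) → Timed (Fin p → Vec d)
  | 0, X => pure X
  | p + 1, X => do
      let Q ← gramSchmidt p (fun j => X j.castSucc)
      let w ← projectOut Q (X (Fin.last p))
      let u ← normalize w
      pure (Fin.snoc Q u)

/-- The product `S v` with `S = n⁻¹ ∑_i τ_i H_2(z_i)`, for unit vectors `z_i` and `v` in a common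
`D`-dimensional subspace of `ℝ^d`, without forming the matrices `H_2(z_i)`. -/
def applyS {d n : ℕ} (D : ℕ) (τ : Fin n → ℝ) (z : Fin n → Vec d) (v : Vec d) : Timed (Vec d) := do
  let c ← array fun i => do
    let a ← dot (z i) v
    mul (τ i) a
  let τsum ← sum fun i => (pure (τ i) : Timed ℝ)
  let shift ← div τsum D
  let D2 ← add D 2
  let D3 ← mul D D2
  let D4 ← div D3 2
  let D5 ← sqrt D4
  let scale ← div D5 n
  array fun l => do
    let a ← sum fun i => mul (c i) (z i l)
    let b ← mul shift (v l)
    let e ← sub a b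
    mul scale e

/-- The product of the empirical matrix `∑_a S_a²` with `v`. -/
def applyM {d n m : ℕ} (D : ℕ) (τ : Fin m → Fin n → ℝ) (z : Fin n → Vec d) (v : Vec d) :
    Timed (Vec d) := do
  let ys ← array fun a => do
    let u ← applyS D (τ a) z v
    applyS D (τ a) z u
  array fun l => sum fun a => (pure (ys a l) : Timed ℝ)

/-- One step of the algorithm, with the eigenvectors computed by `q` rounds of subspace power
iteration started from `init`. The reduced inputs are kept as vectors of `ℝ^d` orthogonal to
the current frame, so the lift by `U_⊥` is implicit; for shape `(1,1)` the contraction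
`V Vᵀ` has the computed vectors as its top eigenvectors. -/
def unfoldingStep {m d n k k' : ℕ} (q : ℕ) (feat : Fin m → ℝ → Vec k → ℝ)
    (data : Fin n → ℝ × Vec d) (U : Fin k → Vec d) (init : Fin (k' - k) → Vec d) :
    Timed (Fin k' → Vec d) := do
  let r ← array fun i => array fun j => dot (U j) (data i).2
  let z ← array fun i => do
    let w ← projectOut U (data i).2
    normalize w
  let τ ← array fun a => array fun i => feature (feat a) (data i).1 (r i)
  let X₀ ← array fun j => projectOut U (init j)
  let X₁ ← gramSchmidt (k' - k) X₀
  let X ← iterate (fun X => do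
    let Y ← array fun j => applyM (d - k) τ z (X j)
    gramSchmidt (k' - k) Y) q X₁
  pure (extend U X)

/-- The multi-step algorithm, run for `t` steps. -/
def unfolding {m d n T : ℕ} {σ : ℕ → ℕ} (q : ℕ) (feat : (t : ℕ) → Fin m → ℝ → Vec (σ t) → ℝ)
    (data : Fin T → Fin n → ℝ × Vec d)
    (init : (t : Fin T) → Fin (σ (t + 1) - σ t) → Vec d) :
    (t : ℕ) → t ≤ T → Timed (Fin (σ t) → Vec d)
  | 0, _ => pure fun _ => 0
  | t + 1, h => do
      let U ← unfolding q feat data init t (Nat.le_of_succ_le h)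
      unfoldingStep q (feat t) (data ⟨t, h⟩) U (init ⟨t, h⟩)

end Timed

/-- The starting vectors of the power iterations have independent standard Gaussian entries. -/
def initLaw (d T : ℕ) (σ : ℕ → ℕ) :
    Measure ((t : Fin T) → Fin (σ (t + 1) - σ t) → Vec d) :=
  Measure.pi fun _ => Measure.pi fun _ => Measure.pi fun _ => gaussianReal 0 1

end SphericalMIM

end

noncomputable section

namespace SphericalMIM

attribute [local instance] Matrix.frobeniusNormedAddCommGroup Matrix.frobeniusNormedSpace

variable {d k l m n p s : ℕ}

/-- Real matrices, with their entries. -/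
abbrev Mat (m n : ℕ) := Matrix (Fin m) (Fin n) ℝ

/-! ### Euclidean length of vectors and Frobenius norm of matrices -/

/-- The Euclidean length of a vector. -/
def nrm (v : Vec d) : ℝ := ‖WithLp.toLp 2 v‖

lemma nrm_nonneg (v : Vec d) : 0 ≤ nrm v := norm_nonneg _

lemma dot_self_eq_nrm_sq (v : Vec d) : v ⬝ᵥ v = nrm v ^ 2 := by
  rw [nrm, EuclideanSpace.norm_sq_eq]
  simp [dotProduct, sq]

lemma nrm_eq_sqrt (v : Vec d) : nrm v = √(v ⬝ᵥ v) := by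
  rw [dot_self_eq_nrm_sq, Real.sqrt_sq (nrm_nonneg v)]

lemma dot_self_nonneg (v : Vec d) : 0 ≤ v ⬝ᵥ v := by
  rw [dot_self_eq_nrm_sq]; positivity

lemma dot_eq_inner (u v : Vec d) :
    u ⬝ᵥ v = inner ℝ (WithLp.toLp 2 v) (WithLp.toLp 2 u) := by
  simp [EuclideanSpace.inner_eq_star_dotProduct]

lemma abs_dot_le (u v : Vec d) : |u ⬝ᵥ v| ≤ nrm u * nrm v := by
  rw [dot_eq_inner, mul_comm]
  exact abs_real_inner_le_norm _ _

lemma nrm_add_le (u v : Vec d) : nrm (u + v) ≤ nrm u + nrm v := by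
  simpa [nrm] using norm_add_le (WithLp.toLp 2 u) (WithLp.toLp 2 v)

lemma nrm_smul (a : ℝ) (v : Vec d) : nrm (a • v) = |a| * nrm v := by
  simp [nrm, norm_smul]

lemma nrm_neg (v : Vec d) : nrm (-v) = nrm v := by
  simp [nrm]

lemma abs_nrm_sub_nrm_le (u v : Vec d) : |nrm u - nrm v| ≤ nrm (u - v) := by
  simpa [nrm] using abs_norm_sub_norm_le (WithLp.toLp 2 u) (WithLp.toLp 2 v)

@[simp] lemma nrm_zero : nrm (0 : Vec d) = 0 := by simp [nrm]

lemma nrm_eq_zero {v : Vec d} : nrm v = 0 ↔ v = 0 := by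
  simp [nrm]

lemma nrm_pos {v : Vec d} (h : v ≠ 0) : 0 < nrm v :=
  lt_of_le_of_ne (nrm_nonneg v) fun h0 => h (nrm_eq_zero.1 h0.symm)

lemma abs_apply_le_nrm (v : Vec d) (i : Fin d) : |v i| ≤ nrm v := by
  simpa [nrm] using PiLp.norm_apply_le (WithLp.toLp 2 v) i

@[fun_prop]
lemma continuous_nrm : Continuous (nrm : Vec d → ℝ) := by
  unfold nrm
  fun_prop

@[fun_prop]
lemma measurable_nrm : Measurable (nrm : Vec d → ℝ) := continuous_nrm.measurable

/-- The vector in the direction of `v`, of length one unless `v = 0`. -/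
def direction (v : Vec d) : Vec d := (nrm v)⁻¹ • v

lemma nrm_direction {v : Vec d} (h : v ≠ 0) : nrm (direction v) = 1 := by
  have := nrm_pos h
  rw [direction, nrm_smul, abs_of_pos (by positivity)]
  field_simp

lemma nrm_direction_le (v : Vec d) : nrm (direction v) ≤ 1 := by
  by_cases h : v = 0
  · simp [direction, h]
  · exact (nrm_direction h).le

@[fun_prop]
lemma measurable_direction : Measurable (direction : Vec d → Vec d) := by
  unfold direction
  fun_prop

lemma frob_sq (A : Mat m n) : ‖A‖ ^ 2 = ∑ i, ∑ j, A i j ^ 2 := by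
  rw [frobenius_norm_def, ← Real.sqrt_eq_rpow, Real.sq_sqrt (by positivity)]
  simp

lemma frob_sq_eq_sum_nrm_col (A : Mat m n) :
    ‖A‖ ^ 2 = ∑ j, nrm (Aᵀ j) ^ 2 := by
  rw [frob_sq, Finset.sum_comm]
  refine Finset.sum_congr rfl fun j _ => ?_
  rw [← dot_self_eq_nrm_sq]
  simp [dotProduct, sq]

lemma frob_sq_eq_trace (A : Mat m n) : ‖A‖ ^ 2 = (Aᵀ * A).trace := by
  rw [frob_sq, Finset.sum_comm]
  simp [Matrix.trace, Matrix.mul_apply, sq]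

lemma abs_entry_le_frob (A : Mat m n) (i : Fin m) (j : Fin n) :
    |A i j| ≤ ‖A‖ := by
  refine abs_le_of_sq_le_sq ?_ (norm_nonneg _)
  rw [frob_sq]
  exact (Finset.single_le_sum (f := fun j => A i j ^ 2) (fun _ _ => sq_nonneg _)
    (Finset.mem_univ j)).trans (Finset.single_le_sum (f := fun i => ∑ j, A i j ^ 2)
      (fun _ _ => Finset.sum_nonneg fun _ _ => sq_nonneg _) (Finset.mem_univ i))

lemma nrm_mulVec_le (A : Mat m n) (v : Vec n) :
    nrm (A *ᵥ v) ≤ ‖A‖ * nrm v := by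
  refine le_of_sq_le_sq ?_ (mul_nonneg (norm_nonneg _) (nrm_nonneg _))
  rw [mul_pow, frob_sq, ← dot_self_eq_nrm_sq, ← dot_self_eq_nrm_sq, Finset.sum_mul]
  simp only [dotProduct, mulVec, ← sq]
  exact Finset.sum_le_sum fun i _ => Finset.sum_mul_sq_le_sq_mul_sq _ _ _

lemma abs_dot_mulVec_le (A : Mat m n) (u : Vec m) (v : Vec n) :
    |u ⬝ᵥ (A *ᵥ v)| ≤ ‖A‖ * nrm u * nrm v := by
  calc _ ≤ nrm u * nrm (A *ᵥ v) := abs_dot_le _ _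
    _ ≤ nrm u * (‖A‖ * nrm v) := by gcongr; exacts [nrm_nonneg _, nrm_mulVec_le A v]
    _ = _ := by ring

lemma frameDist_le (U : Mat d k) (V : Mat d l) :
    frameDist U V ≤ ‖U * Uᵀ - V * Vᵀ‖ := by
  refine ContinuousLinearMap.opNorm_le_bound _ (norm_nonneg _) fun x => ?_
  exact nrm_mulVec_le (U * Uᵀ - V * Vᵀ) (WithLp.ofLp x)

lemma mulVec_dot (A : Mat m n) (u : Vec m) (v : Vec n) :
    u ⬝ᵥ (A *ᵥ v) = (Aᵀ *ᵥ u) ⬝ᵥ v := by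
  rw [Matrix.dotProduct_mulVec, ← mulVec_transpose]

/-! ### Frames and orthogonal complements -/

lemma IsFrame.nrm_mulVec {U : Mat d k} (hU : IsFrame U) (v : Vec k) :
    nrm (U *ᵥ v) = nrm v := by
  rw [nrm_eq_sqrt, nrm_eq_sqrt, mulVec_dot, mulVec_mulVec, show Uᵀ * U = 1 from hU,
    one_mulVec]

lemma IsFrame.nrm_transpose_mulVec_le {U : Mat d k} (hU : IsFrame U)
    (v : Vec d) : nrm (Uᵀ *ᵥ v) ≤ nrm v := by
  by_cases h0 : nrm (Uᵀ *ᵥ v) = 0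
  · rw [h0]; exact nrm_nonneg _
  have hpos := lt_of_le_of_ne (nrm_nonneg _) (Ne.symm h0)
  have h1 : nrm (Uᵀ *ᵥ v) ^ 2 ≤ nrm v * nrm (Uᵀ *ᵥ v) := by
    rw [← dot_self_eq_nrm_sq, ← mulVec_dot]
    refine (le_abs_self _).trans ((abs_dot_le _ _).trans ?_)
    rw [hU.nrm_mulVec]
  nlinarith

lemma IsFrame.mul {U : Mat d k} {V : Mat k l}
    (hU : IsFrame U) (hV : IsFrame V) : IsFrame (U * V) := by
  unfold IsFrame at *
  rw [Matrix.transpose_mul, Matrix.mul_assoc, ← Matrix.mul_assoc Uᵀ, hU, Matrix.one_mul, hV]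

lemma IsFrame.dot_col {U : Mat d k} (hU : IsFrame U) (i j : Fin k) :
    Uᵀ i ⬝ᵥ Uᵀ j = if i = j then 1 else 0 := by
  have h := congrFun (congrFun hU i) j
  rw [Matrix.one_apply] at h
  rw [← h]
  rfl

lemma isFrame_iff {U : Mat d k} :
    IsFrame U ↔ ∀ i j, Uᵀ i ⬝ᵥ Uᵀ j = if i = j then 1 else 0 := by
  refine ⟨fun h => h.dot_col, fun h => ?_⟩
  ext i j
  rw [Matrix.one_apply, ← h i j]
  rfl

lemma IsFrame.nrm_col {U : Mat d k} (hU : IsFrame U) (i : Fin k) :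
    nrm (Uᵀ i) = 1 := by
  rw [nrm_eq_sqrt, hU.dot_col i i]; simp

lemma IsFrame.frob_sq {U : Mat d k} (hU : IsFrame U) :
    ‖U‖ ^ 2 = k := by
  rw [frob_sq_eq_trace, show Uᵀ * U = 1 from hU]; simp

lemma IsFrame.frob_mul {U : Mat d k} (hU : IsFrame U)
    (A : Mat k l) : ‖U * A‖ = ‖A‖ := by
  have : ‖U * A‖ ^ 2 = ‖A‖ ^ 2 := by
    rw [frob_sq_eq_trace, frob_sq_eq_trace, Matrix.transpose_mul, Matrix.mul_assoc,
      ← Matrix.mul_assoc Uᵀ, show Uᵀ * U = 1 from hU, Matrix.one_mul]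
  exact (sq_eq_sq₀ (norm_nonneg _) (norm_nonneg _)).1 this

lemma IsFrame.frob_mul_transpose {U : Mat d k} (hU : IsFrame U)
    (A : Mat l k) : ‖A * Uᵀ‖ = ‖A‖ := by
  rw [← frobenius_norm_transpose, Matrix.transpose_mul, Matrix.transpose_transpose,
    hU.frob_mul, frobenius_norm_transpose]

lemma IsFrame.card_le {U : Mat d k} (hU : IsFrame U) : k ≤ d := by
  have h1 : Function.Injective U.mulVecLin := by
    intro x y hxy
    have := congrArg (fun v => Uᵀ *ᵥ v) hxy
    simpa [mulVec_mulVec, show Uᵀ * U = 1 from hU] using this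
  simpa using LinearMap.finrank_le_finrank_of_injective h1

/-- Orthonormal columns that are orthogonal to a frame and fill up the dimension complete the
identity. -/
lemma IsComplement.add_eq_one {U : Mat d k}
    {Up : Mat d (d - k)} (hU : IsFrame U) (h : IsComplement U Up) :
    U * Uᵀ + Up * Upᵀ = 1 := by
  have hk := hU.card_le
  have h1 : (fromRows Uᵀ Upᵀ) * (fromCols U Up) = 1 := by
    rw [fromRows_mul_fromCols, show Uᵀ * U = 1 from hU, h.2, show Upᵀ * Up = 1 from h.1,
      show Upᵀ * U = 0 by simpa using congrArg Matrix.transpose h.2, fromBlocks_one]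
  have h2 := (Matrix.mul_eq_one_comm_of_card_eq (Fin k ⊕ Fin (d - k)) (Fin d) ℝ (by
    simp only [Fintype.card_sum, Fintype.card_fin]; omega)).1 h1
  rwa [fromCols_mul_fromRows] at h2

lemma toLp_col_orthonormal {U : Mat d k} (hU : IsFrame U) :
    Orthonormal ℝ (fun j => (WithLp.toLp 2 (Uᵀ j) : EuclideanSpace ℝ (Fin d))) := by
  rw [orthonormal_iff_ite]
  intro i j
  rw [← dot_eq_inner, hU.dot_col]
  simp [eq_comm]

/-- A frame extends to an orthonormal basis. -/
lemma exists_isComplement {U : Mat d k} (hU : IsFrame U) :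
    ∃ Up : Mat d (d - k), IsComplement U Up := by
  have hk := hU.card_le
  let K : Submodule ℝ (EuclideanSpace ℝ (Fin d)) :=
    Submodule.span ℝ (Set.range fun j => (WithLp.toLp 2 (Uᵀ j) : EuclideanSpace ℝ (Fin d)))
  have hK : Module.finrank ℝ K = k := by
    simpa using finrank_span_eq_card (toLp_col_orthonormal hU).linearIndependent
  have hK' : Module.finrank ℝ Kᗮ = d - k := by
    have := K.finrank_add_finrank_orthogonal
    rw [hK, finrank_euclideanSpace_fin] at this
    omega
  let b := (stdOrthonormalBasis ℝ Kᗮ).reindex (finCongr hK')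
  refine ⟨Matrix.of fun i j => (b j : EuclideanSpace ℝ (Fin d)) i, ?_, ?_⟩
  · rw [isFrame_iff]
    intro i j
    have h := orthonormal_iff_ite.1 b.orthonormal j i
    rw [Submodule.coe_inner] at h
    have h2 := dot_eq_inner (WithLp.ofLp (b i : EuclideanSpace ℝ (Fin d)))
      (WithLp.ofLp (b j : EuclideanSpace ℝ (Fin d)))
    refine Eq.trans h2 (h.trans ?_)
    simp [eq_comm]
  · ext i j
    have h := (b j).2 (WithLp.toLp 2 (Uᵀ i)) (Submodule.subset_span ⟨i, rfl⟩)
    have h2 := dot_eq_inner (WithLp.ofLp (b j : EuclideanSpace ℝ (Fin d))) (Uᵀ i)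
    rw [Matrix.zero_apply, Matrix.mul_apply]
    refine Eq.trans ?_ (h2.trans h)
    exact Finset.sum_congr rfl fun _ _ => mul_comm _ _

/-- Frames of `ℝ^d` with at most `d` columns exist. -/
lemma exists_isFrame (h : s ≤ d) : ∃ W : Mat d s, IsFrame W := by
  refine ⟨Matrix.of fun i j => if i = Fin.castLE h j then 1 else 0, ?_⟩
  rw [isFrame_iff]
  intro i j
  simp [dotProduct, Matrix.transpose_apply, eq_comm]

lemma proj_mul_self {U : Mat d k} (hU : IsFrame U) :
    (U * Uᵀ) * (U * Uᵀ) = U * Uᵀ := by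
  rw [Matrix.mul_assoc, ← Matrix.mul_assoc Uᵀ, show Uᵀ * U = 1 from hU, Matrix.one_mul]

lemma proj_transpose (U : Mat d k) : (U * Uᵀ)ᵀ = U * Uᵀ := by
  simp [Matrix.transpose_mul]

lemma dot_proj (U : Mat d k) (z : Vec d) :
    z ⬝ᵥ ((U * Uᵀ) *ᵥ z) = (Uᵀ *ᵥ z) ⬝ᵥ (Uᵀ *ᵥ z) := by
  rw [← mulVec_mulVec, mulVec_dot]

lemma IsFrame.frob_proj_sq {U : Mat d k} (hU : IsFrame U) :
    ‖U * Uᵀ‖ ^ 2 = k := by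
  rw [hU.frob_mul_transpose, hU.frob_sq]

lemma IsFrame.fromCols {U : Mat d k} {V : Mat d l}
    (hU : IsFrame U) (hV : IsFrame V) (hUV : Uᵀ * V = 0) :
    ∃ X : Mat d (k + l), IsFrame X ∧ X * Xᵀ = U * Uᵀ + V * Vᵀ ∧
      (∀ j, Xᵀ (Fin.castAdd l j) = Uᵀ j) ∧ ∀ j, Xᵀ (Fin.natAdd k j) = Vᵀ j := by
  have hVU : Vᵀ * U = 0 := by simpa using congrArg Matrix.transpose hUV
  have hl : ∀ j, (Matrix.of fun i => Fin.append (U i) (V i))ᵀ (Fin.castAdd l j) = Uᵀ j := by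
    intro j; ext i; simp
  have hr : ∀ j, (Matrix.of fun i => Fin.append (U i) (V i))ᵀ (Fin.natAdd k j) = Vᵀ j := by
    intro j; ext i; simp
  refine ⟨Matrix.of fun i => Fin.append (U i) (V i), ?_, ?_, hl, hr⟩
  · rw [isFrame_iff]
    intro i j
    refine Fin.addCases (fun i => ?_) (fun i => ?_) i <;>
      refine Fin.addCases (fun j => ?_) (fun j => ?_) j
    · rw [hl, hl, hU.dot_col]; simp
    · have h : i.castAdd l ≠ j.natAdd k := by
        intro h; have := congrArg Fin.val h; simp at this; omega
      rw [hl, hr, if_neg h]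
      exact congrFun (congrFun hUV i) j
    · have h : i.natAdd k ≠ j.castAdd l := by
        intro h; have := congrArg Fin.val h; simp at this; omega
      rw [hl, hr, if_neg h]
      exact congrFun (congrFun hVU i) j
    · rw [hr, hr, hV.dot_col]; simp
  · ext i j
    simp [Matrix.mul_apply, Fin.sum_univ_add]

/-! ### Quadratic forms and top eigenframes -/

/-- The quadratic form of `E` is bounded by `η`. -/
def QForm (E : Mat d d) (η : ℝ) : Prop :=
  ∀ v : Vec d, |v ⬝ᵥ (E *ᵥ v)| ≤ η * (v ⬝ᵥ v)

lemma dot_mulVec_comm {E : Mat d d} (hE : Eᵀ = E) (x y : Vec d) :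
    x ⬝ᵥ (E *ᵥ y) = y ⬝ᵥ (E *ᵥ x) := by
  rw [mulVec_dot, hE, dotProduct_comm]

lemma QForm.bilin {E : Mat d d} {η : ℝ} (hE : Eᵀ = E) (h : QForm E η)
    (x y : Vec d) : |x ⬝ᵥ (E *ᵥ y)| ≤ η * (nrm x * nrm y) := by
  by_cases hx : x = 0
  · simp [hx]
  by_cases hy : y = 0
  · simp [hy]
  have hx' := nrm_pos hx
  have hy' := nrm_pos hy
  have key : ∀ a b : Vec d, |4 * (a ⬝ᵥ (E *ᵥ b))| ≤ 2 * η * (a ⬝ᵥ a + b ⬝ᵥ b) := by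
    intro a b
    have h1 := h (a + b)
    have h2 := h (a - b)
    have e1 : 4 * (a ⬝ᵥ (E *ᵥ b)) =
        (a + b) ⬝ᵥ (E *ᵥ (a + b)) - (a - b) ⬝ᵥ (E *ᵥ (a - b)) := by
      simp only [mulVec_add, mulVec_sub, add_dotProduct, sub_dotProduct, dotProduct_add,
        dotProduct_sub, dot_mulVec_comm hE b a]
      ring
    have e2 : 2 * η * (a ⬝ᵥ a + b ⬝ᵥ b) =
        η * ((a + b) ⬝ᵥ (a + b)) + η * ((a - b) ⬝ᵥ (a - b)) := by
      simp only [add_dotProduct, sub_dotProduct, dotProduct_add, dotProduct_sub]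
      ring
    rw [e1, e2]
    exact (abs_sub _ _).trans (add_le_add h1 h2)
  have h3 := key ((nrm y) • x) ((nrm x) • y)
  simp only [mulVec_smul, smul_dotProduct, dotProduct_smul, smul_eq_mul,
    dot_self_eq_nrm_sq] at h3
  rw [show 4 * (nrm x * (nrm y * (x ⬝ᵥ (E *ᵥ y)))) = (4 * (nrm y * nrm x)) * (x ⬝ᵥ (E *ᵥ y)) by ring,
    abs_mul, abs_of_pos (by positivity : 0 < 4 * (nrm y * nrm x))] at h3
  have h4 : (4 * (nrm y * nrm x)) * |x ⬝ᵥ (E *ᵥ y)| ≤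
      (4 * (nrm y * nrm x)) * (η * (nrm x * nrm y)) := by
    refine h3.trans (le_of_eq ?_); ring
  exact le_of_mul_le_mul_left h4 (by positivity)

lemma QForm.nrm_mulVec_le {E : Mat d d} {η : ℝ} (hE : Eᵀ = E)
    (h : QForm E η) (v : Vec d) : nrm (E *ᵥ v) ≤ η * nrm v := by
  by_cases h0 : nrm (E *ᵥ v) = 0
  · rw [h0]
    by_cases hv : v = 0
    · simp [hv]
    have h1 := (abs_nonneg _).trans (h v)
    rw [dot_self_eq_nrm_sq] at h1
    have := nrm_pos hv
    have : 0 ≤ η := by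
      by_contra hη
      push Not at hη
      nlinarith [mul_pos this this]
    positivity
  have hpos := lt_of_le_of_ne (nrm_nonneg _) (Ne.symm h0)
  have h1 := (le_abs_self _).trans (h.bilin hE (E *ᵥ v) v)
  rw [dot_self_eq_nrm_sq] at h1
  nlinarith

lemma nrm_sub_proj_sq_sum {V V' : Mat d p} (hV : IsFrame V)
    (hV' : IsFrame V') :
    ‖V * Vᵀ - V' * V'ᵀ‖ ^ 2 = 2 * ∑ j, nrm (V'ᵀ j - (V * Vᵀ) *ᵥ V'ᵀ j) ^ 2 := by
  have h1 : ‖V' - (V * Vᵀ) * V'‖ ^ 2 = ∑ j, nrm (V'ᵀ j - (V * Vᵀ) *ᵥ V'ᵀ j) ^ 2 := by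
    rw [frob_sq_eq_sum_nrm_col]
    rfl
  rw [← h1, frob_sq_eq_trace, frob_sq_eq_trace]
  have e1 : (V * Vᵀ - V' * V'ᵀ)ᵀ * (V * Vᵀ - V' * V'ᵀ) =
      V * Vᵀ + V' * V'ᵀ - (V * Vᵀ) * (V' * V'ᵀ) - (V' * V'ᵀ) * (V * Vᵀ) := by
    rw [Matrix.transpose_sub, proj_transpose, proj_transpose, Matrix.sub_mul, Matrix.mul_sub,
      Matrix.mul_sub, proj_mul_self hV, proj_mul_self hV']
    abel
  have e2 : (V' - (V * Vᵀ) * V')ᵀ * (V' - (V * Vᵀ) * V') = 1 - V'ᵀ * ((V * Vᵀ) * V') := by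
    rw [Matrix.transpose_sub, Matrix.transpose_mul, proj_transpose, Matrix.sub_mul, Matrix.mul_sub,
      Matrix.mul_sub, show V'ᵀ * V' = 1 from hV', Matrix.mul_assoc V'ᵀ (V * Vᵀ) ((V * Vᵀ) * V'),
      ← Matrix.mul_assoc (V * Vᵀ) (V * Vᵀ) V', proj_mul_self hV, Matrix.mul_assoc V'ᵀ]
    abel
  have e3 : (V * Vᵀ).trace = p := by
    rw [trace_mul_comm, show Vᵀ * V = 1 from hV]; simp
  have e4 : (V' * V'ᵀ).trace = p := by
    rw [trace_mul_comm, show V'ᵀ * V' = 1 from hV']; simp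
  have e5 : ((V' * V'ᵀ) * (V * Vᵀ)).trace = (V'ᵀ * ((V * Vᵀ) * V')).trace := by
    rw [Matrix.mul_assoc, trace_mul_comm, Matrix.mul_assoc]
  rw [e1, e2, trace_sub, trace_sub, trace_add, trace_sub, e3, e4,
    trace_mul_comm (V * Vᵀ), e5]
  simp
  ring

/-- An eigenvector `v'` of `M'` whose eigenvalue exceeds the quadratic form of `M` on the
complement of the invariant frame `V` by `g` is close to the span of `V`. -/
lemma eigenvector_near {M M' : Mat d d} {V : Mat d p}
    (hM : Mᵀ = M) (hV : IsFrame V) {μ g e : ℝ}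
    (hinv : ∀ x : Vec d, Vᵀ *ᵥ x = 0 → Vᵀ *ᵥ (M *ᵥ x) = 0 ∧ x ⬝ᵥ (M *ᵥ x) ≤ μ * (x ⬝ᵥ x))
    {v' : Vec d} (he : M' *ᵥ v' = e • v') (hg : μ + g ≤ e) :
    g * nrm (v' - (V * Vᵀ) *ᵥ v') ≤ nrm ((M' - M) *ᵥ v') := by
  set x := v' - (V * Vᵀ) *ᵥ v' with hx
  have hVx : Vᵀ *ᵥ x = 0 := by
    rw [hx, mulVec_sub, mulVec_mulVec, ← Matrix.mul_assoc, show Vᵀ * V = 1 from hV,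
      Matrix.one_mul, sub_self]
  obtain ⟨h1, h2⟩ := hinv x hVx
  have hperp : ∀ y : Vec d, x ⬝ᵥ ((V * Vᵀ) *ᵥ y) = 0 := by
    intro y
    rw [← mulVec_mulVec, mulVec_dot, hVx, zero_dotProduct]
  have hv' : v' = x + (V * Vᵀ) *ᵥ v' := by rw [hx]; abel
  have h3 : x ⬝ᵥ v' = x ⬝ᵥ x := by
    conv_lhs => rw [hv']
    rw [dotProduct_add, hperp, add_zero]
  have h4 : x ⬝ᵥ (M *ᵥ v') = x ⬝ᵥ (M *ᵥ x) := by
    have h : (M *ᵥ x) ⬝ᵥ ((V * Vᵀ) *ᵥ v') = 0 := by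
      rw [← mulVec_mulVec, mulVec_dot, h1, zero_dotProduct]
    conv_lhs => rw [hv']
    rw [mulVec_add, dotProduct_add, dot_mulVec_comm hM x ((V * Vᵀ) *ᵥ v'),
      dotProduct_comm ((V * Vᵀ) *ᵥ v'), h, add_zero]
  have h5 : x ⬝ᵥ (M' *ᵥ v') = e * (x ⬝ᵥ x) := by rw [he, dotProduct_smul, h3, smul_eq_mul]
  have h6 : x ⬝ᵥ ((M' - M) *ᵥ v') = e * (x ⬝ᵥ x) - x ⬝ᵥ (M *ᵥ x) := by
    rw [sub_mulVec, dotProduct_sub, h5, h4]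
  have h7 := (le_abs_self _).trans (abs_dot_le x ((M' - M) *ᵥ v'))
  rw [h6, dot_self_eq_nrm_sq] at h7
  rw [dot_self_eq_nrm_sq] at h2
  by_cases h0 : nrm x = 0
  · rw [h0, mul_zero]; exact nrm_nonneg _
  have hpos := lt_of_le_of_ne (nrm_nonneg _) (Ne.symm h0)
  have h8 : nrm x * (g * nrm x) ≤ nrm x * nrm ((M' - M) *ᵥ v') := by
    nlinarith [mul_le_mul_of_nonneg_right hg (sq_nonneg (nrm x))]
  exact le_of_mul_le_mul_left h8 hpos

lemma transpose_mulVec_apply (V : Mat d p) (x : Vec d) (j : Fin p) :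
    (Vᵀ *ᵥ x) j = Vᵀ j ⬝ᵥ x := rfl

/-- Eigenvector equations make the orthogonal complement of a frame invariant. -/
lemma transpose_mulVec_mulVec_eq_zero {M : Mat d d}
    {V : Mat d p} (hM : Mᵀ = M) {eig : Fin p → ℝ}
    (he : ∀ j, M *ᵥ (Vᵀ j) = eig j • Vᵀ j) {x : Vec d} (hx : Vᵀ *ᵥ x = 0) :
    Vᵀ *ᵥ (M *ᵥ x) = 0 := by
  ext j
  rw [transpose_mulVec_apply, dot_mulVec_comm hM, he, dotProduct_smul, dotProduct_comm,
    ← transpose_mulVec_apply, hx]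
  simp

/-- The dependence of the top eigenprojection on a matrix with a spectral gap. -/
lemma eigenframe_lipschitz {M M' : Mat d d}
    {V V' : Mat d p} (hM : Mᵀ = M) (hV : IsFrame V) (hV' : IsFrame V')
    {eig eig' : Fin p → ℝ} (he : ∀ j, M *ᵥ (Vᵀ j) = eig j • Vᵀ j)
    (he' : ∀ j, M' *ᵥ (V'ᵀ j) = eig' j • V'ᵀ j) {μ g : ℝ} (hg0 : 0 < g)
    (hup : ∀ x : Vec d, Vᵀ *ᵥ x = 0 → x ⬝ᵥ (M *ᵥ x) ≤ μ * (x ⬝ᵥ x)) (hg : ∀ j, μ + g ≤ eig' j) :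
    ‖V * Vᵀ - V' * V'ᵀ‖ ^ 2 ≤ 2 * p * (‖M' - M‖ / g) ^ 2 := by
  rw [nrm_sub_proj_sq_sum hV hV', mul_assoc]
  refine mul_le_mul_of_nonneg_left ?_ zero_le_two
  refine (Finset.sum_le_card_nsmul _ _ ((‖M' - M‖ / g) ^ 2) fun j _ => ?_).trans (by simp)
  have h1 := eigenvector_near hM hV
    (fun x hx => ⟨transpose_mulVec_mulVec_eq_zero hM he hx, hup x hx⟩) (he' j) (hg j)
  have h2 : nrm ((M' - M) *ᵥ V'ᵀ j) ≤ ‖M' - M‖ := by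
    refine (nrm_mulVec_le _ _).trans ?_
    rw [hV'.nrm_col, mul_one]
  refine pow_le_pow_left₀ (nrm_nonneg _) ?_ 2
  rw [le_div_iff₀ hg0, mul_comm]
  exact h1.trans h2

lemma top_eigenvalue_ge {M M₀ : Mat d d}
    {V N : Mat d p} (hM : Mᵀ = M) (hN : IsFrame N) {lam η : ℝ}
    (h0 : ∀ x : Vec d, lam * ((Nᵀ *ᵥ x) ⬝ᵥ (Nᵀ *ᵥ x)) ≤ x ⬝ᵥ (M₀ *ᵥ x)) (hE : QForm (M - M₀) η)
    (hV : IsFrame V) {eig : Fin p → ℝ} (he : ∀ j, M *ᵥ (Vᵀ j) = eig j • Vᵀ j)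
    (htop : ∀ x : Vec d, Vᵀ *ᵥ x = 0 → ∀ j, x ⬝ᵥ (M *ᵥ x) ≤ eig j * (x ⬝ᵥ x)) (j : Fin p) :
    lam - η ≤ eig j := by
  obtain ⟨a, ha0, ha⟩ := Matrix.exists_mulVec_eq_zero_iff.2
    (Matrix.det_eq_zero_of_row_eq_zero (A := (Vᵀ * N).updateRow j 0) j (by simp))
  set x := N *ᵥ a with hx
  have hxi : ∀ i, i ≠ j → Vᵀ i ⬝ᵥ x = 0 := by
    intro i hi
    have h := congrFun ha i
    simp only [mulVec, Matrix.updateRow_ne hi, Pi.zero_apply] at h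
    rw [← transpose_mulVec_apply, hx, mulVec_mulVec]
    exact h
  set c := Vᵀ j ⬝ᵥ x with hc
  set x' := x - c • Vᵀ j with hx'
  have hvj : Vᵀ j ⬝ᵥ Vᵀ j = 1 := by rw [hV.dot_col]; simp
  have hVx' : Vᵀ *ᵥ x' = 0 := by
    ext i
    rw [transpose_mulVec_apply, hx', dotProduct_sub, dotProduct_smul, hV.dot_col]
    by_cases h : i = j
    · subst h; simp [hc]
    · simp [h, hxi i h]
  have hx'j : Vᵀ j ⬝ᵥ x' = 0 := by rw [← transpose_mulVec_apply, hVx']; rfl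
  have hxdec : x = c • Vᵀ j + x' := by rw [hx']; abel
  have hNx : Nᵀ *ᵥ x = a := by
    rw [hx, mulVec_mulVec, show Nᵀ * N = 1 from hN, one_mulVec]
  have hxx : x ⬝ᵥ x = a ⬝ᵥ a := by
    rw [dot_self_eq_nrm_sq, hx, hN.nrm_mulVec, dot_self_eq_nrm_sq]
  have haa : 0 < a ⬝ᵥ a := by
    rw [dot_self_eq_nrm_sq]; exact pow_pos (nrm_pos ha0) 2
  have h1 : x ⬝ᵥ x = c ^ 2 + x' ⬝ᵥ x' := by
    conv_lhs => rw [hxdec]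
    simp only [add_dotProduct, dotProduct_add, smul_dotProduct, dotProduct_smul, hvj,
      dotProduct_comm x' (Vᵀ j), hx'j, smul_eq_mul]
    ring
  have h2 : x ⬝ᵥ (M *ᵥ x) = c ^ 2 * eig j + x' ⬝ᵥ (M *ᵥ x') := by
    conv_lhs => rw [hxdec]
    have h3 : Vᵀ j ⬝ᵥ (M *ᵥ x') = 0 := by
      rw [dot_mulVec_comm hM, he, dotProduct_smul, dotProduct_comm, hx'j, smul_zero]
    simp only [mulVec_add, mulVec_smul, add_dotProduct, dotProduct_add, smul_dotProduct,
      dotProduct_smul, h3, he, hvj, dotProduct_comm x' (Vᵀ j), hx'j, smul_eq_mul]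
    ring
  have h3 := htop x' hVx' j
  have h4 := h0 x
  have h5 := (abs_le.1 (hE x)).1
  rw [sub_mulVec, dotProduct_sub] at h5
  rw [hNx] at h4
  have h6 : (lam - η) * (a ⬝ᵥ a) ≤ eig j * (a ⬝ᵥ a) := by
    rw [← hxx] at h4 ⊢
    have h7 : eig j * (x ⬝ᵥ x) = c ^ 2 * eig j + eig j * (x' ⬝ᵥ x') := by rw [h1]; ring
    linarith [sub_mul lam η (x ⬝ᵥ x)]
  exact le_of_mul_le_mul_right h6 haa

/-- The consequences of a spectral gap of `M₀` for the top eigenframes of a nearby matrix `M`. -/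
lemma eigenframe_of_near {M M₀ : Mat d d}
    {V N : Mat d p} (hM : Mᵀ = M) (hM₀ : M₀ᵀ = M₀) (hN : IsFrame N) {lam η : ℝ}
    (h0 : ∀ x : Vec d, lam * ((Nᵀ *ᵥ x) ⬝ᵥ (Nᵀ *ᵥ x)) ≤ x ⬝ᵥ (M₀ *ᵥ x))
    (h0' : ∀ x : Vec d, Nᵀ *ᵥ x = 0 → M₀ *ᵥ x = 0) (hE : QForm (M - M₀) η) (hlam : 0 < lam)
    (hη : η ≤ lam / 2) (hV : IsFrame V) {eig : Fin p → ℝ}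
    (he : ∀ j, M *ᵥ (Vᵀ j) = eig j • Vᵀ j)
    (htop : ∀ x : Vec d, Vᵀ *ᵥ x = 0 → ∀ j, x ⬝ᵥ (M *ᵥ x) ≤ eig j * (x ⬝ᵥ x)) :
    (∀ j, lam / 2 ≤ eig j) ∧ ‖N * Nᵀ - V * Vᵀ‖ ^ 2 ≤ 2 * p * (2 * η / lam) ^ 2 ∧
      ∀ x : Vec d, Vᵀ *ᵥ x = 0 →
        x ⬝ᵥ (M *ᵥ x) ≤ (η + ‖M₀‖ * ‖N * Nᵀ - V * Vᵀ‖) * (x ⬝ᵥ x) := by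
  have h1 : ∀ j, lam / 2 ≤ eig j := fun j => by
    have := top_eigenvalue_ge hM hN h0 hE hV he htop j
    linarith
  refine ⟨h1, ?_, ?_⟩
  · rw [nrm_sub_proj_sq_sum hN hV, mul_assoc]
    refine mul_le_mul_of_nonneg_left ?_ zero_le_two
    refine (Finset.sum_le_card_nsmul _ _ ((2 * η / lam) ^ 2) fun j _ => ?_).trans (by simp)
    have h2 := eigenvector_near (μ := 0) (g := lam / 2) hM₀ hN
      (fun x hx => by rw [h0' x hx]; simp) (he j) (by simpa using h1 j)
    have hsub : (M - M₀)ᵀ = M - M₀ := by rw [Matrix.transpose_sub, hM, hM₀]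
    have h3 := hE.nrm_mulVec_le hsub (Vᵀ j)
    rw [hV.nrm_col, mul_one] at h3
    refine pow_le_pow_left₀ (nrm_nonneg _) ?_ 2
    rw [le_div_iff₀ hlam]
    linarith
  · intro x hx
    have h2 := (abs_le.1 (hE x)).2
    rw [sub_mulVec, dotProduct_sub] at h2
    set y := (N * Nᵀ) *ᵥ x with hy
    have hxy : M₀ *ᵥ x = M₀ *ᵥ y := by
      have : M₀ *ᵥ (x - y) = 0 := by
        apply h0'
        rw [hy, mulVec_sub, mulVec_mulVec, ← Matrix.mul_assoc, show Nᵀ * N = 1 from hN,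
          Matrix.one_mul, sub_self]
      rwa [mulVec_sub, sub_eq_zero] at this
    have h3 : x ⬝ᵥ (M₀ *ᵥ x) = y ⬝ᵥ (M₀ *ᵥ y) := by
      rw [hxy, dot_mulVec_comm hM₀, hxy]
    have h4 : nrm y ^ 2 = x ⬝ᵥ ((N * Nᵀ - V * Vᵀ) *ᵥ x) := by
      rw [sub_mulVec, dotProduct_sub, dot_proj V, hx, dotProduct_zero, sub_zero, hy,
        ← dot_self_eq_nrm_sq, mulVec_dot, proj_transpose, mulVec_mulVec, proj_mul_self hN,
        dotProduct_comm]
    have h5 := (le_abs_self _).trans (abs_dot_mulVec_le (N * Nᵀ - V * Vᵀ) x x)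
    have h6 := (le_abs_self _).trans (abs_dot_mulVec_le M₀ y y)
    rw [← h4] at h5
    rw [← h3] at h6
    have h7 : ‖M₀‖ * nrm y * nrm y ≤ ‖M₀‖ * (‖N * Nᵀ - V * Vᵀ‖ * nrm x * nrm x) := by
      rw [mul_assoc, ← sq]
      exact mul_le_mul_of_nonneg_left h5 (norm_nonneg _)
    rw [dot_self_eq_nrm_sq] at h2 ⊢
    nlinarith

lemma IsTopEigenframe.proj_eq {V X : Mat d p} (hV : IsFrame V)
    (hX : IsTopEigenframe (V * Vᵀ) X) : X * Xᵀ = V * Vᵀ := by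
  obtain ⟨hXf, eig, he, htop⟩ := hX
  have h := (eigenframe_of_near (M := V * Vᵀ) (M₀ := V * Vᵀ) (N := V) (lam := 1) (η := 0)
    (proj_transpose V) (proj_transpose V) hV (fun x => by rw [dot_proj]; simp)
    (fun x hx => by rw [← mulVec_mulVec, hx, mulVec_zero]) (by intro v; simp) one_pos
    (by norm_num) hXf he htop).2.1
  have h2 : ‖V * Vᵀ - X * Xᵀ‖ ^ 2 ≤ 0 := by simpa using h
  have h3 : ‖V * Vᵀ - X * Xᵀ‖ = 0 := by
    have := sq_nonneg ‖V * Vᵀ - X * Xᵀ‖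
    exact pow_eq_zero_iff two_ne_zero |>.1 (le_antisymm h2 this)
  rw [norm_sub_eq_zero_iff] at h3
  exact h3.symm

/-- A symmetric matrix has an orthonormal basis of eigenvectors, with decreasing eigenvalues. -/
lemma exists_eigenbasis {D : ℕ} {M : Mat D D} (hM : Mᵀ = M) :
    ∃ (B : Mat D D) (μ : Fin D → ℝ), IsFrame B ∧ Antitone μ ∧
      ∀ j, M *ᵥ (Bᵀ j) = μ j • Bᵀ j := by
  have hH : M.IsHermitian := by
    rw [Matrix.IsHermitian, Matrix.conjTranspose_eq_transpose_of_trivial, hM]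
  have hT := Matrix.isSymmetric_toEuclideanLin_iff.2 hH
  have hn := finrank_euclideanSpace_fin (𝕜 := ℝ) (n := D)
  set b := hT.eigenvectorBasis hn with hb
  refine ⟨Matrix.of fun i j => b j i, hT.eigenvalues hn, ?_, hT.eigenvalues_antitone hn, ?_⟩
  · rw [isFrame_iff]
    intro i j
    have h := orthonormal_iff_ite.1 b.orthonormal j i
    refine (dot_eq_inner (WithLp.ofLp (b i)) (WithLp.ofLp (b j))).trans (h.trans ?_)
    simp [eq_comm]
  · intro j
    have h := hT.apply_eigenvectorBasis hn j
    exact congrArg WithLp.ofLp h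

lemma exists_isTopEigenframe {D : ℕ} {M : Mat D D} (hM : Mᵀ = M) (hp : p ≤ D) :
    ∃ V : Mat D p, IsTopEigenframe M V := by
  obtain ⟨B, μ, hB, hanti, he⟩ := exists_eigenbasis hM
  refine ⟨Matrix.of fun i j => B i (Fin.castLE hp j), ?_, fun j => μ (Fin.castLE hp j),
    fun j => he _, ?_⟩
  · rw [isFrame_iff]
    intro i j
    refine (hB.dot_col _ _).trans ?_
    simp [Fin.ext_iff]
  · intro x hx j
    have hBB : B * Bᵀ = 1 := mul_eq_one_comm.1 hB
    have hxx : x ⬝ᵥ x = ∑ i, (Bᵀ i ⬝ᵥ x) ^ 2 := by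
      have h := dot_proj B x
      rw [hBB, one_mulVec] at h
      rw [h]
      simp [dotProduct, mulVec, sq]
    have hxM : x ⬝ᵥ (M *ᵥ x) = ∑ i, μ i * (Bᵀ i ⬝ᵥ x) ^ 2 := by
      have h : M *ᵥ x = (B * Bᵀ) *ᵥ (M *ᵥ x) := by rw [hBB, one_mulVec]
      rw [h, ← mulVec_mulVec, mulVec_dot, dotProduct]
      refine Finset.sum_congr rfl fun i _ => ?_
      rw [transpose_mulVec_apply, transpose_mulVec_apply, dot_mulVec_comm hM, he, dotProduct_smul,
        dotProduct_comm x, smul_eq_mul]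
      ring
    rw [hxM, hxx, Finset.mul_sum]
    refine Finset.sum_le_sum fun i _ => ?_
    by_cases hi : (i : ℕ) < p
    · have h : Bᵀ i ⬝ᵥ x = 0 := congrFun hx ⟨i, hi⟩
      simp [h]
    · refine mul_le_mul_of_nonneg_right (hanti ?_) (sq_nonneg _)
      rw [Fin.le_def, Fin.val_castLE]
      omega

/-- An orthonormal basis of the range of a symmetric matrix, on which it is bounded below. -/
lemma exists_range_frame {S : Mat s s} (hS : Sᵀ = S) (hS0 : S ≠ 0) :
    ∃ (p : ℕ) (N : Mat s p) (lam : ℝ), 0 < p ∧ 0 < lam ∧ IsFrame N ∧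
      (∀ x : Vec s, lam * ((Nᵀ *ᵥ x) ⬝ᵥ (Nᵀ *ᵥ x)) ≤ (S *ᵥ x) ⬝ᵥ (S *ᵥ x)) ∧
      ∀ x : Vec s, Nᵀ *ᵥ x = 0 → S *ᵥ x = 0 := by
  obtain ⟨B, μ, hB, -, he⟩ := exists_eigenbasis hS
  have hBB : B * Bᵀ = 1 := mul_eq_one_comm.1 hB
  set J := {i : Fin s // μ i ≠ 0} with hJ
  let e : J ≃ Fin (Fintype.card J) := Fintype.equivFin J
  have hcoef : ∀ x i, Bᵀ i ⬝ᵥ (S *ᵥ x) = μ i * (Bᵀ i ⬝ᵥ x) := by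
    intro x i
    rw [dot_mulVec_comm hS, he, dotProduct_smul, smul_eq_mul, dotProduct_comm]
  have hpars : ∀ x : Vec s, x ⬝ᵥ x = ∑ i, (Bᵀ i ⬝ᵥ x) ^ 2 := by
    intro x
    have h := dot_proj B x
    rw [hBB, one_mulVec] at h
    rw [h]
    simp [dotProduct, mulVec, sq]
  have hSz : ∀ x : Vec s, (∀ i, μ i * (Bᵀ i ⬝ᵥ x) = 0) → S *ᵥ x = 0 := by
    intro x hx
    have : nrm (S *ᵥ x) ^ 2 = 0 := by
      rw [← dot_self_eq_nrm_sq, hpars]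
      refine Finset.sum_eq_zero fun i _ => ?_
      rw [hcoef, hx]; simp
    exact nrm_eq_zero.1 (pow_eq_zero_iff two_ne_zero |>.1 this)
  have hne : Nonempty J := by
    by_contra hJe
    rw [not_nonempty_iff] at hJe
    refine hS0 ?_
    ext i j
    have h := hSz (Pi.single j 1) fun i => by
      have : μ i = 0 := by
        by_contra h; exact hJe.false ⟨i, h⟩
      rw [this, zero_mul]
    have := congrFun h i
    simpa using this
  obtain ⟨i₀, hi₀⟩ := Finite.exists_min fun i : J => μ i ^ 2
  refine ⟨Fintype.card J, Matrix.of fun i j => B i (e.symm j), μ i₀ ^ 2, Fintype.card_pos, ?_, ?_,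
    ?_, ?_⟩
  · have := i₀.2; positivity
  · rw [isFrame_iff]
    intro i j
    refine (hB.dot_col _ _).trans ?_
    simp [Subtype.ext_iff.symm]
  · intro x
    have h1 : ((Matrix.of fun i j => B i (e.symm j))ᵀ *ᵥ x) ⬝ᵥ
        ((Matrix.of fun i j => B i (e.symm j))ᵀ *ᵥ x) = ∑ j : J, (Bᵀ j ⬝ᵥ x) ^ 2 := by
      rw [← Equiv.sum_comp e.symm]
      simp [dotProduct, mulVec, sq]
    rw [h1, hpars, Finset.mul_sum]
    calc _ ≤ ∑ j : J, (μ j * (Bᵀ j ⬝ᵥ x)) ^ 2 := by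
          refine Finset.sum_le_sum fun j _ => ?_
          rw [mul_pow]
          exact mul_le_mul_of_nonneg_right (hi₀ j) (sq_nonneg _)
      _ = ∑ j ∈ Finset.univ.filter (fun i => μ i ≠ 0), (μ j * (Bᵀ j ⬝ᵥ x)) ^ 2 := by
          rw [Finset.sum_subtype (Finset.univ.filter (fun i => μ i ≠ 0)) (p := fun i => μ i ≠ 0)
            (by simp)]
      _ ≤ ∑ i, (μ i * (Bᵀ i ⬝ᵥ x)) ^ 2 :=
          Finset.sum_le_sum_of_subset_of_nonneg (Finset.subset_univ _) fun _ _ _ => sq_nonneg _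
      _ = _ := Finset.sum_congr rfl fun i _ => by rw [hcoef]
  · intro x hx
    refine hSz x fun i => ?_
    by_cases h : μ i = 0
    · rw [h, zero_mul]
    · have h2 := congrFun hx (e ⟨i, h⟩)
      rw [transpose_mulVec_apply] at h2
      have h3 : (Matrix.of fun i j => B i (e.symm j))ᵀ (e ⟨i, h⟩) = Bᵀ i := by
        ext l; simp
      rw [h3] at h2
      rw [h2]; simp

/-! ### Gaussian vectors and the uniform measure on the sphere -/

/-- The standard Gaussian measure on `ℝ^d`. -/
def gaussianVec (d : ℕ) : Measure (Vec d) := Measure.pi fun _ => gaussianReal 0 1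

instance (d : ℕ) : IsProbabilityMeasure (gaussianVec d) := by
  unfold gaussianVec; infer_instance

lemma map_toLp_gaussianVec (d : ℕ) :
    (gaussianVec d).map (WithLp.toLp 2) = stdGaussian (EuclideanSpace ℝ (Fin d)) :=
  map_pi_eq_stdGaussian

@[fun_prop]
lemma measurable_mulVec (A : Mat m n) :
    Measurable fun v : Vec n => A *ᵥ v := Continuous.measurable (by fun_prop)

/-- Frame coordinates of a standard Gaussian vector form a standard Gaussian vector. -/
lemma IsFrame.map_gaussianVec {A : Mat d k} (hA : IsFrame A) :
    (gaussianVec d).map (fun g => Aᵀ *ᵥ g) = gaussianVec k := by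
  have hm : Measurable fun g : Vec d => Aᵀ *ᵥ g := measurable_mulVec _
  have hl : ∀ n : ℕ, Measurable (WithLp.toLp 2 : Vec n → EuclideanSpace ℝ (Fin n)) := fun n => by
    fun_prop
  have hl' : Measurable (WithLp.ofLp : EuclideanSpace ℝ (Fin k) → Vec k) := by fun_prop
  have key : ((gaussianVec d).map (fun g => Aᵀ *ᵥ g)).map (WithLp.toLp 2) =
      stdGaussian (EuclideanSpace ℝ (Fin k)) := by
    have : IsProbabilityMeasure (((gaussianVec d).map (fun g => Aᵀ *ᵥ g)).map
        (WithLp.toLp 2 : Vec k → EuclideanSpace ℝ (Fin k))) := by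
      have := Measure.isProbabilityMeasure_map (μ := gaussianVec d) hm.aemeasurable
      exact Measure.isProbabilityMeasure_map (hl k).aemeasurable
    apply Measure.ext_of_charFun (E := EuclideanSpace ℝ (Fin k))
    ext t
    have h1 := charFun_stdGaussian (WithLp.toLp 2 (A *ᵥ WithLp.ofLp t) : EuclideanSpace ℝ (Fin d))
    rw [← map_toLp_gaussianVec, charFun_apply, integral_map (hl d).aemeasurable (by fun_prop)] at h1
    rw [charFun_stdGaussian, charFun_apply, integral_map (hl k).aemeasurable (by fun_prop),
      integral_map hm.aemeasurable (by fun_prop)]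
    have h2 : ‖(WithLp.toLp 2 (A *ᵥ WithLp.ofLp t) : EuclideanSpace ℝ (Fin d))‖ = ‖t‖ :=
      hA.nrm_mulVec (WithLp.ofLp t)
    rw [h2] at h1
    rw [← h1]
    refine integral_congr_ae (Eventually.of_forall fun g => ?_)
    have h3 := dot_eq_inner (A *ᵥ WithLp.ofLp t) g
    have h4 := dot_eq_inner (WithLp.ofLp t) (Aᵀ *ᵥ g)
    have h5 : (A *ᵥ WithLp.ofLp t) ⬝ᵥ g = WithLp.ofLp t ⬝ᵥ (Aᵀ *ᵥ g) := by
      rw [mulVec_dot, Matrix.transpose_transpose]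
    rw [h3, h4] at h5
    simp only
    rw [h5]
  have h := congrArg (Measure.map (WithLp.ofLp : EuclideanSpace ℝ (Fin k) → Vec k)) key
  rw [← map_toLp_gaussianVec, Measure.map_map hl' (hl k), Measure.map_map hl' (hl k)] at h
  simpa [Function.comp_def] using h

lemma gaussianVec_eq_withDensity (d : ℕ) : gaussianVec d =
    volume.withDensity fun x => ENNReal.ofReal (∏ i, gaussianPDFReal 0 1 (x i)) := by
  refine Measure.pi_eq fun s hs => ?_
  have hpos : ∀ x : Vec d, 0 ≤ ∏ i, gaussianPDFReal 0 1 (x i) := fun x =>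
    Finset.prod_nonneg fun i _ => gaussianPDFReal_nonneg _ _ _
  rw [withDensity_apply _ (MeasurableSet.univ_pi hs), volume_pi, Measure.restrict_pi_pi,
    ← ofReal_integral_eq_lintegral_ofReal, integral_fintype_prod_eq_prod,
    ENNReal.ofReal_prod_of_nonneg]
  · exact Finset.prod_congr rfl fun i _ => (gaussianReal_apply_eq_integral 0 one_ne_zero (s i)).symm
  · exact fun i _ => integral_nonneg fun x => gaussianPDFReal_nonneg _ _ _
  · exact Integrable.fintype_prod fun i => (integrable_gaussianPDFReal 0 1).restrict
  · exact Eventually.of_forall hpos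

lemma prod_gaussianPDFReal (x : Vec d) : ∏ i, gaussianPDFReal 0 1 (x i) =
    (√(2 * Real.pi))⁻¹ ^ d * Real.exp (-(nrm x ^ 2) / 2) := by
  simp only [gaussianPDFReal, Finset.prod_mul_distrib, Finset.prod_const, Finset.card_univ,
    Fintype.card_fin, ← Real.exp_sum, ← dot_self_eq_nrm_sq]
  simp [dotProduct, ← Finset.sum_div, sq, Finset.sum_neg_distrib]

lemma sphere_polar_aux (hd : 0 < d) {A : Set ℝ} {B : Set (Vec d)} (hA : MeasurableSet A)
    (hB : MeasurableSet B) :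
    (gaussianVec d).map (fun g => (nrm g, direction g)) (A ×ˢ B) =
      ((volume : Measure (EuclideanSpace ℝ (Fin d))).toSphere
        {z | WithLp.ofLp (z : EuclideanSpace ℝ (Fin d)) ∈ B}) *
      ∫⁻ r, (A.indicator (fun _ => 1) r.1) * ENNReal.ofReal ((√(2 * Real.pi))⁻¹ ^ d *
        Real.exp (-(r.1 ^ 2) / 2)) ∂(Measure.volumeIoiPow (d - 1)) := by
  have : Nonempty (Fin d) := ⟨⟨0, hd⟩⟩
  have hm : Measurable fun g : Vec d => (nrm g, direction g) := by fun_prop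
  set G : ℝ → ENNReal := fun r => (A.indicator (fun _ => 1) r) *
    ENNReal.ofReal ((√(2 * Real.pi))⁻¹ ^ d * Real.exp (-(r ^ 2) / 2)) with hG
  have hGm : Measurable G := by
    refine (measurable_const.indicator hA).mul ?_
    fun_prop
  set H : Metric.sphere (0 : EuclideanSpace ℝ (Fin d)) 1 → ENNReal :=
    Set.indicator {z | WithLp.ofLp (z : EuclideanSpace ℝ (Fin d)) ∈ B} (fun _ => 1) with hH
  have hBm : MeasurableSet {z : Metric.sphere (0 : EuclideanSpace ℝ (Fin d)) 1 | WithLp.ofLp (z : EuclideanSpace ℝ (Fin d)) ∈ B} := by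
    have : Measurable fun z : Metric.sphere (0 : EuclideanSpace ℝ (Fin d)) 1 => WithLp.ofLp (z : EuclideanSpace ℝ (Fin d)) := by fun_prop
    exact this hB
  have hHm : Measurable H := measurable_const.indicator hBm
  rw [Measure.map_apply hm (hA.prod hB), gaussianVec_eq_withDensity,
    withDensity_apply _ (hm (hA.prod hB)), ← lintegral_indicator (hm (hA.prod hB)),
    ← (PiLp.volume_preserving_ofLp (Fin d)).lintegral_comp]
  swap
  · refine Measurable.indicator ?_ (hm (hA.prod hB))
    simp only [prod_gaussianPDFReal]
    fun_prop
  have hres : ∀ F : EuclideanSpace ℝ (Fin d) → ENNReal, ∫⁻ x, F x =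
      ∫⁻ x : ({0}ᶜ : Set (EuclideanSpace ℝ (Fin d))), F x.1 ∂(volume.comap Subtype.val) := by
    intro F
    rw [lintegral_subtype_comap (measurableSet_singleton _).compl, restrict_compl_singleton]
  rw [hres]
  have hmp := (volume : Measure (EuclideanSpace ℝ (Fin d))).measurePreserving_homeomorphUnitSphereProd
  rw [show Module.finrank ℝ (EuclideanSpace ℝ (Fin d)) = d by simp] at hmp
  have h1 := hmp.lintegral_comp (f := fun p => H p.1 * G p.2)
    ((hHm.comp measurable_fst).mul (hGm.comp (measurable_subtype_coe.comp measurable_snd)))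
  have h0 : ∫⁻ p, H p.1 * G p.2 ∂((volume : Measure (EuclideanSpace ℝ (Fin d))).toSphere.prod
      (Measure.volumeIoiPow (d - 1))) = _ :=
    lintegral_prod_mul hHm.aemeasurable (hGm.comp measurable_subtype_coe).aemeasurable
  rw [h0] at h1
  rw [show ∫⁻ z, H z ∂(volume : Measure (EuclideanSpace ℝ (Fin d))).toSphere =
    (volume : Measure (EuclideanSpace ℝ (Fin d))).toSphere {z | WithLp.ofLp (z : EuclideanSpace ℝ (Fin d)) ∈ B} by
      rw [hH, lintegral_indicator hBm]; simp] at h1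
  refine Eq.trans ?_ h1
  refine lintegral_congr fun x => ?_
  have hx1 : ((homeomorphUnitSphereProd (EuclideanSpace ℝ (Fin d)) x).2 : ℝ) = nrm (WithLp.ofLp x.1) := by
    rw [homeomorphUnitSphereProd_apply_snd_coe]; rfl
  have hx2 : WithLp.ofLp ((homeomorphUnitSphereProd (EuclideanSpace ℝ (Fin d)) x).1 : EuclideanSpace ℝ (Fin d)) = direction (WithLp.ofLp x.1) := by
    rw [homeomorphUnitSphereProd_apply_fst_coe]; rfl
  have e1 : H (homeomorphUnitSphereProd (EuclideanSpace ℝ (Fin d)) x).1 =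
      B.indicator (fun _ => 1) (direction (WithLp.ofLp x.1)) := by
    rw [← hx2]; rfl
  simp only [hx1, e1, hG]
  by_cases hA' : nrm (WithLp.ofLp x.1) ∈ A <;> by_cases hB' : direction (WithLp.ofLp x.1) ∈ B <;>
    simp [hA', hB', Set.indicator, prod_gaussianPDFReal]

/-- The length and the direction of a Gaussian vector are independent, and the direction is uniform
on the sphere. -/
lemma map_nrm_direction (hd : 0 < d) :
    (gaussianVec d).map (fun g => (nrm g, direction g)) =
      ((gaussianVec d).map nrm).prod (sphereUniform d) := by
  have : Nonempty (Fin d) := ⟨⟨0, hd⟩⟩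
  have hm : Measurable fun g : Vec d => (nrm g, direction g) := by fun_prop
  set σ := (volume : Measure (EuclideanSpace ℝ (Fin d))).toSphere with hσ
  have hσ0 : σ Set.univ ≠ 0 := by
    rw [Ne, Measure.measure_univ_eq_zero]
    exact Measure.toSphere_ne_zero _
  have hσt : σ Set.univ ≠ ⊤ := measure_ne_top _ _
  have hcm : Measurable fun z : Metric.sphere (0 : EuclideanSpace ℝ (Fin d)) 1 =>
    WithLp.ofLp (z : EuclideanSpace ℝ (Fin d)) := by fun_prop
  have : IsProbabilityMeasure (sphereUniform d) := by
    refine ⟨?_⟩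
    rw [sphereUniform, Measure.smul_apply, Measure.map_apply hcm MeasurableSet.univ,
      Set.preimage_univ, smul_eq_mul, ENNReal.inv_mul_cancel hσ0 hσt]
  have := Measure.isProbabilityMeasure_map (μ := gaussianVec d) measurable_nrm.aemeasurable
  refine (Measure.prod_eq fun A B hA hB => ?_).symm
  rw [sphere_polar_aux hd hA hB]
  have h2 := sphere_polar_aux hd hA (B := Set.univ) MeasurableSet.univ
  have h3 : (gaussianVec d).map nrm A =
      (gaussianVec d).map (fun g => (nrm g, direction g)) (A ×ˢ Set.univ) := by
    rw [Measure.map_apply measurable_nrm hA, Measure.map_apply hm (hA.prod MeasurableSet.univ)]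
    congr 1
    ext g; simp
  rw [h3, h2, sphereUniform, Measure.smul_apply, Measure.map_apply hcm hB, smul_eq_mul]
  simp only [Set.mem_univ, Set.ofPred_true]
  rw [mul_comm (σ Set.univ), mul_assoc, ← mul_assoc (σ Set.univ), ENNReal.mul_inv_cancel hσ0 hσt,
    one_mul, mul_comm]
  rfl

lemma sphereUniform_eq_map (hd : 0 < d) :
    sphereUniform d = (gaussianVec d).map direction := by
  have hm : Measurable fun g : Vec d => (nrm g, direction g) := by fun_prop
  have := Measure.isProbabilityMeasure_map (μ := gaussianVec d) measurable_nrm.aemeasurable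
  have h := congrArg Measure.snd (map_nrm_direction hd)
  have hS : SFinite (sphereUniform d) := by
    unfold sphereUniform; infer_instance
  rw [Measure.snd_prod, Measure.snd_map_prodMk measurable_nrm] at h
  exact h.symm

/-! ### Moments of Gaussian vectors -/

/-- Coordinates with respect to two mutually orthogonal frames are independent Gaussian vectors. -/
lemma map_gaussianVec_pair {U : Mat d k} {V : Mat d l}
    (hU : IsFrame U) (hV : IsFrame V) (hUV : Uᵀ * V = 0) :
    (gaussianVec d).map (fun g => (Uᵀ *ᵥ g, Vᵀ *ᵥ g)) = (gaussianVec k).prod (gaussianVec l) := by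
  obtain ⟨X, hX, -, hl, hr⟩ := hU.fromCols hV hUV
  have happ : Measurable fun p : Vec k × Vec l => (Fin.append p.1 p.2 : Vec (k + l)) := by
    refine measurable_pi_lambda _ fun i => ?_
    refine Fin.addCases (fun i => ?_) (fun i => ?_) i
    · simp only [Fin.append_left]; fun_prop
    · simp only [Fin.append_right]; fun_prop
  have h1 : gaussianVec (k + l) =
      ((gaussianVec k).prod (gaussianVec l)).map fun p => Fin.append p.1 p.2 := by
    refine Measure.pi_eq fun s hs => ?_
    rw [Measure.map_apply happ (MeasurableSet.univ_pi hs)]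
    have : (fun p : Vec k × Vec l => (Fin.append p.1 p.2 : Vec (k + l))) ⁻¹' Set.univ.pi s =
        (Set.univ.pi fun i => s (Fin.castAdd l i)) ×ˢ (Set.univ.pi fun i => s (Fin.natAdd k i)) := by
      ext p
      simp only [Set.mem_preimage, Set.mem_pi, Set.mem_univ, true_implies, Set.mem_prod]
      constructor
      · intro h
        exact ⟨fun i => by simpa using h (Fin.castAdd l i), fun i => by simpa using h (Fin.natAdd k i)⟩
      · rintro ⟨h1, h2⟩ i
        refine Fin.addCases (fun i => ?_) (fun i => ?_) i
        · simpa using h1 i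
        · simpa using h2 i
    rw [this, Measure.prod_prod, gaussianVec, gaussianVec, Measure.pi_pi, Measure.pi_pi,
      Fin.prod_univ_add]
  set S : Vec (k + l) → Vec k × Vec l :=
    fun x => (fun i => x (Fin.castAdd l i), fun i => x (Fin.natAdd k i)) with hS
  have hSm : Measurable S := by fun_prop
  have h2 := congrArg (Measure.map S) h1
  rw [Measure.map_map hSm happ, ← hX.map_gaussianVec, Measure.map_map hSm (measurable_mulVec _)] at h2
  have e1 : S ∘ (fun p : Vec k × Vec l => (Fin.append p.1 p.2 : Vec (k + l))) = id := by
    ext p <;> simp [hS]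
  have e2 : S ∘ (fun g : Vec d => Xᵀ *ᵥ g) = fun g => (Uᵀ *ᵥ g, Vᵀ *ᵥ g) := by
    funext g
    refine Prod.ext (funext fun i => ?_) (funext fun i => ?_)
    · simp only [hS, Function.comp_apply, transpose_mulVec_apply, hl]
    · simp only [hS, Function.comp_apply, transpose_mulVec_apply, hr]
  rw [e1, e2, Measure.map_id] at h2
  exact h2

lemma map_dot_gaussianVec {v : Vec d} (hv : nrm v = 1) :
    (gaussianVec d).map (fun g => v ⬝ᵥ g) = gaussianReal 0 1 := by
  have hF : IsFrame (Matrix.of fun (i : Fin d) (_ : Fin 1) => v i) := by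
    rw [isFrame_iff]
    intro i j
    have : v ⬝ᵥ v = 1 := by rw [dot_self_eq_nrm_sq, hv]; norm_num
    rw [Subsingleton.elim i j, if_pos rfl]
    exact this
  have h := congrArg (Measure.map (Function.eval 0)) hF.map_gaussianVec
  rw [Measure.map_map (by fun_prop) (measurable_mulVec _)] at h
  have h2 : (gaussianVec 1).map (Function.eval 0) = gaussianReal 0 1 :=
    (measurePreserving_eval (fun _ : Fin 1 => gaussianReal 0 1) 0).map_eq
  rw [h2] at h
  rw [← h]
  rfl

lemma map_dot_gaussianVec' (v : Vec d) :
    (gaussianVec d).map (fun g => v ⬝ᵥ g) = (gaussianReal 0 1).map fun t => nrm v * t := by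
  by_cases hv : v = 0
  · subst hv
    simp
  have h := map_dot_gaussianVec (nrm_direction hv)
  rw [← h, Measure.map_map (by fun_prop) (by fun_prop)]
  congr 1
  funext g
  have := (nrm_pos hv).ne'
  simp only [direction, Function.comp_apply, smul_dotProduct, smul_eq_mul]
  field_simp

lemma measurable_dot (v : Vec d) : Measurable fun g : Vec d => v ⬝ᵥ g :=
  Continuous.measurable (by fun_prop)

lemma integral_dot (v : Vec d) {φ : ℝ → ℝ} (hφ : Measurable φ) :
    ∫ g, φ (v ⬝ᵥ g) ∂gaussianVec d = ∫ t, φ (nrm v * t) ∂gaussianReal 0 1 := by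
  rw [← integral_map (measurable_dot v).aemeasurable hφ.aestronglyMeasurable,
    map_dot_gaussianVec', integral_map (by fun_prop) hφ.aestronglyMeasurable]

lemma integrable_dot_iff (v : Vec d) {φ : ℝ → ℝ} (hφ : Measurable φ) :
    Integrable (fun g => φ (v ⬝ᵥ g)) (gaussianVec d) ↔
      Integrable (fun t => φ (nrm v * t)) (gaussianReal 0 1) := by
  have h1 := integrable_map_measure (μ := gaussianVec d) (f := fun g => v ⬝ᵥ g) (g := φ)
    hφ.aestronglyMeasurable (measurable_dot v).aemeasurable
  rw [map_dot_gaussianVec', integrable_map_measure hφ.aestronglyMeasurable (by fun_prop)] at h1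
  exact h1.symm

lemma gaussian_exp_sq {a : ℝ} (ha : a < 1 / 2) :
    Integrable (fun t : ℝ => Real.exp (a * t ^ 2)) (gaussianReal 0 1) ∧
      ∫ t, Real.exp (a * t ^ 2) ∂gaussianReal 0 1 = (√(1 - 2 * a))⁻¹ := by
  have hb : 0 < 1 / 2 - a := by linarith
  have e : ∀ t : ℝ, gaussianPDFReal 0 1 t • Real.exp (a * t ^ 2) =
      (√(2 * Real.pi))⁻¹ * Real.exp (-(1 / 2 - a) * t ^ 2) := by
    intro t
    rw [gaussianPDFReal, smul_eq_mul, mul_assoc, ← Real.exp_add]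
    simp only [NNReal.coe_one, mul_one, sub_zero]
    congr 2
    ring
  constructor
  · rw [gaussianReal_of_var_ne_zero _ one_ne_zero,
      integrable_withDensity_iff_integrable_smul' (measurable_gaussianPDF _ _)
        (Eventually.of_forall fun _ => gaussianPDF_lt_top)]
    simp only [toReal_gaussianPDF, e]
    exact (integrable_exp_neg_mul_sq hb).const_mul _
  · rw [integral_gaussianReal_eq_integral_smul one_ne_zero]
    simp only [e]
    rw [integral_const_mul, integral_gaussian, ← Real.sqrt_inv, ← Real.sqrt_inv,
      ← Real.sqrt_mul (by positivity)]
    congr 1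
    have := Real.pi_pos.ne'
    have h2 : 1 - 2 * a ≠ 0 := by linarith
    have h3 : 1 / 2 - a ≠ 0 := hb.ne'
    field_simp

lemma gaussian_exp_sq_quarter :
    Integrable (fun t : ℝ => Real.exp (t ^ 2 / 4)) (gaussianReal 0 1) ∧
      ∫ t, Real.exp (t ^ 2 / 4) ∂gaussianReal 0 1 ≤ 2 := by
  have h := gaussian_exp_sq (a := 1 / 4) (by norm_num)
  have e : (fun t : ℝ => Real.exp (t ^ 2 / 4)) = fun t => Real.exp (1 / 4 * t ^ 2) := by
    funext t; congr 1; ring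
  rw [e]
  refine ⟨h.1, h.2.le.trans ?_⟩
  rw [← Real.sqrt_inv, Real.sqrt_le_left (by norm_num)]
  norm_num

lemma exp_dot_sq {v : Vec d} {b : ℝ} (hv : b * nrm v ^ 2 ≤ 1 / 4) :
    Integrable (fun g => Real.exp (b * (v ⬝ᵥ g) ^ 2)) (gaussianVec d) ∧
      ∫ g, Real.exp (b * (v ⬝ᵥ g) ^ 2) ∂gaussianVec d ≤ 2 := by
  have hm : Measurable fun t : ℝ => Real.exp (b * t ^ 2) := by fun_prop
  have hle : ∀ t : ℝ, Real.exp (b * (nrm v * t) ^ 2) ≤ Real.exp (t ^ 2 / 4) := fun t => by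
    refine Real.exp_le_exp.2 ?_
    nlinarith [mul_le_mul_of_nonneg_right hv (sq_nonneg t)]
  have hi : Integrable (fun t : ℝ => Real.exp (b * (nrm v * t) ^ 2)) (gaussianReal 0 1) := by
    refine gaussian_exp_sq_quarter.1.mono' (by fun_prop) (Eventually.of_forall fun t => ?_)
    rw [Real.norm_eq_abs, Real.abs_exp]
    exact hle t
  refine ⟨(integrable_dot_iff v hm).2 hi, ?_⟩
  rw [integral_dot v hm]
  exact (integral_mono hi gaussian_exp_sq_quarter.1 hle).trans gaussian_exp_sq_quarter.2

lemma gaussian_pow_four :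
    Integrable (fun t : ℝ => t ^ 4) (gaussianReal 0 1) ∧
      ∫ t, t ^ 4 ∂gaussianReal 0 1 ≤ 64 := by
  have hle : ∀ t : ℝ, t ^ 4 ≤ 32 * Real.exp (t ^ 2 / 4) := fun t => by
    have := Real.quadratic_le_exp_of_nonneg (show 0 ≤ t ^ 2 / 4 by positivity)
    nlinarith [sq_nonneg t]
  have hi : Integrable (fun t : ℝ => t ^ 4) (gaussianReal 0 1) := by
    refine (gaussian_exp_sq_quarter.1.const_mul 32).mono' (by fun_prop)
      (Eventually.of_forall fun t => ?_)
    rw [Real.norm_eq_abs, abs_of_nonneg (by positivity)]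
    exact hle t
  refine ⟨hi, (integral_mono hi (gaussian_exp_sq_quarter.1.const_mul 32) hle).trans ?_⟩
  rw [integral_const_mul]
  linarith [gaussian_exp_sq_quarter.2]

lemma gaussian_pow_two : ∫ t, t ^ 2 ∂gaussianReal 0 1 = 1 := by
  have h := variance_id_gaussianReal (μ := 0) (v := 1)
  rw [variance_of_integral_eq_zero aemeasurable_id (by simp)] at h
  simpa using h

lemma integrable_gaussian_pow (n : ℕ) : Integrable (fun t : ℝ => t ^ n) (gaussianReal 0 1) := by
  have h := (memLp_id_gaussianReal (μ := 0) (v := 1) n).integrable_norm_pow'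
  refine h.mono (by fun_prop) (Eventually.of_forall fun t => ?_)
  simp

lemma integrable_dot_pow (v : Vec d) (n : ℕ) :
    Integrable (fun g => (v ⬝ᵥ g) ^ n) (gaussianVec d) := by
  rw [integrable_dot_iff v (φ := fun t => t ^ n) (by fun_prop)]
  simp only [mul_pow]
  exact (integrable_gaussian_pow n).const_mul _

lemma integral_dot_sq (v : Vec d) :
    ∫ g, (v ⬝ᵥ g) ^ 2 ∂gaussianVec d = nrm v ^ 2 := by
  rw [integral_dot v (φ := fun t => t ^ 2) (by fun_prop)]
  simp only [mul_pow]
  rw [integral_const_mul, gaussian_pow_two, mul_one]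

lemma integral_dot_pow_four_le (v : Vec d) :
    ∫ g, (v ⬝ᵥ g) ^ 4 ∂gaussianVec d ≤ 64 * nrm v ^ 4 := by
  rw [integral_dot v (φ := fun t => t ^ 4) (by fun_prop)]
  simp only [mul_pow]
  rw [integral_const_mul, mul_comm]
  exact mul_le_mul_of_nonneg_right gaussian_pow_four.2 (by positivity)

lemma integrable_nrm_mulVec_sq (A : Mat k d) :
    Integrable (fun g => nrm (A *ᵥ g) ^ 2) (gaussianVec d) := by
  have : (fun g => nrm (A *ᵥ g) ^ 2) = fun g : Vec d => ∑ i, (A i ⬝ᵥ g) ^ 2 := by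
    funext g
    rw [← dot_self_eq_nrm_sq]
    simp [dotProduct, mulVec, sq]
  rw [this]
  exact integrable_finsetSum _ fun i _ => integrable_dot_pow _ 2

lemma integral_nrm_mulVec_sq (A : Mat k d) :
    ∫ g, nrm (A *ᵥ g) ^ 2 ∂gaussianVec d = ‖A‖ ^ 2 := by
  have : (fun g => nrm (A *ᵥ g) ^ 2) = fun g : Vec d => ∑ i, (A i ⬝ᵥ g) ^ 2 := by
    funext g
    rw [← dot_self_eq_nrm_sq]
    simp [dotProduct, mulVec, sq]
  rw [this, ← frobenius_norm_transpose, frob_sq_eq_sum_nrm_col]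
  refine (integral_finsetSum _ fun i _ => integrable_dot_pow _ 2).trans ?_
  exact Finset.sum_congr rfl fun i _ => integral_dot_sq _

lemma nrm_mulVec_sq_sq_le (A : Mat k d) (g : Vec d) :
    (nrm (A *ᵥ g) ^ 2) ^ 2 ≤ k * ∑ i, (A i ⬝ᵥ g) ^ 4 := by
  have : nrm (A *ᵥ g) ^ 2 = ∑ i, (A i ⬝ᵥ g) ^ 2 := by
    rw [← dot_self_eq_nrm_sq]
    simp [dotProduct, mulVec, sq]
  rw [this]
  have h := sq_sum_le_card_mul_sum_sq (s := (Finset.univ : Finset (Fin k)))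
    (f := fun i => (A i ⬝ᵥ g) ^ 2)
  simpa [← pow_mul] using h

lemma integrable_nrm_sq (d : ℕ) : Integrable (fun g => nrm g ^ 2) (gaussianVec d) := by
  simpa using integrable_nrm_mulVec_sq (1 : Mat d d)

/-- The squared length of a Gaussian vector concentrates around the dimension. -/
lemma variance_nrm_sq (d : ℕ) :
    Integrable (fun g => (nrm g ^ 2 - d) ^ 2) (gaussianVec d) ∧
      ∫ g, (nrm g ^ 2 - d) ^ 2 ∂gaussianVec d ≤ 64 * d := by
  have hmem : MemLp (fun t : ℝ => t ^ 2) 2 (gaussianReal 0 1) := by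
    rw [memLp_two_iff_integrable_sq (by fun_prop)]
    simpa [← pow_mul] using gaussian_pow_four.1
  have hsum : (fun g : Vec d => nrm g ^ 2) = fun g => ∑ i, (g i) ^ 2 := by
    funext g
    rw [← dot_self_eq_nrm_sq]
    simp [dotProduct, sq]
  have hmemS : MemLp (fun g : Vec d => nrm g ^ 2) 2 (gaussianVec d) := by
    rw [hsum]
    refine memLp_finsetSum _ fun i _ => ?_
    exact hmem.comp_measurePreserving (measurePreserving_eval (fun _ : Fin d => gaussianReal 0 1) i)
  have hmean : ∫ g, nrm g ^ 2 ∂gaussianVec d = d := by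
    have h := integral_nrm_mulVec_sq (1 : Mat d d)
    rw [frob_sq_eq_trace] at h
    simpa using h
  have hvar := variance_sum_pi (μ := fun _ : Fin d => gaussianReal 0 1)
    (X := fun _ t => t ^ 2) (fun _ => hmem)
  have hv1 : Var[fun t : ℝ => t ^ 2; gaussianReal 0 1] ≤ 64 := by
    refine (variance_le_expectation_sq (by fun_prop)).trans ?_
    simpa [← pow_mul] using gaussian_pow_four.2
  have hint : Integrable (fun g => (nrm g ^ 2 - d) ^ 2) (gaussianVec d) :=
    (hmemS.sub (memLp_const (d : ℝ))).integrable_sq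
  refine ⟨hint, ?_⟩
  have h1 : Var[fun g : Vec d => nrm g ^ 2; gaussianVec d] =
      ∫ g, (nrm g ^ 2 - d) ^ 2 ∂gaussianVec d := by
    rw [variance_eq_integral (by fun_prop), hmean]
  rw [← h1, hsum]
  have e : (fun g : Vec d => ∑ i, (g i) ^ 2) = ∑ i, fun g : Vec d => (g i) ^ 2 := by
    funext g; simp
  rw [e]
  refine hvar.le.trans ?_
  refine (Finset.sum_le_card_nsmul _ _ 64 fun i _ => hv1).trans ?_
  simp [mul_comm]

lemma exp_neg_nrm_sq (d : ℕ) :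
    Integrable (fun g => Real.exp (-(nrm g ^ 2) / 2)) (gaussianVec d) ∧
      ∫ g, Real.exp (-(nrm g ^ 2) / 2) ∂gaussianVec d = (√2)⁻¹ ^ d := by
  have e : (fun g : Vec d => Real.exp (-(nrm g ^ 2) / 2)) =
      fun g => ∏ i, Real.exp (-1 / 2 * (g i) ^ 2) := by
    funext g
    rw [← Real.exp_sum, ← dot_self_eq_nrm_sq, ← Finset.mul_sum]
    simp only [dotProduct, ← sq]
    congr 1; ring
  have h := gaussian_exp_sq (a := -1 / 2) (by norm_num)
  rw [e]
  refine ⟨Integrable.fintype_prod fun i => h.1, ?_⟩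
  have h2 := integral_fintype_prod_eq_pow (ι := Fin d) (μ := gaussianReal 0 1)
    (fun t : ℝ => Real.exp (-1 / 2 * t ^ 2))
  rw [h.2] at h2
  refine h2.trans ?_
  norm_num

/-! ### The reduced samples in terms of projections -/

/-- `U_⊥ H_2(z_U) U_⊥ᵀ` in terms of the projection `Q = U Uᵀ`. -/
def redMat (Q : Mat d d) (D : ℕ) (z : Vec d) : Mat d d :=
  √((D : ℝ) * (D + 2) / 2) •
    ((√(1 - z ⬝ᵥ (Q *ᵥ z)))⁻¹ ^ 2 • vecMulVec (z - Q *ᵥ z) (z - Q *ᵥ z) -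
      (1 / (D : ℝ)) • (1 - Q))

/-- A bounded weight on squared lengths. -/
def radial (u : ℝ) : ℝ := max 0 (1 - √u)

/-- The value of the feature `τ(y) radial(d ‖r‖²)` at a sample. -/
def sampleWeight (τ : ℝ → ℝ) (Q : Mat d d) (p : ℝ × Vec d) : ℝ :=
  τ p.1 * radial (d * (p.2 ⬝ᵥ (Q *ᵥ p.2)))

/-- The contribution of one sample to the empirical harmonic coefficient. -/
def sampleMat (τ : ℝ → ℝ) (Q : Mat d d) (D : ℕ) (p : ℝ × Vec d) :
    Mat d d :=
  sampleWeight τ Q p • redMat Q D p.2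

/-- The Gaussian limit of the weighted harmonic coefficient. -/
def target (F : Vec s → ℝ) (ρ : Measure ℝ) (τ : ℝ → ℝ) (P : Mat s s) :
    Mat s s :=
  Matrix.of fun i j => ∫ q, (τ (F q.1 + q.2) * radial (q.1 ⬝ᵥ (P *ᵥ q.1))) *
    ((√2)⁻¹ * (((1 - P) *ᵥ q.1) i * ((1 - P) *ᵥ q.1) j - (1 - P) i j))
      ∂(gaussianVec s).prod ρ

/-- The sample `(y, z)` generated from a Gaussian vector and the noise. -/
def modelMap (F : Vec s → ℝ) (W : Mat d s) (p : Vec d × ℝ) : ℝ × Vec d :=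
  (F (√d • (Wᵀ *ᵥ direction p.1)) + p.2, direction p.1)

lemma measurable_modelMap {F : Vec s → ℝ} (hF : Measurable F)
    (W : Mat d s) : Measurable (modelMap F W) := by
  have h1 : Measurable fun p : Vec d × ℝ => Wᵀ *ᵥ direction p.1 :=
    (measurable_mulVec _).comp (measurable_direction.comp measurable_fst)
  unfold modelMap
  exact ((hF.comp (h1.const_smul (√d))).add measurable_snd).prodMk
    (measurable_direction.comp measurable_fst)

lemma polyModel_eq_map (hd : 0 < d) (f : MvPolynomial (Fin s) ℝ) (ρ : Measure ℝ)
    [IsProbabilityMeasure ρ] (W : Mat d s) :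
    polyModel f ρ W =
      ((gaussianVec d).prod ρ).map (modelMap (fun x => MvPolynomial.eval x f) W) := by
  have hf : Measurable fun x : Vec s => MvPolynomial.eval x f :=
    (MvPolynomial.continuous_eval f).measurable
  have hg : Measurable fun p : Vec s × ℝ => MvPolynomial.eval (√d • p.1) f + p.2 :=
    (hf.comp (by fun_prop : Measurable fun p : Vec s × ℝ => √d • p.1)).add measurable_snd
  have hmm := measurable_modelMap hf W
  have hprob : IsProbabilityMeasure (sphereUniform d) := by
    rw [sphereUniform_eq_map hd]
    exact Measure.isProbabilityMeasure_map measurable_direction.aemeasurable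
  have hMk : IsMarkovKernel (polyLink d f ρ) := by
    unfold polyLink
    exact Kernel.IsMarkovKernel.map _ hg
  have hlink : ∀ t A, MeasurableSet A →
      polyLink d f ρ t A = ρ {e | MvPolynomial.eval (√d • t) f + e ∈ A} := by
    intro t A hA
    rw [polyLink, Kernel.map_apply _ hg, Kernel.prod_apply, Kernel.deterministic_apply,
      Kernel.const_apply, Measure.dirac_prod, Measure.map_map hg (by fun_prop),
      Measure.map_apply (hg.comp (by fun_prop)) hA]
    rfl
  ext A hA
  rw [Measure.map_apply hmm hA, Measure.prod_apply (hmm hA), polyModel, model,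
    Measure.map_apply measurable_swap hA, Measure.compProd_apply (measurable_swap hA),
    sphereUniform_eq_map hd, lintegral_map _ measurable_direction]
  · refine lintegral_congr fun g => ?_
    rw [Kernel.comap_apply, hlink _ _ (measurable_prodMk_left (measurable_swap hA))]
    rfl
  · exact Kernel.measurable_kernel_prodMk_left (measurable_swap hA)

lemma radial_nonneg (u : ℝ) : 0 ≤ radial u := le_max_left _ _

lemma radial_le_one (u : ℝ) : radial u ≤ 1 :=
  max_le zero_le_one (by linarith [Real.sqrt_nonneg u])

lemma abs_radial_sub_le (u v : ℝ) : |radial u - radial v| ≤ |√u - √v| := by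
  unfold radial
  refine (abs_max_sub_max_le_max 0 _ 0 _).trans ?_
  simp [abs_sub_comm]

@[fun_prop]
lemma continuous_radial : Continuous radial := by
  unfold radial; fun_prop

lemma proj_mulVec_dot {Q : Mat d d} (hQt : Qᵀ = Q) (hQ : Q * Q = Q)
    (g : Vec d) : nrm (Q *ᵥ g) ^ 2 = g ⬝ᵥ (Q *ᵥ g) := by
  rw [← dot_self_eq_nrm_sq, mulVec_dot, hQt, mulVec_mulVec, hQ, dotProduct_comm]

lemma nrm_sub_proj_sq {Q : Mat d d} (hQt : Qᵀ = Q) (hQ : Q * Q = Q)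
    (g : Vec d) : nrm (g - Q *ᵥ g) ^ 2 = nrm g ^ 2 - g ⬝ᵥ (Q *ᵥ g) := by
  rw [← dot_self_eq_nrm_sq, ← dot_self_eq_nrm_sq, sub_dotProduct, dotProduct_sub, dotProduct_sub,
    dot_self_eq_nrm_sq (Q *ᵥ g), proj_mulVec_dot hQt hQ, dotProduct_comm (Q *ᵥ g)]
  ring

lemma sub_proj_dot {Q : Mat d d} (hQt : Qᵀ = Q) (z v : Vec d) :
    (z - Q *ᵥ z) ⬝ᵥ v = (v - Q *ᵥ v) ⬝ᵥ z := by
  rw [sub_dotProduct, sub_dotProduct, dotProduct_comm z v, dotProduct_comm (Q *ᵥ z),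
    dot_mulVec_comm hQt, dotProduct_comm z]

lemma dot_redMat (Q : Mat d d) (D : ℕ) (z v : Vec d) :
    v ⬝ᵥ (redMat Q D z *ᵥ v) = √((D : ℝ) * (D + 2) / 2) *
      ((√(1 - z ⬝ᵥ (Q *ᵥ z)))⁻¹ ^ 2 * ((z - Q *ᵥ z) ⬝ᵥ v) ^ 2 -
        (1 / (D : ℝ)) * (v ⬝ᵥ (v - Q *ᵥ v))) := by
  have h : vecMulVec (z - Q *ᵥ z) (z - Q *ᵥ z) *ᵥ v = ((z - Q *ᵥ z) ⬝ᵥ v) • (z - Q *ᵥ z) := by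
    rw [vecMulVec_mulVec]
    ext i; simp [mul_comm]
  simp only [redMat, smul_mulVec, sub_mulVec, dotProduct_smul, dotProduct_sub, h,
    one_mulVec, smul_eq_mul, dotProduct_comm v (z - Q *ᵥ z)]
  ring

/-- The squared coordinate of the reduced input along `v`. -/
def redCoord (Q : Mat d d) (v g : Vec d) : ℝ :=
  ((v - Q *ᵥ v) ⬝ᵥ g) ^ 2 / nrm (g - Q *ᵥ g) ^ 2

lemma redCoord_eq {Q : Mat d d} (hQt : Qᵀ = Q) (hQ : Q * Q = Q)
    (v g : Vec d) : (√(1 - direction g ⬝ᵥ (Q *ᵥ direction g)))⁻¹ ^ 2 *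
      ((direction g - Q *ᵥ direction g) ⬝ᵥ v) ^ 2 = redCoord Q v g := by
  by_cases hg : g = 0
  · simp [hg, direction, redCoord]
  have hpos := nrm_pos hg
  have h1 : 1 - direction g ⬝ᵥ (Q *ᵥ direction g) = ((nrm g)⁻¹ * nrm (g - Q *ᵥ g)) ^ 2 := by
    rw [mul_pow, nrm_sub_proj_sq hQt hQ, direction]
    simp only [mulVec_smul, smul_dotProduct, dotProduct_smul, smul_eq_mul]
    field_simp
  rw [h1, Real.sqrt_sq (mul_nonneg (by positivity) (nrm_nonneg _)), sub_proj_dot hQt, redCoord]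
  simp only [direction, dotProduct_smul, smul_eq_mul]
  by_cases hR : nrm (g - Q *ᵥ g) = 0
  · simp [hR]
  · field_simp

lemma redCoord_nonneg (Q : Mat d d) (v g : Vec d) : 0 ≤ redCoord Q v g := by
  unfold redCoord; positivity

lemma redCoord_le {Q : Mat d d} (hQt : Qᵀ = Q) (v g : Vec d) :
    redCoord Q v g ≤ nrm v ^ 2 := by
  unfold redCoord
  refine div_le_of_le_mul₀ (by positivity) (by positivity) ?_
  rw [← sub_proj_dot hQt, ← mul_pow, mul_comm]
  exact sq_le_sq' (by have := neg_le_of_abs_le (abs_dot_le (g - Q *ᵥ g) v); linarith)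
    (le_of_abs_le (abs_dot_le _ _))

lemma measurable_redCoord (Q : Mat d d) (v : Vec d) :
    Measurable (redCoord Q v) := by
  unfold redCoord
  refine ((measurable_dot _).pow_const 2).div ?_
  have : Measurable fun g : Vec d => g - Q *ᵥ g := measurable_id.sub (measurable_mulVec Q)
  exact (measurable_nrm.comp this).pow_const 2

lemma nrm_sub_proj_le {Q : Mat d d} (hQt : Qᵀ = Q) (hQ : Q * Q = Q)
    (v : Vec d) : nrm (v - Q *ᵥ v) ≤ nrm v := by
  refine le_of_sq_le_sq ?_ (nrm_nonneg _)
  rw [nrm_sub_proj_sq hQt hQ, ← proj_mulVec_dot hQt hQ]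
  linarith [sq_nonneg (nrm (Q *ᵥ v))]

/-- The reduced coordinates are uniformly subexponential. -/
lemma exp_redCoord {U : Mat d k} (hU : IsFrame U) {v : Vec d}
    (hv : nrm v ≤ 2) :
    ∫ g, Real.exp (1 / (64 * (k + 1)) * d * redCoord (U * Uᵀ) v g) ∂gaussianVec d ≤ 2 * k + 3 := by
  set Q := U * Uᵀ with hQdef
  have hQt : Qᵀ = Q := proj_transpose U
  have hQ : Q * Q = Q := proj_mul_self hU
  set a : ℝ := 1 / (64 * (k + 1)) with ha
  have ha0 : 0 < a := by positivity
  have ha1 : a ≤ 1 / 64 := by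
    rw [ha]
    apply one_div_le_one_div_of_le (by norm_num)
    nlinarith [Nat.cast_nonneg (α := ℝ) k]
  have hd0 : (0 : ℝ) ≤ d := Nat.cast_nonneg d
  have hv2 : nrm v ^ 2 ≤ 4 := by nlinarith [nrm_nonneg v]
  set v' := v - Q *ᵥ v with hv'
  have hv'2 : nrm v' ^ 2 ≤ 4 := (pow_le_pow_left₀ (nrm_nonneg _) (nrm_sub_proj_le hQt hQ v) 2).trans hv2
  obtain ⟨c, hc⟩ : ∃ c : Fin k → Vec d, ∀ j, c j = Uᵀ j := ⟨fun j => Uᵀ j, fun _ => rfl⟩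
  set B : Vec d → ℝ := fun g => Real.exp (1 / 16 * (v' ⬝ᵥ g) ^ 2) +
    (Real.exp (4 * a * d + d / 4) * Real.exp (-(nrm g ^ 2) / 2) +
      ∑ j, Real.exp (1 / 4 * (c j ⬝ᵥ g) ^ 2)) with hB
  have hI1 := exp_dot_sq (v := v') (b := 1 / 16) (by linarith)
  have hI2 := exp_neg_nrm_sq d
  have hI3 : ∀ j, _ := fun j => exp_dot_sq (v := c j) (b := 1 / 4) (by rw [hc, hU.nrm_col]; norm_num)
  have hpt : ∀ g, Real.exp (a * d * redCoord Q v g) ≤ B g := by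
    intro g
    have hs : 0 ≤ ∑ j, Real.exp (1 / 4 * (c j ⬝ᵥ g) ^ 2) :=
      Finset.sum_nonneg fun _ _ => (Real.exp_pos _).le
    by_cases hR : (d : ℝ) / 4 ≤ nrm (g - Q *ᵥ g) ^ 2
    · have h1 : a * d * redCoord Q v g ≤ 1 / 16 * (v' ⬝ᵥ g) ^ 2 := by
        by_cases hd : (d : ℝ) = 0
        · rw [hd]; simp only [mul_zero, zero_mul]; positivity
        have hdp : (0 : ℝ) < d := lt_of_le_of_ne hd0 (Ne.symm hd)
        have h2 : redCoord Q v g ≤ (v' ⬝ᵥ g) ^ 2 / (d / 4) :=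
          div_le_div_of_nonneg_left (sq_nonneg _) (by positivity) hR
        calc a * d * redCoord Q v g ≤ a * d * ((v' ⬝ᵥ g) ^ 2 / (d / 4)) := by gcongr
          _ = 4 * a * (v' ⬝ᵥ g) ^ 2 := by field_simp
          _ ≤ _ := by gcongr; linarith
      have h2 := Real.exp_le_exp.2 h1
      have h3 : 0 ≤ Real.exp (4 * a * d + d / 4) * Real.exp (-(nrm g ^ 2) / 2) := by positivity
      simp only [hB]
      linarith
    · push Not at hR
      have h1 : a * d * redCoord Q v g ≤ 4 * a * d := by
        have := (redCoord_le hQt v g).trans hv2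
        nlinarith [mul_nonneg ha0.le hd0]
      refine (Real.exp_le_exp.2 h1).trans ?_
      by_cases hg : nrm g ^ 2 < d / 2
      · have h2 : Real.exp (4 * a * d) ≤
            Real.exp (4 * a * d + d / 4) * Real.exp (-(nrm g ^ 2) / 2) := by
          rw [← Real.exp_add]
          exact Real.exp_le_exp.2 (by linarith)
        have h3 := (Real.exp_pos (1 / 16 * (v' ⬝ᵥ g) ^ 2)).le
        simp only [hB]
        linarith
      · push Not at hg
        have hU2 : (d : ℝ) / 4 < ∑ j, (c j ⬝ᵥ g) ^ 2 := by
          have h2 := nrm_sub_proj_sq hQt hQ g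
          rw [dot_proj U] at h2
          have h3 : (Uᵀ *ᵥ g) ⬝ᵥ (Uᵀ *ᵥ g) = ∑ j, (c j ⬝ᵥ g) ^ 2 := by
            simp [dotProduct, mulVec, sq, hc]
          linarith
        obtain ⟨j, hj⟩ : ∃ j, (d : ℝ) / (4 * (k + 1)) ≤ (c j ⬝ᵥ g) ^ 2 := by
          by_contra hcon
          push Not at hcon
          have h2 : ∑ j, (c j ⬝ᵥ g) ^ 2 ≤ k * ((d : ℝ) / (4 * (k + 1))) := by
            refine (Finset.sum_le_card_nsmul _ _ _ fun j _ => (hcon j).le).trans (by simp)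
          have h3 : k * ((d : ℝ) / (4 * (k + 1))) ≤ d / 4 := by
            rw [mul_div_assoc', div_le_div_iff₀ (by positivity) (by norm_num)]
            nlinarith
          linarith
        have h2 : Real.exp (4 * a * d) ≤ Real.exp (1 / 4 * (c j ⬝ᵥ g) ^ 2) := by
          refine Real.exp_le_exp.2 ?_
          have : 4 * a * d = 1 / 4 * ((d : ℝ) / (4 * (k + 1))) := by
            rw [ha]; field_simp; norm_num
          rw [this]
          gcongr
        have h3 := Finset.single_le_sum (f := fun j => Real.exp (1 / 4 * (c j ⬝ᵥ g) ^ 2))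
          (fun _ _ => (Real.exp_pos _).le) (Finset.mem_univ j)
        have h4 := (Real.exp_pos (1 / 16 * (v' ⬝ᵥ g) ^ 2)).le
        have h5 : 0 ≤ Real.exp (4 * a * d + d / 4) * Real.exp (-(nrm g ^ 2) / 2) := by positivity
        simp only [hB]
        linarith
  have hBi : Integrable B (gaussianVec d) :=
    hI1.1.add ((hI2.1.const_mul _).add (integrable_finsetSum _ fun j _ => (hI3 j).1))
  have hBint : ∫ g, B g ∂gaussianVec d ≤ 2 * k + 3 := by
    have e1 : ∫ g, B g ∂gaussianVec d = ∫ g, Real.exp (1 / 16 * (v' ⬝ᵥ g) ^ 2) ∂gaussianVec d +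
        (Real.exp (4 * a * d + d / 4) * ∫ g, Real.exp (-(nrm g ^ 2) / 2) ∂gaussianVec d +
          ∑ j, ∫ g, Real.exp (1 / 4 * (c j ⬝ᵥ g) ^ 2) ∂gaussianVec d) := by
      have hr1 : Integrable (fun g => ∑ j, Real.exp (1 / 4 * (c j ⬝ᵥ g) ^ 2)) (gaussianVec d) :=
        integrable_finsetSum _ fun j _ => (hI3 j).1
      have hr2 : Integrable (fun g => Real.exp (4 * a * d + d / 4) * Real.exp (-(nrm g ^ 2) / 2))
        (gaussianVec d) := hI2.1.const_mul _
      refine (integral_add hI1.1 (hr2.add hr1)).trans (congrArg _ ?_)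
      refine (integral_add hr2 hr1).trans ?_
      rw [integral_const_mul, integral_finsetSum _ fun j _ => (hI3 j).1]
    have e2 : Real.exp (4 * a * d + d / 4) * (√2)⁻¹ ^ d ≤ 1 := by
      have h2 : (√2)⁻¹ = Real.exp (-(Real.log 2) / 2) := by
        rw [← Real.exp_log (show (0 : ℝ) < (√2)⁻¹ by positivity), Real.log_inv,
          Real.log_sqrt (by norm_num)]
        congr 1; ring
      rw [h2, ← Real.exp_nat_mul, ← Real.exp_add, Real.exp_le_one_iff]
      have := Real.log_two_gt_d9
      nlinarith
    rw [e1, hI2.2]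
    have e3 : ∑ j, ∫ g, Real.exp (1 / 4 * (c j ⬝ᵥ g) ^ 2) ∂gaussianVec d ≤ 2 * k := by
      refine (Finset.sum_le_card_nsmul _ _ 2 fun j _ => (hI3 j).2).trans ?_
      simp [mul_comm]
    linarith [hI1.2]
  refine le_trans (integral_mono_of_nonneg (Eventually.of_forall fun g => (Real.exp_pos _).le) hBi
    (Eventually.of_forall hpt)) hBint

lemma integrable_of_bounded {α : Type*} [MeasurableSpace α] {μ : Measure α} [IsFiniteMeasure μ]
    {f : α → ℝ} (hf : Measurable f) (C : ℝ) (hC : ∀ x, |f x| ≤ C) : Integrable f μ :=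
  Integrable.of_bound hf.aestronglyMeasurable C (Eventually.of_forall hC)

lemma integral_redCoord_sq_le (hd : 0 < d) {U : Mat d k} (hU : IsFrame U)
    {v : Vec d} (hv : nrm v ≤ 2) :
    ∫ g, redCoord (U * Uᵀ) v g ^ 2 ∂gaussianVec d ≤ 2 * (64 * (k + 1)) ^ 2 * (2 * k + 3) / d ^ 2 := by
  have hd' : (0 : ℝ) < d := Nat.cast_pos.2 hd
  have hm := measurable_redCoord (U * Uᵀ) v
  have hub : ∀ g, redCoord (U * Uᵀ) v g ≤ 4 := fun g =>
    (redCoord_le (proj_transpose U) v g).trans (by nlinarith [nrm_nonneg v])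
  have hi : Integrable (fun g => Real.exp (1 / (64 * (k + 1)) * d * redCoord (U * Uᵀ) v g))
      (gaussianVec d) := by
    refine integrable_of_bounded (by fun_prop) (Real.exp (1 / (64 * (k + 1)) * d * 4)) fun g => ?_
    rw [Real.abs_exp]
    gcongr
    exact hub g
  have hpt : ∀ g, redCoord (U * Uᵀ) v g ^ 2 ≤ 2 * (64 * (k + 1)) ^ 2 / d ^ 2 *
      Real.exp (1 / (64 * (k + 1)) * d * redCoord (U * Uᵀ) v g) := fun g => by
    have h := Real.quadratic_le_exp_of_nonneg (x := 1 / (64 * (k + 1)) * d * redCoord (U * Uᵀ) v g)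
      (mul_nonneg (by positivity) (redCoord_nonneg _ _ _))
    have h2 : (1 / (64 * (k + 1)) * d * redCoord (U * Uᵀ) v g) ^ 2 / 2 ≤
        Real.exp (1 / (64 * (k + 1)) * d * redCoord (U * Uᵀ) v g) := by
      have := mul_nonneg (show 0 ≤ 1 / (64 * ((k : ℝ) + 1)) * d by positivity)
        (redCoord_nonneg (U * Uᵀ) v g)
      linarith
    calc redCoord (U * Uᵀ) v g ^ 2 = 2 * (64 * (k + 1)) ^ 2 / d ^ 2 *
        ((1 / (64 * (k + 1)) * d * redCoord (U * Uᵀ) v g) ^ 2 / 2) := by field_simp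
      _ ≤ _ := by gcongr
  refine (integral_mono_of_nonneg (Eventually.of_forall fun g => sq_nonneg _) (hi.const_mul _)
    (Eventually.of_forall hpt)).trans ?_
  rw [integral_const_mul]
  refine (mul_le_mul_of_nonneg_left (exp_redCoord hU hv) (by positivity)).trans (le_of_eq ?_)
  ring

/-! ### The Gaussian limit of the weighted harmonic coefficient -/

lemma integrable_mul_fst {α β : Type*} [MeasurableSpace α] [MeasurableSpace β] {μ : Measure α}
    {ν : Measure β} [IsFiniteMeasure μ] [IsFiniteMeasure ν] {h : α × β → ℝ} (hh : Measurable h)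
    (hb : ∀ p, |h p| ≤ 1) {f : α → ℝ} (hf : Integrable f μ) :
    Integrable (fun p => h p * f p.1) (μ.prod ν) :=
  (hf.comp_fst ν).bdd_mul (c := 1) hh.aestronglyMeasurable (Eventually.of_forall hb)

/-- The quadratic form of the target. -/
lemma dot_target {F : Vec s → ℝ} (hF : Continuous F) {ρ : Measure ℝ}
    [IsProbabilityMeasure ρ] {τ : ℝ → ℝ} (hτ : Continuous τ) (hτ1 : ∀ y, |τ y| ≤ 1)
    {P : Mat s s} (hPt : Pᵀ = P) (hP : P * P = P) (w : Vec s) :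
    w ⬝ᵥ (target F ρ τ P *ᵥ w) =
      ∫ q, (τ (F q.1 + q.2) * radial (q.1 ⬝ᵥ (P *ᵥ q.1))) * ((√2)⁻¹ *
        (((w - P *ᵥ w) ⬝ᵥ q.1) ^ 2 - nrm (w - P *ᵥ w) ^ 2)) ∂(gaussianVec s).prod ρ := by
  set h : Vec s × ℝ → ℝ := fun q => τ (F q.1 + q.2) * radial (q.1 ⬝ᵥ (P *ᵥ q.1)) with hh
  have hhm : Measurable h := Continuous.measurable (by fun_prop)
  have hh1 : ∀ q, |h q| ≤ 1 := fun q => by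
    rw [hh, abs_mul, abs_of_nonneg (radial_nonneg _)]
    exact mul_le_one₀ (hτ1 _) (radial_nonneg _) (radial_le_one _)
  have hint : ∀ i j, Integrable (fun q : Vec s × ℝ => h q * ((√2)⁻¹ *
      (((1 - P) *ᵥ q.1) i * ((1 - P) *ᵥ q.1) j - (1 - P) i j))) ((gaussianVec s).prod ρ) := by
    intro i j
    refine integrable_mul_fst hhm hh1 (f := fun x => (√2)⁻¹ *
      (((1 - P) *ᵥ x) i * ((1 - P) *ᵥ x) j - (1 - P) i j)) ?_
    refine ((Integrable.sub ?_ (integrable_const _))).const_mul _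
    refine ((integrable_dot_pow ((1 - P) i) 2).add (integrable_dot_pow ((1 - P) j) 2)).mono'
      (Continuous.aestronglyMeasurable (by fun_prop)) (Eventually.of_forall fun x => ?_)
    have h2 := two_mul_le_add_sq |((1 - P) *ᵥ x) i| |((1 - P) *ᵥ x) j|
    rw [sq_abs, sq_abs] at h2
    rw [Real.norm_eq_abs, abs_mul]
    have h3 : 0 ≤ |((1 - P) *ᵥ x) i| * |((1 - P) *ᵥ x) j| := by positivity
    calc _ ≤ ((1 - P) *ᵥ x) i ^ 2 + ((1 - P) *ᵥ x) j ^ 2 := by linarith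
      _ = _ := rfl
  have e1 : w ⬝ᵥ (target F ρ τ P *ᵥ w) = ∑ i, ∑ j, ∫ q, w i * w j * (h q * ((√2)⁻¹ *
      (((1 - P) *ᵥ q.1) i * ((1 - P) *ᵥ q.1) j - (1 - P) i j))) ∂(gaussianVec s).prod ρ := by
    simp only [dotProduct, mulVec, target, Matrix.of_apply, Finset.mul_sum, hh]
    refine Finset.sum_congr rfl fun i _ => Finset.sum_congr rfl fun j _ => ?_
    rw [integral_const_mul, mul_comm (∫ q, _ ∂_) (w j), ← mul_assoc]
  rw [e1]
  have e2 : ∀ i, ∑ j, ∫ q, w i * w j * (h q * ((√2)⁻¹ *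
      (((1 - P) *ᵥ q.1) i * ((1 - P) *ᵥ q.1) j - (1 - P) i j))) ∂(gaussianVec s).prod ρ =
      ∫ q, ∑ j, w i * w j * (h q * ((√2)⁻¹ *
      (((1 - P) *ᵥ q.1) i * ((1 - P) *ᵥ q.1) j - (1 - P) i j))) ∂(gaussianVec s).prod ρ := fun i =>
    (integral_finsetSum _ fun j _ => (hint i j).const_mul _).symm
  simp only [e2]
  rw [← integral_finsetSum _ fun i _ => integrable_finsetSum _ fun j _ => (hint i j).const_mul _]
  refine integral_congr_ae (Eventually.of_forall fun q => ?_)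
  have e3 : (w - P *ᵥ w) ⬝ᵥ q.1 = ∑ i, w i * ((1 - P) *ᵥ q.1) i := by
    rw [← sub_proj_dot hPt, dotProduct_comm, sub_mulVec, one_mulVec]
    rfl
  have e4 : nrm (w - P *ᵥ w) ^ 2 = ∑ i, ∑ j, w i * w j * (1 - P) i j := by
    rw [nrm_sub_proj_sq hPt hP, ← dot_self_eq_nrm_sq, ← dotProduct_sub]
    rw [show w - P *ᵥ w = (1 - P) *ᵥ w by rw [sub_mulVec, one_mulVec]]
    simp only [dotProduct, mulVec, Finset.mul_sum]
    refine Finset.sum_congr rfl fun i _ => Finset.sum_congr rfl fun j _ => by ring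
  have e5 : (∑ i, w i * ((1 - P) *ᵥ q.1) i) ^ 2 =
      ∑ i, ∑ j, w i * w j * (((1 - P) *ᵥ q.1) i * ((1 - P) *ᵥ q.1) j) := by
    rw [sq, Finset.sum_mul_sum]
    refine Finset.sum_congr rfl fun i _ => Finset.sum_congr rfl fun j _ => by ring
  simp only
  rw [e3, e4, e5, ← Finset.sum_sub_distrib, Finset.mul_sum, Finset.mul_sum]
  refine Finset.sum_congr rfl fun i _ => ?_
  rw [← Finset.sum_sub_distrib, Finset.mul_sum, Finset.mul_sum]
  refine Finset.sum_congr rfl fun j _ => ?_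
  rw [hh]
  ring

/-- The Gaussian coordinates of a frame are independent of a coordinate orthogonal to it. -/
lemma integral_frame_mul_dot {W : Mat d s} (hW : IsFrame W) {b : Vec d}
    (hb : Wᵀ *ᵥ b = 0) {φ : Vec s → ℝ} (hφ : Measurable φ) {ψ : ℝ → ℝ} (hψ : Measurable ψ) :
    ∫ g, φ (Wᵀ *ᵥ g) * ψ (b ⬝ᵥ g) ∂gaussianVec d =
      (∫ x, φ x ∂gaussianVec s) * ∫ t, ψ (nrm b * t) ∂gaussianReal 0 1 := by
  by_cases h0 : b = 0
  · subst h0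
    simp only [zero_dotProduct, nrm_zero, zero_mul, integral_const, probReal_univ, one_smul]
    rw [integral_mul_const, ← hW.map_gaussianVec, integral_map (measurable_mulVec _).aemeasurable
      hφ.aestronglyMeasurable]
  have hV : IsFrame (Matrix.of fun (i : Fin d) (_ : Fin 1) => direction b i) := by
    rw [isFrame_iff]
    intro i j
    have : direction b ⬝ᵥ direction b = 1 := by rw [dot_self_eq_nrm_sq, nrm_direction h0]; norm_num
    rw [Subsingleton.elim i j, if_pos rfl]
    exact this
  have hWV : Wᵀ * (Matrix.of fun (i : Fin d) (_ : Fin 1) => direction b i) = 0 := by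
    ext i j
    have h1 : Wᵀ *ᵥ direction b = 0 := by rw [direction, mulVec_smul, hb, smul_zero]
    exact congrFun h1 i
  have hpair := map_gaussianVec_pair hW hV hWV
  have hm1 : Measurable fun p : Vec s × Vec 1 => φ p.1 * ψ (nrm b * p.2 0) :=
    (hφ.comp measurable_fst).mul (hψ.comp (by fun_prop))
  have hm2 : Measurable fun g : Vec d => (Wᵀ *ᵥ g,
      (Matrix.of fun (i : Fin d) (_ : Fin 1) => direction b i)ᵀ *ᵥ g) :=
    (measurable_mulVec _).prodMk (measurable_mulVec _)
  have h1 : ∫ g, φ (Wᵀ *ᵥ g) * ψ (b ⬝ᵥ g) ∂gaussianVec d =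
      ∫ p, φ p.1 * ψ (nrm b * p.2 0) ∂(gaussianVec s).prod (gaussianVec 1) := by
    rw [← hpair, integral_map hm2.aemeasurable hm1.aestronglyMeasurable]
    refine integral_congr_ae (Eventually.of_forall fun g => ?_)
    have : b ⬝ᵥ g = nrm b * (direction b ⬝ᵥ g) := by
      have := (nrm_pos h0).ne'
      simp only [direction, smul_dotProduct, smul_eq_mul]
      field_simp
    simp only [this]
    rfl
  rw [h1]
  have h2 := integral_prod_mul (μ := gaussianVec s) (ν := gaussianVec 1) φ
    (fun x : Vec 1 => ψ (nrm b * x 0))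
  rw [h2]
  congr 1
  have h3 := (measurePreserving_eval (fun _ : Fin 1 => gaussianReal 0 1) 0).map_eq
  have h4 : Measurable fun t => ψ (nrm b * t) := hψ.comp (by fun_prop)
  rw [← h3, integral_map (measurable_pi_apply 0).aemeasurable h4.aestronglyMeasurable]
  rfl

/-- The quadratic form of the target as an expectation over the ambient Gaussian vector. -/
lemma integral_ambient_eq_target {F : Vec s → ℝ} (hF : Continuous F) {ρ : Measure ℝ}
    [IsProbabilityMeasure ρ] {τ : ℝ → ℝ} (hτ : Continuous τ) (hτ1 : ∀ y, |τ y| ≤ 1)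
    {P : Mat s s} (hPt : Pᵀ = P) (hP : P * P = P) {W : Mat d s}
    (hW : IsFrame W) (v : Vec d) :
    ∫ p, (τ (F (Wᵀ *ᵥ p.1) + p.2) * radial ((Wᵀ *ᵥ p.1) ⬝ᵥ (P *ᵥ (Wᵀ *ᵥ p.1)))) *
      ((√2)⁻¹ * (((v - (W * P * Wᵀ) *ᵥ v) ⬝ᵥ p.1) ^ 2 - nrm (v - (W * P * Wᵀ) *ᵥ v) ^ 2))
        ∂(gaussianVec d).prod ρ = (Wᵀ *ᵥ v) ⬝ᵥ (target F ρ τ P *ᵥ (Wᵀ *ᵥ v)) := by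
  rw [dot_target hF hτ hτ1 hPt hP]
  set w := Wᵀ *ᵥ v with hw
  set a := w - P *ᵥ w with ha
  set b := v - W *ᵥ w with hb
  have hWb : Wᵀ *ᵥ b = 0 := by
    rw [hb, mulVec_sub, mulVec_mulVec, show Wᵀ * W = 1 from hW, one_mulVec, hw,
      sub_self]
  have hv0 : v - (W * P * Wᵀ) *ᵥ v = W *ᵥ a + b := by
    rw [ha, hb, ← mulVec_mulVec, ← mulVec_mulVec, ← hw, mulVec_sub]
    abel
  have hdot : ∀ g : Vec d, (W *ᵥ a + b) ⬝ᵥ g = a ⬝ᵥ (Wᵀ *ᵥ g) + b ⬝ᵥ g := fun g => by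
    rw [add_dotProduct, mulVec_dot, Matrix.transpose_transpose]
  have hnrm : nrm (W *ᵥ a + b) ^ 2 = nrm a ^ 2 + nrm b ^ 2 := by
    rw [← dot_self_eq_nrm_sq, hdot, mulVec_add, hWb, add_zero, mulVec_mulVec,
      show Wᵀ * W = 1 from hW, one_mulVec, dotProduct_add, mulVec_dot, hWb, zero_dotProduct,
      zero_add, dot_self_eq_nrm_sq, dot_self_eq_nrm_sq]
  set h : Vec s × ℝ → ℝ := fun q => τ (F q.1 + q.2) * radial (q.1 ⬝ᵥ (P *ᵥ q.1)) with hh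
  have hhm : Measurable h := Continuous.measurable (by fun_prop)
  have hh1 : ∀ q, |h q| ≤ 1 := fun q => by
    rw [hh, abs_mul, abs_of_nonneg (radial_nonneg _)]
    exact mul_le_one₀ (hτ1 _) (radial_nonneg _) (radial_le_one _)
  set H : Vec d × ℝ → ℝ := fun p => h (Wᵀ *ᵥ p.1, p.2) with hH
  have hmapm : Measurable fun p : Vec d × ℝ => (Wᵀ *ᵥ p.1, p.2) :=
    ((measurable_mulVec _).comp measurable_fst).prodMk measurable_snd
  have hHm : Measurable H := hhm.comp hmapm
  have hH1 : ∀ p, |H p| ≤ 1 := fun p => hh1 _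
  set f1 : Vec d → ℝ := fun g => (√2)⁻¹ * ((a ⬝ᵥ (Wᵀ *ᵥ g)) ^ 2 - nrm a ^ 2) with hf1
  set f2 : Vec d → ℝ := fun g => (√2)⁻¹ *
    (2 * ((a ⬝ᵥ (Wᵀ *ᵥ g)) * (b ⬝ᵥ g)) + ((b ⬝ᵥ g) ^ 2 - nrm b ^ 2)) with hf2
  have hWa : ∀ g : Vec d, a ⬝ᵥ (Wᵀ *ᵥ g) = (W *ᵥ a) ⬝ᵥ g := fun g => by
    rw [mulVec_dot, Matrix.transpose_transpose]
  have hcross : Integrable (fun g : Vec d => (a ⬝ᵥ (Wᵀ *ᵥ g)) * (b ⬝ᵥ g)) (gaussianVec d) := by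
    refine ((integrable_dot_pow (W *ᵥ a) 2).add (integrable_dot_pow b 2)).mono'
      (Continuous.aestronglyMeasurable (by fun_prop)) (Eventually.of_forall fun x => ?_)
    have h2 := two_mul_le_add_sq |(W *ᵥ a) ⬝ᵥ x| |b ⬝ᵥ x|
    rw [sq_abs, sq_abs] at h2
    rw [Real.norm_eq_abs, abs_mul, hWa]
    have h3 : 0 ≤ |(W *ᵥ a) ⬝ᵥ x| * |b ⬝ᵥ x| := by positivity
    calc _ ≤ ((W *ᵥ a) ⬝ᵥ x) ^ 2 + (b ⬝ᵥ x) ^ 2 := by linarith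
      _ = _ := rfl
  have hi1 : Integrable f1 (gaussianVec d) := by
    refine (Integrable.sub ?_ (integrable_const _)).const_mul _
    simp only [hWa]
    exact integrable_dot_pow _ 2
  have hbsq : Integrable (fun g : Vec d => (b ⬝ᵥ g) ^ 2 - nrm b ^ 2) (gaussianVec d) :=
    (integrable_dot_pow b 2).sub (integrable_const _)
  have hi2 : Integrable f2 (gaussianVec d) := ((hcross.const_mul 2).add hbsq).const_mul _
  have e1 : ∫ p, H p * ((√2)⁻¹ *
      (((v - (W * P * Wᵀ) *ᵥ v) ⬝ᵥ p.1) ^ 2 - nrm (v - (W * P * Wᵀ) *ᵥ v) ^ 2))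
        ∂(gaussianVec d).prod ρ = ∫ p, H p * f1 p.1 ∂(gaussianVec d).prod ρ +
          ∫ p, H p * f2 p.1 ∂(gaussianVec d).prod ρ := by
    rw [← integral_add (integrable_mul_fst hHm hH1 hi1) (integrable_mul_fst hHm hH1 hi2)]
    refine integral_congr_ae (Eventually.of_forall fun p => ?_)
    simp only [hv0, hdot, hnrm, hf1, hf2]
    ring
  have e2 : ∫ p, H p * f2 p.1 ∂(gaussianVec d).prod ρ = 0 := by
    rw [integral_prod_symm _ (integrable_mul_fst hHm hH1 hi2)]
    refine integral_eq_zero_of_ae (Eventually.of_forall fun e => ?_)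
    have hhe : Measurable fun x => h (x, e) := hhm.comp (by fun_prop)
    have h1 := integral_frame_mul_dot hW hWb (φ := fun x => h (x, e) * (a ⬝ᵥ x))
      (hhe.mul (measurable_dot a)) (ψ := fun t => t) measurable_id
    have h2 := integral_frame_mul_dot hW hWb (φ := fun x => h (x, e)) hhe
      (ψ := fun t => t ^ 2 - nrm b ^ 2) (by fun_prop)
    have h3 : ∫ t, nrm b * t ∂gaussianReal 0 1 = 0 := by
      rw [integral_const_mul, integral_id_gaussianReal, mul_zero]
    have h4 : ∫ t, ((nrm b * t) ^ 2 - nrm b ^ 2) ∂gaussianReal 0 1 = 0 := by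
      simp only [mul_pow]
      rw [integral_sub ((integrable_gaussian_pow 2).const_mul _) (integrable_const _),
        integral_const_mul, gaussian_pow_two]
      simp
    rw [h3, mul_zero] at h1
    rw [h4, mul_zero] at h2
    have hHe : Measurable fun g => H (g, e) := hHm.comp (by fun_prop)
    have hj1 : Integrable (fun g => H (g, e) * ((a ⬝ᵥ (Wᵀ *ᵥ g)) * (b ⬝ᵥ g))) (gaussianVec d) :=
      hcross.bdd_mul (c := 1) hHe.aestronglyMeasurable (Eventually.of_forall fun g => hH1 _)
    have hj2 : Integrable (fun g => H (g, e) * ((b ⬝ᵥ g) ^ 2 - nrm b ^ 2)) (gaussianVec d) :=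
      hbsq.bdd_mul (c := 1) hHe.aestronglyMeasurable (Eventually.of_forall fun g => hH1 _)
    have h5 : ∫ g, H (g, e) * f2 g ∂gaussianVec d = (√2)⁻¹ * (2 *
        ∫ g, H (g, e) * ((a ⬝ᵥ (Wᵀ *ᵥ g)) * (b ⬝ᵥ g)) ∂gaussianVec d +
        ∫ g, H (g, e) * ((b ⬝ᵥ g) ^ 2 - nrm b ^ 2) ∂gaussianVec d) := by
      rw [← integral_const_mul, ← integral_add (hj1.const_mul 2) hj2, ← integral_const_mul]
      refine integral_congr_ae (Eventually.of_forall fun g => ?_)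
      simp only [hf2]
      ring
    have h6 : ∫ g, H (g, e) * ((a ⬝ᵥ (Wᵀ *ᵥ g)) * (b ⬝ᵥ g)) ∂gaussianVec d = 0 := by
      rw [← h1]
      refine integral_congr_ae (Eventually.of_forall fun g => ?_)
      simp only [hH]
      ring
    have h7 : ∫ g, H (g, e) * ((b ⬝ᵥ g) ^ 2 - nrm b ^ 2) ∂gaussianVec d = 0 := h2
    simp only
    rw [h5, h6, h7]
    simp
  have e3 : ∫ p, H p * f1 p.1 ∂(gaussianVec d).prod ρ =
      ∫ q, h q * ((√2)⁻¹ * ((a ⬝ᵥ q.1) ^ 2 - nrm a ^ 2)) ∂(gaussianVec s).prod ρ := by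
    have hmp : ((gaussianVec d).prod ρ).map (fun p : Vec d × ℝ => (Wᵀ *ᵥ p.1, p.2)) =
        (gaussianVec s).prod ρ := by
      have := Measure.map_prod_map (gaussianVec d) ρ (measurable_mulVec Wᵀ) measurable_id
      rw [hW.map_gaussianVec, Measure.map_id] at this
      exact this.symm
    have hm : Measurable fun q : Vec s × ℝ => h q * ((√2)⁻¹ * ((a ⬝ᵥ q.1) ^ 2 - nrm a ^ 2)) :=
      hhm.mul (Continuous.measurable (by fun_prop))
    rw [← hmp, integral_map hmapm.aemeasurable hm.aestronglyMeasurable]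
  refine Eq.trans ?_ (e1.trans ?_)
  · rfl
  · rw [e2, add_zero, e3]

/-! ### Convergence of the weighted harmonic coefficient -/

/-- `f` is integrable with mean at most `c`. -/
def MeanLE {α : Type*} [MeasurableSpace α] (μ : Measure α) (f : α → ℝ) (c : ℝ) : Prop :=
  Integrable f μ ∧ ∫ x, f x ∂μ ≤ c

lemma MeanLE.add {α : Type*} [MeasurableSpace α] {μ : Measure α} {f g : α → ℝ} {a b : ℝ}
    (hf : MeanLE μ f a) (hg : MeanLE μ g b) : MeanLE μ (fun x => f x + g x) (a + b) :=
  ⟨hf.1.add hg.1, by rw [integral_add hf.1 hg.1]; exact add_le_add hf.2 hg.2⟩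

lemma MeanLE.const_mul {α : Type*} [MeasurableSpace α] {μ : Measure α} {f : α → ℝ} {a r : ℝ}
    (hf : MeanLE μ f a) (hr : 0 ≤ r) : MeanLE μ (fun x => r * f x) (r * a) :=
  ⟨hf.1.const_mul r, by rw [integral_const_mul]; exact mul_le_mul_of_nonneg_left hf.2 hr⟩

lemma MeanLE.const {α : Type*} [MeasurableSpace α] {μ : Measure α} [IsProbabilityMeasure μ]
    (c : ℝ) : MeanLE μ (fun _ => c) c :=
  ⟨integrable_const c, by simp⟩

lemma exists_modulus {F : Vec s → ℝ} (hF : Continuous F) (L : ℝ) {ε : ℝ} (hε : 0 < ε) :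
    ∃ δ > 0, ∀ x x' : Vec s, nrm x ≤ L → nrm x' ≤ L → nrm (x - x') ≤ δ → |F x - F x'| ≤ ε := by
  have hK : IsCompact {x : Vec s | nrm x ≤ L} := by
    refine Metric.isCompact_of_isClosed_isBounded (isClosed_le continuous_nrm continuous_const) ?_
    refine Metric.isBounded_closedBall (x := (0 : Vec s)) (r := |L|) |>.subset fun x hx => ?_
    rw [mem_closedBall_zero_iff, pi_norm_le_iff_of_nonneg (abs_nonneg _)]
    exact fun i => (abs_apply_le_nrm x i).trans (le_trans hx (le_abs_self _))
  have hu := hK.uniformContinuousOn_of_continuous hF.continuousOn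
  obtain ⟨δ, hδ, h⟩ := Metric.uniformContinuousOn_iff_le.1 hu ε hε
  refine ⟨δ, hδ, fun x x' hx hx' hxx => ?_⟩
  refine h x hx x' hx' ?_
  rw [dist_eq_norm, pi_norm_le_iff_of_nonneg hδ.le]
  exact fun i => (abs_apply_le_nrm (x - x') i).trans hxx

/-- The feature of a sample is close to its Gaussian limit. -/
lemma exists_sampleWeight_close {F : Vec s → ℝ} (hF : Continuous F) {τ : ℝ → ℝ}
    (hτ1 : ∀ y, |τ y| ≤ 1) {θ : ℝ} (hθ : 0 ≤ θ) (hτL : ∀ y y', |τ y - τ y'| ≤ θ * |y - y'|)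
    {P : Mat s s} (hPt : Pᵀ = P) (hP : P * P = P) {L₁ ε₁ : ℝ} (hL : 0 < L₁)
    (hε : 0 < ε₁) : ∃ ε > 0, ∀ d : ℕ, 0 < d → ∀ W : Mat d s, IsFrame W →
      ∀ Q : Mat d d, Qᵀ = Q → Q * Q = Q → ∀ (g : Vec d) (e : ℝ),
        nrm (Wᵀ *ᵥ g) ≤ L₁ → |nrm g ^ 2 - d| ≤ ε * d / 2 →
        nrm ((Q - W * P * Wᵀ) *ᵥ g) ≤ ε →
        |sampleWeight τ Q (modelMap F W (g, e)) -
          τ (F (Wᵀ *ᵥ g) + e) * radial ((Wᵀ *ᵥ g) ⬝ᵥ (P *ᵥ (Wᵀ *ᵥ g)))| ≤ ε₁ := by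
  obtain ⟨δ, hδ, hmod⟩ := exists_modulus hF (2 * L₁) (ε := ε₁ / (2 * (θ + 1))) (by positivity)
  refine ⟨min 1 (min (δ / L₁) (ε₁ / (2 * (2 + L₁)))), by positivity, ?_⟩
  set ε := min 1 (min (δ / L₁) (ε₁ / (2 * (2 + L₁)))) with hεdef
  have hε1 : ε ≤ 1 := min_le_left _ _
  have hε0 : 0 < ε := by positivity
  have hε2 : ε * L₁ ≤ δ := by
    rw [← le_div_iff₀ hL]; exact (min_le_right _ _).trans (min_le_left _ _)
  have hε3 : ε * (2 + L₁) ≤ ε₁ / 2 := by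
    have : ε ≤ ε₁ / (2 * (2 + L₁)) := (min_le_right _ _).trans (min_le_right _ _)
    rw [le_div_iff₀ (by positivity)] at this
    linarith
  intro d hd W hW Q hQt hQ g e hX hg hQg
  have hd' : (0 : ℝ) < d := Nat.cast_pos.2 hd
  set X := Wᵀ *ᵥ g with hXdef
  have hg1 := abs_le.1 hg
  have hn2 : (d : ℝ) / 2 ≤ nrm g ^ 2 := by nlinarith
  have hg0 : g ≠ 0 := by
    rintro rfl
    rw [nrm_zero] at hn2
    norm_num at hn2
    linarith
  have hn := nrm_pos hg0
  set c := √d / nrm g with hc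
  have hc0 : 0 ≤ c := by positivity
  have hc2 : c ^ 2 = d / nrm g ^ 2 := by rw [hc, div_pow, Real.sq_sqrt hd'.le]
  have hc1 : |c ^ 2 - 1| ≤ ε := by
    have : c ^ 2 - 1 = (d - nrm g ^ 2) / nrm g ^ 2 := by rw [hc2]; field_simp
    rw [this, abs_div, abs_sub_comm, abs_of_pos (pow_pos hn 2), div_le_iff₀ (pow_pos hn 2)]
    nlinarith
  have hc3 : |c - 1| ≤ ε := by
    have h1 : c ^ 2 - 1 = (c - 1) * (c + 1) := by ring
    rw [h1, abs_mul, abs_of_pos (by linarith : 0 < c + 1)] at hc1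
    nlinarith [abs_nonneg (c - 1)]
  have hc4 : c ≤ 2 := by have := (abs_le.1 hc3).2; linarith
  have hz : √d • (Wᵀ *ᵥ direction g) = c • X := by
    rw [direction, mulVec_smul, smul_smul, hc, div_eq_mul_inv]
  have hu : (d : ℝ) * (direction g ⬝ᵥ (Q *ᵥ direction g)) = (c * nrm (Q *ᵥ g)) ^ 2 := by
    rw [mul_pow, hc2, proj_mulVec_dot hQt hQ, direction]
    simp only [mulVec_smul, smul_dotProduct, dotProduct_smul, smul_eq_mul]
    field_simp
  have hQ0 : nrm ((W * P * Wᵀ) *ᵥ g) = nrm (P *ᵥ X) := by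
    rw [← mulVec_mulVec, ← mulVec_mulVec, hW.nrm_mulVec]
  have hu0 : X ⬝ᵥ (P *ᵥ X) = nrm ((W * P * Wᵀ) *ᵥ g) ^ 2 := by
    rw [hQ0, proj_mulVec_dot hPt hP]
  have hPX : nrm (P *ᵥ X) ≤ L₁ := by
    refine le_trans (le_of_sq_le_sq ?_ (nrm_nonneg _)) hX
    have := nrm_sub_proj_sq hPt hP X
    rw [proj_mulVec_dot hPt hP]
    linarith [sq_nonneg (nrm (X - P *ᵥ X))]
  have hrad : |radial (d * (direction g ⬝ᵥ (Q *ᵥ direction g))) - radial (X ⬝ᵥ (P *ᵥ X))| ≤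
      ε * (2 + L₁) := by
    refine (abs_radial_sub_le _ _).trans ?_
    rw [hu, hu0, Real.sqrt_sq (mul_nonneg hc0 (nrm_nonneg _)), Real.sqrt_sq (nrm_nonneg _)]
    have h1 : c * nrm (Q *ᵥ g) - nrm ((W * P * Wᵀ) *ᵥ g) =
        c * (nrm (Q *ᵥ g) - nrm ((W * P * Wᵀ) *ᵥ g)) + (c - 1) * nrm ((W * P * Wᵀ) *ᵥ g) := by ring
    have h2 : |nrm (Q *ᵥ g) - nrm ((W * P * Wᵀ) *ᵥ g)| ≤ ε := by
      refine (abs_nrm_sub_nrm_le _ _).trans ?_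
      rwa [← sub_mulVec]
    rw [h1]
    refine (abs_add_le _ _).trans ?_
    rw [abs_mul, abs_mul, abs_of_nonneg hc0, abs_of_nonneg (nrm_nonneg ((W * P * Wᵀ) *ᵥ g)), hQ0]
    rw [hQ0] at h2
    nlinarith [abs_nonneg (nrm (Q *ᵥ g) - nrm (P *ᵥ X)), nrm_nonneg (P *ᵥ X), abs_nonneg (c - 1),
      mul_le_mul hc4 h2 (abs_nonneg _) zero_le_two, mul_le_mul hc3 hPX (nrm_nonneg _) hε0.le]
  have hcX : nrm (c • X - X) ≤ δ := by
    have : c • X - X = (c - 1) • X := by rw [sub_smul, one_smul]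
    rw [this, nrm_smul]
    exact (mul_le_mul hc3 hX (nrm_nonneg _) hε0.le).trans hε2
  have hFX := hmod (c • X) X (by
    rw [nrm_smul, abs_of_nonneg hc0]
    exact mul_le_mul hc4 hX (nrm_nonneg _) zero_le_two) (by linarith) hcX
  have hτX : |τ (F (c • X) + e) - τ (F X + e)| ≤ ε₁ / 2 := by
    refine (hτL _ _).trans ?_
    rw [add_sub_add_right_eq_sub]
    calc θ * |F (c • X) - F X| ≤ θ * (ε₁ / (2 * (θ + 1))) := by gcongr
      _ ≤ ε₁ / 2 := by
        rw [mul_div_assoc', div_le_div_iff₀ (by positivity) (by norm_num)]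
        nlinarith
  have e1 : sampleWeight τ Q (modelMap F W (g, e)) =
      τ (F (c • X) + e) * radial (d * (direction g ⬝ᵥ (Q *ᵥ direction g))) := by
    simp only [sampleWeight, modelMap, hz]
  rw [e1]
  set r := radial (d * (direction g ⬝ᵥ (Q *ᵥ direction g)))
  set r₀ := radial (X ⬝ᵥ (P *ᵥ X))
  have e2 : τ (F (c • X) + e) * r - τ (F X + e) * r₀ =
      (τ (F (c • X) + e) - τ (F X + e)) * r + τ (F X + e) * (r - r₀) := by ring
  rw [e2]
  refine (abs_add_le _ _).trans ?_
  rw [abs_mul, abs_mul, abs_of_nonneg (radial_nonneg _ : 0 ≤ r)]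
  have h1 := mul_le_mul hτX (radial_le_one _ : r ≤ 1) (radial_nonneg _) (by positivity)
  have h2 := mul_le_mul (hτ1 (F X + e)) hrad (abs_nonneg _) zero_le_one
  linarith

lemma abs_sampleWeight_le {τ : ℝ → ℝ} (hτ1 : ∀ y, |τ y| ≤ 1) (Q : Mat d d)
    (p : ℝ × Vec d) : |sampleWeight τ Q p| ≤ 1 := by
  rw [sampleWeight, abs_mul, abs_of_nonneg (radial_nonneg _)]
  exact mul_le_one₀ (hτ1 _) (radial_nonneg _) (radial_le_one _)

lemma measurable_sampleWeight {τ : ℝ → ℝ} (hτ : Measurable τ)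
    (Q : Mat d d) : Measurable (sampleWeight τ Q) := by
  unfold sampleWeight
  refine (hτ.comp measurable_fst).mul ?_
  have : Continuous fun p : ℝ × Vec d => radial (d * (p.2 ⬝ᵥ (Q *ᵥ p.2))) := by fun_prop
  exact this.measurable

lemma dot_sampleMat_modelMap (F : Vec s → ℝ) (τ : ℝ → ℝ) (W : Mat d s)
    {Q : Mat d d} (hQt : Qᵀ = Q) (hQ : Q * Q = Q) (D : ℕ) (v : Vec d)
    (p : Vec d × ℝ) :
    v ⬝ᵥ (sampleMat τ Q D (modelMap F W p) *ᵥ v) = sampleWeight τ Q (modelMap F W p) *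
      (√((D : ℝ) * (D + 2) / 2) *
        (redCoord Q v p.1 - (1 / (D : ℝ)) * nrm (v - Q *ᵥ v) ^ 2)) := by
  rw [sampleMat, smul_mulVec, dotProduct_smul, smul_eq_mul, dot_redMat,
    nrm_sub_proj_sq hQt hQ, ← dot_self_eq_nrm_sq v, dotProduct_sub]
  simp only [modelMap]
  rw [redCoord_eq hQt hQ]

lemma redCoord_mul {Q : Mat d d} (hQt : Qᵀ = Q) (v g : Vec d) :
    nrm (g - Q *ᵥ g) ^ 2 * redCoord Q v g = ((v - Q *ᵥ v) ⬝ᵥ g) ^ 2 := by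
  unfold redCoord
  by_cases h : nrm (g - Q *ᵥ g) = 0
  · have h2 := abs_dot_le (g - Q *ᵥ g) v
    rw [h, zero_mul, sub_proj_dot hQt] at h2
    have h3 : (v - Q *ᵥ v) ⬝ᵥ g = 0 := abs_eq_zero.1 (le_antisymm h2 (abs_nonneg _))
    rw [h3, h]; simp
  · field_simp

lemma sqrt_harmonic_bounds (D : ℕ) : ∃ w : ℝ, √((D : ℝ) * (D + 2) / 2) = (√2)⁻¹ * w ∧
    (D : ℝ) ≤ w ∧ w ≤ D + 1 := by
  have hD : (0 : ℝ) ≤ D := Nat.cast_nonneg D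
  refine ⟨√(D * (D + 2)), ?_, ?_, ?_⟩
  · rw [Real.sqrt_div (by positivity), div_eq_inv_mul]
  · exact Real.le_sqrt_of_sq_le (by nlinarith)
  · rw [Real.sqrt_le_left (by positivity)]
    nlinarith

/-- The pointwise comparison of the harmonic of a reduced sample with its Gaussian limit. -/
lemma harmonic_close (hkd : 2 * k < d) {U : Mat d k} (hU : IsFrame U)
    {v v₀ : Vec d} (hv : nrm v ≤ 2) (hv₀ : nrm v₀ ≤ 2) {a : ℝ} (ha : 0 < a)
    (hvv : nrm ((v - (U * Uᵀ) *ᵥ v) - v₀) ≤ 2 * a) {lam : ℝ} (hlam : 0 < lam)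
    (c : Fin k → Vec d) (hc : ∀ j, c j = Uᵀ j) (g : Vec d) :
    |√(((d - k : ℕ) : ℝ) * ((d - k : ℕ) + 2) / 2) * (redCoord (U * Uᵀ) v g -
        (1 / ((d - k : ℕ) : ℝ)) * nrm (v - (U * Uᵀ) *ᵥ v) ^ 2) -
      (√2)⁻¹ * ((v₀ ⬝ᵥ g) ^ 2 - nrm v₀ ^ 2)| ≤
      (lam / 2) * redCoord (U * Uᵀ) v g ^ 2 +
      ((3 / (2 * lam)) * (((k + 1) ^ 2 + (nrm g ^ 2 - d) ^ 2) + k * ∑ j, (c j ⬝ᵥ g) ^ 4) +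
      ((8 / (d : ℝ) + 8 * a) + ((a / 2) * (((v - (U * Uᵀ) *ᵥ v) + v₀) ⬝ᵥ g) ^ 2 +
        (1 / (2 * a)) * (((v - (U * Uᵀ) *ᵥ v) - v₀) ⬝ᵥ g) ^ 2))) := by
  set Q := U * Uᵀ with hQdef
  have hQt : Qᵀ = Q := proj_transpose U
  have hQ : Q * Q = Q := proj_mul_self hU
  set D := d - k with hD
  have hDd : (D : ℝ) = d - k := by rw [hD, Nat.cast_sub (by omega)]
  have hk0 : (0 : ℝ) ≤ k := Nat.cast_nonneg k
  have hkd' : 2 * (k : ℝ) < d := by exact_mod_cast hkd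
  have hd' : (0 : ℝ) < d := by linarith
  have hD0 : (0 : ℝ) < D := by rw [hDd]; linarith
  obtain ⟨w, hw, hw1, hw2⟩ := sqrt_harmonic_bounds D
  have hs2 : (√2)⁻¹ ≤ 1 := inv_le_one_of_one_le₀ (Real.one_le_sqrt.2 (by norm_num))
  have hs0 : 0 ≤ (√2)⁻¹ := by positivity
  set v' := v - Q *ᵥ v with hv'
  have hv'2 : nrm v' ≤ 2 := (nrm_sub_proj_le hQt hQ v).trans hv
  set u := redCoord Q v g with hu
  have hu0 : 0 ≤ u := redCoord_nonneg Q v g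
  have hR := redCoord_mul hQt v g
  rw [← hu, ← hv'] at hR
  set R := nrm (g - Q *ᵥ g) ^ 2 with hRdef
  have e1 : √((D : ℝ) * (D + 2) / 2) * (u - (1 / (D : ℝ)) * nrm v' ^ 2) -
      (√2)⁻¹ * ((v₀ ⬝ᵥ g) ^ 2 - nrm v₀ ^ 2) =
      (√2)⁻¹ * (((w - R) * u - nrm v' ^ 2 * (w / D - 1)) +
        (((v' + v₀) ⬝ᵥ g) * ((v' - v₀) ⬝ᵥ g) - (nrm v' ^ 2 - nrm v₀ ^ 2))) := by
    have ed1 : (v' + v₀) ⬝ᵥ g = v' ⬝ᵥ g + v₀ ⬝ᵥ g := add_dotProduct _ _ _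
    have ed2 : (v' - v₀) ⬝ᵥ g = v' ⬝ᵥ g - v₀ ⬝ᵥ g := sub_dotProduct _ _ _
    rw [hw, ed1, ed2]
    have : (w - R) * u = w * u - (v' ⬝ᵥ g) ^ 2 := by rw [← hR]; ring
    rw [this]
    field_simp
    ring
  have h1 : |(w - R) * u| ≤ (lam / 2) * u ^ 2 + (1 / (2 * lam)) * (w - R) ^ 2 := by
    have h := two_mul_le_add_sq (lam * u) |w - R|
    rw [abs_mul, abs_of_nonneg hu0]
    rw [sq_abs] at h
    have : (lam / 2) * u ^ 2 + (1 / (2 * lam)) * (w - R) ^ 2 =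
        (1 / (2 * lam)) * ((lam * u) ^ 2 + (w - R) ^ 2) := by field_simp
    rw [this]
    calc |w - R| * u = (1 / (2 * lam)) * (2 * (lam * u) * |w - R|) := by field_simp
      _ ≤ _ := by gcongr
  have h2 : (w - R) ^ 2 ≤ 3 * (((k + 1) ^ 2 + (nrm g ^ 2 - d) ^ 2) + k * ∑ j, (c j ⬝ᵥ g) ^ 4) := by
    have h3 : R = nrm g ^ 2 - nrm (Uᵀ *ᵥ g) ^ 2 := by
      rw [hRdef, nrm_sub_proj_sq hQt hQ, dot_proj U, dot_self_eq_nrm_sq]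
    have h4 : (nrm (Uᵀ *ᵥ g) ^ 2) ^ 2 ≤ k * ∑ j, (c j ⬝ᵥ g) ^ 4 := by
      simp only [hc]
      exact nrm_mulVec_sq_sq_le Uᵀ g
    have h5 : |w - d| ≤ k + 1 := by
      rw [abs_le]; constructor <;> linarith
    have h6 : (w - d) ^ 2 ≤ (k + 1) ^ 2 := sq_le_sq' (abs_le.1 h5).1 (abs_le.1 h5).2
    rw [h3]
    nlinarith [sq_nonneg ((w - d) - (d - nrm g ^ 2)), sq_nonneg ((w - d) - nrm (Uᵀ *ᵥ g) ^ 2),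
      sq_nonneg ((d - nrm g ^ 2) - nrm (Uᵀ *ᵥ g) ^ 2)]
  have h3 : |nrm v' ^ 2 * (w / D - 1)| ≤ 8 / (d : ℝ) := by
    have h4 : 0 ≤ w / D - 1 := by rw [sub_nonneg, le_div_iff₀ hD0]; linarith
    have h5 : w / D - 1 ≤ 2 / (d : ℝ) := by
      rw [sub_le_iff_le_add, div_le_iff₀ hD0, hDd]
      have : (2 / (d : ℝ) + 1) * (d - k) = d - k + 2 - 2 * k / d := by field_simp; ring
      rw [this]
      have : 2 * (k : ℝ) / d ≤ 1 := by rw [div_le_one hd']; linarith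
      linarith
    rw [abs_of_nonneg (by positivity)]
    calc nrm v' ^ 2 * (w / D - 1) ≤ 2 ^ 2 * (2 / (d : ℝ)) :=
          mul_le_mul (pow_le_pow_left₀ (nrm_nonneg _) hv'2 2) h5 h4 (by norm_num)
      _ = 8 / (d : ℝ) := by ring
  have h4 : |((v' + v₀) ⬝ᵥ g) * ((v' - v₀) ⬝ᵥ g)| ≤
      (a / 2) * ((v' + v₀) ⬝ᵥ g) ^ 2 + (1 / (2 * a)) * ((v' - v₀) ⬝ᵥ g) ^ 2 := by
    set x := (v' + v₀) ⬝ᵥ g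
    set y := (v' - v₀) ⬝ᵥ g
    have h := two_mul_le_add_sq (a * |x|) |y|
    rw [mul_pow, sq_abs, sq_abs] at h
    rw [abs_mul]
    have : (a / 2) * x ^ 2 + (1 / (2 * a)) * y ^ 2 =
        (1 / (2 * a)) * (a ^ 2 * x ^ 2 + y ^ 2) := by field_simp
    rw [this]
    calc |x| * |y| = (1 / (2 * a)) * (2 * (a * |x|) * |y|) := by field_simp
      _ ≤ _ := by gcongr
  have h5 : |nrm v' ^ 2 - nrm v₀ ^ 2| ≤ 8 * a := by
    have h6 : nrm v' ^ 2 - nrm v₀ ^ 2 = (nrm v' - nrm v₀) * (nrm v' + nrm v₀) := by ring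
    rw [h6, abs_mul, abs_of_nonneg (add_nonneg (nrm_nonneg v') (nrm_nonneg v₀))]
    have h7 := (abs_nrm_sub_nrm_le v' v₀).trans hvv
    calc _ ≤ (2 * a) * 4 := mul_le_mul h7 (by linarith) (add_nonneg (nrm_nonneg v') (nrm_nonneg v₀))
          (by positivity)
      _ = 8 * a := by ring
  have h6 : (1 / (2 * lam)) * (w - R) ^ 2 ≤
      (3 / (2 * lam)) * (((k + 1) ^ 2 + (nrm g ^ 2 - d) ^ 2) + k * ∑ j, (c j ⬝ᵥ g) ^ 4) := by
    calc _ ≤ (1 / (2 * lam)) *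
          (3 * (((k + 1) ^ 2 + (nrm g ^ 2 - d) ^ 2) + k * ∑ j, (c j ⬝ᵥ g) ^ 4)) := by gcongr
      _ = _ := by ring
  rw [e1, abs_mul, abs_of_nonneg hs0]
  refine (mul_le_of_le_one_left (abs_nonneg _) hs2).trans ?_
  have h7 := abs_add_le ((w - R) * u - nrm v' ^ 2 * (w / D - 1))
    (((v' + v₀) ⬝ᵥ g) * ((v' - v₀) ⬝ᵥ g) - (nrm v' ^ 2 - nrm v₀ ^ 2))
  have h8 := abs_sub ((w - R) * u) (nrm v' ^ 2 * (w / D - 1))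
  have h9 := abs_sub (((v' + v₀) ⬝ᵥ g) * ((v' - v₀) ⬝ᵥ g)) (nrm v' ^ 2 - nrm v₀ ^ 2)
  linarith

/-! ### The population matrix -/

lemma abs_integral_le_of_fst {α β : Type*} [MeasurableSpace α] [MeasurableSpace β] {μ : Measure α}
    {ν : Measure β} [IsProbabilityMeasure μ] [IsProbabilityMeasure ν] {f : α × β → ℝ} {b : α → ℝ}
    {c : ℝ} (hb : MeanLE μ b c) (hf : ∀ p, |f p| ≤ b p.1) : |∫ p, f p ∂μ.prod ν| ≤ c := by
  refine (norm_integral_le_of_norm_le (f := f) (hb.1.comp_fst ν) (ae_of_all _ hf)).trans ?_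
  rw [integral_fun_fst (μ := μ) (ν := ν) b]
  simpa using hb.2

lemma measurable_dot_sampleMat {τ : ℝ → ℝ} (hτ : Measurable τ)
    (Q : Mat d d) (D : ℕ) (v : Vec d) :
    Measurable fun p : ℝ × Vec d => v ⬝ᵥ (sampleMat τ Q D p *ᵥ v) := by
  have h : (fun p : ℝ × Vec d => v ⬝ᵥ (sampleMat τ Q D p *ᵥ v)) = fun p =>
      sampleWeight τ Q p * (√((D : ℝ) * (D + 2) / 2) *
      ((√(1 - p.2 ⬝ᵥ (Q *ᵥ p.2)))⁻¹ ^ 2 * ((p.2 - Q *ᵥ p.2) ⬝ᵥ v) ^ 2 -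
        (1 / (D : ℝ)) * (v ⬝ᵥ (v - Q *ᵥ v)))) := by
    funext p
    rw [sampleMat, smul_mulVec, dotProduct_smul, smul_eq_mul, dot_redMat]
  rw [h]
  have h1 : Measurable fun p : ℝ × Vec d => p.2 ⬝ᵥ (Q *ᵥ p.2) :=
    (by fun_prop : Continuous fun p : ℝ × Vec d => p.2 ⬝ᵥ (Q *ᵥ p.2)).measurable
  have h2 : Measurable fun p : ℝ × Vec d => (p.2 - Q *ᵥ p.2) ⬝ᵥ v :=
    (by fun_prop : Continuous fun p : ℝ × Vec d => (p.2 - Q *ᵥ p.2) ⬝ᵥ v).measurable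
  refine (measurable_sampleWeight hτ Q).mul (measurable_const.mul ?_)
  exact (((measurable_const.sub h1).sqrt.inv.pow_const 2).mul (h2.pow_const 2)).sub measurable_const

lemma weight_mul_le {A A₀ q L ε₁ b : ℝ} (hL : 0 < L) (hε : 0 ≤ ε₁) (hb0 : 0 ≤ b)
    (hA : |A| ≤ 1) (hA₀ : |A₀| ≤ 1) (h : |A - A₀| ≤ ε₁ ∨ 1 ≤ b) :
    |A - A₀| * |q| ≤ ε₁ * (1 + q ^ 2) + (L * b + (1 / L) * q ^ 2) := by
  have hq := sq_abs q
  have h3 : 0 ≤ (1 / L) * q ^ 2 := by positivity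
  have h4 : 0 ≤ L * b := by positivity
  rcases h with h | h
  · have h1 : |q| ≤ 1 + q ^ 2 := by nlinarith [sq_nonneg (|q| - 1)]
    have h2 := mul_le_mul h h1 (abs_nonneg _) hε
    linarith
  · have h1 : |A - A₀| ≤ 2 := by
      have := abs_sub A A₀
      linarith
    have h2 : 2 * |q| ≤ L + (1 / L) * q ^ 2 := by
      have := two_mul_le_add_sq L |q|
      have e : L + (1 / L) * q ^ 2 = (L ^ 2 + |q| ^ 2) / L := by rw [hq]; field_simp
      rw [e, le_div_iff₀ hL]
      linarith
    have h5 : L * 1 ≤ L * b := by gcongr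
    have h6 : 0 ≤ ε₁ * (1 + q ^ 2) := by positivity
    have h7 := mul_le_mul_of_nonneg_right h1 (abs_nonneg q)
    linarith

/-- The population version of the empirical matrix, near the frame `W P`. -/
lemma exists_population_close {F : Vec s → ℝ} (hF : Continuous F) (ρ : Measure ℝ)
    [IsProbabilityMeasure ρ] {τ : ℝ → ℝ}
    (hτ1 : ∀ y, |τ y| ≤ 1) {θ : ℝ} (hθ : 0 ≤ θ) (hτL : ∀ y y', |τ y - τ y'| ≤ θ * |y - y'|)
    {P : Mat s s} (hPt : Pᵀ = P) (hP : P * P = P) (k : ℕ) {η : ℝ} (hη : 0 < η) :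
    ∃ a > 0, ∀ᶠ d : ℕ in atTop, ∀ W : Mat d s, IsFrame W →
      ∀ U : Mat d k, IsFrame U → ‖U * Uᵀ - W * P * Wᵀ‖ ≤ a →
        ∀ v : Vec d, nrm v ≤ 2 →
          |∫ p, v ⬝ᵥ (sampleMat τ (U * Uᵀ) (d - k) (modelMap F W p) *ᵥ v)
            ∂(gaussianVec d).prod ρ - (Wᵀ *ᵥ v) ⬝ᵥ (target F ρ τ P *ᵥ (Wᵀ *ᵥ v))| ≤ η := by
  have hτc : Continuous τ := by
    refine (LipschitzWith.of_dist_le_mul (K := ⟨θ, hθ⟩) fun x y => ?_).continuous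
    rw [Real.dist_eq, Real.dist_eq]
    exact hτL x y
  set ζ := η / 9 with hζ
  have hζ0 : 0 < ζ := by positivity
  set L := 1040 / ζ with hL
  have hL0 : 0 < L := by positivity
  set ε₁ := ζ / 1041 with hε₁
  have hε₁0 : 0 < ε₁ := by positivity
  set L₁ := √(L * (s + 1) / ζ) with hL₁
  have hL₁0 : 0 < L₁ := by positivity
  have hL₁2 : L * (s / L₁ ^ 2) ≤ ζ := by
    rw [hL₁, Real.sq_sqrt (by positivity), div_div_eq_mul_div, mul_div_assoc',
      div_le_iff₀ (by positivity)]
    nlinarith [mul_pos hL0 hζ0]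
  obtain ⟨ε, hε0, hclose⟩ := exists_sampleWeight_close hF hτ1 hθ hτL hPt hP hL₁0 hε₁0
  set a := min (ζ / 18) (ε * √(ζ / L)) with ha
  have ha0 : 0 < a := by positivity
  have ha1 : 18 * a ≤ ζ := by have : a ≤ ζ / 18 := min_le_left _ _; linarith
  have ha2 : L * (a ^ 2 / ε ^ 2) ≤ ζ := by
    have h1 : a ≤ ε * √(ζ / L) := min_le_right _ _
    have h2 := pow_le_pow_left₀ ha0.le h1 2
    rw [mul_pow, Real.sq_sqrt (by positivity)] at h2
    rw [mul_div_assoc', div_le_iff₀ (by positivity)]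
    calc L * a ^ 2 ≤ L * (ε ^ 2 * (ζ / L)) := by gcongr
      _ = ζ * ε ^ 2 := by field_simp
  set C₂ : ℝ := (k + 1) ^ 2 + 64 + 64 * k ^ 2 with hC₂
  set L' := 3 / 2 * C₂ / ζ with hL'
  have hC₂0 : 0 < C₂ := by positivity
  have hL'0 : 0 < L' := by positivity
  set C₁ : ℝ := (64 * (k + 1)) ^ 2 * (2 * k + 3) with hC₁
  refine ⟨a, ha0, ?_⟩
  filter_upwards [eventually_gt_atTop (2 * k),
    (tendsto_const_div_atTop_nhds_zero_nat (L' * C₁)).eventually_le_const hζ0,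
    (tendsto_const_div_atTop_nhds_zero_nat 8).eventually_le_const hζ0,
    (tendsto_const_div_atTop_nhds_zero_nat (L * (256 / ε ^ 2))).eventually_le_const hζ0]
    with d hkd hd1 hd2 hd3 W hW U hU hUW v hv
  have hdpos : 0 < d := by omega
  have hd' : (0 : ℝ) < d := Nat.cast_pos.2 hdpos
  obtain ⟨Q, hQ⟩ : ∃ Q, Q = U * Uᵀ := ⟨_, rfl⟩
  obtain ⟨Q₀, hQ₀⟩ : ∃ Q₀, Q₀ = W * P * Wᵀ := ⟨_, rfl⟩
  have hQt : Qᵀ = Q := hQ ▸ proj_transpose U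
  have hQQ : Q * Q = Q := hQ ▸ proj_mul_self hU
  have hQ₀t : Q₀ᵀ = Q₀ := by
    rw [hQ₀, transpose_mul, transpose_mul, transpose_transpose, hPt, Matrix.mul_assoc]
  have hQ₀Q : Q₀ * Q₀ = Q₀ := by
    have hW' : Wᵀ * W = 1 := hW
    rw [hQ₀]
    calc W * P * Wᵀ * (W * P * Wᵀ) = W * P * (Wᵀ * W) * P * Wᵀ := by simp only [Matrix.mul_assoc]
      _ = W * (P * P) * Wᵀ := by rw [hW']; simp only [Matrix.mul_assoc, Matrix.one_mul]
      _ = _ := by rw [hP]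
  obtain ⟨v₀, hv₀⟩ : ∃ v₀, v₀ = v - Q₀ *ᵥ v := ⟨_, rfl⟩
  have hv₀2 : nrm v₀ ≤ 2 := hv₀ ▸ (nrm_sub_proj_le hQ₀t hQ₀Q v).trans hv
  have hv'2 : nrm (v - Q *ᵥ v) ≤ 2 := (nrm_sub_proj_le hQt hQQ v).trans hv
  rw [← hQ, ← hQ₀] at hUW
  have hvv : nrm ((v - Q *ᵥ v) - v₀) ≤ 2 * a := by
    have e : (v - Q *ᵥ v) - v₀ = -((Q - Q₀) *ᵥ v) := by
      rw [hv₀, sub_mulVec]; abel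
    rw [e, nrm_neg]
    refine (nrm_mulVec_le _ _).trans ?_
    rw [mul_comm 2 a]
    exact mul_le_mul hUW hv (nrm_nonneg _) ha0.le
  obtain ⟨c, hc⟩ : ∃ c : Fin k → Vec d, ∀ j, c j = Uᵀ j := ⟨fun j => Uᵀ j, fun _ => rfl⟩
  have hcn : ∀ j, nrm (c j) = 1 := fun j => by rw [hc]; exact hU.nrm_col j
  rw [← integral_ambient_eq_target hF hτc hτ1 hPt hP hW v, ← hQ₀, ← hv₀, ← hQ]
  obtain ⟨q₀, hq₀⟩ : ∃ q₀ : Vec d → ℝ, ∀ g, q₀ g = (√2)⁻¹ * ((v₀ ⬝ᵥ g) ^ 2 - nrm v₀ ^ 2) :=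
    ⟨_, fun _ => rfl⟩
  obtain ⟨h, hh⟩ : ∃ h : Vec d → ℝ, ∀ g, h g = √(((d - k : ℕ) : ℝ) * ((d - k : ℕ) + 2) / 2) *
      (redCoord Q v g - (1 / ((d - k : ℕ) : ℝ)) * nrm (v - Q *ᵥ v) ^ 2) := ⟨_, fun _ => rfl⟩
  obtain ⟨A, hA⟩ : ∃ A : Vec d × ℝ → ℝ, ∀ p, A p = sampleWeight τ Q (modelMap F W p) :=
    ⟨_, fun _ => rfl⟩
  obtain ⟨A₀, hA₀⟩ : ∃ A₀ : Vec d × ℝ → ℝ, ∀ p, A₀ p =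
      τ (F (Wᵀ *ᵥ p.1) + p.2) * radial ((Wᵀ *ᵥ p.1) ⬝ᵥ (P *ᵥ (Wᵀ *ᵥ p.1))) := ⟨_, fun _ => rfl⟩
  have hA1 : ∀ p, |A p| ≤ 1 := fun p => by rw [hA]; exact abs_sampleWeight_le hτ1 Q _
  have hA₀1 : ∀ p, |A₀ p| ≤ 1 := fun p => by
    rw [hA₀, abs_mul, abs_of_nonneg (radial_nonneg _)]
    exact mul_le_one₀ (hτ1 _) (radial_nonneg _) (radial_le_one _)
  have hAm : Measurable A := by
    rw [show A = fun p => sampleWeight τ Q (modelMap F W p) from funext hA]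
    exact (measurable_sampleWeight hτc.measurable Q).comp (measurable_modelMap hF.measurable W)
  have hA₀m : Measurable A₀ := by
    rw [show A₀ = _ from funext hA₀]
    have := continuous_radial
    exact (by fun_prop : Continuous fun p : Vec d × ℝ => τ (F (Wᵀ *ᵥ p.1) + p.2) *
      radial ((Wᵀ *ᵥ p.1) ⬝ᵥ (P *ᵥ (Wᵀ *ᵥ p.1)))).measurable
  simp only [dot_sampleMat_modelMap F τ W hQt hQQ, ← hh, ← hq₀, ← hA, ← hA₀]
  have hhi : Integrable h (gaussianVec d) := by
    rw [show h = _ from funext hh]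
    refine Integrable.const_mul (Integrable.sub ?_ (integrable_const _)) _
    refine integrable_of_bounded (measurable_redCoord Q v) (nrm v ^ 2) fun g => ?_
    rw [abs_of_nonneg (redCoord_nonneg _ _ _)]
    exact redCoord_le hQt v g
  have hqi : Integrable q₀ (gaussianVec d) := by
    rw [show q₀ = _ from funext hq₀]
    exact ((integrable_dot_pow v₀ 2).sub (integrable_const _)).const_mul _
  rw [← integral_sub (integrable_mul_fst hAm hA1 hhi) (integrable_mul_fst hA₀m hA₀1 hqi)]
  have hlam : 0 < d * L' := by positivity
  -- the dominating function of the Gaussian vector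
  have m1 : MeanLE (gaussianVec d) (fun g => (d * L' / 2) * redCoord Q v g ^ 2) ζ := by
    have h1 : MeanLE (gaussianVec d) (fun g => redCoord Q v g ^ 2)
        (2 * (64 * (k + 1)) ^ 2 * (2 * k + 3) / d ^ 2) := by
      refine ⟨integrable_of_bounded ((measurable_redCoord Q v).pow_const 2) ((nrm v ^ 2) ^ 2)
        fun g => ?_, hQ ▸ integral_redCoord_sq_le hdpos hU hv⟩
      rw [abs_of_nonneg (sq_nonneg _)]
      exact pow_le_pow_left₀ (redCoord_nonneg _ _ _) (redCoord_le hQt v g) 2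
    refine ⟨(h1.const_mul (by positivity : 0 ≤ d * L' / 2)).1,
      (h1.const_mul (by positivity : 0 ≤ d * L' / 2)).2.trans (le_trans (le_of_eq ?_) hd1)⟩
    rw [hC₁]; field_simp
  have m2 : MeanLE (gaussianVec d) (fun g => (3 / (2 * (d * L'))) *
      (((k + 1) ^ 2 + (nrm g ^ 2 - d) ^ 2) + k * ∑ j, (c j ⬝ᵥ g) ^ 4)) ζ := by
    have h1 : MeanLE (gaussianVec d) (fun g => ∑ j, (c j ⬝ᵥ g) ^ 4) (64 * k) := by
      refine ⟨integrable_finsetSum _ fun j _ => integrable_dot_pow _ _, ?_⟩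
      rw [integral_finsetSum _ fun j _ => integrable_dot_pow _ _]
      refine (Finset.sum_le_sum fun j _ => integral_dot_pow_four_le (c j)).trans ?_
      simp [hcn, mul_comm]
    have h2 := ((MeanLE.const (μ := gaussianVec d) ((k + 1 : ℝ) ^ 2)).add
      (variance_nrm_sq d)).add (h1.const_mul (Nat.cast_nonneg k))
    refine ⟨(h2.const_mul (by positivity : 0 ≤ 3 / (2 * (d * L')))).1,
      (h2.const_mul (by positivity : 0 ≤ 3 / (2 * (d * L')))).2.trans ?_⟩
    have h3 : ((k + 1 : ℝ) ^ 2 + 64 * d) + k * (64 * k) ≤ C₂ * d := by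
      have : (1 : ℝ) ≤ d := by exact_mod_cast hdpos
      rw [hC₂]
      nlinarith [sq_nonneg (k + 1 : ℝ), sq_nonneg (k : ℝ)]
    calc _ ≤ 3 / (2 * (d * L')) * (C₂ * d) := by gcongr
      _ = ζ := by rw [hL']; field_simp
  have m3 : MeanLE (gaussianVec d) (fun g => (8 / (d : ℝ) + 8 * a) +
      ((a / 2) * (((v - Q *ᵥ v) + v₀) ⬝ᵥ g) ^ 2 +
        (1 / (2 * a)) * (((v - Q *ᵥ v) - v₀) ⬝ᵥ g) ^ 2)) (ζ + ζ) := by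
    have h1 : ∀ {w : Vec d} {r : ℝ}, nrm w ≤ r →
        MeanLE (gaussianVec d) (fun g => (w ⬝ᵥ g) ^ 2) (r ^ 2) := fun {w r} hw =>
      ⟨integrable_dot_pow w 2, by rw [integral_dot_sq]; exact pow_le_pow_left₀ (nrm_nonneg _) hw 2⟩
    have h2 := (MeanLE.const (μ := gaussianVec d) (8 / (d : ℝ) + 8 * a)).add
      (((h1 ((nrm_add_le (v - Q *ᵥ v) v₀).trans (add_le_add hv'2 hv₀2))).const_mul
        (by positivity : 0 ≤ a / 2)).add ((h1 hvv).const_mul (by positivity : 0 ≤ 1 / (2 * a))))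
    refine ⟨h2.1, h2.2.trans ?_⟩
    have e : 1 / (2 * a) * (2 * a) ^ 2 = 2 * a := by field_simp
    rw [e]
    linarith
  have mq : MeanLE (gaussianVec d) (fun g => q₀ g ^ 2) 1040 := by
    have h1 : MeanLE (gaussianVec d) (fun g => (v₀ ⬝ᵥ g) ^ 4 + 16) (64 * 2 ^ 4 + 16) :=
      MeanLE.add ⟨integrable_dot_pow v₀ 4, (integral_dot_pow_four_le v₀).trans (by
        have := pow_le_pow_left₀ (nrm_nonneg v₀) hv₀2 4
        linarith)⟩ (MeanLE.const 16)
    have h2 : ∀ g, q₀ g ^ 2 ≤ (v₀ ⬝ᵥ g) ^ 4 + 16 := fun g => by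
      rw [hq₀, mul_pow, inv_pow, Real.sq_sqrt (by norm_num)]
      have h3 := pow_le_pow_left₀ (nrm_nonneg v₀) hv₀2 4
      have h4 : 0 ≤ (v₀ ⬝ᵥ g) ^ 2 * nrm v₀ ^ 2 := by positivity
      have h5 : 0 ≤ (v₀ ⬝ᵥ g) ^ 4 := by positivity
      have h6 : 0 ≤ nrm v₀ ^ 4 := by positivity
      have e : ((v₀ ⬝ᵥ g) ^ 2 - nrm v₀ ^ 2) ^ 2 =
        (v₀ ⬝ᵥ g) ^ 4 - 2 * ((v₀ ⬝ᵥ g) ^ 2 * nrm v₀ ^ 2) + nrm v₀ ^ 4 := by ring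
      rw [e]
      linarith
    have hqm : Measurable q₀ := by
      rw [show q₀ = _ from funext hq₀]
      exact (((measurable_dot v₀).pow_const 2).sub measurable_const).const_mul _
    have h3 : Integrable (fun g => q₀ g ^ 2) (gaussianVec d) :=
      h1.1.mono' (hqm.pow_const 2).aestronglyMeasurable (ae_of_all _ fun g => by
        rw [Real.norm_eq_abs, abs_of_nonneg (sq_nonneg _)]; exact h2 g)
    exact ⟨h3, (integral_mono h3 h1.1 h2).trans (h1.2.trans (by norm_num))⟩
  obtain ⟨b, hb⟩ : ∃ b : Vec d → ℝ, ∀ g, b g = (1 / L₁ ^ 2) * nrm (Wᵀ *ᵥ g) ^ 2 +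
      ((4 / (ε * d) ^ 2) * (nrm g ^ 2 - d) ^ 2 + (1 / ε ^ 2) * nrm ((Q - Q₀) *ᵥ g) ^ 2) :=
    ⟨_, fun _ => rfl⟩
  have mb : MeanLE (gaussianVec d) (fun g => L * b g) (ζ + (ζ + ζ)) := by
    have h1 : MeanLE (gaussianVec d) (fun g => nrm (Wᵀ *ᵥ g) ^ 2) s :=
      ⟨integrable_nrm_mulVec_sq _, by
        rw [integral_nrm_mulVec_sq, frobenius_norm_transpose, hW.frob_sq]⟩
    have h2 : MeanLE (gaussianVec d) (fun g => nrm ((Q - Q₀) *ᵥ g) ^ 2) (a ^ 2) :=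
      ⟨integrable_nrm_mulVec_sq _, by
        rw [integral_nrm_mulVec_sq]; exact pow_le_pow_left₀ (norm_nonneg _) hUW 2⟩
    have h0 : MeanLE (gaussianVec d) (fun g => (nrm g ^ 2 - d) ^ 2) (64 * d) := variance_nrm_sq d
    have h3 := ((h1.const_mul (by positivity : 0 ≤ 1 / L₁ ^ 2)).add
      ((h0.const_mul (by positivity : 0 ≤ 4 / (ε * d) ^ 2)).add
        (h2.const_mul (by positivity : 0 ≤ 1 / ε ^ 2)))).const_mul hL0.le
    simp only [hb]
    refine ⟨h3.1, h3.2.trans ?_⟩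
    have e1 : L * (1 / L₁ ^ 2 * s) = L * (s / L₁ ^ 2) := by ring
    have e2 : L * (4 / (ε * d) ^ 2 * (64 * d)) = L * (256 / ε ^ 2) / d := by field_simp; norm_num
    have e3 : L * (1 / ε ^ 2 * a ^ 2) = L * (a ^ 2 / ε ^ 2) := by ring
    rw [mul_add, mul_add, e1, e2, e3]
    linarith
  have mw : MeanLE (gaussianVec d) (fun g => ε₁ * (1 + q₀ g ^ 2) + (L * b g + (1 / L) * q₀ g ^ 2))
      (ζ + ((ζ + (ζ + ζ)) + ζ)) := by
    have h1 := (((MeanLE.const (μ := gaussianVec d) 1).add mq).const_mul hε₁0.le).add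
      (mb.add (mq.const_mul (by positivity : 0 ≤ 1 / L)))
    refine ⟨h1.1, h1.2.trans (le_of_eq ?_)⟩
    rw [hε₁, hL]; field_simp; norm_num
  have mall := (m1.add (m2.add m3)).add mw
  refine abs_integral_le_of_fst (b := fun g => _) (c := η)
    ⟨mall.1, mall.2.trans (le_of_eq (by rw [hζ]; ring))⟩ fun p => ?_
  have e : A p * h p.1 - A₀ p * q₀ p.1 = A p * (h p.1 - q₀ p.1) + (A p - A₀ p) * q₀ p.1 := by ring
  rw [e]
  refine (abs_add_le _ _).trans (add_le_add ?_ ?_)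
  · rw [abs_mul]
    refine (mul_le_of_le_one_left (abs_nonneg _) (hA1 p)).trans ?_
    rw [hh, hq₀, hQ]
    exact harmonic_close hkd hU hv hv₀2 ha0 (hQ ▸ hvv) hlam c hc p.1
  · rw [abs_mul]
    have hb0 : 0 ≤ b p.1 := by rw [hb]; positivity
    refine weight_mul_le hL0 hε₁0.le hb0 (hA1 p) (hA₀1 p) ?_
    by_cases hX : nrm (Wᵀ *ᵥ p.1) ≤ L₁
    · by_cases hg : |nrm p.1 ^ 2 - d| ≤ ε * d / 2
      · by_cases hq : nrm ((Q - Q₀) *ᵥ p.1) ≤ ε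
        · left
          rw [hA, hA₀]
          exact hclose d hdpos W hW Q hQt hQQ p.1 p.2 hX hg (hQ₀ ▸ hq)
        · right
          rw [hb]
          have h1 : 1 ≤ (1 / ε ^ 2) * nrm ((Q - Q₀) *ᵥ p.1) ^ 2 := by
            rw [one_div_mul_eq_div, one_le_div (by positivity)]
            exact pow_le_pow_left₀ hε0.le (not_le.1 hq).le 2
          have h2 : 0 ≤ (1 / L₁ ^ 2) * nrm (Wᵀ *ᵥ p.1) ^ 2 := by positivity
          have h3 : 0 ≤ (4 / (ε * d) ^ 2) * (nrm p.1 ^ 2 - d) ^ 2 := by positivity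
          linarith
      · right
        rw [hb]
        have h1 : 1 ≤ (4 / (ε * d) ^ 2) * (nrm p.1 ^ 2 - d) ^ 2 := by
          rw [div_mul_eq_mul_div, one_le_div (by positivity)]
          have := pow_le_pow_left₀ (by positivity) (not_le.1 hg).le 2
          rw [sq_abs] at this
          linarith
        have h2 : 0 ≤ (1 / L₁ ^ 2) * nrm (Wᵀ *ᵥ p.1) ^ 2 := by positivity
        have h3 : 0 ≤ (1 / ε ^ 2) * nrm ((Q - Q₀) *ᵥ p.1) ^ 2 := by positivity
        linarith
    · right
      rw [hb]
      have h1 : 1 ≤ (1 / L₁ ^ 2) * nrm (Wᵀ *ᵥ p.1) ^ 2 := by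
        rw [one_div_mul_eq_div, one_le_div (by positivity)]
        exact pow_le_pow_left₀ hL₁0.le (not_le.1 hX).le 2
      have h2 : 0 ≤ (4 / (ε * d) ^ 2) * (nrm p.1 ^ 2 - d) ^ 2 := by positivity
      have h3 : 0 ≤ (1 / ε ^ 2) * nrm ((Q - Q₀) *ᵥ p.1) ^ 2 := by positivity
      linarith

/-! ### Nondegeneracy of the Gaussian limit -/

lemma withDensity_map_integral {α : Type*} [MeasurableSpace α] {μ : Measure α} {F w : α → ℝ}
    (hF : Measurable F) (hw : Measurable w) (hw0 : ∀ x, 0 ≤ w x)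
    {G : ℝ → ℂ} (hG : Measurable G) :
    ∫ y, G y ∂(μ.withDensity fun x => ENNReal.ofReal (w x)).map F = ∫ x, (w x : ℂ) * G (F x) ∂μ := by
  rw [integral_map hF.aemeasurable hG.aestronglyMeasurable,
    integral_withDensity_eq_integral_toReal_smul hw.ennreal_ofReal (ae_of_all _ fun _ =>
      ENNReal.ofReal_lt_top)]
  refine integral_congr_ae (ae_of_all _ fun x => ?_)
  simp only [ENNReal.toReal_ofReal (hw0 x), Complex.real_smul]

lemma withDensity_map_memLp {α : Type*} [MeasurableSpace α] {μ : Measure α} {F w : α → ℝ}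
    (hF : Measurable F) (hw : Measurable w) (hw0 : ∀ x, 0 ≤ w x)
    (hi : ∀ n : ℕ, Integrable (fun x => F x ^ n * w x) μ) (n : ℕ) :
    MemLp id n ((μ.withDensity fun x => ENNReal.ofReal (w x)).map F) := by
  by_cases hn : n = 0
  · subst hn
    rw [Nat.cast_zero, memLp_zero_iff_aestronglyMeasurable]
    exact measurable_id.aestronglyMeasurable
  rw [← integrable_norm_rpow_iff measurable_id.aestronglyMeasurable (by simpa using hn) (by simp)]
  rw [integrable_map_measure (measurable_id.norm.pow_const _).aestronglyMeasurable hF.aemeasurable,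
    integrable_withDensity_iff_integrable_smul' hw.ennreal_ofReal (ae_of_all _ fun _ =>
      ENNReal.ofReal_lt_top)]
  refine (hi n).norm.congr (ae_of_all _ fun x => ?_)
  simp [ENNReal.toReal_ofReal (hw0 x), abs_of_nonneg (hw0 x), mul_comm]

lemma integral_pow_mul_eq_zero {α : Type*} [MeasurableSpace α] {μ : Measure α}
    [IsFiniteMeasure μ] {F h : α → ℝ} (hF : Measurable F) (hh : Measurable h)
    (hi : ∀ n : ℕ, Integrable (fun x => F x ^ n * h x) μ) {ρ : Measure ℝ} [IsProbabilityMeasure ρ]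
    (hc : ∀ θ : ℝ, ∫ p, Real.cos (θ * (F p.1 + p.2)) * h p.1 ∂μ.prod ρ = 0)
    (hs : ∀ θ : ℝ, ∫ p, Real.sin (θ * (F p.1 + p.2)) * h p.1 ∂μ.prod ρ = 0) (n : ℕ) :
    ∫ x, F x ^ n * h x ∂μ = 0 := by
  have hhi : Integrable h μ := by simpa using hi 0
  set p : α → ℝ := fun x => max (h x) 0 with hp
  set m : α → ℝ := fun x => max (-h x) 0 with hm
  have hpm : Measurable p := hh.max measurable_const
  have hmm : Measurable m := hh.neg.max measurable_const
  have hp0 : ∀ x, 0 ≤ p x := fun x => le_max_right _ _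
  have hm0 : ∀ x, 0 ≤ m x := fun x => le_max_right _ _
  have hsub : ∀ x, p x - m x = h x := fun x => max_zero_sub_max_neg_zero_eq_self (h x)
  have hle : ∀ x, |p x| ≤ |h x| ∧ |m x| ≤ |h x| := fun x => by
    rw [abs_of_nonneg (hp0 x), abs_of_nonneg (hm0 x)]
    exact ⟨max_le (le_abs_self _) (abs_nonneg _), max_le (neg_le_abs _) (abs_nonneg _)⟩
  have hip : ∀ n : ℕ, Integrable (fun x => F x ^ n * p x) μ := fun n =>
    (hi n).mono ((hF.pow_const n).mul hpm).aestronglyMeasurable (ae_of_all _ fun x => by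
      rw [norm_mul, norm_mul]; exact mul_le_mul_of_nonneg_left (hle x).1 (norm_nonneg _))
  have him : ∀ n : ℕ, Integrable (fun x => F x ^ n * m x) μ := fun n =>
    (hi n).mono ((hF.pow_const n).mul hmm).aestronglyMeasurable (ae_of_all _ fun x => by
      rw [norm_mul, norm_mul]; exact mul_le_mul_of_nonneg_left (hle x).2 (norm_nonneg _))
  have hip0 : Integrable p μ := by simpa using hip 0
  have him0 : Integrable m μ := by simpa using him 0
  have hfp := isFiniteMeasure_withDensity_ofReal hip0.2
  have hfm := isFiniteMeasure_withDensity_ofReal him0.2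
  set νp := (μ.withDensity fun x => ENNReal.ofReal (p x)).map F with hνp
  set νm := (μ.withDensity fun x => ENNReal.ofReal (m x)).map F with hνm
  have hexp : ∀ θ : ℝ, Measurable fun y : ℝ => Complex.exp (θ * y * Complex.I) := fun θ => by
    fun_prop
  have hbd : ∀ (θ : ℝ) (w : α → ℝ), Measurable w → Integrable w μ →
      Integrable (fun x => (w x : ℂ) * Complex.exp (θ * F x * Complex.I)) μ := by
    intro θ w hwm hw
    refine hw.mono (by fun_prop) (ae_of_all _ fun x => ?_)
    rw [norm_mul, Complex.norm_real]
    have : (θ : ℂ) * F x * Complex.I = ((θ * F x : ℝ) : ℂ) * Complex.I := by push_cast; ring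
    rw [this, Complex.norm_exp_ofReal_mul_I, mul_one]
  have hdiff : ∀ θ : ℝ, charFun νp θ - charFun νm θ =
      ∫ x, (h x : ℂ) * Complex.exp (θ * F x * Complex.I) ∂μ := by
    intro θ
    rw [charFun_apply_real, charFun_apply_real, hνp, hνm,
      withDensity_map_integral hF hpm hp0 (hexp θ), withDensity_map_integral hF hmm hm0 (hexp θ),
      ← integral_sub (hbd θ p hpm hip0) (hbd θ m hmm him0)]
    refine integral_congr_ae (ae_of_all _ fun x => ?_)
    simp only [← hsub x]
    push_cast
    ring
  have hprod : ∀ θ : ℝ, (∫ x, (h x : ℂ) * Complex.exp (θ * F x * Complex.I) ∂μ) *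
      charFun ρ θ = 0 := by
    intro θ
    rw [charFun_apply_real, ← integral_prod_mul]
    have hint : ∀ φ : ℝ → ℝ, Measurable φ → (∀ y, |φ y| ≤ 1) →
        Integrable (fun p : α × ℝ => φ (θ * (F p.1 + p.2)) * h p.1) (μ.prod ρ) := fun φ hφ hφ1 =>
      integrable_mul_fst (h := fun p : α × ℝ => φ (θ * (F p.1 + p.2))) (hφ.comp (by fun_prop))
        (fun p => hφ1 _) hhi
    have e : ∀ p : α × ℝ, (h p.1 : ℂ) * Complex.exp (θ * F p.1 * Complex.I) *
        Complex.exp (θ * p.2 * Complex.I) = ((Real.cos (θ * (F p.1 + p.2)) * h p.1 : ℝ) : ℂ) +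
          ((Real.sin (θ * (F p.1 + p.2)) * h p.1 : ℝ) : ℂ) * Complex.I := by
      intro p
      rw [mul_assoc, ← Complex.exp_add]
      have : (θ : ℂ) * F p.1 * Complex.I + θ * p.2 * Complex.I =
        ((θ * (F p.1 + p.2) : ℝ) : ℂ) * Complex.I := by push_cast; ring
      rw [this, Complex.exp_mul_I]
      push_cast
      ring
    simp only [e]
    rw [integral_add (hint _ Real.measurable_cos Real.abs_cos_le_one).ofReal
      ((hint _ Real.measurable_sin Real.abs_sin_le_one).ofReal.mul_const _), integral_mul_const,
      integral_complex_ofReal, integral_complex_ofReal, hc, hs]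
    simp
  have hev : ∀ᶠ θ in nhds (0 : ℝ), charFun νp θ = charFun νm θ := by
    have h1 : ∀ᶠ θ in nhds (0 : ℝ), charFun ρ θ ≠ 0 := by
      have hcont : Continuous (charFun ρ) := continuous_charFun
      refine hcont.continuousAt.eventually_ne ?_
      rw [charFun_zero]
      simp
    filter_upwards [h1] with θ hθ
    rw [← sub_eq_zero, hdiff]
    exact (mul_eq_zero.1 (hprod θ)).resolve_right hθ
  have hder := Filter.EventuallyEq.iteratedDeriv_eq (n := n) hev
  rw [iteratedDeriv_charFun_zero (withDensity_map_memLp hF hpm hp0 hip n),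
    iteratedDeriv_charFun_zero (withDensity_map_memLp hF hmm hm0 him n)] at hder
  have hder' := mul_left_cancel₀ (pow_ne_zero n Complex.I_ne_zero) hder
  have hR : ∀ w : α → ℝ, Measurable w → (∀ x, 0 ≤ w x) →
      ∫ y, y ^ n ∂(μ.withDensity fun x => ENNReal.ofReal (w x)).map F = ∫ x, F x ^ n * w x ∂μ := by
    intro w hw hw0
    rw [integral_map hF.aemeasurable (by fun_prop),
      integral_withDensity_eq_integral_toReal_smul hw.ennreal_ofReal (ae_of_all _ fun _ =>
        ENNReal.ofReal_lt_top)]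
    refine integral_congr_ae (ae_of_all _ fun x => ?_)
    simp only [ENNReal.toReal_ofReal (hw0 x), smul_eq_mul, mul_comm]
  have hder2 : ∫ y, y ^ n ∂νp = ∫ y, y ^ n ∂νm := by exact_mod_cast hder'
  rw [hνp, hνm, hR p hpm hp0, hR m hmm hm0] at hder2
  have : ∀ x, F x ^ n * h x = F x ^ n * p x - F x ^ n * m x := fun x => by rw [← hsub x]; ring
  simp only [this]
  rw [integral_sub (hip n) (him n), hder2, sub_self]

lemma integrable_eval_gaussianVec (f : MvPolynomial (Fin s) ℝ) :
    Integrable (fun x => MvPolynomial.eval x f) (gaussianVec s) := by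
  simp only [MvPolynomial.eval_eq']
  refine integrable_finsetSum _ fun m _ => Integrable.const_mul ?_ _
  exact Integrable.fintype_prod fun i => integrable_gaussian_pow (m i)

/-- A polynomial that depends on the directions outside the range of `P` is unbounded there. -/
lemma exists_large_eval (f : MvPolynomial (Fin s) ℝ) {P : Mat s s}
    (hP : P * P = P)
    (hPf : ¬ ∀ x, MvPolynomial.eval x f = MvPolynomial.eval (P *ᵥ x) f) (K : ℝ) :
    ∃ x : Vec s, nrm (P *ᵥ x) < 1 ∧ K < nrm (x - P *ᵥ x) ^ 2 ∧ K < MvPolynomial.eval x f ^ 2 := by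
  push Not at hPf
  obtain ⟨x₀, hx₀⟩ := hPf
  set a := P *ᵥ x₀ with ha
  set b := x₀ - P *ᵥ x₀ with hb
  have hPP : ∀ x, P *ᵥ (P *ᵥ x) = P *ᵥ x := fun x => by rw [mulVec_mulVec, hP]
  have hline : ∀ u v : Vec s, ∃ q : Polynomial ℝ, ∀ t : ℝ,
      q.eval t = MvPolynomial.eval (u + t • v) f := by
    intro u v
    refine ⟨MvPolynomial.eval₂Hom Polynomial.C
      (fun i => Polynomial.C (u i) + Polynomial.C (v i) * Polynomial.X) f, fun t => ?_⟩
    change ((Polynomial.evalRingHom t).comp (MvPolynomial.eval₂Hom Polynomial.C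
      (fun i => Polynomial.C (u i) + Polynomial.C (v i) * Polynomial.X))) f = _
    refine congrArg (fun φ : MvPolynomial (Fin s) ℝ →+* ℝ => φ f) (MvPolynomial.ringHom_ext ?_ ?_)
    · intro r; simp
    · intro i; simp; ring
  obtain ⟨q₁, hq₁⟩ := hline b a
  obtain ⟨q₀, hq₀⟩ := hline 0 a
  have hne : q₁ ≠ q₀ := by
    intro h
    have h1 := hq₁ 1
    rw [h, hq₀] at h1
    apply hx₀
    have e : b + (1 : ℝ) • a = x₀ := by rw [one_smul, hb]; abel
    rw [e, one_smul, zero_add] at h1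
    exact h1.symm
  have hfin : Set.Finite {t | q₁.eval t = q₀.eval t} := by
    by_contra h
    exact hne (Polynomial.eq_of_infinite_eval_eq q₁ q₀ h)
  obtain ⟨t, ht, htn⟩ : ∃ t ∈ Set.Ioo (0 : ℝ) (1 / (nrm a + 1)), q₁.eval t ≠ q₀.eval t := by
    by_contra! h
    refine Set.Infinite.mono (s := Set.Ioo (0 : ℝ) (1 / (nrm a + 1))) (fun t ht => h t ht) ?_ hfin
    exact Set.Ioo_infinite (by have := nrm_nonneg a; positivity)
  obtain ⟨q, hq⟩ := hline (t • a) b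
  have hdeg : 0 < q.degree := by
    by_contra! h
    apply htn
    have h1 := hq 0
    have h2 := hq 1
    rw [Polynomial.eq_C_of_degree_le_zero h, Polynomial.eval_C] at h1 h2
    rw [h1] at h2
    rw [hq₁, hq₀, zero_add]
    rw [zero_smul, add_zero, one_smul, add_comm] at h2
    exact h2.symm
  have hb0 : b ≠ 0 := by
    intro h
    apply htn
    rw [hq₁, hq₀, h]
  have hbn := nrm_pos hb0
  have hPb : P *ᵥ b = 0 := by rw [hb, mulVec_sub, hPP, sub_self]
  have hPa : P *ᵥ a = a := hPP x₀
  have h1 := (Polynomial.abs_tendsto_atTop q hdeg).eventually_gt_atTop (|K| + 1)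
  have h2 : ∀ᶠ u : ℝ in atTop, (|K| + 1) / nrm b < u := eventually_gt_atTop _
  obtain ⟨u, hu1, hu2⟩ := (h1.and h2).exists
  refine ⟨t • a + u • b, ?_, ?_, ?_⟩
  · have e : P *ᵥ (t • a + u • b) = t • a := by
      rw [mulVec_add, mulVec_smul, mulVec_smul, hPa, hPb, smul_zero, add_zero]
    rw [e, nrm_smul, abs_of_pos ht.1]
    have h3 := nrm_nonneg a
    have h4 := ht.2
    rw [lt_div_iff₀ (by linarith)] at h4
    nlinarith [ht.1]
  · have e : (t • a + u • b) - P *ᵥ (t • a + u • b) = u • b := by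
      rw [mulVec_add, mulVec_smul, mulVec_smul, hPa, hPb, smul_zero, add_zero,
        add_sub_cancel_left]
    rw [div_lt_iff₀ hbn] at hu2
    have hu0 : 0 < u := by
      by_contra! h
      nlinarith [abs_nonneg K]
    rw [e, nrm_smul, abs_of_pos hu0]
    nlinarith [le_abs_self K, abs_nonneg K]
  · rw [← hq, ← sq_abs]
    nlinarith [le_abs_self K, abs_nonneg K]

lemma isOpenPosMeasure_gaussianVec (s : ℕ) : (gaussianVec s).IsOpenPosMeasure := by
  have h : (volume : Measure (Vec s)) ≪ gaussianVec s := by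
    rw [gaussianVec_eq_withDensity]
    refine withDensity_absolutelyContinuous' ?_ (ae_of_all _ fun x => ?_)
    · exact (by unfold gaussianPDFReal; fun_prop : Measurable fun x : Vec s =>
        ENNReal.ofReal (∏ i, gaussianPDFReal 0 1 (x i))).aemeasurable
    · rw [Ne, ENNReal.ofReal_eq_zero, not_le]
      exact Finset.prod_pos fun i _ => gaussianPDFReal_pos 0 1 _ one_ne_zero
  exact h.isOpenPosMeasure

lemma trace_target {F : Vec s → ℝ} (hF : Continuous F) {ρ : Measure ℝ}
    [IsProbabilityMeasure ρ] {τ : ℝ → ℝ} (hτ : Continuous τ) (hτ1 : ∀ y, |τ y| ≤ 1)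
    (P : Mat s s) :
    (target F ρ τ P).trace = (√2)⁻¹ * ∫ q, τ (F q.1 + q.2) * (radial (q.1 ⬝ᵥ (P *ᵥ q.1)) *
      (nrm (q.1 - P *ᵥ q.1) ^ 2 - (1 - P).trace)) ∂(gaussianVec s).prod ρ := by
  have hAm : Measurable fun q : Vec s × ℝ => τ (F q.1 + q.2) * radial (q.1 ⬝ᵥ (P *ᵥ q.1)) := by
    have := continuous_radial
    exact (by fun_prop : Continuous fun q : Vec s × ℝ =>
      τ (F q.1 + q.2) * radial (q.1 ⬝ᵥ (P *ᵥ q.1))).measurable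
  have hA1 : ∀ q : Vec s × ℝ, |τ (F q.1 + q.2) * radial (q.1 ⬝ᵥ (P *ᵥ q.1))| ≤ 1 := fun q => by
    rw [abs_mul, abs_of_nonneg (radial_nonneg _)]
    exact mul_le_one₀ (hτ1 _) (radial_nonneg _) (radial_le_one _)
  simp only [target, trace, diag_apply, Matrix.of_apply]
  rw [← integral_finsetSum, ← integral_const_mul]
  · refine integral_congr_ae (ae_of_all _ fun q => ?_)
    have e : nrm (q.1 - P *ᵥ q.1) ^ 2 = ∑ i, ((1 - P) *ᵥ q.1) i * ((1 - P) *ᵥ q.1) i := by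
      rw [← dot_self_eq_nrm_sq, sub_mulVec, one_mulVec]
      rfl
    simp only
    rw [e, ← Finset.mul_sum, ← Finset.mul_sum, Finset.sum_sub_distrib]
    ring
  · intro i _
    obtain ⟨b, hb⟩ : ∃ b : Vec s, ∀ x, ((1 - P) *ᵥ x) i = b ⬝ᵥ x := ⟨fun j => (1 - P) i j, fun _ => rfl⟩
    refine integrable_mul_fst hAm hA1 (f := fun x => (√2)⁻¹ *
      (((1 - P) *ᵥ x) i * ((1 - P) *ᵥ x) i - (1 - P) i i)) ?_
    simp only [hb, ← sq]
    exact ((integrable_dot_pow b 2).sub (integrable_const _)).const_mul _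

/-- If `f` is not a function of `P x`, some bounded feature of the response has a nonzero
conditional second harmonic. -/
theorem exists_target_ne_zero (f : MvPolynomial (Fin s) ℝ) (ρ : Measure ℝ)
    [IsProbabilityMeasure ρ] {P : Mat s s} (hPt : Pᵀ = P) (hP : P * P = P)
    (hPf : ¬ ∀ x, MvPolynomial.eval x f = MvPolynomial.eval (P *ᵥ x) f) :
    ∃ (τ : ℝ → ℝ) (θ : ℝ), 0 ≤ θ ∧ (∀ y, |τ y| ≤ 1) ∧ (∀ y y', |τ y - τ y'| ≤ θ * |y - y'|) ∧
      target (fun x => MvPolynomial.eval x f) ρ τ P ≠ 0 := by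
  by_contra! hall
  set F : Vec s → ℝ := fun x => MvPolynomial.eval x f with hFdef
  have hF : Continuous F := MvPolynomial.continuous_eval f
  set κ := (1 - P).trace with hκ
  obtain ⟨h, hh⟩ : ∃ h : Vec s → ℝ, ∀ x, h x = radial (x ⬝ᵥ (P *ᵥ x)) *
    (nrm (x - P *ᵥ x) ^ 2 - κ) := ⟨_, fun _ => rfl⟩
  have hhc : Continuous h := by
    rw [show h = _ from funext hh]
    have := continuous_radial
    have h2 : Continuous fun x : Vec s => nrm (x - P *ᵥ x) := continuous_nrm.comp (by fun_prop)
    fun_prop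
  have hs2 : (√2)⁻¹ ≠ 0 := by positivity
  have hzero : ∀ (τ : ℝ → ℝ) (θ : ℝ), 0 ≤ θ → (∀ y, |τ y| ≤ 1) →
      (∀ y y', |τ y - τ y'| ≤ θ * |y - y'|) →
      ∫ q, τ (F q.1 + q.2) * h q.1 ∂(gaussianVec s).prod ρ = 0 := by
    intro τ θ hθ hτ1 hτL
    have hτc : Continuous τ := by
      refine (LipschitzWith.of_dist_le_mul (K := ⟨θ, hθ⟩) fun x y => ?_).continuous
      rw [Real.dist_eq, Real.dist_eq]
      exact hτL x y
    have h1 := trace_target hF (ρ := ρ) hτc hτ1 P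
    rw [hall τ θ hθ hτ1 hτL, trace_zero] at h1
    simp only [hh]
    exact (mul_eq_zero.1 h1.symm).resolve_left hs2
  have hbd : ∀ x, |h x| ≤ nrm x ^ 2 + |κ| := by
    intro x
    rw [hh, abs_mul, abs_of_nonneg (radial_nonneg _)]
    refine (mul_le_of_le_one_left (abs_nonneg _) (radial_le_one _)).trans ?_
    refine (abs_sub _ _).trans (add_le_add_left ?_ _)
    rw [abs_of_nonneg (sq_nonneg _)]
    exact pow_le_pow_left₀ (nrm_nonneg _) (nrm_sub_proj_le hPt hP x) 2
  have hi : ∀ n : ℕ, Integrable (fun x => F x ^ n * h x) (gaussianVec s) := by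
    intro n
    have h1 := integrable_eval_gaussianVec
      ((1 + f ^ (2 * n)) * (∑ i, MvPolynomial.X i ^ 2 + MvPolynomial.C |κ|))
    refine h1.mono' ((hF.pow n).mul hhc).aestronglyMeasurable (ae_of_all _ fun x => ?_)
    have e : MvPolynomial.eval x (∑ i, MvPolynomial.X i ^ 2 : MvPolynomial (Fin s) ℝ) =
        nrm x ^ 2 := by
      rw [← dot_self_eq_nrm_sq]
      simp [dotProduct, sq]
    rw [map_mul, map_add, map_add, map_one, map_pow, MvPolynomial.eval_C, e, norm_mul,
      Real.norm_eq_abs, Real.norm_eq_abs, pow_mul']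
    refine mul_le_mul ?_ (hbd x) (abs_nonneg _) (by positivity)
    have := sq_abs (F x ^ n)
    change |F x ^ n| ≤ 1 + (F x ^ n) ^ 2
    nlinarith [sq_nonneg (|F x ^ n| - 1)]
  have habs : ∀ θ y y' : ℝ, |θ * y - θ * y'| = |θ| * |y - y'| := fun θ y y' => by
    rw [← mul_sub, abs_mul]
  have hmom := integral_pow_mul_eq_zero hF.measurable hhc.measurable hi (ρ := ρ)
    (fun θ => hzero (fun y => Real.cos (θ * y)) |θ| (abs_nonneg _) (fun y => Real.abs_cos_le_one _)
      fun y y' => (Real.abs_cos_sub_cos_le _ _).trans_eq (habs θ y y'))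
    (fun θ => hzero (fun y => Real.sin (θ * y)) |θ| (abs_nonneg _) (fun y => Real.abs_sin_le_one _)
      fun y y' => (Real.abs_sin_sub_sin_le _ _).trans_eq (habs θ y y'))
  -- a compact set carrying the negative part of `h`
  obtain ⟨M, hM0, hM⟩ : ∃ M : ℝ, 0 ≤ M ∧ ∀ x, nrm x ^ 2 ≤ 1 + |κ| → F x ^ 2 ≤ M := by
    have hK : IsCompact {x : Vec s | nrm x ^ 2 ≤ 1 + |κ|} := by
      refine Metric.isCompact_of_isClosed_isBounded
        (isClosed_le (continuous_nrm.pow 2) continuous_const) ?_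
      refine Metric.isBounded_closedBall (x := (0 : Vec s)) (r := 1 + |κ|) |>.subset fun x hx => ?_
      rw [mem_closedBall_zero_iff, pi_norm_le_iff_of_nonneg (by positivity)]
      intro i
      have h1 : nrm x ^ 2 ≤ 1 + |κ| := hx
      refine (abs_apply_le_nrm x i).trans ?_
      nlinarith [nrm_nonneg x, abs_nonneg κ, sq_nonneg (nrm x - 1)]
    obtain ⟨M, hM⟩ := hK.bddAbove_image (f := fun x => F x ^ 2) (by fun_prop)
    exact ⟨max M 0, le_max_right _ _, fun x hx => (hM ⟨x, hx, rfl⟩).trans (le_max_left _ _)⟩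
  set O : Set (Vec s) := {x | nrm (P *ᵥ x) < 1 ∧ |κ| < nrm (x - P *ᵥ x) ^ 2 ∧ 2 * M + 1 < F x ^ 2}
    with hO
  have hPd : ∀ x, x ⬝ᵥ (P *ᵥ x) = nrm (P *ᵥ x) ^ 2 := fun x => (proj_mulVec_dot hPt hP x).symm
  have hOo : IsOpen O := by
    have h1 : Continuous fun x : Vec s => nrm (x - P *ᵥ x) := continuous_nrm.comp (by fun_prop)
    have h2 : Continuous fun x : Vec s => nrm (P *ᵥ x) := continuous_nrm.comp (by fun_prop)
    exact (isOpen_lt h2 continuous_const).inter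
      ((isOpen_lt continuous_const (h1.pow 2)).inter (isOpen_lt continuous_const (hF.pow 2)))
  have hOne : O.Nonempty := by
    obtain ⟨x, h1, h2, h3⟩ := exists_large_eval f hP hPf (max |κ| (2 * M + 1))
    exact ⟨x, h1, lt_of_le_of_lt (le_max_left _ _) h2, lt_of_le_of_lt (le_max_right _ _) h3⟩
  have hradpos : ∀ x, nrm (P *ᵥ x) < 1 → 0 < radial (x ⬝ᵥ (P *ᵥ x)) := fun x hx => by
    rw [hPd, radial, Real.sqrt_sq (nrm_nonneg _)]
    exact lt_max_of_lt_right (by linarith)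
  have hhO : ∀ x ∈ O, 0 < h x := fun x hx => by
    rw [hh]
    exact mul_pos (hradpos x hx.1) (by have := hx.2.1; have := le_abs_self κ; linarith)
  have hhi : Integrable h (gaussianVec s) := by simpa using hi 0
  have hcpos : 0 < ∫ x in O, h x ∂gaussianVec s := by
    rw [setIntegral_pos_iff_support_of_nonneg_ae]
    · have hsub : O ⊆ Function.support h ∩ O := fun x hx => ⟨(hhO x hx).ne', hx⟩
      have := isOpenPosMeasure_gaussianVec s
      exact lt_of_lt_of_le (hOo.measure_pos _ hOne) (measure_mono hsub)
    · exact (ae_restrict_mem hOo.measurableSet).mono fun x hx => (hhO x hx).le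
    · exact hhi.integrableOn
  set c := ∫ x in O, h x ∂gaussianVec s with hc
  have hlow : ∀ (n : ℕ) x, O.indicator (fun x => (2 * M + 1) ^ n * h x) x - M ^ n * |κ| ≤
      F x ^ (2 * n) * h x := by
    intro n x
    have hMk : 0 ≤ M ^ n * |κ| := by positivity
    have hFn : 0 ≤ F x ^ (2 * n) := by rw [pow_mul]; positivity
    by_cases hx : x ∈ O
    · rw [Set.indicator_of_mem hx, pow_mul]
      have h1 : (2 * M + 1) ^ n ≤ (F x ^ 2) ^ n :=
        pow_le_pow_left₀ (by linarith) hx.2.2.le n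
      have h2 := mul_le_mul_of_nonneg_right h1 (hhO x hx).le
      linarith
    · rw [Set.indicator_of_notMem hx, zero_sub]
      by_cases hneg : 0 ≤ h x
      · have := mul_nonneg hFn hneg
        linarith
      · push Not at hneg
        rw [hh] at hneg
        have h0 := radial_nonneg (x ⬝ᵥ (P *ᵥ x))
        have h1 : nrm (x - P *ᵥ x) ^ 2 < κ := by
          by_contra! h2
          have := mul_nonneg h0 (sub_nonneg.2 h2)
          linarith
        have h2 : nrm (P *ᵥ x) ≤ 1 := by
          by_contra! h3
          have : radial (x ⬝ᵥ (P *ᵥ x)) = 0 := by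
            rw [hPd, radial, Real.sqrt_sq (nrm_nonneg _)]
            exact max_eq_left (by linarith)
          rw [this, zero_mul] at hneg
          exact lt_irrefl _ hneg
        have h3 : nrm x ^ 2 ≤ 1 + |κ| := by
          have h4 := nrm_sub_proj_sq hPt hP x
          rw [hPd] at h4
          have h5 := le_abs_self κ
          have h6 : nrm (P *ᵥ x) ^ 2 ≤ 1 := pow_le_one₀ (nrm_nonneg _) h2
          linarith
        have h4 : F x ^ (2 * n) ≤ M ^ n := by
          rw [pow_mul]
          exact pow_le_pow_left₀ (sq_nonneg _) (hM x h3) n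
        have h5 : -|κ| ≤ h x := by
          rw [hh]
          have h6 := le_abs_self κ
          have h7 := radial_le_one (x ⬝ᵥ (P *ᵥ x))
          nlinarith [sq_nonneg (nrm (x - P *ᵥ x)), abs_nonneg κ]
        have h6 := mul_le_mul_of_nonneg_left h5 hFn
        have h7 := mul_le_mul_of_nonneg_right h4 (abs_nonneg κ)
        linarith
  have hfinal : ∀ n : ℕ, (2 * M + 1) ^ n * c ≤ M ^ n * |κ| := by
    intro n
    have h1 : Integrable (O.indicator (fun x => (2 * M + 1) ^ n * h x)) (gaussianVec s) :=
      (hhi.const_mul _).indicator hOo.measurableSet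
    have h2 := integral_mono (h1.sub (integrable_const (M ^ n * |κ|))) (hi (2 * n)) (hlow n)
    rw [hmom (2 * n)] at h2
    have h3 : ∫ x, (O.indicator (fun x => (2 * M + 1) ^ n * h x) x - M ^ n * |κ|)
        ∂gaussianVec s = (2 * M + 1) ^ n * c - M ^ n * |κ| := by
      rw [integral_sub h1 (integrable_const _), integral_indicator hOo.measurableSet,
        integral_const_mul]
      simp [hc]
    have h4 := h3.symm.trans_le h2
    linarith
  have hr : M / (2 * M + 1) < 1 := by rw [div_lt_one (by linarith)]; linarith
  have hlim : Tendsto (fun n : ℕ => (M / (2 * M + 1)) ^ n * |κ|) atTop (nhds 0) := by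
    have := (tendsto_pow_atTop_nhds_zero_of_lt_one (by positivity) hr).mul_const |κ|
    rwa [zero_mul] at this
  have hle : c ≤ 0 := by
    refine ge_of_tendsto' hlim fun n => ?_
    rw [div_pow, div_mul_eq_mul_div, le_div_iff₀ (by positivity), mul_comm c]
    exact hfinal n
  linarith

/-! ### Well-posedness -/

lemma indepFun_map {α β γ δ : Type*} [MeasurableSpace α] [MeasurableSpace β] [MeasurableSpace γ]
    [MeasurableSpace δ] {μ : Measure α} {T : α → β} (hT : Measurable T) {f : β → γ} {g : β → δ}
    (hf : Measurable f) (hg : Measurable g) (h : IndepFun (f ∘ T) (g ∘ T) μ) :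
    IndepFun f g (μ.map T) := by
  rw [indepFun_iff_measure_inter_preimage_eq_mul] at h ⊢
  intro s t hs ht
  rw [Measure.map_apply hT ((hf hs).inter (hg ht)), Measure.map_apply hT (hf hs),
    Measure.map_apply hT (hg ht)]
  exact h s t hs ht

lemma MeasurePreserving.indepFun_comp {α β γ δ : Type*} [MeasurableSpace α] [MeasurableSpace β]
    [MeasurableSpace γ] [MeasurableSpace δ] {μ : Measure α} {ν : Measure β} {T : α → β}
    (hT : MeasurePreserving T μ ν) {f : β → γ} {g : β → δ} (hf : Measurable f) (hg : Measurable g)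
    (h : IndepFun f g ν) : IndepFun (f ∘ T) (g ∘ T) μ := by
  rw [indepFun_iff_measure_inter_preimage_eq_mul] at h ⊢
  intro s t hs ht
  have := h s t hs ht
  rwa [← hT.measure_preimage ((hf hs).inter (hg ht)).nullMeasurableSet,
    ← hT.measure_preimage (hf hs).nullMeasurableSet,
    ← hT.measure_preimage (hg ht).nullMeasurableSet] at this

lemma direction_smul {c : ℝ} (hc : 0 < c) (v : Vec d) : direction (c • v) = direction v := by
  unfold direction
  rw [nrm_smul, abs_of_pos hc, smul_smul, mul_inv]
  congr 1
  field_simp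

lemma nrm_sq_complement {U : Mat d k}
    {Up : Mat d (d - k)} (hU : IsFrame U) (hUp : IsComplement U Up) (g : Vec d) :
    nrm g ^ 2 = nrm (Uᵀ *ᵥ g) ^ 2 + nrm (Upᵀ *ᵥ g) ^ 2 := by
  rw [← dot_self_eq_nrm_sq, ← dot_self_eq_nrm_sq, ← dot_self_eq_nrm_sq, ← dot_proj, ← dot_proj,
    ← dotProduct_add, ← add_mulVec, hUp.add_eq_one hU, one_mulVec]

lemma reducedInput_direction {Y : Type*} {U : Mat d k}
    {Up : Mat d (d - k)} (hU : IsFrame U) (hUp : IsComplement U Up) (y : Y)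
    (g : Vec d) : reducedInput U Up (y, direction g) = direction (Upᵀ *ᵥ g) := by
  by_cases hg : g = 0
  · subst hg
    simp [reducedInput, direction]
  have hn := nrm_pos hg
  have h1 := nrm_sq_complement hU hUp (direction g)
  rw [nrm_direction hg, one_pow] at h1
  have h2 : 1 - (Uᵀ *ᵥ direction g) ⬝ᵥ (Uᵀ *ᵥ direction g) = nrm (Upᵀ *ᵥ direction g) ^ 2 := by
    rw [dot_self_eq_nrm_sq, h1]; ring
  have h3 : reducedInput U Up (y, direction g) = direction (Upᵀ *ᵥ direction g) := by
    simp only [reducedInput]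
    rw [h2, Real.sqrt_sq (nrm_nonneg _)]
    rfl
  rw [h3]
  conv_lhs => rw [show direction g = (nrm g)⁻¹ • g from rfl]
  rw [mulVec_smul, direction_smul (inv_pos.2 hn)]

/-- Outside the frame, the direction of a Gaussian vector is independent of the rest. -/
lemma measurePreserving_split (hk : k < d) {U : Mat d k}
    {Up : Mat d (d - k)} (hU : IsFrame U) (hUp : IsComplement U Up)
    (ρ : Measure ℝ) [IsProbabilityMeasure ρ] :
    MeasurePreserving (fun p : Vec d × ℝ =>
      (direction (Upᵀ *ᵥ p.1), ((Uᵀ *ᵥ p.1, nrm (Upᵀ *ᵥ p.1)), p.2))) ((gaussianVec d).prod ρ)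
      ((sphereUniform (d - k)).prod
        (((gaussianVec k).prod ((gaussianVec (d - k)).map nrm)).prod ρ)) := by
  have hprob : IsProbabilityMeasure (sphereUniform (d - k)) := by
    rw [sphereUniform_eq_map (by omega)]
    exact Measure.isProbabilityMeasure_map measurable_direction.aemeasurable
  have hprob2 : IsProbabilityMeasure ((gaussianVec (d - k)).map nrm) :=
    Measure.isProbabilityMeasure_map measurable_nrm.aemeasurable
  have h1 : MeasurePreserving (fun g : Vec d => (Uᵀ *ᵥ g, Upᵀ *ᵥ g)) (gaussianVec d)
      ((gaussianVec k).prod (gaussianVec (d - k))) :=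
    ⟨(measurable_mulVec _).prodMk (measurable_mulVec _), map_gaussianVec_pair hU hUp.1 hUp.2⟩
  have h2 : MeasurePreserving (fun g : Vec (d - k) => (nrm g, direction g)) (gaussianVec (d - k))
      (((gaussianVec (d - k)).map nrm).prod (sphereUniform (d - k))) :=
    ⟨measurable_nrm.prodMk measurable_direction, map_nrm_direction (by omega)⟩
  have h3 := ((MeasurePreserving.id (gaussianVec k)).prod h2).comp h1
  have h4 := (measurePreserving_prodAssoc (gaussianVec k) ((gaussianVec (d - k)).map nrm)
    (sphereUniform (d - k))).symm.comp h3
  have h5 := (Measure.measurePreserving_swap (μ := (gaussianVec k).prod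
    ((gaussianVec (d - k)).map nrm)) (ν := sphereUniform (d - k))).comp h4
  have h6 := h5.prod (MeasurePreserving.id ρ)
  exact (measurePreserving_prodAssoc (sphereUniform (d - k)) ((gaussianVec k).prod
    ((gaussianVec (d - k)).map nrm)) ρ).comp h6

lemma range_mul_lt {W : Mat d s} (hW : IsFrame W)
    {Q : Mat s k} (hk : k < s) :
    LinearMap.range (W * Q).mulVecLin < LinearMap.range W.mulVecLin := by
  refine lt_of_le_of_ne ?_ fun h => ?_
  · rw [mulVecLin_mul]
    exact LinearMap.range_comp_le_range _ _
  · have h1 : Module.finrank ℝ (LinearMap.range W.mulVecLin) = s := by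
      rw [LinearMap.finrank_range_of_inj, Module.finrank_fin_fun]
      intro x y hxy
      have hW' : Wᵀ * W = 1 := hW
      have h2 : W *ᵥ x = W *ᵥ y := hxy
      have h3 := congrArg (fun v => Wᵀ *ᵥ v) h2
      simpa only [mulVec_mulVec, hW', one_mulVec] using h3
    have h2 : Module.finrank ℝ (LinearMap.range (W * Q).mulVecLin) ≤ k := by
      refine (LinearMap.finrank_range_le _).trans ?_
      rw [Module.finrank_fin_fun]
    rw [h, h1] at h2
    omega

/-- In a well-posed problem, the link depends on all directions. -/
theorem link_depends {f : MvPolynomial (Fin s) ℝ} {ρ : Measure ℝ} [IsProbabilityMeasure ρ]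
    (hres : ∀ᶠ d : ℕ in atTop, ∀ W : Mat d s, IsFrame W →
      ∀ (k : ℕ) (U : Mat d k) (Up : Mat d (d - k)),
        IsStrictSubframe U W → IsComplement U Up →
        ¬ IndepFun (reducedResponse U) (reducedInput U Up) (polyModel f ρ W))
    (hk : k < s) {Q : Mat s k} (hQ : IsFrame Q) :
    ¬ ∀ x, MvPolynomial.eval x f = MvPolynomial.eval ((Q * Qᵀ) *ᵥ x) f := by
  intro hfun
  obtain ⟨d, hd, hsd⟩ := (hres.and (eventually_ge_atTop s)).exists
  obtain ⟨W, hW⟩ := exists_isFrame hsd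
  have hU : IsFrame (W * Q) := hW.mul hQ
  obtain ⟨Up, hUp⟩ := exists_isComplement hU
  refine hd W hW k (W * Q) Up ⟨hU, range_mul_lt hW hk⟩ hUp ?_
  have hd0 : 0 < d := by omega
  set F : Vec s → ℝ := fun x => MvPolynomial.eval x f with hF
  have hFm : Measurable F := (MvPolynomial.continuous_eval f).measurable
  rw [polyModel_eq_map hd0]
  have hm1 : Measurable (reducedResponse (Y := ℝ) (W * Q)) :=
    measurable_fst.prodMk ((measurable_mulVec _).comp measurable_snd)
  have hm2 : Measurable (reducedInput (Y := ℝ) (W * Q) Up) := by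
    unfold reducedInput
    have h1 : Measurable fun p : ℝ × Vec d => ((W * Q)ᵀ *ᵥ p.2) ⬝ᵥ ((W * Q)ᵀ *ᵥ p.2) :=
      (by fun_prop : Continuous fun p : ℝ × Vec d =>
        ((W * Q)ᵀ *ᵥ p.2) ⬝ᵥ ((W * Q)ᵀ *ᵥ p.2)).measurable
    exact (measurable_const.sub h1).sqrt.inv.smul ((measurable_mulVec _).comp measurable_snd)
  refine indepFun_map (measurable_modelMap hFm W) hm1 hm2 ?_
  have hprob : IsProbabilityMeasure (sphereUniform (d - k)) := by
    rw [sphereUniform_eq_map (by omega)]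
    exact Measure.isProbabilityMeasure_map measurable_direction.aemeasurable
  have hprob2 : IsProbabilityMeasure ((gaussianVec (d - k)).map nrm) :=
    Measure.isProbabilityMeasure_map measurable_nrm.aemeasurable
  set N : (Vec k × ℝ) → ℝ := fun q => (√(nrm q.1 ^ 2 + q.2 ^ 2))⁻¹ with hN
  have hNm : Measurable N :=
    (((measurable_nrm.comp measurable_fst).pow_const 2).add (measurable_snd.pow_const 2)).sqrt.inv
  set Φ : (Vec k × ℝ) × ℝ → ℝ × Vec k := fun q =>
    (F (√d • (Q *ᵥ (N q.1 • q.1.1))) + q.2, N q.1 • q.1.1) with hΦ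
  have hΦm : Measurable Φ := by
    have h1 : Measurable fun q : (Vec k × ℝ) × ℝ => N q.1 • q.1.1 :=
      (hNm.comp measurable_fst).smul (measurable_fst.comp measurable_fst)
    exact ((hFm.comp (((measurable_mulVec Q).comp h1).const_smul (√d))).add
      measurable_snd).prodMk h1
  have hmp := measurePreserving_split (by omega) hU hUp ρ
  have hind : IndepFun (fun ω : Vec (d - k) × ((Vec k × ℝ) × ℝ) => Φ ω.2) (fun ω => ω.1)
      ((sphereUniform (d - k)).prod
        (((gaussianVec k).prod ((gaussianVec (d - k)).map nrm)).prod ρ)) :=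
    (indepFun_prod (X := id) (Y := Φ) measurable_id hΦm).symm
  have h := MeasurePreserving.indepFun_comp hmp (hΦm.comp measurable_snd) measurable_fst hind
  convert! h using 1
  · funext p
    have hn : (nrm p.1)⁻¹ = N ((W * Q)ᵀ *ᵥ p.1, nrm (Upᵀ *ᵥ p.1)) := by
      simp only [hN]
      rw [← nrm_sq_complement hU hUp, Real.sqrt_sq (nrm_nonneg _)]
    have hdir : (W * Q)ᵀ *ᵥ direction p.1 = (nrm p.1)⁻¹ • ((W * Q)ᵀ *ᵥ p.1) := by
      rw [direction, mulVec_smul]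
    simp only [Function.comp, hΦ, reducedResponse, modelMap]
    rw [← hn, ← hdir]
    refine Prod.ext ?_ rfl
    simp only
    congr 1
    have : F (√d • (Wᵀ *ᵥ direction p.1)) =
        F ((Q * Qᵀ) *ᵥ (√d • (Wᵀ *ᵥ direction p.1))) := hfun _
    rw [this, mulVec_smul, mulVec_mulVec, mulVec_mulVec, transpose_mul,
      Matrix.mul_assoc]
  · funext p
    simp only [Function.comp, modelMap]
    exact reducedInput_direction hU hUp _ _

/-! ### Concentration of the empirical matrix -/

lemma exp_le_quadratic (x : ℝ) : Real.exp x ≤ 1 + x + x ^ 2 * Real.exp |x| := by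
  have h := Complex.norm_exp_sub_sum_le_norm_mul_exp (x : ℂ) 2
  have e : Complex.exp (x : ℂ) - ∑ m ∈ Finset.range 2, (x : ℂ) ^ m / (m.factorial : ℂ) =
      ((Real.exp x - (1 + x) : ℝ) : ℂ) := by
    simp [Finset.sum_range_succ]
  rw [e, Complex.norm_real, Complex.norm_real, Real.norm_eq_abs, Real.norm_eq_abs, sq_abs] at h
  linarith [le_abs_self (Real.exp x - (1 + x))]

lemma sq_le_exp_abs {b : ℝ} (hb : 0 < b) (x : ℝ) :
    x ^ 2 ≤ 8 / b ^ 2 * Real.exp (b / 2 * |x|) := by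
  have h := Real.quadratic_le_exp_of_nonneg (x := b / 2 * |x|) (by positivity)
  have h0 : 0 ≤ b / 2 * |x| := by positivity
  have h1 : (b / 2 * |x|) ^ 2 = b ^ 2 / 4 * x ^ 2 := by rw [mul_pow, sq_abs]; ring
  rw [h1] at h
  rw [div_mul_eq_mul_div, le_div_iff₀ (by positivity)]
  linarith

/-- A moment generating function bound from one exponential moment. -/
lemma mgf_le_of_exp_abs {α : Type*} [MeasurableSpace α] {μ : Measure α} [IsProbabilityMeasure μ]
    {X : α → ℝ} (hX : Measurable X) {b K : ℝ} (hb : 0 < b)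
    (hK : MeanLE μ (fun x => Real.exp (b * |X x|)) K) {t : ℝ} (ht : |t| ≤ b / 2) :
    Integrable (fun x => Real.exp (t * X x)) μ ∧
      ∫ x, Real.exp (t * X x) ∂μ ≤ Real.exp (t * (∫ x, X x ∂μ) + 8 / b ^ 2 * K * t ^ 2) := by
  have hXi : Integrable X μ := by
    refine (hK.1.const_mul (1 / b)).mono' hX.aestronglyMeasurable (ae_of_all _ fun x => ?_)
    have := Real.add_one_le_exp (b * |X x|)
    rw [Real.norm_eq_abs, one_div_mul_eq_div, le_div_iff₀ hb]
    linarith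
  have hint : Integrable (fun x => Real.exp (t * X x)) μ := by
    refine hK.1.mono' (by fun_prop) (ae_of_all _ fun x => ?_)
    rw [Real.norm_eq_abs, Real.abs_exp]
    refine Real.exp_le_exp.2 ((le_abs_self _).trans ?_)
    rw [abs_mul]
    exact mul_le_mul_of_nonneg_right (by linarith) (abs_nonneg _)
  have hpt : ∀ x, Real.exp (t * X x) ≤
      (1 + t * X x) + t ^ 2 * (8 / b ^ 2) * Real.exp (b * |X x|) := by
    intro x
    refine (exp_le_quadratic _).trans (add_le_add_right ?_ _)
    rw [mul_pow, abs_mul, mul_assoc, mul_assoc]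
    refine mul_le_mul_of_nonneg_left ?_ (sq_nonneg t)
    have h1 : Real.exp (|t| * |X x|) ≤ Real.exp (b / 2 * |X x|) :=
      Real.exp_le_exp.2 (mul_le_mul_of_nonneg_right ht (abs_nonneg _))
    calc X x ^ 2 * Real.exp (|t| * |X x|) ≤
        (8 / b ^ 2 * Real.exp (b / 2 * |X x|)) * Real.exp (b / 2 * |X x|) :=
          mul_le_mul (sq_le_exp_abs hb _) h1 (Real.exp_pos _).le (by positivity)
      _ = 8 / b ^ 2 * Real.exp (b * |X x|) := by
          rw [mul_assoc, ← Real.exp_add]; congr 2; ring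
  have hl : Integrable (fun x => 1 + t * X x) μ := (integrable_const 1).add (hXi.const_mul t)
  have hr := hK.1.const_mul (t ^ 2 * (8 / b ^ 2))
  refine ⟨hint, (integral_mono hint (hl.add hr) hpt).trans ?_⟩
  have e : ∫ x, ((1 + t * X x) + t ^ 2 * (8 / b ^ 2) * Real.exp (b * |X x|)) ∂μ =
      1 + t * (∫ x, X x ∂μ) + t ^ 2 * (8 / b ^ 2) * ∫ x, Real.exp (b * |X x|) ∂μ := by
    rw [integral_add hl hr, integral_add (integrable_const 1) (hXi.const_mul t),
      integral_const_mul, integral_const_mul]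
    simp
  refine (le_of_eq e).trans ?_
  have h2 := mul_le_mul_of_nonneg_left hK.2 (by positivity : 0 ≤ t ^ 2 * (8 / b ^ 2))
  have h3 := Real.add_one_le_exp (t * (∫ x, X x ∂μ) + 8 / b ^ 2 * K * t ^ 2)
  linarith

lemma upper_tail {α : Type*} [MeasurableSpace α] {μ : Measure α} [IsProbabilityMeasure μ]
    {X : α → ℝ} (hX : Measurable X) {b K : ℝ} (hb : 0 < b)
    (hK : MeanLE μ (fun x => Real.exp (b * |X x|)) K) {η : ℝ} {t : ℝ}
    (ht0 : 0 ≤ t) (ht : t ≤ b / 2) (n : ℕ) :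
    (Measure.pi fun _ : Fin n => μ).real {ω | n * ((∫ x, X x ∂μ) + η) ≤ ∑ i, X (ω i)} ≤
      Real.exp (-(n * (t * η - 8 / b ^ 2 * K * t ^ 2))) := by
  obtain ⟨hint, hmgf⟩ := mgf_le_of_exp_abs hX hb hK (t := t) (by rwa [abs_of_nonneg ht0])
  have e : ∀ ω : Fin n → α, Real.exp (t * ∑ i, X (ω i)) = ∏ i, Real.exp (t * X (ω i)) := fun ω => by
    rw [Finset.mul_sum, Real.exp_sum]
  have hi : Integrable (fun ω : Fin n → α => Real.exp (t * ∑ i, X (ω i)))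
      (Measure.pi fun _ : Fin n => μ) := by
    simp only [e]
    exact Integrable.fintype_prod fun _ => hint
  refine (measure_ge_le_exp_mul_mgf _ ht0 hi).trans ?_
  have h1 : mgf (fun ω : Fin n → α => ∑ i, X (ω i)) (Measure.pi fun _ : Fin n => μ) t =
      (∫ x, Real.exp (t * X x) ∂μ) ^ n := by
    rw [mgf]
    simp only [e]
    rw [integral_fintype_prod_eq_pow (fun x => Real.exp (t * X x)), Fintype.card_fin]
  rw [h1]
  calc _ ≤ Real.exp (-t * (n * ((∫ x, X x ∂μ) + η))) *
        Real.exp (t * (∫ x, X x ∂μ) + 8 / b ^ 2 * K * t ^ 2) ^ n := by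
        gcongr
    _ = _ := by
        rw [← Real.exp_nat_mul, ← Real.exp_add]
        congr 1
        ring

/-- A two-sided exponential tail bound for averages. -/
lemma average_tail {b K η : ℝ} (hb : 0 < b) (hK0 : 0 < K) (hη : 0 < η) : ∃ c > 0,
    ∀ {α : Type} [MeasurableSpace α] (μ : Measure α) [IsProbabilityMeasure μ] (X : α → ℝ),
      Measurable X → MeanLE μ (fun x => Real.exp (b * |X x|)) K → ∀ n : ℕ, 0 < n →
      (Measure.pi fun _ : Fin n => μ) {ω | η ≤ |1 / (n : ℝ) * ∑ i, X (ω i) - ∫ x, X x ∂μ|} ≤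
        ENNReal.ofReal (2 * Real.exp (-(c * n))) := by
  set C := 8 / b ^ 2 * K with hC
  have hC0 : 0 < C := by positivity
  set t := min (b / 2) (η / (2 * C)) with ht
  have ht0 : 0 < t := by positivity
  have ht1 : t ≤ b / 2 := min_le_left _ _
  have ht2 : C * t ≤ η / 2 := by
    have : t ≤ η / (2 * C) := min_le_right _ _
    rw [le_div_iff₀ (by positivity)] at this
    linarith
  refine ⟨t * η / 2, by positivity, ?_⟩
  intro α _ μ _ X hX hK n hn
  have hn' : (0 : ℝ) < n := Nat.cast_pos.2 hn
  have hK' : MeanLE μ (fun x => Real.exp (b * |(-X) x|)) K := by simpa using hK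
  have h1 := upper_tail hX hb hK (η := η) ht0.le ht1 n
  have h2 := upper_tail hX.neg hb hK' (η := η) ht0.le ht1 n
  have h3 : Real.exp (-(n * (t * η - 8 / b ^ 2 * K * t ^ 2))) ≤ Real.exp (-(t * η / 2 * n)) := by
    refine Real.exp_le_exp.2 (neg_le_neg ?_)
    rw [← hC, mul_comm]
    refine mul_le_mul_of_nonneg_left ?_ hn'.le
    nlinarith
  have hsub : {ω : Fin n → α | η ≤ |1 / (n : ℝ) * ∑ i, X (ω i) - ∫ x, X x ∂μ|} ⊆
      {ω | n * ((∫ x, X x ∂μ) + η) ≤ ∑ i, X (ω i)} ∪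
      {ω | n * ((∫ x, (-X) x ∂μ) + η) ≤ ∑ i, (-X) (ω i)} := by
    intro ω hω
    have hω' : η ≤ |1 / (n : ℝ) * ∑ i, X (ω i) - ∫ x, X x ∂μ| := hω
    have e : ∑ i, X (ω i) = n * (1 / (n : ℝ) * ∑ i, X (ω i)) := by field_simp
    rcases le_abs.1 hω' with h | h
    · left
      change n * ((∫ x, X x ∂μ) + η) ≤ ∑ i, X (ω i)
      rw [e]
      exact mul_le_mul_of_nonneg_left (by linarith) hn'.le
    · right
      change n * ((∫ x, (-X) x ∂μ) + η) ≤ ∑ i, (-X) (ω i)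
      simp only [Pi.neg_apply, integral_neg, Finset.sum_neg_distrib]
      rw [e, ← mul_neg]
      exact mul_le_mul_of_nonneg_left (by linarith) hn'.le
  refine (measure_mono hsub).trans ((measure_union_le _ _).trans ?_)
  rw [two_mul, ENNReal.ofReal_add (Real.exp_pos _).le (Real.exp_pos _).le]
  refine add_le_add ?_ ?_
  · rw [← ENNReal.ofReal_toReal (measure_ne_top _ {ω : Fin n → α | n * ((∫ x, X x ∂μ) + η) ≤ _})]
    exact ENNReal.ofReal_le_ofReal (h1.trans h3)
  · rw [← ENNReal.ofReal_toReal (measure_ne_top _ {ω : Fin n → α | n * ((∫ x, (-X) x ∂μ) + η) ≤ _})]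
    exact ENNReal.ofReal_le_ofReal (h2.trans h3)

lemma exists_maximal_form (E : Mat d d) :
    ∃ v : Vec d, nrm v ≤ 1 ∧ QForm E |v ⬝ᵥ (E *ᵥ v)| := by
  have hK : IsCompact {x : Vec d | nrm x ≤ 1} := by
    refine Metric.isCompact_of_isClosed_isBounded (isClosed_le continuous_nrm continuous_const) ?_
    refine Metric.isBounded_closedBall (x := (0 : Vec d)) (r := 1) |>.subset fun x hx => ?_
    rw [mem_closedBall_zero_iff, pi_norm_le_iff_of_nonneg zero_le_one]
    exact fun i => (abs_apply_le_nrm x i).trans hx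
  obtain ⟨v, hv, hmax⟩ := hK.exists_isMaxOn ⟨0, by simp [nrm_zero]⟩
    (f := fun x => |x ⬝ᵥ (E *ᵥ x)|) (by fun_prop)
  refine ⟨v, hv, fun x => ?_⟩
  by_cases hx : x = 0
  · simp [hx]
  have hn := nrm_pos hx
  have h1 : |direction x ⬝ᵥ (E *ᵥ direction x)| ≤ |v ⬝ᵥ (E *ᵥ v)| :=
    hmax (nrm_direction_le x : nrm (direction x) ≤ 1)
  have e : x = nrm x • direction x := by
    rw [direction, smul_smul, mul_inv_cancel₀ hn.ne', one_smul]
  have e2 : x ⬝ᵥ (E *ᵥ x) = nrm x ^ 2 * (direction x ⬝ᵥ (E *ᵥ direction x)) := by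
    conv_lhs => rw [e]
    rw [mulVec_smul, smul_dotProduct, dotProduct_smul, smul_eq_mul, smul_eq_mul]
    ring
  rw [e2, abs_mul, dot_self_eq_nrm_sq, abs_of_nonneg (sq_nonneg _), mul_comm]
  exact mul_le_mul_of_nonneg_right h1 (sq_nonneg _)

lemma form_large_nearby {E : Mat d d} (hE : Eᵀ = E) {v w : Vec d}
    (hv : nrm v ≤ 1) (hq : QForm E |v ⬝ᵥ (E *ᵥ v)|) (hw : nrm (w - v) ≤ 1 / 4) :
    |v ⬝ᵥ (E *ᵥ v)| / 4 ≤ |w ⬝ᵥ (E *ᵥ w)| := by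
  have h1 := hq.bilin hE (w - v) (w + v)
  have h2 : nrm (w + v) ≤ 9 / 4 := by
    have e : w + v = (w - v) + (v + v) := by abel
    rw [e]
    refine (nrm_add_le _ _).trans ?_
    have := nrm_add_le v v
    linarith
  have e : (w - v) ⬝ᵥ (E *ᵥ (w + v)) = w ⬝ᵥ (E *ᵥ w) - v ⬝ᵥ (E *ᵥ v) := by
    have hc := dot_mulVec_comm hE v w
    rw [mulVec_add, dotProduct_add, sub_dotProduct, sub_dotProduct, hc]
    ring
  rw [e] at h1
  have h3 : nrm (w - v) * nrm (w + v) ≤ 1 / 4 * (9 / 4) :=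
    mul_le_mul hw h2 (nrm_nonneg _) (by norm_num)
  have h4 := mul_le_mul_of_nonneg_left h3 (abs_nonneg (v ⬝ᵥ (E *ᵥ v)))
  have h5 := abs_sub_abs_le_abs_sub (v ⬝ᵥ (E *ᵥ v)) (w ⬝ᵥ (E *ᵥ w))
  rw [abs_sub_comm (v ⬝ᵥ (E *ᵥ v))] at h5
  linarith [abs_nonneg (v ⬝ᵥ (E *ᵥ v))]

lemma volume_ball (d : ℕ) (v : Vec d) :
    (8 : ENNReal) ^ d * volume {w : Vec d | nrm (w - v) ≤ 1 / 4} = volume {w : Vec d | nrm w ≤ 2} := by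
  have h1 : {w : Vec d | nrm (w - v) ≤ 1 / 4} = (fun w => w + -v) ⁻¹' {w | nrm w ≤ 1 / 4} := by
    ext w; simp [sub_eq_add_neg]
  have h2 : {w : Vec d | nrm w ≤ 1 / 4} = ((8 : ℝ) • ·) ⁻¹' {w | nrm w ≤ 2} := by
    ext w
    change nrm w ≤ 1 / 4 ↔ nrm ((8 : ℝ) • w) ≤ 2
    rw [nrm_smul, abs_of_pos (by norm_num)]
    constructor <;> intro h <;> linarith
  rw [h1, measure_preimage_add_right, h2, Measure.addHaar_preimage_smul _ (by norm_num),
    Module.finrank_fin_fun, abs_of_pos (by positivity), ENNReal.ofReal_inv_of_pos (by positivity),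
    ENNReal.ofReal_pow (by norm_num), ← mul_assoc]
  rw [show ENNReal.ofReal 8 = 8 by simp, ENNReal.mul_inv_cancel (by positivity) (by simp), one_mul]

/-- A uniform bound for a random quadratic form from bounds at fixed vectors. -/
lemma measure_not_QForm_le {Ω : Type*} [MeasurableSpace Ω] {μ : Measure Ω} [IsProbabilityMeasure μ]
    {E : Ω → Mat d d} (hE : ∀ ω, (E ω)ᵀ = E ω)
    (hm : Measurable fun q : Ω × Vec d => q.2 ⬝ᵥ (E q.1 *ᵥ q.2)) {η : ℝ}
    {ε : ENNReal} (h : ∀ w : Vec d, nrm w ≤ 2 → μ {ω | η / 4 ≤ |w ⬝ᵥ (E ω *ᵥ w)|} ≤ ε) :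
    μ {ω | ¬ QForm (E ω) η} ≤ 8 ^ d * ε := by
  set B : Set (Vec d) := {w | nrm w ≤ 2} with hB
  have hBm : MeasurableSet B := measurableSet_le measurable_nrm measurable_const
  set S : Set (Ω × Vec d) := {q | q.2 ∈ B ∧ η / 4 ≤ |q.2 ⬝ᵥ (E q.1 *ᵥ q.2)|} with hS
  have hSm : MeasurableSet S :=
    (measurable_snd hBm).inter (measurableSet_le measurable_const hm.norm)
  set V := volume B with hV
  have hVtop : V ≠ ⊤ := by
    have : B ⊆ Metric.closedBall 0 2 := fun x hx => by
      rw [mem_closedBall_zero_iff, pi_norm_le_iff_of_nonneg zero_le_two]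
      exact fun i => (abs_apply_le_nrm x i).trans hx
    exact ((measure_mono this).trans_lt measure_closedBall_lt_top).ne
  have hV0 : V ≠ 0 := by
    have hO : IsOpen {w : Vec d | nrm w < 2} := isOpen_lt continuous_nrm continuous_const
    refine ((hO.measure_pos volume ⟨0, by simp [nrm_zero]⟩).trans_le
      (measure_mono fun w (hw : nrm w < 2) => ?_)).ne'
    exact hw.le
  have hsub : {ω | ¬ QForm (E ω) η} ⊆ {ω | V ≤ 8 ^ d * volume (Prod.mk ω ⁻¹' S)} := by
    intro ω hω
    obtain ⟨v, hv, hq⟩ := exists_maximal_form (E ω)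
    have hlt : η < |v ⬝ᵥ (E ω *ᵥ v)| := by
      by_contra! hle
      refine hω fun x => (hq x).trans (mul_le_mul_of_nonneg_right hle ?_)
      exact dot_self_nonneg x
    change V ≤ _
    rw [hV, hB, ← volume_ball d v]
    gcongr
    intro w hw
    have hw' : nrm (w - v) ≤ 1 / 4 := hw
    refine ⟨?_, ?_⟩
    · have := nrm_add_le (w - v) v
      rw [sub_add_cancel] at this
      change nrm w ≤ 2
      linarith
    · have := form_large_nearby (hE ω) hv hq hw'
      change η / 4 ≤ |w ⬝ᵥ (E ω *ᵥ w)|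
      linarith
  have hF : ∫⁻ ω, volume (Prod.mk ω ⁻¹' S) ∂μ ≤ ε * V := by
    rw [← Measure.prod_apply hSm, Measure.prod_apply_symm hSm]
    calc ∫⁻ w, μ ((fun ω => (ω, w)) ⁻¹' S) ≤ ∫⁻ w, B.indicator (fun _ => ε) w := by
          refine lintegral_mono fun w => ?_
          by_cases hw : w ∈ B
          · rw [Set.indicator_of_mem hw]
            exact (measure_mono fun ω hω => hω.2).trans (h w hw)
          · rw [Set.indicator_of_notMem hw]
            have : (fun ω => (ω, w)) ⁻¹' S = ∅ := by
              ext ω; simp [hS, hw]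
            rw [this, measure_empty]
      _ = ε * V := by rw [lintegral_indicator hBm, setLIntegral_const]
  have hM := mul_meas_ge_le_lintegral (μ := μ)
    ((measurable_measure_prodMk_left (ν := (volume : Measure (Vec d))) hSm).const_mul (8 ^ d)) V
  rw [lintegral_const_mul _ (measurable_measure_prodMk_left hSm)] at hM
  have h2 : V * μ {ω | ¬ QForm (E ω) η} ≤ V * (8 ^ d * ε) := by
    calc _ ≤ V * μ {ω | V ≤ 8 ^ d * volume (Prod.mk ω ⁻¹' S)} := by gcongr
      _ ≤ 8 ^ d * (ε * V) := hM.trans (by gcongr)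
      _ = _ := by ring
  exact (ENNReal.mul_le_mul_iff_right hV0 hVtop).1 h2

/-! ### The empirical matrix of one batch -/

/-- The empirical harmonic coefficient, in terms of the projection `Q`. -/
def empMat (τ : ℝ → ℝ) (Q : Mat d d) (D : ℕ) (data : Fin n → ℝ × Vec d) :
    Mat d d :=
  (1 / (n : ℝ)) • ∑ i, sampleMat τ Q D (data i)

lemma dot_empMat (τ : ℝ → ℝ) (Q : Mat d d) (D : ℕ)
    (data : Fin n → ℝ × Vec d) (v : Vec d) : v ⬝ᵥ (empMat τ Q D data *ᵥ v) =
      1 / (n : ℝ) * ∑ i, v ⬝ᵥ (sampleMat τ Q D (data i) *ᵥ v) := by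
  rw [empMat, smul_mulVec, dotProduct_smul, smul_eq_mul, sum_mulVec, dotProduct_sum]

lemma redMat_transpose {Q : Mat d d} (hQt : Qᵀ = Q) (D : ℕ) (z : Vec d) :
    (redMat Q D z)ᵀ = redMat Q D z := by
  rw [redMat, transpose_smul, transpose_sub, transpose_smul, transpose_smul, transpose_vecMulVec,
    transpose_sub, transpose_one, hQt]

lemma empMat_transpose (τ : ℝ → ℝ) {Q : Mat d d} (hQt : Qᵀ = Q) (D : ℕ)
    (data : Fin n → ℝ × Vec d) : (empMat τ Q D data)ᵀ = empMat τ Q D data := by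
  rw [empMat, transpose_smul, transpose_sum]
  congr 1
  refine Finset.sum_congr rfl fun i _ => ?_
  rw [sampleMat, transpose_smul, redMat_transpose hQt]

lemma measurable_dot_sampleMat_pair {τ : ℝ → ℝ} (hτ : Measurable τ)
    (Q : Mat d d) (D : ℕ) :
    Measurable fun q : (ℝ × Vec d) × Vec d => q.2 ⬝ᵥ (sampleMat τ Q D q.1 *ᵥ q.2) := by
  have h : (fun q : (ℝ × Vec d) × Vec d => q.2 ⬝ᵥ (sampleMat τ Q D q.1 *ᵥ q.2)) = fun q =>
      sampleWeight τ Q q.1 * (√((D : ℝ) * (D + 2) / 2) *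
      ((√(1 - q.1.2 ⬝ᵥ (Q *ᵥ q.1.2)))⁻¹ ^ 2 * ((q.1.2 - Q *ᵥ q.1.2) ⬝ᵥ q.2) ^ 2 -
        (1 / (D : ℝ)) * (q.2 ⬝ᵥ (q.2 - Q *ᵥ q.2)))) := by
    funext q
    rw [sampleMat, smul_mulVec, dotProduct_smul, smul_eq_mul, dot_redMat]
  rw [h]
  have h1 : Measurable fun q : (ℝ × Vec d) × Vec d => q.1.2 ⬝ᵥ (Q *ᵥ q.1.2) :=
    (by fun_prop : Continuous fun q : (ℝ × Vec d) × Vec d => q.1.2 ⬝ᵥ (Q *ᵥ q.1.2)).measurable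
  have h2 : Measurable fun q : (ℝ × Vec d) × Vec d => (q.1.2 - Q *ᵥ q.1.2) ⬝ᵥ q.2 :=
    (by fun_prop : Continuous fun q : (ℝ × Vec d) × Vec d =>
      (q.1.2 - Q *ᵥ q.1.2) ⬝ᵥ q.2).measurable
  have h3 : Measurable fun q : (ℝ × Vec d) × Vec d => q.2 ⬝ᵥ (q.2 - Q *ᵥ q.2) :=
    (by fun_prop : Continuous fun q : (ℝ × Vec d) × Vec d => q.2 ⬝ᵥ (q.2 - Q *ᵥ q.2)).measurable
  refine ((measurable_sampleWeight hτ Q).comp measurable_fst).mul (measurable_const.mul ?_)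
  exact (((measurable_const.sub h1).sqrt.inv.pow_const 2).mul (h2.pow_const 2)).sub (h3.const_mul _)

/-- The exponential moment of one sample. -/
lemma exp_abs_dot_sampleMat (hkd : k < d) {F : Vec s → ℝ} (hF : Continuous F)
    (ρ : Measure ℝ) [IsProbabilityMeasure ρ] {τ : ℝ → ℝ} (hτ : Measurable τ)
    (hτ1 : ∀ y, |τ y| ≤ 1) (W : Mat d s) {U : Mat d k}
    (hU : IsFrame U) {v : Vec d} (hv : nrm v ≤ 2) :
    MeanLE (((gaussianVec d).prod ρ).map (modelMap F W))
      (fun p => Real.exp (1 / (128 * (k + 1)) * |v ⬝ᵥ (sampleMat τ (U * Uᵀ) (d - k) p *ᵥ v)|))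
      (Real.exp 1 * (2 * k + 3)) := by
  obtain ⟨Q, hQ⟩ : ∃ Q, Q = U * Uᵀ := ⟨_, rfl⟩
  have hQt : Qᵀ = Q := hQ ▸ proj_transpose U
  have hQQ : Q * Q = Q := hQ ▸ proj_mul_self hU
  have hexp := exp_redCoord hU hv
  rw [← hQ] at hexp ⊢
  have hk0 : (0 : ℝ) ≤ k := Nat.cast_nonneg k
  have hD1 : 1 ≤ d - k := by omega
  have hD : (1 : ℝ) ≤ ((d - k : ℕ) : ℝ) := by exact_mod_cast hD1
  have hDd : ((d - k : ℕ) : ℝ) + 1 ≤ 2 * d := by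
    rw [Nat.cast_sub hkd.le] at hD ⊢
    linarith
  have hb : ∀ p : Vec d × ℝ, |v ⬝ᵥ (sampleMat τ Q (d - k) (modelMap F W p) *ᵥ v)| ≤
      2 * d * redCoord Q v p.1 + 8 := by
    intro p
    rw [dot_sampleMat_modelMap F τ W hQt hQQ, abs_mul]
    refine (mul_le_of_le_one_left (abs_nonneg _) (abs_sampleWeight_le hτ1 Q _)).trans ?_
    obtain ⟨w, hw, hw1, hw2⟩ := sqrt_harmonic_bounds (d - k)
    have hs2 : (√2)⁻¹ ≤ 1 := inv_le_one_of_one_le₀ (Real.one_le_sqrt.2 (by norm_num))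
    have hs0 : 0 ≤ (√2)⁻¹ := by positivity
    have hw0 : 0 ≤ w := le_trans (by linarith) hw1
    have hc : √(((d - k : ℕ) : ℝ) * ((d - k : ℕ) + 2) / 2) ≤ (d - k : ℕ) + 1 := by
      rw [hw]
      exact (mul_le_of_le_one_left hw0 hs2).trans hw2
    have hr := redCoord_nonneg Q v p.1
    have hn : nrm (v - Q *ᵥ v) ^ 2 ≤ 4 := by
      have := pow_le_pow_left₀ (nrm_nonneg _) ((nrm_sub_proj_le hQt hQQ v).trans hv) 2
      linarith
    rw [abs_mul, abs_of_nonneg (Real.sqrt_nonneg _)]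
    have h1 : |redCoord Q v p.1 - 1 / ((d - k : ℕ) : ℝ) * nrm (v - Q *ᵥ v) ^ 2| ≤
        redCoord Q v p.1 + 1 / ((d - k : ℕ) : ℝ) * 4 := by
      refine (abs_sub _ _).trans ?_
      rw [abs_of_nonneg hr, abs_of_nonneg (by positivity)]
      gcongr
    calc _ ≤ (((d - k : ℕ) : ℝ) + 1) * (redCoord Q v p.1 + 1 / ((d - k : ℕ) : ℝ) * 4) :=
          mul_le_mul hc h1 (abs_nonneg _) (by positivity)
      _ = (((d - k : ℕ) : ℝ) + 1) * redCoord Q v p.1 + (4 + 4 / ((d - k : ℕ) : ℝ)) := by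
          field_simp
      _ ≤ 2 * d * redCoord Q v p.1 + 8 := by
          have h4 : 4 / ((d - k : ℕ) : ℝ) ≤ 4 := by
            rw [div_le_iff₀ (by linarith)]; linarith
          have := mul_le_mul_of_nonneg_right hDd hr
          linarith
  have hmm := measurable_modelMap hF.measurable W
  have hmX : Measurable fun p => Real.exp (1 / (128 * ((k : ℝ) + 1)) *
      |v ⬝ᵥ (sampleMat τ Q (d - k) p *ᵥ v)|) :=
    ((measurable_dot_sampleMat hτ Q (d - k) v).norm.const_mul _).exp
  have hb2 : ∀ p : Vec d × ℝ, Real.exp (1 / (128 * ((k : ℝ) + 1)) *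
      |v ⬝ᵥ (sampleMat τ Q (d - k) (modelMap F W p) *ᵥ v)|) ≤
      Real.exp 1 * Real.exp (1 / (64 * (k + 1)) * d * redCoord Q v p.1) := by
    intro p
    rw [← Real.exp_add]
    refine Real.exp_le_exp.2 ?_
    calc _ ≤ 1 / (128 * ((k : ℝ) + 1)) * (2 * d * redCoord Q v p.1 + 8) := by
          gcongr; exact hb p
      _ = 8 / (128 * ((k : ℝ) + 1)) + 1 / (64 * (k + 1)) * d * redCoord Q v p.1 := by
          field_simp; ring
      _ ≤ _ := by
          gcongr
          rw [div_le_one (by positivity)]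
          linarith
  have hi : Integrable (fun g => Real.exp (1 / (64 * ((k : ℝ) + 1)) * d * redCoord Q v g))
      (gaussianVec d) := by
    refine integrable_of_bounded (((measurable_redCoord Q v).const_mul _).exp)
      (Real.exp (1 / (64 * ((k : ℝ) + 1)) * d * nrm v ^ 2)) fun g => ?_
    rw [Real.abs_exp]
    refine Real.exp_le_exp.2 ?_
    gcongr
    exact redCoord_le hQt v g
  have hi2 := (hi.const_mul (Real.exp 1)).comp_fst ρ
  have hi3 : Integrable (fun p : Vec d × ℝ => Real.exp (1 / (128 * ((k : ℝ) + 1)) *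
      |v ⬝ᵥ (sampleMat τ Q (d - k) (modelMap F W p) *ᵥ v)|)) ((gaussianVec d).prod ρ) := by
    refine hi2.mono' (hmX.comp hmm).aestronglyMeasurable (ae_of_all _ fun p => ?_)
    rw [Real.norm_eq_abs, Real.abs_exp]
    exact hb2 p
  refine ⟨(integrable_map_measure hmX.aestronglyMeasurable hmm.aemeasurable).2 hi3, ?_⟩
  rw [integral_map hmm.aemeasurable hmX.aestronglyMeasurable]
  refine (integral_mono hi3 hi2 hb2).trans ?_
  rw [integral_fun_fst (μ := gaussianVec d) (ν := ρ)
    (fun g => Real.exp 1 * Real.exp (1 / (64 * ((k : ℝ) + 1)) * d * redCoord Q v g)),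
    integral_const_mul]
  simp only [probReal_univ, one_smul]
  gcongr

lemma target_transpose (F : Vec s → ℝ) (ρ : Measure ℝ) (τ : ℝ → ℝ)
    {P : Mat s s} (hPt : Pᵀ = P) : (target F ρ τ P)ᵀ = target F ρ τ P := by
  ext i j
  rw [transpose_apply, target, Matrix.of_apply, Matrix.of_apply]
  have h1 : (1 - P)ᵀ = 1 - P := by rw [transpose_sub, transpose_one, hPt]
  have h2 : (1 - P) j i = (1 - P) i j := by rw [← transpose_apply (1 - P), h1]
  simp only [h2, mul_comm (((1 - P) *ᵥ _) j)]

/-- With `N d` samples, the empirical matrix is close to its limit. -/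
theorem exists_batch_concentration {F : Vec s → ℝ} (hF : Continuous F) (ρ : Measure ℝ)
    [IsProbabilityMeasure ρ] {τ : ℝ → ℝ}
    (hτ1 : ∀ y, |τ y| ≤ 1) {θ : ℝ} (hθ : 0 ≤ θ) (hτL : ∀ y y', |τ y - τ y'| ≤ θ * |y - y'|)
    {P : Mat s s} (hPt : Pᵀ = P) (hP : P * P = P) (k : ℕ) {η : ℝ} (hη : 0 < η) :
    ∃ a > 0, ∃ N₀ : ℕ, ∀ N ≥ N₀, ∀ᶠ d : ℕ in atTop, ∀ W : Mat d s, IsFrame W →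
      ∀ U : Mat d k, IsFrame U → ‖U * Uᵀ - W * P * Wᵀ‖ ≤ a →
        (Measure.pi fun _ : Fin (N * d) => ((gaussianVec d).prod ρ).map (modelMap F W))
          {data | ¬ QForm (empMat τ (U * Uᵀ) (d - k) data - W * target F ρ τ P * Wᵀ) η} ≤
            ENNReal.ofReal (Real.exp (-d)) := by
  have hτ : Measurable τ := by
    refine (LipschitzWith.of_dist_le_mul (K := ⟨θ, hθ⟩) fun x y => ?_).continuous.measurable
    rw [Real.dist_eq, Real.dist_eq]
    exact hτL x y
  obtain ⟨a, ha, hpop⟩ := exists_population_close hF ρ hτ1 hθ hτL hPt hP k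
    (by positivity : 0 < η / 8)
  obtain ⟨c, hc, htail⟩ := average_tail (b := 1 / (128 * ((k : ℝ) + 1)))
    (K := Real.exp 1 * (2 * k + 3)) (η := η / 8) (by positivity) (by positivity) (by positivity)
  refine ⟨a, ha, ⌈5 / c⌉₊ + 1, fun N hN => ?_⟩
  have hN0 : 0 < N := by omega
  have hNc : 5 ≤ c * N := by
    have h1 : 5 / c ≤ N := (Nat.le_ceil _).trans (by exact_mod_cast (by omega : ⌈5 / c⌉₊ ≤ N))
    rw [div_le_iff₀ hc] at h1
    linarith
  filter_upwards [hpop, eventually_gt_atTop k, eventually_ge_atTop 1] with d hd hkd hd1 W hW U hU hUW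
  have hmm := measurable_modelMap hF.measurable W
  set μ := ((gaussianVec d).prod ρ).map (modelMap F W) with hμ
  have hμp : IsProbabilityMeasure μ := Measure.isProbabilityMeasure_map hmm.aemeasurable
  set M₀ := W * target F ρ τ P * Wᵀ with hM₀
  have hM₀t : M₀ᵀ = M₀ := by
    rw [hM₀, transpose_mul, transpose_mul, transpose_transpose, target_transpose F ρ τ hPt, Matrix.mul_assoc]
  have hdot : ∀ (data : Fin (N * d) → ℝ × Vec d) (w : Vec d),
      w ⬝ᵥ ((empMat τ (U * Uᵀ) (d - k) data - M₀) *ᵥ w) =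
      1 / ((N * d : ℕ) : ℝ) * ∑ i, w ⬝ᵥ (sampleMat τ (U * Uᵀ) (d - k) (data i) *ᵥ w) -
        w ⬝ᵥ (M₀ *ᵥ w) := fun data w => by
    rw [sub_mulVec, dotProduct_sub, dot_empMat]
  have hn : 0 < N * d := Nat.mul_pos hN0 hd1
  have hmain := measure_not_QForm_le (μ := Measure.pi fun _ : Fin (N * d) => μ)
    (E := fun data => empMat τ (U * Uᵀ) (d - k) data - M₀) (η := η)
    (ε := ENNReal.ofReal (2 * Real.exp (-(c * ((N * d : ℕ) : ℝ)))))
    (fun data => by rw [transpose_sub, empMat_transpose τ (proj_transpose U), hM₀t]) ?_ ?_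
  · refine hmain.trans ?_
    have h8 : (8 : ENNReal) ^ d = ENNReal.ofReal (8 ^ d) := by
      rw [ENNReal.ofReal_pow (by norm_num)]; simp
    rw [h8, ← ENNReal.ofReal_mul (by positivity)]
    refine ENNReal.ofReal_le_ofReal ?_
    have hd' : (1 : ℝ) ≤ d := by exact_mod_cast hd1
    have h3 : (8 : ℝ) ≤ Real.exp 3 := by
      have h1 : (2 : ℝ) ≤ Real.exp 1 := by have := Real.add_one_le_exp 1; linarith
      have h2 := pow_le_pow_left₀ zero_le_two h1 3
      rw [← Real.exp_nat_mul] at h2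
      norm_num at h2
      exact h2
    have h4 : (8 : ℝ) ^ d ≤ Real.exp (3 * d) := by
      rw [mul_comm, Real.exp_nat_mul]
      exact pow_le_pow_left₀ (by norm_num) h3 d
    have h5 : (2 : ℝ) ≤ Real.exp d := by
      have := Real.add_one_le_exp (d : ℝ)
      linarith
    calc (8 : ℝ) ^ d * (2 * Real.exp (-(c * ((N * d : ℕ) : ℝ)))) ≤
        Real.exp (3 * d) * (Real.exp d * Real.exp (-(5 * d))) := by
          have h6 : 5 * (d : ℝ) ≤ c * ((N * d : ℕ) : ℝ) := by
            push_cast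
            rw [← mul_assoc]
            exact mul_le_mul_of_nonneg_right hNc (by linarith)
          gcongr
      _ = Real.exp (-d) := by rw [← Real.exp_add, ← Real.exp_add]; congr 1; ring
  · simp only [hdot]
    refine (measurable_const.mul (Finset.measurable_sum _ fun i _ => ?_)).sub ?_
    · have hg : Measurable fun q : (Fin (N * d) → ℝ × Vec d) × Vec d => (q.1 i, q.2) :=
        ((measurable_pi_apply i).comp measurable_fst).prodMk measurable_snd
      exact (measurable_dot_sampleMat_pair hτ (U * Uᵀ) (d - k)).comp hg
    · exact (by fun_prop : Continuous fun q : (Fin (N * d) → ℝ × Vec d) × Vec d =>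
        q.2 ⬝ᵥ (M₀ *ᵥ q.2)).measurable
  · intro w hw
    have hX := measurable_dot_sampleMat hτ (U * Uᵀ) (d - k) w
    have h1 := htail μ (fun p => w ⬝ᵥ (sampleMat τ (U * Uᵀ) (d - k) p *ᵥ w)) hX
      (exp_abs_dot_sampleMat hkd hF ρ hτ hτ1 W hU hw) (N * d) hn
    refine (measure_mono fun data hdata => ?_).trans h1
    have h2 : η / 4 ≤ |w ⬝ᵥ ((empMat τ (U * Uᵀ) (d - k) data - M₀) *ᵥ w)| := hdata
    rw [hdot] at h2
    have h3 := hd W hW U hU hUW w hw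
    rw [← integral_map hmm.aemeasurable (f := fun p => w ⬝ᵥ (sampleMat τ (U * Uᵀ) (d - k) p *ᵥ w))
      hX.aestronglyMeasurable, ← hμ] at h3
    have h4 : w ⬝ᵥ (M₀ *ᵥ w) = (Wᵀ *ᵥ w) ⬝ᵥ (target F ρ τ P *ᵥ (Wᵀ *ᵥ w)) := by
      rw [hM₀, ← mulVec_mulVec, ← mulVec_mulVec, mulVec_dot]
    rw [← h4] at h3
    change η / 8 ≤ |_ - _|
    have h5 := abs_sub_le (1 / ((N * d : ℕ) : ℝ) *
      ∑ i, w ⬝ᵥ (sampleMat τ (U * Uᵀ) (d - k) (data i) *ᵥ w))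
      (∫ p, w ⬝ᵥ (sampleMat τ (U * Uᵀ) (d - k) p *ᵥ w) ∂μ) (w ⬝ᵥ (M₀ *ᵥ w))
    linarith

/-! ### The stages of the algorithm in the limit -/

lemma target_mulVec_proj {F : Vec s → ℝ} (hF : Continuous F) {ρ : Measure ℝ}
    [IsProbabilityMeasure ρ] {τ : ℝ → ℝ} (hτ : Continuous τ) (hτ1 : ∀ y, |τ y| ≤ 1)
    {P : Mat s s} (hPt : Pᵀ = P) (hP : P * P = P) (x : Vec s) :
    target F ρ τ P *ᵥ (P *ᵥ x) = 0 := by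
  obtain ⟨S, hS⟩ : ∃ S, S = target F ρ τ P := ⟨_, rfl⟩
  have hSt : Sᵀ = S := hS ▸ target_transpose F ρ τ hPt
  rw [← hS]
  have hform : ∀ a u : Vec s, (u + P *ᵥ a) ⬝ᵥ (S *ᵥ (u + P *ᵥ a)) = u ⬝ᵥ (S *ᵥ u) := by
    intro a u
    have e : (u + P *ᵥ a) - P *ᵥ (u + P *ᵥ a) = u - P *ᵥ u := by
      rw [mulVec_add, mulVec_mulVec, hP]; abel
    rw [hS, dot_target hF hτ hτ1 hPt hP, dot_target hF hτ hτ1 hPt hP, e]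
  have hcross : ∀ u : Vec s, u ⬝ᵥ (S *ᵥ (P *ᵥ x)) = 0 := by
    intro u
    have h1 := hform x u
    have h2 := hform x 0
    rw [zero_add, mulVec_zero, dotProduct_zero] at h2
    have hc := dot_mulVec_comm hSt (P *ᵥ x) u
    rw [mulVec_add, dotProduct_add, add_dotProduct, add_dotProduct, h2, hc] at h1
    linarith
  exact dotProduct_eq_zero_iff.1 fun u => by rw [dotProduct_comm]; exact hcross u

/-- `P` is the projection onto a `k`-dimensional space. -/
def IsProj (k : ℕ) (P : Mat s s) : Prop :=
  ∃ Q : Mat s k, IsFrame Q ∧ P = Q * Qᵀ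

/-- One stage of the limiting algorithm: with the feature `τ`, the target has range of dimension
`k' - k`, and this range extends `P` to `P'`. -/
structure IsStage (F : Vec s → ℝ) (ρ : Measure ℝ) (k k' : ℕ) (P P' : Mat s s)
    (τ : ℝ → ℝ) (θ lam : ℝ) : Prop where
  lt : k < k'
  proj : IsProj k P
  abs_le_one : ∀ y, |τ y| ≤ 1
  nonneg : 0 ≤ θ
  lipschitz : ∀ y y', |τ y - τ y'| ≤ θ * |y - y'|
  pos : 0 < lam
  exists_frame : ∃ N : Mat s (k' - k), IsFrame N ∧ P' = P + N * Nᵀ ∧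
    (∀ x : Vec s, lam * ((Nᵀ *ᵥ x) ⬝ᵥ (Nᵀ *ᵥ x)) ≤
      (target F ρ τ P *ᵥ x) ⬝ᵥ (target F ρ τ P *ᵥ x)) ∧
    ∀ x : Vec s, Nᵀ *ᵥ x = 0 → target F ρ τ P *ᵥ x = 0

lemma continuous_of_lipschitz {τ : ℝ → ℝ} {θ : ℝ} (hθ : 0 ≤ θ)
    (hτL : ∀ y y', |τ y - τ y'| ≤ θ * |y - y'|) : Continuous τ := by
  refine (LipschitzWith.of_dist_le_mul (K := ⟨θ, hθ⟩) fun x y => ?_).continuous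
  rw [Real.dist_eq, Real.dist_eq]
  exact hτL x y

lemma IsProj.transpose {P : Mat s s} (h : IsProj k P) : Pᵀ = P := by
  obtain ⟨Q, -, rfl⟩ := h
  exact proj_transpose Q

lemma IsProj.mul_self {P : Mat s s} (h : IsProj k P) : P * P = P := by
  obtain ⟨Q, hQ, rfl⟩ := h
  exact proj_mul_self hQ

lemma IsProj.le {P : Mat s s} (h : IsProj k P) : k ≤ s := by
  obtain ⟨Q, hQ, -⟩ := h
  exact hQ.card_le

lemma IsProj.eq_one {P : Mat s s} (h : IsProj s P) : P = 1 := by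
  obtain ⟨Q, hQ, rfl⟩ := h
  exact mul_eq_one_comm.1 hQ

lemma isProj_zero (s : ℕ) : IsProj 0 (0 : Mat s s) := by
  refine ⟨0, ?_, by simp⟩
  rw [IsFrame]
  ext i
  exact i.elim0

/-- The link is not a function of fewer directions. -/
def DependsOnAll (f : MvPolynomial (Fin s) ℝ) : Prop :=
  ∀ (k : ℕ) (P : Mat s s), k < s → IsProj k P →
    ¬ ∀ x, MvPolynomial.eval x f = MvPolynomial.eval (P *ᵥ x) f

lemma exists_stage {f : MvPolynomial (Fin s) ℝ} (ρ : Measure ℝ) [IsProbabilityMeasure ρ]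
    (hf : DependsOnAll f) {P : Mat s s} (hP : IsProj k P) (hk : k < s) :
    ∃ (k' : ℕ) (P' : Mat s s) (τ : ℝ → ℝ) (θ lam : ℝ), IsProj k' P' ∧
      IsStage (fun x => MvPolynomial.eval x f) ρ k k' P P' τ θ lam := by
  obtain ⟨τ, θ, hθ, hτ1, hτL, hne⟩ :=
    exists_target_ne_zero f ρ hP.transpose hP.mul_self (hf k P hk hP)
  have hF : Continuous fun x => MvPolynomial.eval x f := MvPolynomial.continuous_eval f
  set S := target (fun x => MvPolynomial.eval x f) ρ τ P with hS
  have hSt : Sᵀ = S := target_transpose _ ρ τ hP.transpose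
  obtain ⟨p, N, lam, hp, hlam, hN, hN1, hN2⟩ := exists_range_frame hSt hne
  obtain ⟨Q, hQ, hPQ⟩ := id hP
  have hQN : Qᵀ * N = 0 := by
    have h1 : Nᵀ * Q = 0 := by
      refine Matrix.toLin'.injective (LinearMap.ext fun y => ?_)
      rw [map_zero, LinearMap.zero_apply, Matrix.toLin'_apply, ← mulVec_mulVec]
      have h2 : Q *ᵥ y = P *ᵥ (Q *ᵥ y) := by
        have hQ' : Qᵀ * Q = 1 := hQ
        rw [hPQ, mulVec_mulVec, Matrix.mul_assoc, hQ', Matrix.mul_one]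
      have h3 : S *ᵥ (Q *ᵥ y) = 0 := by
        rw [h2]
        exact target_mulVec_proj hF (continuous_of_lipschitz hθ hτL) hτ1 hP.transpose hP.mul_self _
      have h4 := hN1 (Q *ᵥ y)
      rw [h3, dotProduct_zero] at h4
      have h5 := dot_self_nonneg (Nᵀ *ᵥ (Q *ᵥ y))
      exact dotProduct_self_eq_zero.1 (le_antisymm (by nlinarith) h5)
    have := congrArg Matrix.transpose h1
    rwa [transpose_mul, transpose_transpose, transpose_zero] at this
  obtain ⟨X, hX, hXX, -, -⟩ := hQ.fromCols hN hQN
  refine ⟨k + p, P + N * Nᵀ, τ, θ, lam, ⟨X, hX, by rw [hXX, hPQ]⟩, ?_⟩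
  refine ⟨by omega, hP, hτ1, hθ, hτL, hlam, ?_⟩
  rw [Nat.add_sub_cancel_left]
  exact ⟨N, hN, rfl, hN1, hN2⟩

lemma exists_stages_from {f : MvPolynomial (Fin s) ℝ} (ρ : Measure ℝ)
    [IsProbabilityMeasure ρ] (hf : DependsOnAll f) (n : ℕ) :
    ∀ {k : ℕ} {P : Mat s s}, IsProj k P → s ≤ k + n →
    ∃ (T : ℕ) (σ : ℕ → ℕ) (Pr : ℕ → Mat s s) (τ : ℕ → ℝ → ℝ) (θ lam : ℕ → ℝ),
      T ≤ n ∧ σ 0 = k ∧ Pr 0 = P ∧ σ T = s ∧ IsProj (σ T) (Pr T) ∧ ∀ t < T,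
        IsStage (fun x => MvPolynomial.eval x f) ρ (σ t) (σ (t + 1)) (Pr t) (Pr (t + 1)) (τ t) (θ t)
          (lam t) := by
  induction n with
  | zero =>
    intro k P hP hs
    have hks : k = s := le_antisymm hP.le hs
    exact ⟨0, fun _ => k, fun _ => P, fun _ _ => 0, fun _ => 0, fun _ => 0, le_rfl, rfl, rfl, hks, hP,
      fun t ht => absurd ht (Nat.not_lt_zero t)⟩
  | succ n ih =>
    intro k P hP hs
    by_cases hks : k = s
    · exact ⟨0, fun _ => k, fun _ => P, fun _ _ => 0, fun _ => 0, fun _ => 0, Nat.zero_le _, rfl, rfl,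
        hks, hP, fun t ht => absurd ht (Nat.not_lt_zero t)⟩
    obtain ⟨k', P', τ₀, θ₀, lam₀, hP', hst⟩ := exists_stage ρ hf hP (lt_of_le_of_ne hP.le hks)
    have := hst.lt
    obtain ⟨T, σ, Pr, τ, θ, lam, hT, hσ0, hPr0, hσT, hPT, hall⟩ := ih hP' (by omega)
    refine ⟨T + 1, fun t => Nat.casesOn t k σ, fun t => Nat.casesOn t P Pr,
      fun t => Nat.casesOn t τ₀ τ, fun t => Nat.casesOn t θ₀ θ, fun t => Nat.casesOn t lam₀ lam,
      by omega, rfl, rfl, hσT, hPT, ?_⟩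
    intro t ht
    cases t with
    | zero =>
      change IsStage _ ρ k (σ 0) P (Pr 0) τ₀ θ₀ lam₀
      rw [hσ0, hPr0]
      exact hst
    | succ t => exact hall t (by omega)

/-- The squared form of a perturbed symmetric matrix. -/
lemma QForm.sq {E S : Mat d d} (hE : Eᵀ = E) (hS : Sᵀ = S) {η : ℝ}
    (hη : 0 ≤ η) (h : QForm (E - S) η) : QForm (E * E - S * S) (η * (2 * ‖S‖ + η)) := by
  intro x
  have hES : (E - S)ᵀ = E - S := by rw [transpose_sub, hE, hS]
  have h1 := QForm.nrm_mulVec_le hES h x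
  have h2 : nrm (S *ᵥ x) ≤ ‖S‖ * nrm x := SphericalMIM.nrm_mulVec_le S x
  have e1 : E *ᵥ x = (E - S) *ᵥ x + S *ᵥ x := by rw [sub_mulVec]; abel
  have h3 : nrm (E *ᵥ x + S *ᵥ x) ≤ (2 * ‖S‖ + η) * nrm x := by
    refine (nrm_add_le _ _).trans ?_
    have h4 : nrm (E *ᵥ x) ≤ η * nrm x + ‖S‖ * nrm x := by
      rw [e1]
      exact (nrm_add_le _ _).trans (add_le_add h1 h2)
    linarith
  have e : x ⬝ᵥ ((E * E - S * S) *ᵥ x) = ((E - S) *ᵥ x) ⬝ᵥ (E *ᵥ x + S *ᵥ x) := by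
    rw [sub_mulVec, dotProduct_sub, ← mulVec_mulVec, ← mulVec_mulVec,
      mulVec_dot E, mulVec_dot S, hE, hS, sub_mulVec, sub_dotProduct, dotProduct_add,
      dotProduct_add, dotProduct_comm (S *ᵥ x) (E *ᵥ x)]
    ring
  rw [e]
  refine (abs_dot_le _ _).trans ?_
  rw [dot_self_eq_nrm_sq]
  calc _ ≤ (η * nrm x) * ((2 * ‖S‖ + η) * nrm x) :=
        mul_le_mul h1 h3 (nrm_nonneg _) (mul_nonneg hη (nrm_nonneg _))
    _ = _ := by ring

lemma lift_norm {W : Mat d s} (hW : IsFrame W)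
    (S : Mat s s) : ‖W * S * Wᵀ‖ = ‖S‖ := by
  rw [hW.frob_mul_transpose, hW.frob_mul]

lemma lift_transpose (W : Mat d s)
    {S : Mat s s} (hS : Sᵀ = S) : (W * S * Wᵀ)ᵀ = W * S * Wᵀ := by
  rw [transpose_mul, transpose_mul, transpose_transpose, hS, Matrix.mul_assoc]

/-- A good approximation of the target determines the top eigenspace up to a small error. -/
lemma exists_spectral_tolerance {S : Mat s s} (hS : Sᵀ = S)
    {N : Mat s p} (hN : IsFrame N) {lam : ℝ} (hlam : 0 < lam)
    (h1 : ∀ x : Vec s, lam * ((Nᵀ *ᵥ x) ⬝ᵥ (Nᵀ *ᵥ x)) ≤ (S *ᵥ x) ⬝ᵥ (S *ᵥ x))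
    (h2 : ∀ x : Vec s, Nᵀ *ᵥ x = 0 → S *ᵥ x = 0) {b : ℝ} (hb : 0 < b) :
    ∃ η > 0, ∀ {d : ℕ} {W : Mat d s}, IsFrame W →
      ∀ {E : Mat d d}, Eᵀ = E → QForm (E - W * S * Wᵀ) η →
      ∀ {V : Mat d p}, IsFrame V → ∀ {eig : Fin p → ℝ},
      (∀ j, (E * E) *ᵥ (Vᵀ j) = eig j • Vᵀ j) →
      (∀ x : Vec d, Vᵀ *ᵥ x = 0 → ∀ j, x ⬝ᵥ ((E * E) *ᵥ x) ≤ eig j * (x ⬝ᵥ x)) →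
      (∀ j, lam / 2 ≤ eig j) ∧ ‖W * (N * Nᵀ) * Wᵀ - V * Vᵀ‖ ≤ b ∧
        ∀ x : Vec d, Vᵀ *ᵥ x = 0 → x ⬝ᵥ ((E * E) *ᵥ x) ≤ lam / 4 * (x ⬝ᵥ x) := by
  set c := √(2 * p) * 2 / lam with hc
  have hc0 : 0 ≤ c := by positivity
  set η₂ := min (lam / 8) (min (b / (c + 1)) (lam / 8 / (‖S * S‖ * c + 1))) with hη₂
  have hη₂0 : 0 < η₂ := by positivity
  have hη₂1 : η₂ ≤ lam / 8 := min_le_left _ _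
  have hη₂2 : c * η₂ ≤ b := by
    have : η₂ ≤ b / (c + 1) := (min_le_right _ _).trans (min_le_left _ _)
    rw [le_div_iff₀ (by positivity)] at this
    nlinarith
  have hη₂3 : ‖S * S‖ * (c * η₂) ≤ lam / 8 := by
    have : η₂ ≤ lam / 8 / (‖S * S‖ * c + 1) := (min_le_right _ _).trans (min_le_right _ _)
    rw [le_div_iff₀ (by positivity)] at this
    nlinarith
  set η := min 1 (η₂ / (2 * ‖S‖ + 1)) with hη
  have hη0 : 0 < η := by positivity
  have hη1 : η * (2 * ‖S‖ + η) ≤ η₂ := by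
    have h3 : η ≤ η₂ / (2 * ‖S‖ + 1) := min_le_right _ _
    have h4 : η ≤ 1 := min_le_left _ _
    rw [le_div_iff₀ (by positivity)] at h3
    refine le_trans ?_ h3
    gcongr
  refine ⟨η, hη0, ?_⟩
  intro d W hW E hE hq V hV eig he htop
  have hW' : Wᵀ * W = 1 := hW
  have hS₀ := lift_transpose W hS
  have hsq := QForm.sq hE hS₀ hη0.le hq
  have hq2 : QForm (E * E - (W * S * Wᵀ) * (W * S * Wᵀ)) η₂ := fun x => by
    refine (hsq x).trans (mul_le_mul_of_nonneg_right ?_ (dot_self_nonneg x))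
    rwa [lift_norm hW]
  have hSS : (W * S * Wᵀ) * (W * S * Wᵀ) = W * (S * S) * Wᵀ := by
    calc _ = W * S * (Wᵀ * W) * S * Wᵀ := by simp only [Matrix.mul_assoc]
      _ = _ := by rw [hW', Matrix.mul_one]; simp only [Matrix.mul_assoc]
  rw [hSS] at hq2
  have hWN : IsFrame (W * N) := hW.mul hN
  have hform : ∀ x : Vec d, x ⬝ᵥ ((W * (S * S) * Wᵀ) *ᵥ x) =
      (S *ᵥ (Wᵀ *ᵥ x)) ⬝ᵥ (S *ᵥ (Wᵀ *ᵥ x)) := fun x => by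
    rw [← mulVec_mulVec, ← mulVec_mulVec, mulVec_dot W, ← mulVec_mulVec,
      mulVec_dot S, hS]
  have hNW : ∀ x : Vec d, (W * N)ᵀ *ᵥ x = Nᵀ *ᵥ (Wᵀ *ᵥ x) := fun x => by
    rw [transpose_mul, mulVec_mulVec]
  obtain ⟨r1, r2, r3⟩ := eigenframe_of_near (M := E * E) (M₀ := W * (S * S) * Wᵀ) (N := W * N)
    (lam := lam) (η := η₂) (by rw [transpose_mul, hE])
    (lift_transpose W (by rw [transpose_mul, hS])) hWN
    (fun x => by rw [hform, hNW]; exact h1 _)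
    (fun x hx => by
      rw [hNW] at hx
      rw [← mulVec_mulVec, ← mulVec_mulVec, ← mulVec_mulVec, h2 _ hx,
        mulVec_zero, mulVec_zero]) hq2 hlam (by linarith) hV he htop
  have eN : W * N * (W * N)ᵀ = W * (N * Nᵀ) * Wᵀ := by
    rw [transpose_mul]; simp only [Matrix.mul_assoc]
  rw [eN] at r2 r3
  have r4 : ‖W * (N * Nᵀ) * Wᵀ - V * Vᵀ‖ ≤ c * η₂ := by
    refine le_of_sq_le_sq (r2.trans_eq ?_) (by positivity)
    have e : √(2 * p) ^ 2 = 2 * p := Real.sq_sqrt (by positivity)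
    calc 2 * (p : ℝ) * (2 * η₂ / lam) ^ 2 = √(2 * p) ^ 2 * (2 * η₂ / lam) ^ 2 := by rw [e]
      _ = _ := by rw [hc]; ring
  refine ⟨r1, r4.trans hη₂2, fun x hx => (r3 x hx).trans ?_⟩
  refine mul_le_mul_of_nonneg_right ?_ (dot_self_nonneg x)
  rw [lift_norm hW]
  have := mul_le_mul_of_nonneg_left r4 (norm_nonneg (S * S))
  linarith

/-! ### One step of the algorithm -/

/-- The feature `τ(y) radial(d ‖r‖²)`. -/
def radialFeature (d : ℕ) (τ : ℝ → ℝ) : Fin 1 → ℝ → Vec k → ℝ :=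
  fun _ y r => τ y * radial (d * (r ⬝ᵥ r))

lemma isAdmissible_radialFeature (d : ℕ) {τ : ℝ → ℝ} (hτ : Measurable τ) (hτ1 : ∀ y, |τ y| ≤ 1)
    (k : ℕ) : IsAdmissible 1 (radialFeature d τ (k := k)) := by
  have hb : ∀ y (r : Vec k), |τ y * radial (d * (r ⬝ᵥ r))| ≤ 1 := fun y r => by
    rw [abs_mul, abs_of_nonneg (radial_nonneg _)]
    exact mul_le_one₀ (hτ1 _) (radial_nonneg _) (radial_le_one _)
  refine ⟨fun _ => ?_, fun p p' => ?_, fun Q hQ y r y' r' => ?_⟩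
  · have h : Continuous fun p : ℝ × Vec k => radial (d * (p.2 ⬝ᵥ p.2)) :=
      continuous_radial.comp (by fun_prop)
    exact (hτ.comp measurable_fst).mul h.measurable
  · simp only [featureKernel, radialFeature, Fin.sum_univ_one]
    rw [abs_mul]
    exact mul_le_one₀ (hb _ _) (abs_nonneg _) (hb _ _)
  · have h : ∀ r : Vec k, (Q *ᵥ r) ⬝ᵥ (Q *ᵥ r) = r ⬝ᵥ r := fun r => by
      have hQ' : Qᵀ * Q = 1 := (Matrix.mem_orthogonalGroup_iff' (Fin k) ℝ).1 hQ
      rw [mulVec_dot, mulVec_mulVec, hQ', one_mulVec]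
    simp only [featureKernel, radialFeature, h]

lemma harmonicTwo_transpose {D : ℕ} (z : Vec D) : (harmonicTwo z)ᵀ = harmonicTwo z := by
  rw [harmonicTwo, transpose_smul, transpose_sub, transpose_smul, transpose_vecMulVec, transpose_one]

lemma lift_harmonicTwo {U : Mat d k}
    {Up : Mat d (d - k)} (hU : IsFrame U) (hUp : IsComplement U Up)
    (p : ℝ × Vec d) :
    Up * harmonicTwo (reducedInput U Up p) * Upᵀ = redMat (U * Uᵀ) (d - k) p.2 := by
  have hc : Up * Upᵀ = 1 - U * Uᵀ := by rw [← hUp.add_eq_one hU, add_sub_cancel_left]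
  have h1 : Up *ᵥ reducedInput U Up p =
      (√(1 - p.2 ⬝ᵥ ((U * Uᵀ) *ᵥ p.2)))⁻¹ • (p.2 - (U * Uᵀ) *ᵥ p.2) := by
    rw [reducedInput, mulVec_smul, mulVec_mulVec, hc, sub_mulVec,
      one_mulVec, dot_proj]
  rw [harmonicTwo, redMat, Matrix.mul_smul, Matrix.smul_mul, Matrix.mul_sub, Matrix.sub_mul,
    Matrix.mul_smul, Matrix.smul_mul, Matrix.mul_one, hc, mul_vecMulVec, vecMulVec_mul,
    vecMul_transpose, h1, smul_vecMulVec, vecMulVec_smul, smul_smul, sq]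

lemma empiricalMatrix_radialFeature (τ : ℝ → ℝ) {U : Mat d k}
    {Up : Mat d (d - k)} (hU : IsFrame U) (hUp : IsComplement U Up)
    (data : Fin n → ℝ × Vec d) :
    ∃ h : Mat (d - k) (d - k), hᵀ = h ∧
      empiricalMatrix (radialFeature d τ) (fun i => reducedResponse U (data i))
        (fun i => reducedInput U Up (data i)) = h * h ∧
      Up * h * Upᵀ = empMat τ (U * Uᵀ) (d - k) data := by
  obtain ⟨w, hw⟩ : ∃ w : Fin n → ℝ, ∀ i, w i = sampleWeight τ (U * Uᵀ) (data i) :=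
    ⟨_, fun _ => rfl⟩
  obtain ⟨H, hH⟩ : ∃ H : Fin n → Mat (d - k) (d - k),
      ∀ i, H i = harmonicTwo (reducedInput U Up (data i)) := ⟨_, fun _ => rfl⟩
  have hHt : ∀ i, (H i)ᵀ = H i := fun i => by rw [hH, harmonicTwo_transpose]
  refine ⟨(1 / (n : ℝ)) • ∑ i, w i • H i, ?_, ?_, ?_⟩
  · rw [transpose_smul, transpose_sum]
    simp only [transpose_smul, hHt]
  · have hK : ∀ i j, featureKernel (radialFeature d τ) (reducedResponse U (data i))
        (reducedResponse U (data j)) = w i * w j := fun i j => by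
      rw [hw, hw, sampleWeight, sampleWeight, dot_proj, dot_proj]
      simp only [featureKernel, radialFeature, Fin.sum_univ_one, reducedResponse]
    simp only [empiricalMatrix, hK, ← hH, hHt]
    rw [Matrix.smul_mul, Matrix.mul_smul, smul_smul, Finset.sum_mul]
    congr 1
    · rw [sq, one_div_mul_one_div]
    · refine Finset.sum_congr rfl fun i _ => ?_
      rw [Finset.mul_sum]
      refine Finset.sum_congr rfl fun j _ => ?_
      rw [Matrix.smul_mul, Matrix.mul_smul, smul_smul]
  · rw [empMat, Matrix.mul_smul, Matrix.smul_mul, Matrix.mul_sum, Matrix.sum_mul]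
    congr 1
    refine Finset.sum_congr rfl fun i _ => ?_
    rw [sampleMat, ← lift_harmonicTwo hU hUp, Matrix.mul_smul, Matrix.smul_mul, hw, hH]

lemma IsTopEigenframe.lift {U : Mat d k}
    {Up : Mat d (d - k)} (hUp : IsComplement U Up)
    {h : Mat (d - k) (d - k)} (hh : hᵀ = h)
    {V : Mat (d - k) p} (hV : IsTopEigenframe (h * h) V) :
    IsTopEigenframe ((Up * h * Upᵀ) * (Up * h * Upᵀ)) (Up * V) := by
  obtain ⟨hVf, eig, he, htop⟩ := hV
  have hUp' : Upᵀ * Up = 1 := hUp.1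
  have hE : (Up * h * Upᵀ) * (Up * h * Upᵀ) = Up * (h * h) * Upᵀ := by
    calc _ = Up * h * (Upᵀ * Up) * h * Upᵀ := by simp only [Matrix.mul_assoc]
      _ = _ := by rw [hUp', Matrix.mul_one]; simp only [Matrix.mul_assoc]
  have hcol : ∀ j, (Up * V)ᵀ j = Up *ᵥ (Vᵀ j) := fun j => rfl
  have hnn : ∀ j, 0 ≤ eig j := fun j => by
    have h1 : Vᵀ j ⬝ᵥ ((h * h) *ᵥ Vᵀ j) = eig j := by
      refine (congrArg (fun x => Vᵀ j ⬝ᵥ x) (he j)).trans ?_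
      refine (dotProduct_smul (eig j) (Vᵀ j) (Vᵀ j)).trans ?_
      refine (congrArg (eig j • ·) (dot_self_eq_nrm_sq (Vᵀ j))).trans ?_
      rw [hVf.nrm_col]; simp
    rw [← h1, ← mulVec_mulVec, mulVec_dot, hh]
    exact dot_self_nonneg _
  refine ⟨hUp.1.mul hVf, eig, fun j => ?_, fun x hx j => ?_⟩
  · rw [hE]
    refine (congrArg (fun x => (Up * (h * h) * Upᵀ) *ᵥ x) (hcol j)).trans ?_
    refine Eq.trans ?_ (congrArg (fun x => eig j • x) (hcol j)).symm
    rw [mulVec_mulVec, Matrix.mul_assoc, hUp', Matrix.mul_one, ← mulVec_smul,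
      ← mulVec_mulVec]
    exact congrArg (Up *ᵥ ·) (he j)
  · have hx' : Vᵀ *ᵥ (Upᵀ *ᵥ x) = 0 := by rwa [mulVec_mulVec, ← transpose_mul]
    have h1 := htop _ hx' j
    rw [hE, ← mulVec_mulVec, ← mulVec_mulVec, mulVec_dot Up]
    refine h1.trans (mul_le_mul_of_nonneg_left ?_ (hnn j))
    rw [dot_self_eq_nrm_sq, dot_self_eq_nrm_sq]
    exact pow_le_pow_left₀ (nrm_nonneg _) (hUp.1.nrm_transpose_mulVec_le x) 2

lemma extend_of_lt {k' : ℕ} (U : Fin k → Vec d) (X : Fin (k' - k) → Vec d) (j : Fin k')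
    (hj : j.val < k) : extend U X j = U ⟨j.val, hj⟩ := dif_pos hj

lemma extend_of_ge {k' : ℕ} (U : Fin k → Vec d) (X : Fin (k' - k) → Vec d) (j : Fin k')
    (hj : ¬ j.val < k) : extend U X j = X ⟨j.val - k, by omega⟩ := dif_neg hj

lemma extend_frame {k' : ℕ} (hk : k ≤ k') {U : Mat d k}
    {V : Mat d (k' - k)} (hU : IsFrame U) (hV : IsFrame V) (hUV : Uᵀ * V = 0)
    {U' : Mat d k'} (h : U'ᵀ = extend Uᵀ Vᵀ) :
    IsFrame U' ∧ U' * U'ᵀ = U * Uᵀ + V * Vᵀ := by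
  obtain ⟨X, hX, hXX, h1, h2⟩ := hU.fromCols hV hUV
  set e : Fin (k + (k' - k)) ≃ Fin k' := finCongr (by omega)
  have hU' : U' = X.submatrix id e.symm := by
    ext i j
    have h3 : U'ᵀ j = Xᵀ (e.symm j) := by
      by_cases hj : j.val < k
      · exact (congrFun h j).trans ((extend_of_lt _ _ _ hj).trans ((h1 ⟨j.val, hj⟩).symm.trans rfl))
      · refine (congrFun h j).trans ((extend_of_ge _ _ _ hj).trans ((h2 ⟨j.val - k, by omega⟩).symm.trans
          (congrArg Xᵀ (Fin.ext ?_))))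
        change k + (j.val - k) = j.val
        omega
    exact congrFun h3 i
  have hX' : Xᵀ * X = 1 := hX
  constructor
  · rw [IsFrame, hU', transpose_submatrix, ← submatrix_mul _ _ e.symm id e.symm
      Function.bijective_id, hX', submatrix_one_equiv]
  · rw [← hXX, hU', transpose_submatrix, ← submatrix_mul _ _ id e.symm id e.symm.bijective,
      submatrix_id_id]

/-- A step of the algorithm adds a top eigenframe of the squared empirical matrix. -/
lemma unfoldingStep_spec {k' : ℕ} (hk : k ≤ k') {τ : ℝ → ℝ} {data : Fin n → ℝ × Vec d}
    {U : Mat d k} {U' : Mat d k'} (hU : IsFrame U)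
    (h : IsUnfoldingStep (radialFeature d τ) data U U') :
    ∃ V : Mat d (k' - k),
      IsTopEigenframe (empMat τ (U * Uᵀ) (d - k) data * empMat τ (U * Uᵀ) (d - k) data) V ∧
      IsFrame U' ∧ U' * U'ᵀ = U * Uᵀ + V * Vᵀ := by
  obtain ⟨Up, V, X, hUp, hV, hX, hU'⟩ := h
  obtain ⟨h, hh, hM, hE⟩ := empiricalMatrix_radialFeature τ hU hUp data
  rw [hM] at hV
  have hproj := hX.proj_eq hV.1
  have hUX : Uᵀ * (Up * X) = 0 := by rw [← Matrix.mul_assoc, hUp.2, Matrix.zero_mul]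
  obtain ⟨h1, h2⟩ := extend_frame hk hU (hUp.1.mul hX.1) hUX hU'
  refine ⟨Up * V, hE ▸ hV.lift hUp hh, h1, ?_⟩
  rw [h2, transpose_mul, transpose_mul]
  congr 1
  calc Up * X * (Xᵀ * Upᵀ) = Up * (X * Xᵀ) * Upᵀ := by simp only [Matrix.mul_assoc]
    _ = _ := by rw [hproj]; simp only [Matrix.mul_assoc]

lemma exists_unfoldingStep {k' : ℕ} (hkd : k' ≤ d) (τ : ℝ → ℝ)
    (data : Fin n → ℝ × Vec d) {U : Mat d k} (hU : IsFrame U) :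
    ∃ U' : Mat d k', IsUnfoldingStep (radialFeature d τ) data U U' := by
  obtain ⟨Up, hUp⟩ := exists_isComplement hU
  obtain ⟨h, hh, hM, -⟩ := empiricalMatrix_radialFeature τ hU hUp data
  obtain ⟨V, hV⟩ := exists_isTopEigenframe (M := h * h) (p := k' - k)
    (by rw [transpose_mul, hh]) (by omega)
  obtain ⟨X, hX⟩ := exists_isTopEigenframe (M := V * Vᵀ) (p := k' - k) (proj_transpose V) (by omega)
  exact ⟨(extend Uᵀ (Up * X)ᵀ : Fin k' → Vec d)ᵀ, Up, V, X, hUp, hM ▸ hV, hX, rfl⟩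

/-- The algorithm can be run. -/
lemma exists_unfoldingRun {T : ℕ} {σ : ℕ → ℕ} (h0 : σ 0 = 0) (hσ : ∀ t < T, σ t ≤ σ (t + 1))
    (hd : ∀ t ≤ T, σ t ≤ d) (τ : ℕ → ℝ → ℝ) (data : Fin T → Fin n → ℝ × Vec d) :
    ∃ U : (t : ℕ) → Mat d (σ t),
      IsUnfoldingRun (fun t => radialFeature d (τ t)) data U := by
  classical
  let next : (t : ℕ) → Mat d (σ t) → Matrix (Fin d) (Fin (σ (t + 1))) ℝ :=
    fun t U => if h : ∃ (ht : t < T) (U' : Matrix (Fin d) (Fin (σ (t + 1))) ℝ),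
      IsUnfoldingStep (radialFeature d (τ t)) (data ⟨t, ht⟩) U U' then h.choose_spec.choose else 0
  let U : (t : ℕ) → Mat d (σ t) := fun t => Nat.rec 0 next t
  have hstep : ∀ t (ht : t < T), IsFrame (U t) →
      IsUnfoldingStep (radialFeature d (τ t)) (data ⟨t, ht⟩) (U t) (U (t + 1)) := by
    intro t ht hU
    have h : ∃ (ht : t < T) (U' : Matrix (Fin d) (Fin (σ (t + 1))) ℝ),
      IsUnfoldingStep (radialFeature d (τ t)) (data ⟨t, ht⟩) (U t) U' :=
      ⟨ht, exists_unfoldingStep (hd (t + 1) ht) (τ t) (data ⟨t, ht⟩) hU⟩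
    have e : U (t + 1) = h.choose_spec.choose := dif_pos h
    rw [e]
    exact h.choose_spec.choose_spec
  have hframe : ∀ t ≤ T, IsFrame (U t) := by
    intro t
    induction t with
    | zero =>
      intro _
      have : IsEmpty (Fin (σ 0)) := by rw [h0]; infer_instance
      exact Subsingleton.elim _ _
    | succ t ih =>
      intro ht
      obtain ⟨V, -, h, -⟩ := unfoldingStep_spec (hσ t ht) (ih (by omega)) (hstep t ht (ih (by omega)))
      exact h
  exact ⟨U, fun t => hstep t t.2 (hframe t t.2.le)⟩

/-! ### Sequential conditioning in product spaces -/

lemma measure_pi_le_of_update {ι : Type*} [Fintype ι] [DecidableEq ι] {X : ι → Type*}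
    [∀ i, MeasurableSpace (X i)] (μ : ∀ i, Measure (X i)) [∀ i, IsProbabilityMeasure (μ i)]
    {S : Set (∀ i, X i)} (hS : MeasurableSet S) {ε : ENNReal} (i : ι)
    (h : ∀ ω, μ i {x | Function.update ω i x ∈ S} ≤ ε) : Measure.pi μ S ≤ ε := by
  obtain ⟨x⟩ : Nonempty (∀ i, X i) :=
    ⟨fun i => (nonempty_of_isProbabilityMeasure (μ i)).some⟩
  have hm : Measurable (S.indicator (fun _ => (1 : ENNReal))) := measurable_const.indicator hS
  rw [← lintegral_indicator_one hS, lintegral_eq_lmarginal_univ x]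
  change (∫⋯∫⁻_Finset.univ, S.indicator (fun _ => (1 : ENNReal)) ∂μ) x ≤ ε
  rw [lmarginal_erase' _ hm (Finset.mem_univ i)]
  have hle : (fun ω => ∫⁻ y, S.indicator (fun _ => (1 : ENNReal)) (Function.update ω i y) ∂μ i) ≤
      fun _ => ε := fun ω => by
    have e : ∫⁻ y, S.indicator (fun _ => (1 : ENNReal)) (Function.update ω i y) ∂μ i =
        μ i {y | Function.update ω i y ∈ S} :=
      Eq.trans (by rfl) (lintegral_indicator_one (μ := μ i) ((measurable_update (a := i) ω) hS))
    exact e.trans_le (h ω)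
  refine (lmarginal_mono hle x).trans ?_
  simp [lmarginal]

lemma measure_prod_le_of_right {α β : Type*} [MeasurableSpace α] [MeasurableSpace β] {μ : Measure α}
    {ν : Measure β} [IsProbabilityMeasure μ] [IsProbabilityMeasure ν] {S : Set (α × β)}
    (hS : MeasurableSet S) {ε : ENNReal} (h : ∀ x, ν (Prod.mk x ⁻¹' S) ≤ ε) : μ.prod ν S ≤ ε := by
  rw [Measure.prod_apply hS]
  exact (lintegral_mono h).trans (by simp)

lemma measure_prod_le_of_left {α β : Type*} [MeasurableSpace α] [MeasurableSpace β] {μ : Measure α}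
    {ν : Measure β} [IsProbabilityMeasure μ] [IsProbabilityMeasure ν] {S : Set (α × β)}
    (hS : MeasurableSet S) {ε : ENNReal} (h : ∀ y, μ ((fun x => (x, y)) ⁻¹' S) ≤ ε) :
    μ.prod ν S ≤ ε := by
  rw [Measure.prod_apply_symm hS]
  exact (lintegral_mono h).trans (by simp)

/-! ### Measurability of the empirical matrices -/

instance : MeasurableSpace (Mat m n) :=
  inferInstanceAs (MeasurableSpace (Fin m → Fin n → ℝ))

instance : BorelSpace (Mat m n) :=
  inferInstanceAs (BorelSpace (Fin m → Fin n → ℝ))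

lemma measurable_matrix_iff {α : Type*} [MeasurableSpace α]
    {M : α → Mat m n} : Measurable M ↔ ∀ i j, Measurable fun x => M x i j :=
  measurable_pi_iff.trans (forall_congr' fun _ => measurable_pi_iff)

lemma measurable_empMat {τ : ℝ → ℝ} (hτ : Measurable τ) (D : ℕ) :
    Measurable fun q : Mat d d × (Fin n → ℝ × Vec d) => empMat τ q.1 D q.2 := by
  refine measurable_matrix_iff.2 fun i j => ?_
  have e : (fun q : Mat d d × (Fin n → ℝ × Vec d) => empMat τ q.1 D q.2 i j) =
      fun q => (1 / (n : ℝ)) * ∑ l, (τ (q.2 l).1 * radial (d * ((q.2 l).2 ⬝ᵥ (q.1 *ᵥ (q.2 l).2)))) *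
        (√((D : ℝ) * (D + 2) / 2) *
          ((√(1 - (q.2 l).2 ⬝ᵥ (q.1 *ᵥ (q.2 l).2)))⁻¹ ^ 2 *
            (((q.2 l).2 - q.1 *ᵥ (q.2 l).2) i * ((q.2 l).2 - q.1 *ᵥ (q.2 l).2) j) -
            (1 / (D : ℝ)) * (1 - q.1) i j)) := by
    funext q
    simp only [empMat, sampleMat, sampleWeight, redMat, Matrix.smul_apply, Matrix.sum_apply,
      Matrix.sub_apply, vecMulVec_apply, smul_eq_mul]
  rw [e]
  have hx : ∀ (l : Fin n) (i : Fin d), Measurable fun q : Mat d d ×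
      (Fin n → ℝ × Vec d) => (q.2 l).2 i := fun l i =>
    (by fun_prop : Continuous fun q : Mat d d × (Fin n → ℝ × Vec d) =>
      (q.2 l).2 i).measurable
  have hQ : ∀ i j : Fin d, Measurable fun q : Mat d d × (Fin n → ℝ × Vec d) =>
      q.1 i j := fun i j => measurable_matrix_iff.1 measurable_fst i j
  have hQx : ∀ (l : Fin n) (i : Fin d), Measurable fun q : Mat d d ×
      (Fin n → ℝ × Vec d) => (q.1 *ᵥ (q.2 l).2) i := fun l i => by
    change Measurable fun q : Mat d d × (Fin n → ℝ × Vec d) =>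
      ∑ j, q.1 i j * (q.2 l).2 j
    exact Finset.measurable_sum _ fun j _ => (hQ i j).mul (hx l j)
  have hu : ∀ l : Fin n, Measurable fun q : Mat d d × (Fin n → ℝ × Vec d) =>
      (q.2 l).2 ⬝ᵥ (q.1 *ᵥ (q.2 l).2) := fun l => by
    change Measurable fun q : Mat d d × (Fin n → ℝ × Vec d) =>
      ∑ j, (q.2 l).2 j * (q.1 *ᵥ (q.2 l).2) j
    exact Finset.measurable_sum _ fun j _ => (hx l j).mul (hQx l j)
  refine (Finset.measurable_sum _ fun l _ => ?_).const_mul _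
  refine Measurable.mul (Measurable.mul ?_ ?_) (Measurable.const_mul (Measurable.sub ?_ ?_) _)
  · exact hτ.comp (measurable_fst.comp ((measurable_pi_apply l).comp measurable_snd))
  · exact continuous_radial.measurable.comp ((hu l).const_mul _)
  · exact ((measurable_const.sub (hu l)).sqrt.inv.pow_const 2).mul
      (((hx l i).sub (hQx l i)).mul ((hx l j).sub (hQx l j)))
  · exact (measurable_const.sub (hQ i j)).const_mul _

lemma isClosed_QForm (S : Mat d d) (η : ℝ) :
    IsClosed {E : Mat d d | QForm (E - S) η} := by
  simp only [QForm, Set.ofPred_forall]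
  exact isClosed_iInter fun v => isClosed_le (by fun_prop) (by fun_prop)

/-! ### Stage tolerances -/

/-- Within `η` of the target, the top eigenspace of the square is well separated and within `b`
of the expected one. -/
def SpectralTol (S N : Mat s s) (p : ℕ) (lam η b : ℝ) : Prop :=
  ∀ {d : ℕ} {W : Mat d s}, IsFrame W →
    ∀ {E : Mat d d}, Eᵀ = E → QForm (E - W * S * Wᵀ) η →
      ∀ {V : Mat d p}, IsFrame V → ∀ {eig : Fin p → ℝ},
      (∀ j, (E * E) *ᵥ (Vᵀ j) = eig j • Vᵀ j) →
      (∀ x : Vec d, Vᵀ *ᵥ x = 0 → ∀ j, x ⬝ᵥ ((E * E) *ᵥ x) ≤ eig j * (x ⬝ᵥ x)) →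
      (∀ j, lam / 2 ≤ eig j) ∧ ‖W * N * Wᵀ - V * Vᵀ‖ ≤ b ∧
        ∀ x : Vec d, Vᵀ *ᵥ x = 0 → x ⬝ᵥ ((E * E) *ᵥ x) ≤ lam / 4 * (x ⬝ᵥ x)

/-- With enough samples, the empirical matrix at any frame near the limit is near the target. -/
def BatchTol (F : Vec s → ℝ) (ρ : Measure ℝ) (k : ℕ) (P : Mat s s)
    (τ : ℝ → ℝ) (a η : ℝ) (d N : ℕ) : Prop :=
  ∀ W : Mat d s, IsFrame W →
    ∀ U : Mat d k, IsFrame U → ‖U * Uᵀ - W * P * Wᵀ‖ ≤ a →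
      (Measure.pi fun _ : Fin (N * d) => ((gaussianVec d).prod ρ).map (modelMap F W))
        {data | ¬ QForm (empMat τ (U * Uᵀ) (d - k) data - W * target F ρ τ P * Wᵀ) η} ≤
          ENNReal.ofReal (Real.exp (-d))

lemma IsStage.exists_tol {F : Vec s → ℝ} (hF : Continuous F) {ρ : Measure ℝ}
    [IsProbabilityMeasure ρ] {k' : ℕ} {P P' : Mat s s} {τ : ℝ → ℝ} {θ lam : ℝ}
    (h : IsStage F ρ k k' P P' τ θ lam) {b : ℝ} (hb : 0 < b) :
    ∃ a > 0, a ≤ b / 3 ∧ ∃ η > 0, SpectralTol (target F ρ τ P) (P' - P) (k' - k) lam η (b / 3) ∧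
      ∃ N₀ : ℕ, ∀ N ≥ N₀, ∀ᶠ d : ℕ in atTop, BatchTol F ρ k P τ a η d N := by
  obtain ⟨N, hN, hP', h1, h2⟩ := h.exists_frame
  obtain ⟨η, hη, hs⟩ := exists_spectral_tolerance (target_transpose F ρ τ h.proj.transpose) hN h.pos
    h1 h2 (by positivity : 0 < b / 3)
  obtain ⟨a, ha, N₀, hc⟩ := exists_batch_concentration hF ρ h.abs_le_one h.nonneg h.lipschitz
    h.proj.transpose h.proj.mul_self k hη
  have hN' : N * Nᵀ = P' - P := by rw [hP', add_sub_cancel_left]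
  rw [hN'] at hs
  refine ⟨min a (b / 3), by positivity, min_le_right _ _, η, hη, hs, N₀, fun N hN => ?_⟩
  filter_upwards [hc N hN] with d hd W hW U hU hUW
  exact hd W hW U hU (hUW.trans (min_le_left _ _))

lemma exists_backward_chain {T : ℕ} {R : ℕ → ℝ → ℝ → Prop}
    (h : ∀ t < T, ∀ b > 0, ∃ a > 0, R t a b) {δ : ℝ} (hδ : 0 < δ) :
    ∃ a : ℕ → ℝ, a T = δ ∧ (∀ t ≤ T, 0 < a t) ∧ ∀ t < T, R t (a t) (a (t + 1)) := by
  have h' : ∀ t b, ∃ a, t < T → 0 < b → 0 < a ∧ R t a b := fun t b => by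
    by_cases hc : t < T ∧ 0 < b
    · obtain ⟨a, h1, h2⟩ := h t hc.1 b hc.2
      exact ⟨a, fun _ _ => ⟨h1, h2⟩⟩
    · exact ⟨0, fun h1 h2 => absurd ⟨h1, h2⟩ hc⟩
  choose g hg using h'
  let r : ℕ → ℝ := fun n => Nat.rec δ (fun n x => g (T - (n + 1)) x) n
  have hr : ∀ n ≤ T, 0 < r n := by
    intro n
    induction n with
    | zero => exact fun _ => hδ
    | succ n ih => exact fun hn => (hg (T - (n + 1)) (r n) (by omega) (ih (by omega))).1
  refine ⟨fun t => r (T - t), by simp [r], fun t _ => hr _ (by omega), fun t ht => ?_⟩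
  have e : T - t = (T - (t + 1)) + 1 := by omega
  have e2 : T - (T - (t + 1) + 1) = t := by omega
  have h1 := (hg (T - (T - (t + 1) + 1)) (r (T - (t + 1))) (by omega) (hr _ (by omega))).2
  simp only [e]
  rw [e2] at h1
  change R t (g (T - (T - (t + 1) + 1)) (r (T - (t + 1)))) _
  rw [e2]
  exact h1

/-! ### Measurability of the top eigenspace -/

open Classical in
/-- The projection onto a top eigenspace of the square, at matrices within `η` of `S`. -/
def topProj (p : ℕ) (S : Mat d d) (η : ℝ) (E : Mat d d) :
    Mat d d :=
  if h : (Eᵀ = E ∧ QForm (E - S) η) ∧ ∃ V : Mat d p, IsTopEigenframe (E * E) V then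
    h.2.choose * h.2.chooseᵀ else 0

lemma topProj_spec {S E : Mat d d} {η : ℝ} (hp : p ≤ d) (hE : Eᵀ = E)
    (h : QForm (E - S) η) :
    ∃ V : Mat d p, IsTopEigenframe (E * E) V ∧ topProj p S η E = V * Vᵀ := by
  have h' : (Eᵀ = E ∧ QForm (E - S) η) ∧ ∃ V : Mat d p, IsTopEigenframe (E * E) V :=
    ⟨⟨hE, h⟩, exists_isTopEigenframe (by rw [transpose_mul, hE]) hp⟩
  exact ⟨h'.2.choose, h'.2.choose_spec, dif_pos h'⟩

/-- Top eigenframes of nearby well separated matrices are close. -/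
lemma SpectralTol.lipschitz {S N : Mat s s} {lam η b : ℝ}
    (hs : SpectralTol S N p lam η b) (hlam : 0 < lam) {W : Mat d s}
    (hW : IsFrame W) {E E' : Mat d d} (hE : Eᵀ = E) (hE' : E'ᵀ = E')
    (h : QForm (E - W * S * Wᵀ) η) (h' : QForm (E' - W * S * Wᵀ) η)
    {V V' : Mat d p} (hV : IsTopEigenframe (E * E) V)
    (hV' : IsTopEigenframe (E' * E') V') :
    ‖V * Vᵀ - V' * V'ᵀ‖ ^ 2 ≤ 2 * p * (‖E' * E' - E * E‖ / (lam / 4)) ^ 2 := by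
  obtain ⟨hVf, eig, he, htop⟩ := hV
  obtain ⟨hVf', eig', he', htop'⟩ := hV'
  obtain ⟨-, -, r3⟩ := hs hW hE h hVf he htop
  obtain ⟨r1, -, -⟩ := hs hW hE' h' hVf' he' htop'
  refine eigenframe_lipschitz (by rw [transpose_mul, hE]) hVf hVf' he he' (by positivity) r3
    fun j => ?_
  have := r1 j
  linarith

lemma SpectralTol.proj_eq {S N : Mat s s} {lam η b : ℝ}
    (hs : SpectralTol S N p lam η b) (hlam : 0 < lam) {W : Mat d s}
    (hW : IsFrame W) {E : Mat d d} (hE : Eᵀ = E)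
    (h : QForm (E - W * S * Wᵀ) η) {V V' : Mat d p}
    (hV : IsTopEigenframe (E * E) V) (hV' : IsTopEigenframe (E * E) V') : V * Vᵀ = V' * V'ᵀ := by
  have h1 := hs.lipschitz hlam hW hE hE h h hV hV'
  rw [sub_self, norm_zero, zero_div, zero_pow two_ne_zero, mul_zero] at h1
  have h2 : ‖V * Vᵀ - V' * V'ᵀ‖ = 0 := by
    have := sq_nonneg ‖V * Vᵀ - V' * V'ᵀ‖
    exact pow_eq_zero_iff two_ne_zero |>.1 (le_antisymm h1 this)
  exact sub_eq_zero.1 (norm_eq_zero.1 h2)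

lemma SpectralTol.measurable_topProj {S N : Mat s s} {lam η b : ℝ}
    (hs : SpectralTol S N p lam η b) (hlam : 0 < lam) {W : Mat d s}
    (hW : IsFrame W) (hp : p ≤ d) : Measurable (topProj (d := d) p (W * S * Wᵀ) η) := by
  classical
  set K : Set (Mat d d) := {E | Eᵀ = E} ∩ {E | QForm (E - W * S * Wᵀ) η} with hK
  have hKc : IsClosed K :=
    (isClosed_eq (by fun_prop) continuous_id).inter (isClosed_QForm _ _)
  refine measurable_matrix_iff.2 fun i j => ?_
  have e : (fun E => topProj p (W * S * Wᵀ) η E i j) =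
      K.piecewise (fun E => topProj p (W * S * Wᵀ) η E i j) (fun _ => 0) := by
    funext E
    by_cases hE : E ∈ K
    · rw [Set.piecewise_eq_of_mem _ _ _ hE]
    · rw [Set.piecewise_eq_of_notMem _ _ _ hE, topProj, dif_neg (fun h => hE h.1)]
      rfl
  rw [e]
  refine ContinuousOn.measurable_piecewise (fun E hE => ?_) continuousOn_const hKc.measurableSet
  set C := √(2 * p) / (lam / 4) with hC
  have hlip : ∀ E' ∈ K, dist (topProj p (W * S * Wᵀ) η E' i j) (topProj p (W * S * Wᵀ) η E i j) ≤
      C * ‖E * E - E' * E'‖ := by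
    intro E' hE'
    obtain ⟨V, hV, hVe⟩ := topProj_spec hp hE.1 hE.2
    obtain ⟨V', hV', hVe'⟩ := topProj_spec hp hE'.1 hE'.2
    rw [Real.dist_eq, hVe, hVe', ← Matrix.sub_apply]
    refine (abs_entry_le_frob _ i j).trans (le_of_sq_le_sq ?_ (by positivity))
    refine (hs.lipschitz hlam hW hE'.1 hE.1 hE'.2 hE.2 hV' hV).trans_eq ?_
    have e : √(2 * p) ^ 2 = 2 * p := Real.sq_sqrt (by positivity)
    calc _ = √(2 * p) ^ 2 * (‖E * E - E' * E'‖ / (lam / 4)) ^ 2 := by rw [e]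
      _ = _ := by rw [hC]; ring
  have hlim : Tendsto (fun E' : Mat d d => C * ‖E * E - E' * E'‖) (nhdsWithin E K)
      (nhds 0) := by
    have hc : Continuous fun E' : Mat d d => C * ‖E * E - E' * E'‖ := by fun_prop
    have := (hc.tendsto E).mono_left (nhdsWithin_le_nhds (s := K))
    simpa using this
  refine tendsto_iff_dist_tendsto_zero.2 (squeeze_zero' (Eventually.of_forall fun _ => dist_nonneg)
    (eventually_mem_nhdsWithin.mono hlip) hlim)

/-! ### The exact algorithm -/

/-- The stages of the limiting algorithm together with the tolerances of each stage. -/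
structure StageChain (F : Vec s → ℝ) (ρ : Measure ℝ) (T : ℕ) (σ : ℕ → ℕ)
    (Pr : ℕ → Mat s s) (τ : ℕ → ℝ → ℝ) (θ lam a η : ℕ → ℝ) : Prop where
  sigma_zero : σ 0 = 0
  proj_zero : Pr 0 = 0
  sigma_last : σ T = s
  proj_last : IsProj (σ T) (Pr T)
  pos : ∀ t ≤ T, 0 < a t
  stage : ∀ t < T, IsStage F ρ (σ t) (σ (t + 1)) (Pr t) (Pr (t + 1)) (τ t) (θ t) (lam t)
  le : ∀ t < T, a t ≤ a (t + 1) / 3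
  spectral : ∀ t < T, SpectralTol (target F ρ (τ t) (Pr t)) (Pr (t + 1) - Pr t) (σ (t + 1) - σ t)
    (lam t) (η t) (a (t + 1) / 3)

/-- The empirical matrix of stage `t` at the projection `Q`. -/
def stageMat {T : ℕ} (σ : ℕ → ℕ) (τ : ℕ → ℝ → ℝ) (ω : Fin T → Fin n → ℝ × Vec d) (t : ℕ)
    (Q : Mat d d) : Mat d d :=
  if h : t < T then empMat (τ t) Q (d - σ t) (ω ⟨t, h⟩) else 0

/-- The projections onto the successive frames of the exact algorithm. -/
def projSeq {T : ℕ} (σ : ℕ → ℕ) (τ : ℕ → ℝ → ℝ) (S : ℕ → Mat d d) (η : ℕ → ℝ)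
    (ω : Fin T → Fin n → ℝ × Vec d) : ℕ → Mat d d
  | 0 => 0
  | t + 1 => projSeq σ τ S η ω t +
      topProj (σ (t + 1) - σ t) (S t) (η t) (stageMat σ τ ω t (projSeq σ τ S η ω t))

/-- At stage `t` the empirical matrix is near its target. -/
def GoodAt {T : ℕ} (σ : ℕ → ℕ) (τ : ℕ → ℝ → ℝ) (S : ℕ → Mat d d) (η : ℕ → ℝ)
    (ω : Fin T → Fin n → ℝ × Vec d) (t : ℕ) : Prop :=
  QForm (stageMat σ τ ω t (projSeq σ τ S η ω t) - S t) (η t)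

lemma stageMat_update {T : ℕ} (σ : ℕ → ℕ) (τ : ℕ → ℝ → ℝ) (ω : Fin T → Fin n → ℝ × Vec d)
    (i : Fin T) (x : Fin n → ℝ × Vec d) {t : ℕ} (ht : t < i) (Q : Mat d d) :
    stageMat σ τ (Function.update ω i x) t Q = stageMat σ τ ω t Q := by
  have hT : t < T := ht.trans i.2
  have hne : (⟨t, hT⟩ : Fin T) ≠ i := fun h => by rw [← h] at ht; exact lt_irrefl _ ht
  rw [stageMat, stageMat, dif_pos hT, dif_pos hT, Function.update_of_ne hne]

lemma projSeq_update {T : ℕ} (σ : ℕ → ℕ) (τ : ℕ → ℝ → ℝ) (S : ℕ → Mat d d)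
    (η : ℕ → ℝ) (ω : Fin T → Fin n → ℝ × Vec d) (i : Fin T) (x : Fin n → ℝ × Vec d) :
    ∀ {t : ℕ}, t ≤ i → projSeq σ τ S η (Function.update ω i x) t = projSeq σ τ S η ω t
  | 0, _ => rfl
  | t + 1, ht => by
    rw [projSeq, projSeq, projSeq_update σ τ S η ω i x (Nat.le_of_succ_le ht),
      stageMat_update σ τ ω i x ht]

namespace StageChain

variable {F : Vec s → ℝ} {ρ : Measure ℝ} {T : ℕ} {σ : ℕ → ℕ}
  {Pr : ℕ → Mat s s} {τ : ℕ → ℝ → ℝ} {θ lam a η : ℕ → ℝ}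

lemma sigma_le (h : StageChain F ρ T σ Pr τ θ lam a η) {t : ℕ} (ht : t ≤ T) : σ t ≤ s := by
  rcases ht.lt_or_eq with ht | rfl
  · exact (h.stage t ht).proj.le
  · exact h.proj_last.le

lemma continuous (h : StageChain F ρ T σ Pr τ θ lam a η) {t : ℕ} (ht : t < T) :
    Continuous (τ t) :=
  continuous_of_lipschitz (h.stage t ht).nonneg (h.stage t ht).lipschitz

variable {W : Mat d s}

lemma measurable_stageMat (h : StageChain F ρ T σ Pr τ θ lam a η) (t : ℕ) :
    Measurable fun q : Mat d d × (Fin T → Fin n → ℝ × Vec d) =>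
      stageMat σ τ q.2 t q.1 := by
  by_cases ht : t < T
  · have e : (fun q : Mat d d × (Fin T → Fin n → ℝ × Vec d) =>
        stageMat σ τ q.2 t q.1) = (fun q : Mat d d × (Fin n → ℝ × Vec d) =>
          empMat (τ t) q.1 (d - σ t) q.2) ∘ fun q => (q.1, q.2 ⟨t, ht⟩) :=
      funext fun q => dif_pos ht
    rw [e]
    have h1 : Measurable fun q : Mat d d × (Fin T → Fin n → ℝ × Vec d) =>
        (q.1, q.2 ⟨t, ht⟩) :=
      measurable_fst.prodMk ((measurable_pi_apply (⟨t, ht⟩ : Fin T)).comp measurable_snd)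
    have h2 := measurable_empMat (d := d) (n := n) (h.continuous ht).measurable (d - σ t)
    exact h2.comp h1
  · have e : (fun q : Mat d d × (Fin T → Fin n → ℝ × Vec d) =>
        stageMat σ τ q.2 t q.1) = fun _ => 0 := funext fun q => dif_neg ht
    rw [e]
    exact measurable_const

lemma measurable_projSeq (h : StageChain F ρ T σ Pr τ θ lam a η) (hW : IsFrame W) (hd : s ≤ d) :
    ∀ t ≤ T, Measurable fun ω : Fin T → Fin n → ℝ × Vec d =>
      projSeq σ τ (fun t => W * target F ρ (τ t) (Pr t) * Wᵀ) η ω t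
  | 0, _ => measurable_const
  | t + 1, ht => by
    have ih := measurable_projSeq h hW hd t (by omega)
    have hle := h.sigma_le ht
    have h1 := (SpectralTol.measurable_topProj (h.spectral t ht) (h.stage t ht).pos hW (by omega)).comp
      ((h.measurable_stageMat t).comp (ih.prodMk measurable_id))
    have h2 : ∀ i j, Measurable fun ω : Fin T → Fin n → ℝ × Vec d =>
        projSeq σ τ (fun t => W * target F ρ (τ t) (Pr t) * Wᵀ) η ω (t + 1) i j := fun i j =>
      (measurable_matrix_iff.1 ih i j).add (measurable_matrix_iff.1 h1 i j)
    exact measurable_matrix_iff.2 h2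

lemma measurableSet_goodAt (h : StageChain F ρ T σ Pr τ θ lam a η) (hW : IsFrame W) (hd : s ≤ d)
    {t : ℕ} (ht : t ≤ T) : MeasurableSet {ω : Fin T → Fin n → ℝ × Vec d |
      GoodAt σ τ (fun t => W * target F ρ (τ t) (Pr t) * Wᵀ) η ω t} :=
  ((h.measurable_stageMat t).comp ((h.measurable_projSeq hW hd t ht).prodMk measurable_id))
    (isClosed_QForm (W * target F ρ (τ t) (Pr t) * Wᵀ) (η t)).measurableSet

lemma run_spec (h : StageChain F ρ T σ Pr τ θ lam a η) (hW : IsFrame W) (hd : s ≤ d)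
    {ω : Fin T → Fin n → ℝ × Vec d} {U : (t : ℕ) → Mat d (σ t)}
    (hU : IsUnfoldingRun (fun t => radialFeature d (τ t)) ω U) :
    ∀ t ≤ T, (∀ t' < t, GoodAt σ τ (fun t => W * target F ρ (τ t) (Pr t) * Wᵀ) η ω t') →
      IsFrame (U t) ∧ U t * (U t)ᵀ = projSeq σ τ (fun t => W * target F ρ (τ t) (Pr t) * Wᵀ) η ω t ∧
        ‖U t * (U t)ᵀ - W * Pr t * Wᵀ‖ ≤ a t
  | 0, _, _ => by
    have h0 : IsEmpty (Fin (σ 0)) := by rw [h.sigma_zero]; infer_instance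
    have hz : U 0 * (U 0)ᵀ = 0 := by
      ext i j
      rw [Matrix.mul_apply]
      exact Finset.sum_eq_zero fun k _ => h0.elim k
    refine ⟨?_, hz, ?_⟩
    · rw [IsFrame]
      ext i
      exact h0.elim i
    · rw [hz, h.proj_zero, Matrix.mul_zero, Matrix.zero_mul, sub_zero, norm_zero]
      exact (h.pos 0 (Nat.zero_le _)).le
  | t + 1, ht, hg => by
    obtain ⟨hf, hp, hn⟩ := h.run_spec hW hd hU t (by omega) fun t' ht' => hg t' (by omega)
    have hst := h.stage t ht
    obtain ⟨V, hV, hf', hp'⟩ := unfoldingStep_spec hst.lt.le hf (hU ⟨t, ht⟩)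
    have hE : stageMat σ τ ω t
        (projSeq σ τ (fun t => W * target F ρ (τ t) (Pr t) * Wᵀ) η ω t) =
        empMat (τ t) (U t * (U t)ᵀ) (d - σ t) (ω ⟨t, ht⟩) := by
      rw [stageMat, dif_pos (show t < T from ht), hp]
    have hgt := hg t (by omega)
    rw [GoodAt, hE] at hgt
    have hEt := empMat_transpose (d := d) (D := d - σ t) (data := ω ⟨t, ht⟩) (τ t)
      (proj_transpose (U t))
    obtain ⟨V', hV', hpV'⟩ := topProj_spec (p := σ (t + 1) - σ t)
      (by have := h.sigma_le ht; omega) hEt hgt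
    refine ⟨hf', ?_, ?_⟩
    · rw [hp', projSeq, hE, hpV', hp,
        SpectralTol.proj_eq (h.spectral t ht) hst.pos hW hEt hgt hV hV']
    · obtain ⟨hVf, eig, he, htop⟩ := hV
      obtain ⟨-, h2, -⟩ := h.spectral t ht hW hEt hgt hVf he htop
      have e : U (t + 1) * (U (t + 1))ᵀ - W * Pr (t + 1) * Wᵀ = (U t * (U t)ᵀ - W * Pr t * Wᵀ) -
          (W * (Pr (t + 1) - Pr t) * Wᵀ - V * Vᵀ) := by
        rw [hp', Matrix.mul_sub, Matrix.sub_mul]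
        abel
      rw [e]
      have h3 := h.le t ht
      have h4 := h.pos (t + 1) ht
      refine (norm_sub_le _ _).trans ?_
      linarith

lemma measure_not_goodAt_le [IsProbabilityMeasure ρ] (h : StageChain F ρ T σ Pr τ θ lam a η)
    (hF : Continuous F) (hW : IsFrame W) (hd : s ≤ d) {N : ℕ}
    (hB : ∀ t < T, BatchTol F ρ (σ t) (Pr t) (τ t) (a t) (η t) d N) :
    dataLaw T (N * d) (((gaussianVec d).prod ρ).map (modelMap F W))
      {ω | ¬ ∀ t < T, GoodAt σ τ (fun t => W * target F ρ (τ t) (Pr t) * Wᵀ) η ω t} ≤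
        T * ENNReal.ofReal (Real.exp (-d)) := by
  classical
  have hm : IsProbabilityMeasure (((gaussianVec d).prod ρ).map (modelMap F W)) :=
    Measure.isProbabilityMeasure_map (measurable_modelMap hF.measurable W).aemeasurable
  set G : ℕ → Set (Fin T → Fin (N * d) → ℝ × Vec d) := fun t =>
    {ω | GoodAt σ τ (fun t => W * target F ρ (τ t) (Pr t) * Wᵀ) η ω t} with hG
  have hsub : {ω | ¬ ∀ t < T, ω ∈ G t} ⊆ ⋃ i : Fin T, (⋂ t : Fin i, G t) ∩ (G i)ᶜ := by
    intro ω hω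
    have hex : ∃ t, t < T ∧ ω ∉ G t := by
      by_contra hc
      exact hω fun t ht => by_contra fun hn => hc ⟨t, ht, hn⟩
    refine Set.mem_iUnion.2 ⟨⟨Nat.find hex, (Nat.find_spec hex).1⟩, Set.mem_iInter.2 fun t => ?_,
      (Nat.find_spec hex).2⟩
    by_contra hn
    exact Nat.find_min hex t.2 ⟨t.2.trans (Nat.find_spec hex).1, hn⟩
  have hone : ∀ i : Fin T, dataLaw T (N * d) (((gaussianVec d).prod ρ).map (modelMap F W))
      ((⋂ t : Fin i, G t) ∩ (G i)ᶜ) ≤ ENNReal.ofReal (Real.exp (-d)) := by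
    intro i
    refine measure_pi_le_of_update _ ((MeasurableSet.iInter fun t =>
      h.measurableSet_goodAt hW hd (t.2.trans i.2).le).inter
        (h.measurableSet_goodAt hW hd i.2.le).compl) i fun ω => ?_
    by_cases hω : ∀ t < i.1, ω ∈ G t
    · obtain ⟨U, hU⟩ := exists_unfoldingRun (T := T) h.sigma_zero
        (fun t ht => (h.stage t ht).lt.le) (fun t ht => (h.sigma_le ht).trans hd) τ ω
      obtain ⟨hf, hp, hn⟩ := h.run_spec hW hd hU i i.2.le hω
      refine (measure_mono fun x hx => ?_).trans (hB i i.2 W hW (U i) hf hn)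
      have hx2 : ¬ GoodAt σ τ (fun t => W * target F ρ (τ t) (Pr t) * Wᵀ) η
        (Function.update ω i x) i := hx.2
      rw [GoodAt, projSeq_update σ τ _ η ω i x le_rfl, stageMat, dif_pos i.2,
        Function.update_self, ← hp] at hx2
      exact hx2
    · refine le_trans (le_of_eq ?_) zero_le
      refine measure_mono_null (fun x hx => ?_) measure_empty
      refine hω fun t ht => ?_
      have hx1 : GoodAt σ τ (fun t => W * target F ρ (τ t) (Pr t) * Wᵀ) η
        (Function.update ω i x) t := Set.mem_iInter.1 hx.1 ⟨t, ht⟩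
      rw [GoodAt, projSeq_update σ τ _ η ω i x ht.le, stageMat_update σ τ ω i x ht] at hx1
      exact hx1
  refine (measure_mono hsub).trans ((measure_iUnion_le _).trans ?_)
  rw [tsum_fintype]
  refine (Finset.sum_le_sum fun i _ => hone i).trans ?_
  simp

lemma run_frameDist_le (h : StageChain F ρ T σ Pr τ θ lam a η) (hW : IsFrame W) (hd : s ≤ d)
    {ω : Fin T → Fin n → ℝ × Vec d}
    (hg : ∀ t < T, GoodAt σ τ (fun t => W * target F ρ (τ t) (Pr t) * Wᵀ) η ω t)
    {U : (t : ℕ) → Mat d (σ t)}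
    (hU : IsUnfoldingRun (fun t => radialFeature d (τ t)) ω U) : frameDist (U T) W ≤ a T := by
  have h1 := (h.run_spec hW hd hU T le_rfl hg).2.2
  have h2 : Pr T = 1 := by
    have := h.proj_last
    rw [h.sigma_last] at this
    exact this.eq_one
  rw [h2, Matrix.mul_one] at h1
  exact (frameDist_le _ _).trans h1

/-- Outside an event of small probability the exact algorithm can be run, and all its outputs are
close to the truth. -/
lemma measure_run_le [IsProbabilityMeasure ρ] (h : StageChain F ρ T σ Pr τ θ lam a η)
    (hF : Continuous F) (hW : IsFrame W) (hd : s ≤ d) {N : ℕ}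
    (hB : ∀ t < T, BatchTol F ρ (σ t) (Pr t) (τ t) (a t) (η t) d N) :
    dataLaw T (N * d) (((gaussianVec d).prod ρ).map (modelMap F W))
      {ω | ¬ ((∃ U : (t : ℕ) → Mat d (σ t),
          IsUnfoldingRun (fun t => radialFeature d (τ t)) ω U) ∧
        ∀ U : (t : ℕ) → Mat d (σ t),
          IsUnfoldingRun (fun t => radialFeature d (τ t)) ω U → frameDist (U T) W ≤ a T)} ≤
        T * ENNReal.ofReal (Real.exp (-d)) := by
  refine le_trans (measure_mono ?_) (h.measure_not_goodAt_le hF hW hd hB)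
  refine fun ω (hω : ¬ _) (hg : ∀ t < T, _) => hω ⟨?_, fun U hU => ?_⟩
  · exact exists_unfoldingRun h.sigma_zero (fun t ht => (h.stage t ht).lt.le)
      (fun t ht => (h.sigma_le ht).trans hd) τ ω
  · exact h.run_frameDist_le hW hd hg hU

end StageChain

/-- The limiting stages can be equipped with tolerances that end at any prescribed accuracy. -/
lemma exists_stageChain {f : MvPolynomial (Fin s) ℝ} (ρ : Measure ℝ)
    [IsProbabilityMeasure ρ] (hf : DependsOnAll f) {δ : ℝ} (hδ : 0 < δ) :
    ∃ (T : ℕ) (σ : ℕ → ℕ) (Pr : ℕ → Mat s s) (τ : ℕ → ℝ → ℝ)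
      (θ lam a η : ℕ → ℝ) (N : ℕ), T ≤ s ∧ 0 < N ∧ a T = δ ∧
      StageChain (fun x => MvPolynomial.eval x f) ρ T σ Pr τ θ lam a η ∧
      ∀ᶠ d : ℕ in atTop, ∀ t < T,
        BatchTol (fun x => MvPolynomial.eval x f) ρ (σ t) (Pr t) (τ t) (a t) (η t) d N := by
  obtain ⟨T, σ, Pr, τ, θ, lam, hT, hσ0, hPr0, hσT, hPT, hst⟩ :=
    exists_stages_from ρ hf s (isProj_zero s) (by omega)
  have hF : Continuous fun x => MvPolynomial.eval x f := MvPolynomial.continuous_eval f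
  obtain ⟨a, haT, ha, hR⟩ := exists_backward_chain (T := T) (R := fun t a b => a ≤ b / 3 ∧ ∃ η > 0,
    SpectralTol (target (fun x => MvPolynomial.eval x f) ρ (τ t) (Pr t)) (Pr (t + 1) - Pr t)
      (σ (t + 1) - σ t) (lam t) η (b / 3) ∧ ∃ N₀ : ℕ, ∀ N ≥ N₀, ∀ᶠ d : ℕ in atTop,
        BatchTol (fun x => MvPolynomial.eval x f) ρ (σ t) (Pr t) (τ t) a η d N)
    (fun t ht b hb => (hst t ht).exists_tol hF hb) hδ
  have hR' : ∀ t, ∃ (η : ℝ) (N₀ : ℕ), t < T →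
      SpectralTol (target (fun x => MvPolynomial.eval x f) ρ (τ t) (Pr t)) (Pr (t + 1) - Pr t)
        (σ (t + 1) - σ t) (lam t) η (a (t + 1) / 3) ∧ ∀ N ≥ N₀, ∀ᶠ d : ℕ in atTop,
        BatchTol (fun x => MvPolynomial.eval x f) ρ (σ t) (Pr t) (τ t) (a t) η d N := fun t => by
    by_cases ht : t < T
    · obtain ⟨-, η, -, h1, N₀, h2⟩ := hR t ht
      exact ⟨η, N₀, fun _ => ⟨h1, h2⟩⟩
    · exact ⟨0, 0, fun h => absurd h ht⟩
  choose η N₀ hη using hR'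
  refine ⟨T, σ, Pr, τ, θ, lam, a, η, ∑ t ∈ Finset.range T, N₀ t + 1, hT, Nat.succ_pos _, haT,
    ⟨hσ0, hPr0, hσT, hPT, ha, hst, fun t ht => (hR t ht).1, fun t ht => (hη t ht).1⟩, ?_⟩
  have h1 : ∀ t ∈ Finset.range T, ∀ᶠ d : ℕ in atTop, BatchTol (fun x => MvPolynomial.eval x f) ρ
      (σ t) (Pr t) (τ t) (a t) (η t) d (∑ t ∈ Finset.range T, N₀ t + 1) := fun t ht =>
    (hη t (Finset.mem_range.1 ht)).2 _
      ((Finset.single_le_sum (fun _ _ => Nat.zero_le _) ht).trans (Nat.le_succ _))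
  filter_upwards [(Finset.eventually_all _).2 h1] with d hd t ht
  exact hd t (Finset.mem_range.2 ht)

/-! ### Subspace power iteration -/

namespace Timed

lemma projectOut_val (Q : Fin k → Vec d) (v : Vec d) :
    (projectOut Q v).val = v - ∑ j, (Q j ⬝ᵥ v) • Q j := by
  ext i
  rw [Pi.sub_apply, Finset.sum_apply]
  rfl

lemma normalize_val (v : Vec d) : (normalize v).val = direction v := by
  ext i
  rw [direction, nrm_eq_sqrt, Pi.smul_apply, smul_eq_mul, inv_mul_eq_div]
  rfl

lemma gramSchmidt_val_succ (X : Fin (p + 1) → Vec d) : (gramSchmidt (p + 1) X).val =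
    Fin.snoc (gramSchmidt p fun j => X j.castSucc).val (direction (X (Fin.last p) -
      ∑ j, ((gramSchmidt p fun j => X j.castSucc).val j ⬝ᵥ X (Fin.last p)) •
        (gramSchmidt p fun j => X j.castSucc).val j)) := by
  rw [← projectOut_val, ← normalize_val]
  rfl

end Timed

lemma direction_dot_self {v : Vec d} (h : v ≠ 0) : direction v ⬝ᵥ direction v = 1 := by
  rw [dot_self_eq_nrm_sq, nrm_direction h, one_pow]

/-- On independent vectors, Gram–Schmidt produces a frame in their span. -/
lemma gramSchmidt_spec : ∀ (p : ℕ) (X : Fin p → Vec d), LinearIndependent ℝ X →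
    IsFrame (Matrix.of (Timed.gramSchmidt p X).val)ᵀ ∧
      ∀ j, (Timed.gramSchmidt p X).val j ∈ Submodule.span ℝ (Set.range X)
  | 0, X, _ => ⟨isFrame_iff.2 fun i => i.elim0, fun j => j.elim0⟩
  | p + 1, X, hX => by
    obtain ⟨hX1, hX2⟩ := linearIndependent_finSucc'.1 hX
    obtain ⟨ihf, ihs⟩ := gramSchmidt_spec p (fun j => X j.castSucc) hX1
    rw [Timed.gramSchmidt_val_succ]
    set Q := (Timed.gramSchmidt p fun j => X j.castSucc).val with hQ
    have hQo : ∀ i j, Q i ⬝ᵥ Q j = if i = j then 1 else 0 := fun i j => isFrame_iff.1 ihf i j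
    set w := X (Fin.last p) - ∑ j, (Q j ⬝ᵥ X (Fin.last p)) • Q j with hw
    have hsum : ∑ j, (Q j ⬝ᵥ X (Fin.last p)) • Q j ∈
        Submodule.span ℝ (Set.range fun j : Fin p => X j.castSucc) :=
      Submodule.sum_mem _ fun j _ => Submodule.smul_mem _ _ (ihs j)
    have hw0 : w ≠ 0 := fun h => hX2 (by
      have : X (Fin.last p) = ∑ j, (Q j ⬝ᵥ X (Fin.last p)) • Q j := sub_eq_zero.1 h
      rw [this]
      exact hsum)
    have hQw : ∀ i, Q i ⬝ᵥ w = 0 := fun i => by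
      rw [hw, dotProduct_sub, dotProduct_sum]
      simp [hQo]
    have hQu : ∀ i, Q i ⬝ᵥ direction w = 0 := fun i => by
      rw [direction, dotProduct_smul, hQw, smul_zero]
    have hle : Submodule.span ℝ (Set.range fun j : Fin p => X j.castSucc) ≤
        Submodule.span ℝ (Set.range X) :=
      Submodule.span_mono (by rintro _ ⟨j, rfl⟩; exact ⟨_, rfl⟩)
    refine ⟨isFrame_iff.2 fun i j => ?_, fun j => ?_⟩
    · change (Fin.snoc (α := fun _ => Vec d) Q (direction w) i : Vec d) ⬝ᵥ
        (Fin.snoc (α := fun _ => Vec d) Q (direction w) j : Vec d) = _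
      induction i using Fin.lastCases with
      | last =>
        induction j using Fin.lastCases with
        | last => rw [Fin.snoc_last, direction_dot_self hw0, if_pos rfl]
        | cast j =>
          rw [Fin.snoc_last, Fin.snoc_castSucc, dotProduct_comm, hQu,
            if_neg (Fin.castSucc_lt_last j).ne']
      | cast i =>
        induction j using Fin.lastCases with
        | last => rw [Fin.snoc_last, Fin.snoc_castSucc, hQu, if_neg (Fin.castSucc_lt_last i).ne]
        | cast j => simp only [Fin.snoc_castSucc, hQo, Fin.castSucc_inj]
    · induction j using Fin.lastCases with
      | last =>
        rw [Fin.snoc_last]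
        exact Submodule.smul_mem _ _ (Submodule.sub_mem _ (Submodule.subset_span ⟨_, rfl⟩)
          (hle hsum))
      | cast j =>
        rw [Fin.snoc_castSucc]
        exact hle (ihs j)

lemma IsFrame.linearIndependent {X : Fin p → Vec d} (hX : IsFrame (Matrix.of X)ᵀ) :
    LinearIndependent ℝ X := by
  rw [Fintype.linearIndependent_iff]
  intro c hc j
  have h1 : X j ⬝ᵥ ∑ i, c i • X i = c j := by
    have h : ∀ i, X j ⬝ᵥ X i = if j = i then 1 else 0 := fun i => isFrame_iff.1 hX j i
    rw [dotProduct_sum]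
    simp [h]
  rw [← h1, hc, dotProduct_zero]

/-- Subspace iteration keeps an orthonormal system in the iterated image of the initial span. -/
lemma iterate_spec {M : Mat d d} {X₀ : Fin p → Vec d}
    (hX : LinearIndependent ℝ X₀)
    (hinj : ∀ (q : ℕ), ∀ y ∈ Submodule.span ℝ (Set.range X₀), (M ^ q) *ᵥ y = 0 → y = 0)
    {g : (Fin p → Vec d) → Timed (Fin p → Vec d)}
    (hg : ∀ X, (g X).val = (Timed.gramSchmidt p fun j => M *ᵥ X j).val) : ∀ q : ℕ,
    IsFrame (Matrix.of (Timed.iterate g q (Timed.gramSchmidt p X₀).val).val)ᵀ ∧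
      ∀ j, ∃ y ∈ Submodule.span ℝ (Set.range X₀),
        (Timed.iterate g q (Timed.gramSchmidt p X₀).val).val j = (M ^ q) *ᵥ y
  | 0 => by
    obtain ⟨h1, h2⟩ := gramSchmidt_spec p X₀ hX
    refine ⟨h1, fun j => ⟨_, h2 j, ?_⟩⟩
    rw [pow_zero, one_mulVec]
    rfl
  | q + 1 => by
    obtain ⟨h1, h2⟩ := iterate_spec hX hinj hg q
    set X := (Timed.iterate g q (Timed.gramSchmidt p X₀).val).val with hXdef
    have hval : (Timed.iterate g (q + 1) (Timed.gramSchmidt p X₀).val).val =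
        (Timed.gramSchmidt p fun j => M *ᵥ X j).val := hg X
    have hspan : ∀ x ∈ Submodule.span ℝ (Set.range X),
        ∃ y ∈ Submodule.span ℝ (Set.range X₀), x = (M ^ q) *ᵥ y := by
      intro x hx
      have hle : Submodule.span ℝ (Set.range X) ≤
          (Submodule.span ℝ (Set.range X₀)).map (M ^ q).mulVecLin := by
        rw [Submodule.span_le]
        rintro _ ⟨j, rfl⟩
        obtain ⟨y, hy, hj⟩ := h2 j
        exact ⟨y, hy, hj.symm⟩
      obtain ⟨y, hy, rfl⟩ := hle hx
      exact ⟨y, hy, rfl⟩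
    have hMs : ∀ y : Vec d, M *ᵥ ((M ^ q) *ᵥ y) = (M ^ (q + 1)) *ᵥ y := fun y => by
      rw [mulVec_mulVec, pow_succ']
    have hind : LinearIndependent ℝ fun j => M *ᵥ X j := by
      have hli := Fintype.linearIndependent_iff.1 h1.linearIndependent
      rw [Fintype.linearIndependent_iff]
      intro c hc
      refine hli c ?_
      obtain ⟨y, hy, hxy⟩ := hspan (∑ j, c j • X j) (Submodule.sum_mem _ fun j _ =>
        Submodule.smul_mem _ _ (Submodule.subset_span ⟨j, rfl⟩))
      have h3 : M *ᵥ (∑ j, c j • X j) = 0 := by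
        rw [← hc, mulVec_sum]
        exact Finset.sum_congr rfl fun j _ => mulVec_smul _ _ _
      rw [hxy, hMs] at h3
      rw [hxy, hinj _ y hy h3, mulVec_zero]
    obtain ⟨h3, h4⟩ := gramSchmidt_spec p _ hind
    rw [hval]
    refine ⟨h3, fun j => ?_⟩
    have hle : Submodule.span ℝ (Set.range fun j => M *ᵥ X j) ≤
        (Submodule.span ℝ (Set.range X₀)).map (M ^ (q + 1)).mulVecLin := by
      rw [Submodule.span_le]
      rintro _ ⟨j, rfl⟩
      obtain ⟨y, hy, hj⟩ := h2 j
      refine ⟨y, hy, ?_⟩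
      change (M ^ (q + 1)) *ᵥ y = M *ᵥ X j
      rw [hj, hMs]
    obtain ⟨y, hy, hj⟩ := hle (h4 j)
    exact ⟨y, hy, hj.symm⟩

/-- Powers of a matrix with a spectral gap amplify the top eigenspace. -/
lemma pow_mulVec_bounds {E : Mat d d} (hE : Eᵀ = E)
    {V : Mat d p} (hV : IsFrame V) {eig : Fin p → ℝ}
    (he : ∀ j, (E * E) *ᵥ (Vᵀ j) = eig j • Vᵀ j) {lam : ℝ} (hlam : 0 < lam)
    (h1 : ∀ j, lam / 2 ≤ eig j)
    (h2 : ∀ x : Vec d, Vᵀ *ᵥ x = 0 → x ⬝ᵥ ((E * E) *ᵥ x) ≤ lam / 4 * (x ⬝ᵥ x)) (y : Vec d) (q : ℕ) :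
    (lam / 2) ^ q * nrm (Vᵀ *ᵥ y) ≤ nrm (Vᵀ *ᵥ (((E * E) ^ q) *ᵥ y)) ∧
      nrm (((E * E) ^ q) *ᵥ y - (V * Vᵀ) *ᵥ (((E * E) ^ q) *ᵥ y)) ≤
        (lam / 4) ^ q * nrm (y - (V * Vᵀ) *ᵥ y) := by
  obtain ⟨M, hM⟩ : ∃ M, M = E * E := ⟨_, rfl⟩
  rw [← hM] at he h2 ⊢
  have hMt : Mᵀ = M := by rw [hM, transpose_mul, hE]
  have hVV : Vᵀ * V = 1 := hV
  have hMV : M * V = V * Matrix.diagonal eig := by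
    ext i j
    rw [Matrix.mul_diagonal]
    exact (congrFun (he j) i).trans (mul_comm _ _)
  have hcomm : M * (V * Vᵀ) = (V * Vᵀ) * M := by
    have h : M * (V * Vᵀ) = V * Matrix.diagonal eig * Vᵀ := by rw [← Matrix.mul_assoc, hMV]
    have h' := congrArg Matrix.transpose h
    rw [transpose_mul, hMt, proj_transpose, transpose_mul, transpose_mul, transpose_transpose,
      Matrix.diagonal_transpose, ← Matrix.mul_assoc] at h'
    rw [h, h']
  have hperp : ∀ x : Vec d, Vᵀ *ᵥ (x - (V * Vᵀ) *ᵥ x) = 0 := fun x => by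
    rw [mulVec_sub, mulVec_mulVec, ← Matrix.mul_assoc, hVV, Matrix.one_mul, sub_self]
  have hup : ∀ x : Vec d, Vᵀ *ᵥ x = 0 → nrm (M *ᵥ x) ≤ lam / 4 * nrm x := by
    intro x hx
    have hB : (M * (1 - V * Vᵀ))ᵀ = M * (1 - V * Vᵀ) := by
      rw [transpose_mul, transpose_sub, transpose_one, proj_transpose, hMt, Matrix.sub_mul,
        Matrix.mul_sub, hcomm, Matrix.one_mul, Matrix.mul_one]
    have hx' : ∀ v : Vec d, (M * (1 - V * Vᵀ)) *ᵥ v = M *ᵥ (v - (V * Vᵀ) *ᵥ v) := fun v => by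
      rw [← mulVec_mulVec, sub_mulVec, one_mulVec]
    have hQ : QForm (M * (1 - V * Vᵀ)) (lam / 4) := by
      intro v
      set v' := v - (V * Vᵀ) *ᵥ v with hv'
      have e : v ⬝ᵥ (M *ᵥ v') = v' ⬝ᵥ (M *ᵥ v') := by
        have h3 : ((V * Vᵀ) *ᵥ v) ⬝ᵥ (M *ᵥ v') = 0 := by
          rw [dotProduct_comm, mulVec_dot, proj_transpose, mulVec_mulVec, ← hcomm,
            ← mulVec_mulVec, ← mulVec_mulVec, hperp v, mulVec_zero,
            mulVec_zero, zero_dotProduct]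
        have h4 : v = v' + (V * Vᵀ) *ᵥ v := by rw [hv']; abel
        conv_lhs => rw [h4]
        rw [add_dotProduct, h3, add_zero]
      have hpos : 0 ≤ v' ⬝ᵥ (M *ᵥ v') := by
        rw [hM, ← mulVec_mulVec, mulVec_dot, hE]
        exact dot_self_nonneg _
      rw [hx', e, abs_of_nonneg hpos]
      refine (h2 v' (hperp v)).trans (mul_le_mul_of_nonneg_left ?_ (by positivity))
      rw [dot_self_eq_nrm_sq, dot_self_eq_nrm_sq]
      exact pow_le_pow_left₀ (nrm_nonneg _)
        (nrm_sub_proj_le (proj_transpose V) (proj_mul_self hV) v) 2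
    have h3 := QForm.nrm_mulVec_le hB hQ x
    rwa [hx', ← mulVec_mulVec x, hx, mulVec_zero, sub_zero] at h3
  have hlow : ∀ x : Vec d, lam / 2 * nrm (Vᵀ *ᵥ x) ≤ nrm (Vᵀ *ᵥ (M *ᵥ x)) := by
    intro x
    have hc : ∀ j, (Vᵀ *ᵥ (M *ᵥ x)) j = eig j * (Vᵀ *ᵥ x) j := by
      intro j
      have h3 : Vᵀ j ⬝ᵥ (M *ᵥ x) = eig j * (Vᵀ j ⬝ᵥ x) := by
        refine (mulVec_dot M (Vᵀ j) x).trans ?_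
        have h4 : Mᵀ *ᵥ (Vᵀ j) = eig j • Vᵀ j := hMt.symm ▸ he j
        refine (congrArg (· ⬝ᵥ x) h4).trans ?_
        exact smul_dotProduct _ _ _
      exact h3
    refine le_of_sq_le_sq ?_ (nrm_nonneg _)
    rw [mul_pow, ← dot_self_eq_nrm_sq, ← dot_self_eq_nrm_sq, dotProduct, dotProduct, Finset.mul_sum]
    refine Finset.sum_le_sum fun j _ => ?_
    rw [hc]
    have h3 : (lam / 2) ^ 2 ≤ eig j ^ 2 := pow_le_pow_left₀ (by positivity) (h1 j) 2
    nlinarith [mul_self_nonneg ((Vᵀ *ᵥ x) j)]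
  induction q with
  | zero => simp
  | succ q ih =>
    have hs : (M ^ (q + 1)) *ᵥ y = M *ᵥ ((M ^ q) *ᵥ y) := by
      rw [mulVec_mulVec, pow_succ']
    refine ⟨?_, ?_⟩
    · rw [hs]
      refine le_trans ?_ (hlow _)
      rw [pow_succ', mul_assoc]
      exact mul_le_mul_of_nonneg_left ih.1 (by positivity)
    · have e : (M ^ (q + 1)) *ᵥ y - (V * Vᵀ) *ᵥ ((M ^ (q + 1)) *ᵥ y) =
          M *ᵥ ((M ^ q) *ᵥ y - (V * Vᵀ) *ᵥ ((M ^ q) *ᵥ y)) := by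
        rw [hs, mulVec_sub, mulVec_mulVec _ M (V * Vᵀ), hcomm]
        congr 1
        exact mulVec_mulVec _ _ _
      rw [e]
      refine (hup _ (hperp _)).trans ?_
      rw [pow_succ', mul_assoc]
      exact mul_le_mul_of_nonneg_left ih.2 (by positivity)

/-! ### One implemented step -/

/-- The matrix applied by the implementation. -/
def iterMat (D : ℕ) (w : Fin n → ℝ) (z : Fin n → Vec d) : Mat d d :=
  (√((D : ℝ) * (D + 2) / 2) / n) •
    (∑ i, w i • vecMulVec (z i) (z i) - ((∑ i, w i) / D) • (1 : Mat d d))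

lemma iterMat_mulVec (D : ℕ) (w : Fin n → ℝ) (z : Fin n → Vec d) (v : Vec d) :
    iterMat D w z *ᵥ v = (√((D : ℝ) * (D + 2) / 2) / n) •
      (∑ i, (w i * (z i ⬝ᵥ v)) • z i - ((∑ i, w i) / D) • v) := by
  have h : ∀ i, (w i • vecMulVec (z i) (z i)) *ᵥ v = (w i * (z i ⬝ᵥ v)) • z i := fun i => by
    rw [smul_mulVec, vecMulVec_mulVec, op_smul_eq_smul, smul_smul]
  rw [iterMat, smul_mulVec, sub_mulVec, sum_mulVec, smul_mulVec,
    one_mulVec]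
  simp only [h]

lemma applyS_val (D : ℕ) (w : Fin n → ℝ) (z : Fin n → Vec d) (v : Vec d) :
    (Timed.applyS D w z v).val = iterMat D w z *ᵥ v := by
  rw [iterMat_mulVec]
  ext l
  rw [Pi.smul_apply, Pi.sub_apply, Pi.smul_apply, Finset.sum_apply]
  rfl

lemma applyM_val (D : ℕ) (w : Fin 1 → Fin n → ℝ) (z : Fin n → Vec d) (v : Vec d) :
    (Timed.applyM D w z v).val = (iterMat D (w 0) z * iterMat D (w 0) z) *ᵥ v := by
  rw [← mulVec_mulVec, ← applyS_val, ← applyS_val]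
  ext l
  change ∑ a : Fin 1, (Timed.applyS D (w a) z (Timed.applyS D (w a) z v).val).val l = _
  rw [Fin.sum_univ_one]

/-- On the complement of the current frame, the implementation applies the empirical matrix. -/
lemma iterMat_mulVec_eq (τ : ℝ → ℝ) {U : Mat d k} (hU : IsFrame U)
    {data : Fin n → ℝ × Vec d} (hz : ∀ i, nrm (data i).2 = 1 ∨ (data i).2 = 0) {v : Vec d}
    (hv : (U * Uᵀ) *ᵥ v = 0) :
    iterMat (d - k) (fun i => sampleWeight τ (U * Uᵀ) (data i))
      (fun i => direction ((data i).2 - (U * Uᵀ) *ᵥ (data i).2)) *ᵥ v =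
        empMat τ (U * Uᵀ) (d - k) data *ᵥ v := by
  obtain ⟨Q, hQ⟩ : ∃ Q, Q = U * Uᵀ := ⟨_, rfl⟩
  have hQt : Qᵀ = Q := hQ ▸ proj_transpose U
  have hQQ : Q * Q = Q := hQ ▸ proj_mul_self hU
  rw [← hQ] at hv ⊢
  have hdir : ∀ i, direction ((data i).2 - Q *ᵥ (data i).2) =
      (√(1 - (data i).2 ⬝ᵥ (Q *ᵥ (data i).2)))⁻¹ • ((data i).2 - Q *ᵥ (data i).2) := by
    intro i
    rcases hz i with h | h
    · have h1 := nrm_sub_proj_sq hQt hQQ (data i).2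
      rw [h, one_pow] at h1
      rw [direction, ← h1, Real.sqrt_sq (nrm_nonneg _)]
    · rw [h, mulVec_zero, sub_zero, direction, smul_zero, smul_zero]
  have hS : ∀ i, sampleMat τ Q (d - k) (data i) *ᵥ v =
      √(((d - k : ℕ) : ℝ) * ((d - k : ℕ) + 2) / 2) • ((sampleWeight τ Q (data i) *
        (direction ((data i).2 - Q *ᵥ (data i).2) ⬝ᵥ v)) •
          direction ((data i).2 - Q *ᵥ (data i).2) -
            (sampleWeight τ Q (data i) / ((d - k : ℕ) : ℝ)) • v) := by
    intro i
    rw [hdir, sampleMat, redMat, smul_mulVec, smul_mulVec, sub_mulVec,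
      smul_mulVec, smul_mulVec, vecMulVec_mulVec, op_smul_eq_smul, sub_mulVec,
      one_mulVec, hv, sub_zero, smul_dotProduct]
    ext l
    simp only [Pi.smul_apply, Pi.sub_apply, smul_eq_mul]
    ring
  rw [iterMat_mulVec, empMat, smul_mulVec, sum_mulVec]
  simp only [hS]
  rw [← Finset.smul_sum, Finset.sum_sub_distrib, ← Finset.sum_smul, ← Finset.sum_div, smul_smul]
  congr 1
  ring

lemma proj_empMat (τ : ℝ → ℝ) {U : Mat d k} (hU : IsFrame U)
    (data : Fin n → ℝ × Vec d) (v : Vec d) :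
    (U * Uᵀ) *ᵥ (empMat τ (U * Uᵀ) (d - k) data *ᵥ v) = 0 := by
  obtain ⟨Up, hUp⟩ := exists_isComplement hU
  obtain ⟨h, -, -, hE⟩ := empiricalMatrix_radialFeature τ hU hUp data
  have hz : (U * Uᵀ) * (Up * h * Upᵀ) = 0 := by
    have h1 : Uᵀ * Up = 0 := hUp.2
    calc _ = U * (Uᵀ * Up) * (h * Upᵀ) := by simp only [Matrix.mul_assoc]
      _ = 0 := by rw [h1, Matrix.mul_zero, Matrix.zero_mul]
  rw [← hE, mulVec_mulVec, hz, zero_mulVec]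

/-- Starting vectors that are spread with respect to `V`. -/
def IsSpread (V : Mat d p) (ε L : ℝ) (g : Fin p → Vec d) : Prop :=
  (∀ j, nrm (g j) ≤ L) ∧
    ∀ c : Fin p → ℝ, (∃ j, c j = 1) → ε ≤ nrm (Vᵀ *ᵥ ∑ i, c i • g i)

lemma IsSpread.bound {V : Mat d p} {ε L : ℝ} {g : Fin p → Vec d}
    (h : IsSpread V ε L g) (hε : 0 < ε) {P : Mat d d}
    (hP : ∀ v : Vec d, nrm (P *ᵥ v) ≤ nrm v) (hVP : Vᵀ * P = Vᵀ) (c : Fin p → ℝ) (hc : c ≠ 0) :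
    0 < nrm (Vᵀ *ᵥ ∑ i, c i • (P *ᵥ g i)) ∧
      nrm (∑ i, c i • (P *ᵥ g i)) ≤ p * L / ε * nrm (Vᵀ *ᵥ ∑ i, c i • (P *ᵥ g i)) := by
  obtain ⟨l, hl⟩ : ∃ l, c l ≠ 0 := by
    by_contra hcon
    exact hc (funext fun l => by_contra fun hl => hcon ⟨l, hl⟩)
  obtain ⟨j, -, hj⟩ := Finset.exists_max_image Finset.univ (fun j => |c j|) ⟨l, Finset.mem_univ l⟩
  have hj0 : 0 < |c j| := (abs_pos.2 hl).trans_le (hj l (Finset.mem_univ l))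
  have hj1 : c j ≠ 0 := abs_pos.1 hj0
  have e1 : ∑ i, c i • (P *ᵥ g i) = P *ᵥ ∑ i, c i • g i := by
    rw [mulVec_sum]
    exact Finset.sum_congr rfl fun i _ => (mulVec_smul _ _ _).symm
  have e2 : ∑ i, c i • g i = c j • ∑ i, (c i / c j) • g i := by
    rw [Finset.smul_sum]
    exact Finset.sum_congr rfl fun i _ => by rw [smul_smul, mul_div_cancel₀ _ hj1]
  have h1 := h.2 (fun i => c i / c j) ⟨j, div_self hj1⟩
  have h2 : nrm (Vᵀ *ᵥ ∑ i, c i • (P *ᵥ g i)) =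
      |c j| * nrm (Vᵀ *ᵥ ∑ i, (c i / c j) • g i) := by
    rw [e1, mulVec_mulVec, hVP, e2, mulVec_smul, nrm_smul]
  have h3 : |c j| * ε ≤ nrm (Vᵀ *ᵥ ∑ i, c i • (P *ᵥ g i)) := by
    rw [h2]
    exact mul_le_mul_of_nonneg_left h1 hj0.le
  have h4 : nrm (∑ i, c i • (P *ᵥ g i)) ≤ p * (|c j| * L) := by
    have h5 : ∀ S : Finset (Fin p), nrm (∑ i ∈ S, c i • (P *ᵥ g i)) ≤ S.card * (|c j| * L) := by
      intro S
      induction S using Finset.induction_on with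
      | empty => simp [nrm_eq_zero.2 rfl]
      | insert a S ha ih =>
        rw [Finset.sum_insert ha, Finset.card_insert_of_notMem ha, Nat.cast_succ]
        refine (nrm_add_le _ _).trans ?_
        rw [nrm_smul]
        have := mul_le_mul (hj a (Finset.mem_univ a)) ((hP (g a)).trans (h.1 a)) (nrm_nonneg _)
          hj0.le
        linarith
    simpa using h5 Finset.univ
  have hL : 0 ≤ L := (nrm_nonneg _).trans (h.1 j)
  refine ⟨(mul_pos hj0 hε).trans_le h3, h4.trans ?_⟩
  calc (p : ℝ) * (|c j| * L) = p * L / ε * (|c j| * ε) := by field_simp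
    _ ≤ _ := mul_le_mul_of_nonneg_left h3 (by positivity)

/-- The implemented step nearly finds the top eigenspace when its starting vectors are spread. -/
lemma implementedStep_close {k' : ℕ} (hk : k ≤ k') (q : ℕ) {τ : ℝ → ℝ}
    {data : Fin n → ℝ × Vec d} (hz : ∀ i, nrm (data i).2 = 1 ∨ (data i).2 = 0)
    {U : Fin k → Vec d} (hU : IsFrame (Matrix.of U)ᵀ) {Q E : Mat d d}
    (hQ : Q = (Matrix.of U)ᵀ * (Matrix.of U)ᵀᵀ) (hE : E = empMat τ Q (d - k) data)
    {V : Mat d (k' - k)} (hV : IsFrame V) {eig : Fin (k' - k) → ℝ}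
    (he : ∀ j, (E * E) *ᵥ (Vᵀ j) = eig j • Vᵀ j) {lam : ℝ} (hlam : 0 < lam)
    (h1 : ∀ j, lam / 2 ≤ eig j)
    (h2 : ∀ x : Vec d, Vᵀ *ᵥ x = 0 → x ⬝ᵥ ((E * E) *ᵥ x) ≤ lam / 4 * (x ⬝ᵥ x))
    {g : Fin (k' - k) → Vec d} {ε L : ℝ} (hε : 0 < ε) (hg : IsSpread V ε L g)
    {U' : Fin k' → Vec d}
    (hU' : U' = (Timed.unfoldingStep q (radialFeature d τ) data U g).val) :
    IsFrame (Matrix.of U')ᵀ ∧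
      ‖(Matrix.of U')ᵀ * (Matrix.of U')ᵀᵀ - (Q + V * Vᵀ)‖ ^ 2 ≤
        2 * (k' - k : ℕ) * ((1 / 2) ^ q * ((k' - k : ℕ) * L / ε)) ^ 2 := by
  have hQt : Qᵀ = Q := hQ ▸ proj_transpose _
  have hQQ : Q * Q = Q := hQ ▸ proj_mul_self hU
  have hEt : Eᵀ = E := hE ▸ empMat_transpose τ hQt _ _
  have hQE : ∀ v : Vec d, Q *ᵥ (E *ᵥ v) = 0 := fun v => by
    rw [hE, hQ]; exact proj_empMat τ hU data v
  have hQv : ∀ v : Vec d, Q *ᵥ v = ∑ j, (U j ⬝ᵥ v) • U j := fun v => by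
    rw [hQ, ← mulVec_mulVec]
    ext i
    rw [Finset.sum_apply]
    change ∑ j, U j i * (U j ⬝ᵥ v) = ∑ j, (U j ⬝ᵥ v) * U j i
    exact Finset.sum_congr rfl fun j _ => mul_comm _ _
  have hVQ : Vᵀ * Q = 0 := by
    ext j i
    obtain ⟨v, hvV, hv⟩ : ∃ v : Vec d, (∀ l, v l = V l j) ∧ (E * E) *ᵥ v = eig j • v :=
      ⟨Vᵀ j, fun _ => rfl, he j⟩
    have h3 : Q *ᵥ v = 0 := by
      have h4 : eig j • (Q *ᵥ v) = 0 := by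
        rw [← mulVec_smul, ← hv, ← mulVec_mulVec, hQE]
      exact (smul_eq_zero.1 h4).resolve_left (by have := h1 j; linarith)
    rw [Matrix.zero_apply, Matrix.mul_apply]
    refine (Finset.sum_congr rfl fun l _ => ?_).trans (congrFun h3 i)
    have h4 : Q l i = Q i l := congrFun (congrFun hQt i) l
    change V l j * Q l i = Q i l * v l
    rw [hvV, h4, mul_comm]
  have hVP : Vᵀ * (1 - Q) = Vᵀ := by rw [Matrix.mul_sub, hVQ, Matrix.mul_one, sub_zero]
  set w : Fin n → ℝ := fun i => sampleWeight τ Q (data i) with hw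
  set z : Fin n → Vec d := fun i => direction ((data i).2 - Q *ᵥ (data i).2) with hzdef
  set A := iterMat (d - k) w z with hA
  have hAE : ∀ v : Vec d, Q *ᵥ v = 0 → A *ᵥ v = E *ᵥ v := fun v hv => by
    have := iterMat_mulVec_eq τ hU hz (v := v) (by rw [← hQ]; exact hv)
    rw [← hQ, ← hE] at this
    exact this
  set X₀ : Fin (k' - k) → Vec d := fun j => (1 - Q) *ᵥ g j with hX₀
  have hQX : ∀ y ∈ Submodule.span ℝ (Set.range X₀), Q *ᵥ y = 0 := by
    have hle : Submodule.span ℝ (Set.range X₀) ≤ LinearMap.ker Q.mulVecLin := by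
      rw [Submodule.span_le]
      rintro _ ⟨j, rfl⟩
      change Q *ᵥ ((1 - Q) *ᵥ g j) = 0
      rw [mulVec_mulVec, Matrix.mul_sub, hQQ, Matrix.mul_one, sub_self, zero_mulVec]
    exact fun y hy => hle hy
  have hpow : ∀ (q : ℕ) (y : Vec d), Q *ᵥ y = 0 →
      ((A * A) ^ q) *ᵥ y = ((E * E) ^ q) *ᵥ y ∧ Q *ᵥ (((E * E) ^ q) *ᵥ y) = 0 := by
    intro q y hy
    induction q with
    | zero => simpa using hy
    | succ q ih =>
      obtain ⟨i1, i2⟩ := ih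
      rw [pow_succ', pow_succ', ← mulVec_mulVec, ← mulVec_mulVec, i1,
        ← mulVec_mulVec, ← mulVec_mulVec, hAE _ i2, hAE _ (hQE _)]
      exact ⟨rfl, hQE _⟩
  have hPle : ∀ v : Vec d, nrm ((1 - Q) *ᵥ v) ≤ nrm v := fun v => by
    rw [sub_mulVec, one_mulVec]
    exact nrm_sub_proj_le hQt hQQ v
  have hspan : ∀ y ∈ Submodule.span ℝ (Set.range X₀), ∃ c : Fin (k' - k) → ℝ, ∑ i, c i • X₀ i = y :=
    fun y hy => Submodule.mem_span_range_iff_exists_fun ℝ |>.1 hy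
  have hX₀ind : LinearIndependent ℝ X₀ := by
    rw [Fintype.linearIndependent_iff]
    intro c hc
    by_contra hcon
    have h3 := (hg.bound hε hPle hVP c (fun h => hcon fun i => by rw [h]; rfl)).1
    rw [hc, mulVec_zero, nrm_eq_zero.2 rfl] at h3
    exact lt_irrefl _ h3
  have hbd : ∀ y ∈ Submodule.span ℝ (Set.range X₀), y ≠ 0 →
      0 < nrm (Vᵀ *ᵥ y) ∧ nrm y ≤ (k' - k : ℕ) * L / ε * nrm (Vᵀ *ᵥ y) := by
    intro y hy hy0
    obtain ⟨c, rfl⟩ := hspan y hy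
    refine hg.bound hε hPle hVP c fun h => hy0 ?_
    simp [h]
  have hinj : ∀ (q : ℕ), ∀ y ∈ Submodule.span ℝ (Set.range X₀),
      ((A * A) ^ q) *ᵥ y = 0 → y = 0 := by
    intro q y hy h0
    by_contra hy0
    rw [(hpow q y (hQX y hy)).1] at h0
    have h3 := (pow_mulVec_bounds hEt hV he hlam h1 h2 y q).1
    rw [h0, mulVec_zero, nrm_eq_zero.2 rfl] at h3
    have h4 := (hbd y hy hy0).1
    have : 0 < (lam / 2) ^ q * nrm (Vᵀ *ᵥ y) := by positivity
    linarith
  have hzval : ∀ i, (Timed.normalize (Timed.projectOut U (data i).2).val).val = z i := fun i => by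
    rw [Timed.normalize_val, Timed.projectOut_val, ← hQv]
  have hrr : ∀ i, (fun j => U j ⬝ᵥ (data i).2) ⬝ᵥ (fun j => U j ⬝ᵥ (data i).2) =
      (data i).2 ⬝ᵥ (Q *ᵥ (data i).2) := fun i => by
    rw [hQ, dot_proj]
    rfl
  have hwval : ∀ i, radialFeature d τ 0 (data i).1 (fun j => U j ⬝ᵥ (data i).2) = w i := fun i => by
    change τ (data i).1 * radial (d * _) = _
    rw [hrr]
    rfl
  obtain ⟨G, hG, hUG⟩ : ∃ G : (Fin (k' - k) → Vec d) → Timed (Fin (k' - k) → Vec d),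
      (∀ X, (G X).val = (Timed.gramSchmidt (k' - k) fun j => (A * A) *ᵥ X j).val) ∧
        U' = extend U (Timed.iterate G q (Timed.gramSchmidt (k' - k) X₀).val).val := by
    refine ⟨fun X => do
      let Y ← Timed.array fun j => Timed.applyM (d - k)
        (fun a i => radialFeature d τ a (data i).1 fun j => U j ⬝ᵥ (data i).2)
        (fun i => (Timed.normalize (Timed.projectOut U (data i).2).val).val) (X j)
      Timed.gramSchmidt (k' - k) Y, fun X => ?_, ?_⟩
    · change (Timed.gramSchmidt (k' - k) fun j => (Timed.applyM (d - k)
        (fun a i => radialFeature d τ a (data i).1 fun j => U j ⬝ᵥ (data i).2)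
        (fun i => (Timed.normalize (Timed.projectOut U (data i).2).val).val) (X j)).val).val = _
      simp only [applyM_val, hzval, hwval]
      rfl
    · have e : X₀ = fun j => (Timed.projectOut U (g j)).val := funext fun j => by
        rw [Timed.projectOut_val, ← hQv, hX₀]
        simp only [sub_mulVec, one_mulVec]
      rw [hU', e]
      rfl
  obtain ⟨hXf, hXy⟩ := iterate_spec hX₀ind hinj hG q
  set X := (Timed.iterate G q (Timed.gramSchmidt (k' - k) X₀).val).val with hX
  have hXQ : ∀ j, Q *ᵥ X j = 0 := fun j => by
    obtain ⟨y, hy, hj⟩ := hXy j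
    rw [hj, (hpow q y (hQX y hy)).1, (hpow q y (hQX y hy)).2]
  have hUX : (Matrix.of U)ᵀᵀ * (Matrix.of X)ᵀ = 0 := by
    ext i j
    have h3 : (Matrix.of U)ᵀᵀ *ᵥ (Q *ᵥ X j) = (Matrix.of U)ᵀᵀ *ᵥ 0 := congrArg _ (hXQ j)
    have hUU : (Matrix.of U)ᵀᵀ * (Matrix.of U)ᵀ = 1 := hU
    rw [hQ, mulVec_mulVec, ← Matrix.mul_assoc, hUU, Matrix.one_mul, mulVec_zero] at h3
    exact congrFun h3 i
  obtain ⟨r1, r2⟩ := extend_frame (U' := (Matrix.of U')ᵀ) hk hU hXf hUX hUG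
  refine ⟨r1, ?_⟩
  rw [r2, hQ, add_sub_add_left_eq_sub, ← norm_neg, neg_sub, nrm_sub_proj_sq_sum hV hXf, mul_assoc]
  refine mul_le_mul_of_nonneg_left ?_ zero_le_two
  have hone : ∀ j, nrm (X j - (V * Vᵀ) *ᵥ X j) ^ 2 ≤
      ((1 / 2) ^ q * ((k' - k : ℕ) * L / ε)) ^ 2 := by
    intro j
    obtain ⟨y, hy, hj⟩ := hXy j
    rw [(hpow q y (hQX y hy)).1] at hj
    obtain ⟨b1, b2⟩ := pow_mulVec_bounds hEt hV he hlam h1 h2 y q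
    have hXj : nrm (X j) = 1 := hXf.nrm_col j
    have hy0 : y ≠ 0 := fun h => by
      rw [hj, h, mulVec_zero, nrm_eq_zero.2 rfl] at hXj
      exact zero_ne_one hXj
    obtain ⟨c1, c2⟩ := hbd y hy hy0
    refine pow_le_pow_left₀ (nrm_nonneg _) ?_ 2
    have hR : 0 ≤ (k' - k : ℕ) * L / ε := by
      by_contra hcon
      have := mul_neg_of_neg_of_pos (not_le.1 hcon) c1
      linarith [nrm_nonneg y]
    have b3 : (lam / 2) ^ q * nrm (Vᵀ *ᵥ y) ≤ 1 := by
      refine b1.trans ?_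
      rw [← hj]
      exact (hV.nrm_transpose_mulVec_le _).trans hXj.le
    have b4 : nrm (y - (V * Vᵀ) *ᵥ y) ≤ nrm y :=
      nrm_sub_proj_le (proj_transpose V) (proj_mul_self hV) y
    rw [hj]
    calc _ ≤ (lam / 4) ^ q * nrm (y - (V * Vᵀ) *ᵥ y) := b2
      _ ≤ (lam / 4) ^ q * ((k' - k : ℕ) * L / ε * nrm (Vᵀ *ᵥ y)) :=
        mul_le_mul_of_nonneg_left (b4.trans c2) (by positivity)
      _ = (1 / 2) ^ q * ((k' - k : ℕ) * L / ε) * ((lam / 2) ^ q * nrm (Vᵀ *ᵥ y)) := by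
        rw [show lam / 4 = 1 / 2 * (lam / 2) by ring, mul_pow]
        ring
      _ ≤ _ := mul_le_of_le_one_right (by positivity) b3
  refine (Finset.sum_le_sum fun j _ => hone j).trans ?_
  simp

/-! ### Gaussian starting vectors -/

lemma gaussianReal_abs_lt_le (ε : ℝ) :
    gaussianReal 0 1 {t | |t| < ε} ≤ ENNReal.ofReal ε := by
  have h2 : (2 : ℝ) ≤ √(2 * Real.pi) := by
    refine Real.le_sqrt_of_sq_le ?_
    have := Real.pi_gt_three
    linarith
  have hpdf : ∀ x, gaussianPDF 0 1 x ≤ ENNReal.ofReal (1 / 2) := fun x => by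
    refine ENNReal.ofReal_le_ofReal ?_
    rw [gaussianPDFReal, NNReal.coe_one, mul_one]
    calc _ ≤ (√(2 * Real.pi))⁻¹ * 1 := by
          refine mul_le_mul_of_nonneg_left (Real.exp_le_one_iff.2 ?_) (by positivity)
          exact div_nonpos_of_nonpos_of_nonneg (neg_nonpos.2 (sq_nonneg _)) (by norm_num)
      _ ≤ 1 / 2 := by
          rw [mul_one, one_div]
          exact inv_anti₀ two_pos h2
  rw [gaussianReal_apply _ one_ne_zero]
  refine (lintegral_mono fun x => hpdf x).trans ?_
  have hset : {t : ℝ | |t| < ε} = Set.Ioo (-ε) ε := Set.ext fun t => (abs_lt : |t| < ε ↔ _)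
  rw [lintegral_const, Measure.restrict_apply MeasurableSet.univ, Set.univ_inter, hset,
    Real.volume_Ioo, ← ENNReal.ofReal_mul (by norm_num)]
  exact ENNReal.ofReal_le_ofReal (by linarith)

lemma gaussianVec_nrm_gt_le (d : ℕ) {L : ℝ} (hL : 0 < L) :
    gaussianVec d {g | L < nrm g} ≤ ENNReal.ofReal (d / L ^ 2) := by
  have h1 : ∫ g, nrm g ^ 2 ∂gaussianVec d = d := by
    have h := integral_nrm_mulVec_sq (1 : Mat d d)
    have h1 : IsFrame (1 : Mat d d) := by rw [IsFrame, transpose_one, one_mul]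
    rw [h1.frob_sq] at h
    simpa using h
  have hp : IsProbabilityMeasure (gaussianVec d) := by unfold gaussianVec; infer_instance
  have h2 := mul_meas_ge_le_integral_of_nonneg (μ := gaussianVec d) (f := fun g => nrm g ^ 2)
    (Eventually.of_forall fun g => sq_nonneg _) (integrable_nrm_sq d) (L ^ 2)
  rw [h1] at h2
  have h3 : {g : Vec d | L < nrm g} ⊆ {g | L ^ 2 ≤ nrm g ^ 2} := fun g hg =>
    pow_le_pow_left₀ hL.le (le_of_lt hg) 2
  refine (measure_mono h3).trans ?_
  rw [← ENNReal.ofReal_toReal (measure_ne_top (gaussianVec d) {g | L ^ 2 ≤ nrm g ^ 2})]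
  refine ENNReal.ofReal_le_ofReal ?_
  rw [le_div_iff₀ (by positivity), mul_comm]
  exact h2

/-- Fewer than `p` vectors have a common unit normal in dimension `p`. -/
lemma exists_normal (u : Fin p → Vec p) (j : Fin p) :
    ∃ n : Vec p, nrm n = 1 ∧ ∀ i, i ≠ j → n ⬝ᵥ u i = 0 := by
  classical
  let φ : Vec p →ₗ[ℝ] Vec p := (Matrix.of fun i => if i = j then 0 else u i).mulVecLin
  have hφ : ¬ Function.Injective φ := by
    rw [LinearMap.injective_iff_surjective]
    intro h
    obtain ⟨x, hx⟩ := h (Pi.single j 1)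
    have h1 : φ x j = 0 := by
      change (if j = j then (0 : Vec p) else u j) ⬝ᵥ x = 0
      rw [if_pos rfl, zero_dotProduct]
    rw [hx, Pi.single_eq_same] at h1
    exact one_ne_zero h1
  rw [← LinearMap.ker_eq_bot, Submodule.eq_bot_iff] at hφ
  push Not at hφ
  obtain ⟨n, hn, hn0⟩ := hφ
  refine ⟨direction n, nrm_direction hn0, fun i hi => ?_⟩
  have h1 : φ n i = 0 := by rw [LinearMap.mem_ker.1 hn]; rfl
  have h2 : (if i = j then (0 : Vec p) else u i) ⬝ᵥ n = 0 := h1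
  rw [if_neg hi] at h2
  rw [direction, smul_dotProduct, dotProduct_comm, h2, smul_zero]

lemma measure_not_isSpread_le {V : Mat d p} (hV : IsFrame V) {ε L : ℝ}
    (hL : 0 < L) : (Measure.pi fun _ : Fin p => gaussianVec d) {g | ¬ IsSpread V ε L g} ≤
      p * (ENNReal.ofReal ε + ENNReal.ofReal (d / L ^ 2)) := by
  have hp : IsProbabilityMeasure (gaussianVec d) := by unfold gaussianVec; infer_instance
  set S : Fin p → Set (Fin p → Vec d) := fun j =>
    ⋃ c ∈ {c : Fin p → ℝ | c j = 1}, {g | nrm (Vᵀ *ᵥ ∑ i, c i • g i) < ε} with hS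
  set B : Fin p → Set (Fin p → Vec d) := fun j => {g | L < nrm (g j)} with hB
  have hsub : {g | ¬ IsSpread V ε L g} ⊆ ⋃ j, S j ∪ B j := by
    intro g hg
    by_contra hcon
    rw [Set.mem_iUnion] at hcon
    push Not at hcon
    refine hg ⟨fun j => ?_, fun c hc => ?_⟩
    · by_contra h
      exact hcon j (Or.inr (not_le.1 h))
    · obtain ⟨j, hj⟩ := hc
      by_contra h
      exact hcon j (Or.inl (Set.mem_biUnion (x := c) hj (not_le.1 h)))
  have hSj : ∀ j, (Measure.pi fun _ : Fin p => gaussianVec d) (S j) ≤ ENNReal.ofReal ε := by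
    intro j
    have hopen : IsOpen (S j) := by
      refine isOpen_biUnion fun c _ => isOpen_lt ?_ continuous_const
      exact continuous_nrm.comp (by fun_prop)
    refine measure_pi_le_of_update _ hopen.measurableSet j fun g => ?_
    obtain ⟨n, hn, hno⟩ := exists_normal (fun i => Vᵀ *ᵥ g i) j
    have hVn : nrm (V *ᵥ n) = 1 := (hV.nrm_mulVec n).trans hn
    have hsec : {x | Function.update g j x ∈ S j} ⊆ {x | |(V *ᵥ n) ⬝ᵥ x| < ε} := by
      intro x hx
      obtain ⟨c, hc, hx⟩ := Set.mem_iUnion₂.1 hx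
      have hx' : nrm (Vᵀ *ᵥ ∑ i, c i • Function.update g j x i) < ε := hx
      have hcj : c j = 1 := hc
      have e : n ⬝ᵥ (Vᵀ *ᵥ ∑ i, c i • Function.update g j x i) = (V *ᵥ n) ⬝ᵥ x := by
        rw [mulVec_sum, dotProduct_sum, Finset.sum_eq_single j]
        · rw [hcj, one_smul, Function.update_self, mulVec_dot, transpose_transpose]
        · intro i _ hi
          rw [Function.update_of_ne hi, mulVec_smul, dotProduct_smul, hno i hi, smul_zero]
        · exact fun h => absurd (Finset.mem_univ j) h
      change |(V *ᵥ n) ⬝ᵥ x| < ε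
      rw [← e]
      refine (abs_dot_le _ _).trans_lt ?_
      rwa [hn, one_mul]
    refine (measure_mono hsec).trans ?_
    have h1 : gaussianVec d {x | |(V *ᵥ n) ⬝ᵥ x| < ε} = gaussianReal 0 1 {t | |t| < ε} := by
      rw [← map_dot_gaussianVec hVn, Measure.map_apply (measurable_dot _)
        (measurableSet_lt (by fun_prop) measurable_const)]
      rfl
    rw [h1]
    exact gaussianReal_abs_lt_le ε
  have hBj : ∀ j, (Measure.pi fun _ : Fin p => gaussianVec d) (B j) ≤ ENNReal.ofReal (d / L ^ 2) := by
    intro j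
    have h1 := (measurePreserving_eval (fun _ : Fin p => gaussianVec d) j).measure_preimage
      (measurableSet_lt measurable_const measurable_nrm : MeasurableSet {x : Vec d | L < nrm x}).nullMeasurableSet
    exact (le_of_eq h1).trans (gaussianVec_nrm_gt_le d hL)
  refine (measure_mono hsub).trans ((measure_iUnion_le _).trans ?_)
  rw [tsum_fintype]
  refine (Finset.sum_le_sum fun j _ => (measure_union_le _ _).trans (add_le_add (hSj j) (hBj j))).trans ?_
  simp [mul_add]

/-! ### Measurability of the implementation -/

section Measurability

variable {α : Type*} [MeasurableSpace α]

lemma measurable_dot_dot {u v : α → Vec d} (hu : Measurable u) (hv : Measurable v) :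
    Measurable fun x => u x ⬝ᵥ v x := by
  change Measurable fun x => ∑ i, u x i * v x i
  exact Finset.measurable_sum _ fun i _ =>
    ((measurable_pi_apply i).comp hu).mul ((measurable_pi_apply i).comp hv)

lemma measurable_projectOut {Q : α → Fin k → Vec d} {v : α → Vec d} (hQ : Measurable Q)
    (hv : Measurable v) : Measurable fun x => (Timed.projectOut (Q x) (v x)).val := by
  have hQj : ∀ j, Measurable fun x => Q x j := fun j => (measurable_pi_apply j).comp hQ
  refine measurable_pi_iff.2 fun i => ?_
  change Measurable fun x => v x i - ∑ j, (Q x j ⬝ᵥ v x) * Q x j i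
  exact ((measurable_pi_apply i).comp hv).sub (Finset.measurable_sum _ fun j _ =>
    (measurable_dot_dot (hQj j) hv).mul ((measurable_pi_apply i).comp (hQj j)))

lemma measurable_normalize {v : α → Vec d} (hv : Measurable v) :
    Measurable fun x => (Timed.normalize (v x)).val := by
  simp only [Timed.normalize_val]
  exact measurable_direction.comp hv

lemma measurable_gramSchmidt : ∀ (p : ℕ) {X : α → Fin p → Vec d}, Measurable X →
    Measurable fun x => (Timed.gramSchmidt p (X x)).val
  | 0, _, hX => hX
  | p + 1, X, hX => by
    have hX' : Measurable fun x => fun j : Fin p => X x j.castSucc :=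
      measurable_pi_iff.2 fun j => (measurable_pi_apply j.castSucc).comp hX
    have ih := measurable_gramSchmidt p hX'
    have hl : Measurable fun x => X x (Fin.last p) := (measurable_pi_apply _).comp hX
    refine measurable_pi_iff.2 fun j => ?_
    induction j using Fin.lastCases with
    | last =>
      have e : (fun x => (Timed.gramSchmidt (p + 1) (X x)).val (Fin.last p)) = fun x =>
          (Timed.normalize (Timed.projectOut (Timed.gramSchmidt p fun j => X x j.castSucc).val
            (X x (Fin.last p))).val).val := funext fun x => Fin.snoc_last (α := fun _ => Vec d) _ _
      rw [e]
      exact measurable_normalize (measurable_projectOut ih hl)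
    | cast j =>
      have e : (fun x => (Timed.gramSchmidt (p + 1) (X x)).val j.castSucc) = fun x =>
          (Timed.gramSchmidt p fun j => X x j.castSucc).val j :=
        funext fun x => Fin.snoc_castSucc (α := fun _ => Vec d) _ _ _
      rw [e]
      exact (measurable_pi_apply j).comp ih

lemma measurable_applyS (D : ℕ) {w : α → Fin n → ℝ} {z : α → Fin n → Vec d}
    {v : α → Vec d} (hw : Measurable w) (hz : Measurable z) (hv : Measurable v) :
    Measurable fun x => (Timed.applyS D (w x) (z x) (v x)).val := by
  have hwi : ∀ i, Measurable fun x => w x i := fun i => (measurable_pi_apply i).comp hw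
  have hzi : ∀ i, Measurable fun x => z x i := fun i => (measurable_pi_apply i).comp hz
  refine measurable_pi_iff.2 fun l => ?_
  change Measurable fun x => (√((D : ℝ) * (D + 2) / 2) / n) *
    (∑ i, (w x i * (z x i ⬝ᵥ v x)) * z x i l - ((∑ i, w x i) / D) * v x l)
  refine Measurable.const_mul (Measurable.sub ?_ ?_) _
  · exact Finset.measurable_sum _ fun i _ => ((hwi i).mul (measurable_dot_dot (hzi i) hv)).mul
      ((measurable_pi_apply l).comp (hzi i))
  · exact ((Finset.measurable_sum _ fun i _ => hwi i).div_const _).mul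
      ((measurable_pi_apply l).comp hv)

lemma measurable_applyM (D : ℕ) {w : α → Fin 1 → Fin n → ℝ} {z : α → Fin n → Vec d}
    {v : α → Vec d} (hw : Measurable w) (hz : Measurable z) (hv : Measurable v) :
    Measurable fun x => (Timed.applyM D (w x) (z x) (v x)).val := by
  have hw0 : Measurable fun x => w x 0 := (measurable_pi_apply 0).comp hw
  have h := measurable_applyS D hw0 hz (measurable_applyS D hw0 hz hv)
  simp only [applyS_val, mulVec_mulVec] at h
  simp only [applyM_val]
  exact h

lemma measurable_extend {k' : ℕ} {U : α → Fin k → Vec d} {X : α → Fin (k' - k) → Vec d}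
    (hU : Measurable U) (hX : Measurable X) :
    Measurable fun x => (extend (U x) (X x) : Fin k' → Vec d) := by
  refine measurable_pi_iff.2 fun j => ?_
  by_cases hj : j.val < k
  · simp only [extend_of_lt _ _ j hj]
    exact (measurable_pi_apply _).comp hU
  · simp only [extend_of_ge _ _ j hj]
    exact (measurable_pi_apply _).comp hX

lemma measurable_unfoldingStep {k' : ℕ} (q : ℕ) {τ : ℝ → ℝ} (hτ : Measurable τ)
    {data : α → Fin n → ℝ × Vec d} {U : α → Fin k → Vec d} {init : α → Fin (k' - k) → Vec d}
    (hd : Measurable data) (hU : Measurable U) (hi : Measurable init) :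
    Measurable fun x =>
      (Timed.unfoldingStep (k' := k') q (radialFeature d τ) (data x) (U x) (init x)).val := by
  have hdi : ∀ i, Measurable fun x => data x i := fun i => (measurable_pi_apply i).comp hd
  have hUj : ∀ j, Measurable fun x => U x j := fun j => (measurable_pi_apply j).comp hU
  have hr : ∀ i, Measurable fun x => fun j => U x j ⬝ᵥ (data x i).2 := fun i =>
    measurable_pi_iff.2 fun j => measurable_dot_dot (hUj j) (hdi i).snd
  have hw : Measurable fun x => fun (a : Fin 1) (i : Fin n) =>
      radialFeature d τ a (data x i).1 fun j => U x j ⬝ᵥ (data x i).2 :=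
    measurable_pi_iff.2 fun a => measurable_pi_iff.2 fun i =>
      (hτ.comp (hdi i).fst).mul (continuous_radial.measurable.comp
        ((measurable_dot_dot (hr i) (hr i)).const_mul _))
  have hz : Measurable fun x => fun i : Fin n =>
      (Timed.normalize (Timed.projectOut (U x) (data x i).2).val).val :=
    measurable_pi_iff.2 fun i => measurable_normalize (measurable_projectOut hU (hdi i).snd)
  have hX : Measurable fun x => fun j => (Timed.projectOut (U x) (init x j)).val :=
    measurable_pi_iff.2 fun j => measurable_projectOut hU ((measurable_pi_apply j).comp hi)
  have hit : ∀ q : ℕ, Measurable fun x => (Timed.iterate (fun X => do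
      let Y ← Timed.array fun j => Timed.applyM (d - k) (fun (a : Fin 1) (i : Fin n) =>
        radialFeature d τ a (data x i).1 fun j => U x j ⬝ᵥ (data x i).2)
          (fun i => (Timed.normalize (Timed.projectOut (U x) (data x i).2).val).val) (X j)
      Timed.gramSchmidt (k' - k) Y) q (Timed.gramSchmidt (k' - k)
        fun j => (Timed.projectOut (U x) (init x j)).val).val).val := by
    intro q
    induction q with
    | zero => exact measurable_gramSchmidt _ hX
    | succ q ih =>
      refine measurable_gramSchmidt _ (measurable_pi_iff.2 fun j => ?_)
      exact measurable_applyM _ hw hz ((measurable_pi_apply j).comp ih)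
  exact measurable_extend hU (hit q)

lemma measurable_unfolding {T : ℕ} {σ : ℕ → ℕ} (q : ℕ) {τ : ℕ → ℝ → ℝ}
    (hτ : ∀ t < T, Measurable (τ t)) {data : α → Fin T → Fin n → ℝ × Vec d}
    {init : α → (t : Fin T) → Fin (σ (t + 1) - σ t) → Vec d}
    (hd : Measurable data) (hi : Measurable init) : ∀ (t : ℕ) (ht : t ≤ T), Measurable fun x =>
      (Timed.unfolding q (fun t => radialFeature d (τ t)) (data x) (init x) t ht).val
  | 0, _ => measurable_const
  | t + 1, ht => measurable_unfoldingStep q (hτ t ht)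
      ((measurable_pi_apply (⟨t, ht⟩ : Fin T)).comp hd)
      (measurable_unfolding q hτ hd hi t (Nat.le_of_succ_le ht))
      ((measurable_pi_apply (⟨t, ht⟩ : Fin T)).comp hi)

end Measurability

/-! ### The implemented algorithm -/

lemma unfolding_update_data {T : ℕ} {σ : ℕ → ℕ} (q : ℕ)
    (feat : (t : ℕ) → Fin m → ℝ → Vec (σ t) → ℝ) (data : Fin T → Fin n → ℝ × Vec d)
    (init : (t : Fin T) → Fin (σ (t + 1) - σ t) → Vec d) (i : Fin T) (x : Fin n → ℝ × Vec d) :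
    ∀ (t : ℕ) (ht : t ≤ T), t ≤ i →
      Timed.unfolding q feat (Function.update data i x) init t ht =
        Timed.unfolding q feat data init t ht
  | 0, _, _ => rfl
  | t + 1, ht, hi => by
    have hne : (⟨t, ht⟩ : Fin T) ≠ i := fun h => by
      rw [← h] at hi
      exact Nat.not_succ_le_self t hi
    rw [Timed.unfolding, Timed.unfolding, unfolding_update_data q feat data init i x t _ (by omega),
      Function.update_of_ne hne]

lemma unfolding_update_init {T : ℕ} {σ : ℕ → ℕ} (q : ℕ)
    (feat : (t : ℕ) → Fin m → ℝ → Vec (σ t) → ℝ) (data : Fin T → Fin n → ℝ × Vec d)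
    (init : (t : Fin T) → Fin (σ (t + 1) - σ t) → Vec d) (i : Fin T)
    (x : Fin (σ (i + 1) - σ i) → Vec d) :
    ∀ (t : ℕ) (ht : t ≤ T), t ≤ i →
      Timed.unfolding q feat data (Function.update init i x) t ht =
        Timed.unfolding q feat data init t ht
  | 0, _, _ => rfl
  | t + 1, ht, hi => by
    have hne : (⟨t, ht⟩ : Fin T) ≠ i := fun h => by
      rw [← h] at hi
      exact Nat.not_succ_le_self t hi
    rw [Timed.unfolding, Timed.unfolding, unfolding_update_init q feat data init i x t _ (by omega),
      Function.update_of_ne hne]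

/-- The projection onto the span of the frame with the given columns. -/
def spanProj (X : Fin k → Vec d) : Mat d d :=
  (Matrix.of X)ᵀ * (Matrix.of X)ᵀᵀ

lemma measurable_spanProj : Measurable (spanProj : (Fin k → Vec d) → _) := by
  refine measurable_matrix_iff.2 fun a b => ?_
  change Measurable fun X : Fin k → Vec d => ∑ j, X j a * X j b
  exact Continuous.measurable (by fun_prop)

lemma isClosed_isFrame : IsClosed {X : Fin k → Vec d | IsFrame (Matrix.of X)ᵀ} := by
  have e : {X : Fin k → Vec d | IsFrame (Matrix.of X)ᵀ} =
      ⋂ i, ⋂ j, {X | X i ⬝ᵥ X j = if i = j then 1 else 0} := by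
    ext X
    simp only [Set.mem_iInter]
    exact isFrame_iff
  rw [e]
  exact isClosed_iInter fun i => isClosed_iInter fun j => isClosed_eq (by fun_prop) continuous_const

lemma isClosed_unit_or_zero : IsClosed {p : ℝ × Vec d | nrm p.2 = 1 ∨ p.2 = 0} :=
  (isClosed_eq (continuous_nrm.comp continuous_snd) continuous_const).union
    (isClosed_eq continuous_snd continuous_const)

/-- The inputs of the model are almost surely unit vectors (or zero, in dimension zero). -/
lemma pi_modelMap_unit_or_zero {F : Vec s → ℝ} (hF : Continuous F) (ρ : Measure ℝ)
    [IsProbabilityMeasure ρ] (W : Mat d s) (n : ℕ) :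
    (Measure.pi fun _ : Fin n => ((gaussianVec d).prod ρ).map (modelMap F W))
      {data | ¬ ∀ i, nrm (data i).2 = 1 ∨ (data i).2 = 0} = 0 := by
  have hm : IsProbabilityMeasure (((gaussianVec d).prod ρ).map (modelMap F W)) :=
    Measure.isProbabilityMeasure_map (measurable_modelMap hF.measurable W).aemeasurable
  have hz : ((gaussianVec d).prod ρ).map (modelMap F W) {p | nrm p.2 = 1 ∨ p.2 = 0}ᶜ = 0 := by
    rw [Measure.map_apply (measurable_modelMap hF.measurable W)
      isClosed_unit_or_zero.measurableSet.compl]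
    refine measure_mono_null (fun p hp => ?_) measure_empty
    refine hp ?_
    change nrm (direction p.1) = 1 ∨ direction p.1 = 0
    by_cases h : p.1 = 0
    · exact Or.inr (by rw [h, direction, smul_zero])
    · exact Or.inl (nrm_direction h)
  have hsub : {data : Fin n → ℝ × Vec d | ¬ ∀ i, nrm (data i).2 = 1 ∨ (data i).2 = 0} ⊆
      ⋃ i, Function.eval i ⁻¹' {p | nrm p.2 = 1 ∨ p.2 = 0}ᶜ := by
    intro data hd
    obtain ⟨i, hi⟩ := not_forall.1 hd
    exact Set.mem_iUnion.2 ⟨i, hi⟩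
  refine measure_mono_null hsub (measure_iUnion_null fun i => ?_)
  rw [(measurePreserving_eval (fun _ : Fin n => ((gaussianVec d).prod ρ).map (modelMap F W))
    i).measure_preimage isClosed_unit_or_zero.measurableSet.compl.nullMeasurableSet]
  exact hz

namespace StageChain

variable {F : Vec s → ℝ} {ρ : Measure ℝ} {T : ℕ} {σ : ℕ → ℕ}
  {Pr : ℕ → Mat s s} {τ : ℕ → ℝ → ℝ} {θ lam a η : ℕ → ℝ}
  {W : Mat d s}

lemma implementedStep (h : StageChain F ρ T σ Pr τ θ lam a η) (hW : IsFrame W) {t : ℕ} (ht : t < T)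
    {q : ℕ} {ε L : ℝ} (hε : 0 < ε) (hq : 2 * (σ (t + 1) - σ t : ℕ) *
      ((1 / 2) ^ q * ((σ (t + 1) - σ t : ℕ) * L / ε)) ^ 2 ≤ (a (t + 1) / 3) ^ 2)
    {data : Fin n → ℝ × Vec d} (hz : ∀ i, nrm (data i).2 = 1 ∨ (data i).2 = 0)
    {U : Fin (σ t) → Vec d} (hU : IsFrame (Matrix.of U)ᵀ)
    (hUW : ‖spanProj U - W * Pr t * Wᵀ‖ ≤ a t)
    (hE : QForm (empMat (τ t) (spanProj U) (d - σ t) data - W * target F ρ (τ t) (Pr t) * Wᵀ) (η t))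
    {V : Matrix (Fin d) (Fin (σ (t + 1) - σ t)) ℝ}
    (hV : IsTopEigenframe (empMat (τ t) (spanProj U) (d - σ t) data *
      empMat (τ t) (spanProj U) (d - σ t) data) V)
    {g : Fin (σ (t + 1) - σ t) → Vec d} (hg : IsSpread V ε L g) {U' : Fin (σ (t + 1)) → Vec d}
    (hU' : U' = (Timed.unfoldingStep q (radialFeature d (τ t)) data U g).val) :
    IsFrame (Matrix.of U')ᵀ ∧ ‖spanProj U' - W * Pr (t + 1) * Wᵀ‖ ≤ a (t + 1) := by
  have hst := h.stage t ht
  obtain ⟨E, hEdef⟩ : ∃ E, E = empMat (τ t) (spanProj U) (d - σ t) data := ⟨_, rfl⟩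
  rw [← hEdef] at hE hV
  have hEt : Eᵀ = E := hEdef ▸ empMat_transpose (τ t) (proj_transpose _) _ _
  obtain ⟨hVf, eig, he, htop⟩ := hV
  obtain ⟨h1, h2, h3⟩ := h.spectral t ht hW hEt hE hVf he htop
  obtain ⟨r1, r2⟩ := implementedStep_close hst.lt.le q hz hU rfl hEdef hVf he hst.pos h1 h3 hε hg hU'
  refine ⟨r1, ?_⟩
  have hpos := h.pos (t + 1) ht
  have r3 : ‖spanProj U' - (spanProj U + V * Vᵀ)‖ ≤ a (t + 1) / 3 :=
    le_of_sq_le_sq (r2.trans hq) (by positivity)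
  have e : spanProj U' - W * Pr (t + 1) * Wᵀ = (spanProj U' - (spanProj U + V * Vᵀ)) +
      ((spanProj U - W * Pr t * Wᵀ) - (W * (Pr (t + 1) - Pr t) * Wᵀ - V * Vᵀ)) := by
    rw [Matrix.mul_sub, Matrix.sub_mul]
    abel
  rw [e]
  refine (norm_add_le _ _).trans ((add_le_add r3 (norm_sub_le _ _)).trans ?_)
  have := h.le t ht
  linarith

/-- Outside an event of small probability the output of the implementation is close to the truth. -/
lemma measure_implementation_le [IsProbabilityMeasure ρ] (h : StageChain F ρ T σ Pr τ θ lam a η)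
    (hF : Continuous F) (hW : IsFrame W) (hd : s ≤ d) {N : ℕ}
    (hB : ∀ t < T, BatchTol F ρ (σ t) (Pr t) (τ t) (a t) (η t) d N) {q : ℕ} {ε L : ℝ} (hε : 0 < ε)
    (hL : 0 < L) (hq : ∀ t < T, 2 * (σ (t + 1) - σ t : ℕ) *
      ((1 / 2) ^ q * ((σ (t + 1) - σ t : ℕ) * L / ε)) ^ 2 ≤ (a (t + 1) / 3) ^ 2) :
    ((dataLaw T (N * d) (((gaussianVec d).prod ρ).map (modelMap F W))).prod (initLaw d T σ))
      {ω | ¬ frameDist (Matrix.transpose (Matrix.of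
        (Timed.unfolding q (fun t => radialFeature d (τ t)) ω.1 ω.2 T le_rfl).val)) W ≤ a T} ≤
      T * (ENNReal.ofReal (Real.exp (-d)) +
        s * (ENNReal.ofReal ε + ENNReal.ofReal (d / L ^ 2))) := by
  classical
  have hm : IsProbabilityMeasure (((gaussianVec d).prod ρ).map (modelMap F W)) :=
    Measure.isProbabilityMeasure_map (measurable_modelMap hF.measurable W).aemeasurable
  have hm1 : IsProbabilityMeasure
      (dataLaw T (N * d) (((gaussianVec d).prod ρ).map (modelMap F W))) := by
    unfold dataLaw; infer_instance
  have hm2 : IsProbabilityMeasure (initLaw d T σ) := by unfold initLaw; infer_instance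
  have hm3 : IsProbabilityMeasure (gaussianVec d) := by unfold gaussianVec; infer_instance
  set feat : (t : ℕ) → Fin 1 → ℝ → Vec (σ t) → ℝ := fun t => radialFeature d (τ t) with hfeat
  let Ω := (Fin T → Fin (N * d) → ℝ × Vec d) × ((t : Fin T) → Fin (σ (t + 1) - σ t) → Vec d)
  let Û : Ω → (t : ℕ) → t ≤ T → Fin (σ t) → Vec d := fun ω t ht =>
    (Timed.unfolding q feat ω.1 ω.2 t ht).val
  let G : (t : ℕ) → t ≤ T → Set Ω := fun t ht => {ω | IsFrame (Matrix.of (Û ω t ht))ᵀ ∧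
    ‖spanProj (Û ω t ht) - W * Pr t * Wᵀ‖ ≤ a t}
  let H : Fin T → Set Ω := fun t => {ω | (∀ i, nrm (ω.1 t i).2 = 1 ∨ (ω.1 t i).2 = 0) ∧
    QForm (empMat (τ t) (spanProj (Û ω t t.2.le)) (d - σ t) (ω.1 t) -
      W * target F ρ (τ t) (Pr t) * Wᵀ) (η t)}
  have hÛm : ∀ t ht, Measurable fun ω : Ω => Û ω t ht := fun t ht =>
    measurable_unfolding q (fun t ht => (h.continuous ht).measurable) measurable_fst measurable_snd t ht
  have hGm : ∀ t ht, MeasurableSet (G t ht) := fun t ht => by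
    refine MeasurableSet.inter ((hÛm t ht) isClosed_isFrame.measurableSet) ?_
    have hc : IsClosed {M : Mat d d | ‖M - W * Pr t * Wᵀ‖ ≤ a t} :=
      isClosed_le (by fun_prop) continuous_const
    exact (measurable_spanProj.comp (hÛm t ht)) hc.measurableSet
  have hHm : ∀ t, MeasurableSet (H t) := fun t => by
    have hdt : Measurable fun ω : Ω => ω.1 t := (measurable_pi_apply t).comp measurable_fst
    refine MeasurableSet.inter ?_ ?_
    · refine MeasurableSet.congr (s := ⋂ i, (fun ω : Ω => ω.1 t i) ⁻¹'
        {p | nrm p.2 = 1 ∨ p.2 = 0}) (MeasurableSet.iInter fun i =>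
          ((measurable_pi_apply i).comp hdt) isClosed_unit_or_zero.measurableSet) ?_
      exact Set.ext fun ω => Set.mem_iInter
    · exact ((measurable_empMat (h.continuous t.2).measurable (d - σ t)).comp
        ((measurable_spanProj.comp (hÛm t t.2.le)).prodMk hdt)) (isClosed_QForm _ _).measurableSet
  have hG0 : ∀ ω, ω ∈ G 0 (Nat.zero_le _) := fun ω => by
    have h0 : IsEmpty (Fin (σ 0)) := by rw [h.sigma_zero]; infer_instance
    refine ⟨isFrame_iff.2 fun i => h0.elim i, ?_⟩
    have hz : spanProj (Û ω 0 (Nat.zero_le _)) = 0 := by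
      ext i j
      rw [spanProj, Matrix.mul_apply]
      exact Finset.sum_eq_zero fun k _ => h0.elim k
    rw [hz, h.proj_zero, Matrix.mul_zero, Matrix.zero_mul, sub_zero, norm_zero]
    exact (h.pos 0 (Nat.zero_le _)).le
  have hsub : {ω : Ω | ¬ frameDist (Matrix.transpose (Matrix.of (Û ω T le_rfl))) W ≤ a T} ⊆
      ⋃ t : Fin T, (G t t.2.le ∩ (H t)ᶜ) ∪ ((G t t.2.le ∩ H t) ∩ (G (t + 1) t.2)ᶜ) := by
    intro ω hω
    by_contra hcon
    rw [Set.mem_iUnion] at hcon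
    push Not at hcon
    have hall : ∀ t ht, ω ∈ G t ht := by
      intro t
      induction t with
      | zero => exact fun _ => hG0 ω
      | succ t ih =>
        intro ht
        have hg := ih (Nat.le_of_succ_le ht)
        by_contra hn
        refine hcon ⟨t, ht⟩ ?_
        by_cases hh : ω ∈ H ⟨t, ht⟩
        · exact Or.inr ⟨⟨hg, hh⟩, hn⟩
        · exact Or.inl ⟨hg, hh⟩
    have h2 : Pr T = 1 := by
      have := h.proj_last
      rw [h.sigma_last] at this
      exact this.eq_one
    have h1 := (hall T le_rfl).2
    rw [h2, Matrix.mul_one] at h1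
    exact hω ((frameDist_le _ _).trans h1)
  have hone : ∀ t : Fin T, ((dataLaw T (N * d) (((gaussianVec d).prod ρ).map (modelMap F W))).prod
      (initLaw d T σ)) (G t t.2.le ∩ (H t)ᶜ) ≤ ENNReal.ofReal (Real.exp (-d)) := by
    intro t
    have hS := (hGm t t.2.le).inter (hHm t).compl
    refine measure_prod_le_of_left hS fun y => ?_
    refine measure_pi_le_of_update _ (measurable_prodMk_right hS) t fun x => ?_
    have hup : ∀ x', Û (Function.update x t x', y) t t.2.le = Û (x, y) t t.2.le := fun x' =>
      congrArg Timed.val (unfolding_update_data q feat x y t x' t t.2.le le_rfl)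
    by_cases hg : (x, y) ∈ G t t.2.le
    · refine le_trans (measure_mono (t := _ ∪ _) ?_) ((measure_union_le _ _).trans (add_le_add
        (hB t t.2 W hW (Matrix.of (Û (x, y) t t.2.le))ᵀ hg.1 hg.2)
        (pi_modelMap_unit_or_zero hF ρ W (N * d)).le)) |>.trans_eq (add_zero _)
      intro x' hx'
      have hn : ¬ ((∀ i, nrm (Function.update x t x' t i).2 = 1 ∨
          (Function.update x t x' t i).2 = 0) ∧ QForm (empMat (τ t)
          (spanProj (Û (Function.update x t x', y) t t.2.le)) (d - σ t) (Function.update x t x' t) -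
            W * target F ρ (τ t) (Pr t) * Wᵀ) (η t)) := hx'.2
      rw [hup, Function.update_self] at hn
      by_cases hu : ∀ i, nrm (x' i).2 = 1 ∨ (x' i).2 = 0
      · exact Or.inl fun hQ => hn ⟨hu, hQ⟩
      · exact Or.inr hu
    · refine le_trans (le_of_eq (measure_mono_null (fun x' hx' => ?_) measure_empty)) zero_le
      have h1 : IsFrame (Matrix.of (Û (Function.update x t x', y) t t.2.le))ᵀ ∧
        ‖spanProj (Û (Function.update x t x', y) t t.2.le) - W * Pr t * Wᵀ‖ ≤ a t := hx'.1
      rw [hup] at h1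
      exact hg h1
  have htwo : ∀ t : Fin T, ((dataLaw T (N * d) (((gaussianVec d).prod ρ).map (modelMap F W))).prod
      (initLaw d T σ)) ((G t t.2.le ∩ H t) ∩ (G (t + 1) t.2)ᶜ) ≤
        s * (ENNReal.ofReal ε + ENNReal.ofReal (d / L ^ 2)) := by
    intro t
    have hS := ((hGm t t.2.le).inter (hHm t)).inter (hGm (t + 1) t.2).compl
    refine measure_prod_le_of_right hS fun x => ?_
    refine measure_pi_le_of_update _ (measurable_prodMk_left hS) t fun y => ?_
    have hup : ∀ y', Û (x, Function.update y t y') t t.2.le = Û (x, y) t t.2.le := fun y' =>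
      congrArg Timed.val (unfolding_update_init q feat x y t y' t t.2.le le_rfl)
    by_cases hg : (x, y) ∈ G t t.2.le ∩ H t
    · obtain ⟨⟨g1, g2⟩, g3, g4⟩ := hg
      have hσ : σ (t + 1) ≤ s := h.sigma_le t.2
      obtain ⟨V, hV⟩ := exists_isTopEigenframe (p := σ (t + 1) - σ t)
        (M := empMat (τ t) (spanProj (Û (x, y) t t.2.le)) (d - σ t) (x t) *
          empMat (τ t) (spanProj (Û (x, y) t t.2.le)) (d - σ t) (x t))
        (by rw [transpose_mul, empMat_transpose (τ t) (Q := spanProj _) (proj_transpose _)])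
        (by omega)
      have hcast : ((σ (t + 1) - σ t : ℕ) : ENNReal) ≤ s := Nat.cast_le.2 (by omega)
      refine le_trans (measure_mono ?_) ((measure_not_isSpread_le hV.1 hL).trans
        (mul_le_mul_left hcast _))
      intro y' hy' hsp
      refine hy'.2 ?_
      change IsFrame (Matrix.of (Û (x, Function.update y t y') (t + 1) t.2))ᵀ ∧
        ‖spanProj (Û (x, Function.update y t y') (t + 1) t.2) - W * Pr (t + 1) * Wᵀ‖ ≤ a (t + 1)
      refine h.implementedStep hW t.2 hε (hq t t.2) g3 g1 g2 g4 hV hsp ?_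
      have e : Û (x, Function.update y t y') (t + 1) t.2 = (Timed.unfoldingStep q
        (radialFeature d (τ t)) (x t) (Û (x, Function.update y t y') t t.2.le)
          (Function.update y t y' t)).val := rfl
      rw [e, hup, Function.update_self]
    · refine le_trans (le_of_eq (measure_mono_null (fun y' hy' => ?_) measure_empty)) zero_le
      have h1 : (IsFrame (Matrix.of (Û (x, Function.update y t y') t t.2.le))ᵀ ∧
        ‖spanProj (Û (x, Function.update y t y') t t.2.le) - W * Pr t * Wᵀ‖ ≤ a t) ∧
          (∀ i, nrm (x t i).2 = 1 ∨ (x t i).2 = 0) ∧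
          QForm (empMat (τ t) (spanProj (Û (x, Function.update y t y') t t.2.le)) (d - σ t) (x t) -
            W * target F ρ (τ t) (Pr t) * Wᵀ) (η t) := hy'.1
      rw [hup] at h1
      exact hg h1
  refine (measure_mono hsub).trans ((measure_iUnion_le _).trans ?_)
  rw [tsum_fintype]
  refine (Finset.sum_le_sum fun t _ => (measure_union_le _ _).trans
    (add_le_add (hone t) (htwo t))).trans ?_
  simp [mul_add]

end StageChain

/-! ### The step count -/

lemma cost_dot (u v : Vec d) : (Timed.dot u v).cost = 2 * d := by
  change ∑ _i : Fin d, 1 + d = 2 * d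
  simp only [Finset.sum_const, Finset.card_univ, Fintype.card_fin, smul_eq_mul]
  ring

lemma cost_projectOut (Q : Fin k → Vec d) (v : Vec d) :
    (Timed.projectOut Q v).cost = (4 * k + 1) * d := by
  change ∑ j, (Timed.dot (Q j) v).cost + ∑ _i : Fin d, ((∑ _j : Fin k, 1 + k) + 1) = _
  simp only [cost_dot, Finset.sum_const, Finset.card_univ, Fintype.card_fin, smul_eq_mul]
  ring

lemma cost_normalize (v : Vec d) : (Timed.normalize v).cost = 3 * d + 1 := by
  change (Timed.dot v v).cost + (1 + ∑ _i : Fin d, 1) = _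
  simp only [cost_dot, Finset.sum_const, Finset.card_univ, Fintype.card_fin, smul_eq_mul]
  ring

lemma cost_gramSchmidt_le (hd : 0 < d) : ∀ (p : ℕ) (X : Fin p → Vec d),
    (Timed.gramSchmidt p X).cost ≤ p * (4 * p + 5) * d
  | 0, _ => Nat.zero_le _
  | p + 1, X => by
    have ih := cost_gramSchmidt_le hd p fun j => X j.castSucc
    change (Timed.gramSchmidt p fun j => X j.castSucc).cost + ((Timed.projectOut _ _).cost +
      ((Timed.normalize _).cost + 0)) ≤ _
    rw [cost_projectOut, cost_normalize]
    nlinarith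

lemma cost_applyS (D : ℕ) (w : Fin n → ℝ) (z : Fin n → Vec d) (v : Vec d) :
    (Timed.applyS D w z v).cost = 4 * n * d + 2 * n + 3 * d + 6 := by
  change ∑ i, ((Timed.dot (z i) v).cost + 1) + ((∑ _i : Fin n, 0 + n) + (1 + (1 + (1 + (1 + (1 +
    (1 + ∑ _l : Fin d, ((∑ _i : Fin n, 1 + n) + (1 + (1 + 1))))))))))  = _
  simp only [cost_dot, Finset.sum_const, Finset.card_univ, Fintype.card_fin, smul_eq_mul]
  ring

lemma cost_applyM (D : ℕ) (w : Fin 1 → Fin n → ℝ) (z : Fin n → Vec d) (v : Vec d) :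
    (Timed.applyM D w z v).cost = 8 * n * d + 4 * n + 7 * d + 12 := by
  change ∑ a : Fin 1, ((Timed.applyS D (w a) z v).cost +
    (Timed.applyS D (w a) z (Timed.applyS D (w a) z v).val).cost) +
      ∑ _l : Fin d, (∑ _a : Fin 1, 0 + 1) = _
  simp only [cost_applyS, Finset.sum_const, Finset.card_univ, Fintype.card_fin, smul_eq_mul]
  ring

lemma cost_iterate_bounds {α : Type} {g : α → Timed α} {c C : ℕ} (hc : ∀ x, c ≤ (g x).cost)
    (hC : ∀ x, (g x).cost ≤ C) : ∀ (q : ℕ) (x : α),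
    q * c ≤ (Timed.iterate g q x).cost ∧ (Timed.iterate g q x).cost ≤ q * C
  | 0, _ => by
    rw [Nat.zero_mul, Nat.zero_mul]
    exact ⟨le_rfl, le_rfl⟩
  | q + 1, x => by
    obtain ⟨h1, h2⟩ := cost_iterate_bounds hc hC q x
    have e : (Timed.iterate g (q + 1) x).cost =
      (Timed.iterate g q x).cost + (g (Timed.iterate g q x).val).cost := rfl
    have h3 := hc (Timed.iterate g q x).val
    have h4 := hC (Timed.iterate g q x).val
    rw [e, Nat.succ_mul, Nat.succ_mul]
    omega

lemma cost_unfoldingStep_bounds {N k' : ℕ} (hd : 0 < d) (hN : 0 < N) (hk : k < k')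
    (hs : k' ≤ s) (q : ℕ) (feat : Fin 1 → ℝ → Vec k → ℝ) (data : Fin (N * d) → ℝ × Vec d)
    (U : Fin k → Vec d) (init : Fin (k' - k) → Vec d) :
    q * d ^ 2 ≤ (Timed.unfoldingStep q feat data U init).cost ∧
      (Timed.unfoldingStep q feat data U init).cost ≤ 100 * (s + 1) ^ 2 * N * (q + 1) * d ^ 2 := by
  have hp1 : 1 ≤ k' - k := by omega
  have hps : k' - k ≤ s := by omega
  have hks : k ≤ s := by omega
  have hM1 : d ^ 2 ≤ 8 * (N * d) * d + 4 * (N * d) + 7 * d + 12 := by nlinarith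
  have hM2 : 8 * (N * d) * d + 4 * (N * d) + 7 * d + 12 ≤ 31 * (N * d ^ 2) := by
    have h1 : N * d ≤ N * d ^ 2 := Nat.mul_le_mul_left _ (Nat.le_self_pow two_ne_zero d)
    have h2 : d ≤ N * d := Nat.le_mul_of_pos_left d hN
    have h3 : 8 * (N * d) * d = 8 * (N * d ^ 2) := by ring
    omega
  obtain ⟨z, hz⟩ : ∃ z : Fin (N * d) → Vec d, z = fun i =>
      (Timed.normalize (Timed.projectOut U (data i).2).val).val := ⟨_, rfl⟩
  obtain ⟨w, hw⟩ : ∃ w : Fin 1 → Fin (N * d) → ℝ, w = fun a i =>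
      feat a (data i).1 fun j => U j ⬝ᵥ (data i).2 := ⟨_, rfl⟩
  obtain ⟨G, hG⟩ : ∃ G : (Fin (k' - k) → Vec d) →
      Timed (Fin (k' - k) → Vec d), G = fun X => (do
      let Y ← Timed.array fun j => Timed.applyM (d - k) w z (X j)
      Timed.gramSchmidt (k' - k) Y : Timed (Fin (k' - k) → Vec d)) := ⟨_, rfl⟩
  obtain ⟨X₀, hX₀⟩ : ∃ X₀ : Fin (k' - k) → Vec d, X₀ = fun j => (Timed.projectOut U (init j)).val :=
    ⟨_, rfl⟩
  have e : (Timed.unfoldingStep q feat data U init).cost =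
      ∑ i, ∑ j, (Timed.dot (U j) (data i).2).cost + (∑ i, ((Timed.projectOut U (data i).2).cost +
        (Timed.normalize (Timed.projectOut U (data i).2).val).cost) + (∑ _a : Fin 1,
          ∑ _i : Fin (N * d), 1 + (∑ j, (Timed.projectOut U (init j)).cost +
            ((Timed.gramSchmidt (k' - k) X₀).cost +
              ((Timed.iterate G q (Timed.gramSchmidt (k' - k) X₀).val).cost + 0))))) := by
    rw [hG, hw, hz, hX₀]
    rfl
  have hGc : ∀ Y, (G Y).cost = (k' - k) * (8 * (N * d) * d + 4 * (N * d) + 7 * d + 12) +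
      (Timed.gramSchmidt (k' - k) fun j => (Timed.applyM (d - k) w z (Y j)).val).cost := fun Y => by
    rw [hG]
    change ∑ j, (Timed.applyM (d - k) w z (Y j)).cost + _ = _
    simp only [cost_applyM, Finset.sum_const, Finset.card_univ, Fintype.card_fin, smul_eq_mul]
    rfl
  have hgs : ∀ X : Fin (k' - k) → Vec d, (Timed.gramSchmidt (k' - k) X).cost ≤ s * (4 * s + 5) * (N * d ^ 2) :=
    fun X => (cost_gramSchmidt_le hd (k' - k) X).trans (Nat.mul_le_mul (Nat.mul_le_mul hps (by omega))
      ((Nat.le_self_pow two_ne_zero d).trans (Nat.le_mul_of_pos_left _ hN)))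
  obtain ⟨h1, h2⟩ := cost_iterate_bounds (g := G) (c := d ^ 2)
    (C := s * (31 * (N * d ^ 2)) + s * (4 * s + 5) * (N * d ^ 2))
    (fun Y => by
      rw [hGc]
      exact (hM1.trans (Nat.le_mul_of_pos_left _ hp1)).trans (Nat.le_add_right _ _)) (fun Y => by
      rw [hGc]
      exact Nat.add_le_add (Nat.mul_le_mul hps hM2) (hgs _)) q (Timed.gramSchmidt (k' - k) X₀).val
  have h3 := hgs X₀
  simp only [cost_dot, cost_projectOut, cost_normalize, Finset.sum_const, Finset.card_univ,
    Fintype.card_fin, smul_eq_mul, one_mul, mul_one, add_zero] at e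
  refine ⟨by rw [e]; omega, ?_⟩
  have hNd : N * d ≤ N * d ^ 2 := Nat.mul_le_mul_left _ (Nat.le_self_pow two_ne_zero d)
  have hdN : d ≤ N * d ^ 2 :=
    (Nat.le_self_pow two_ne_zero d).trans (Nat.le_mul_of_pos_left _ hN)
  have b1 : N * d * (k * (2 * d)) ≤ 2 * s * (N * d ^ 2) := by
    calc N * d * (k * (2 * d)) = 2 * k * (N * d ^ 2) := by ring
      _ ≤ _ := Nat.mul_le_mul_right _ (by omega)
  have b2 : N * d * ((4 * k + 1) * d + (3 * d + 1)) ≤ (4 * s + 5) * (N * d ^ 2) := by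
    calc N * d * ((4 * k + 1) * d + (3 * d + 1)) = (4 * k + 4) * (N * d ^ 2) + N * d := by ring
      _ ≤ (4 * k + 4) * (N * d ^ 2) + N * d ^ 2 := Nat.add_le_add_left hNd _
      _ = (4 * k + 5) * (N * d ^ 2) := by ring
      _ ≤ _ := Nat.mul_le_mul_right _ (by omega)
  have b3 : (k' - k) * ((4 * k + 1) * d) ≤ s * (4 * s + 1) * (N * d ^ 2) := by
    rw [← mul_assoc]
    exact Nat.mul_le_mul (Nat.mul_le_mul hps (by omega)) hdN
  obtain ⟨x, hx⟩ : ∃ x, x = N * d ^ 2 := ⟨_, rfl⟩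
  rw [← hx] at b1 b2 b3 h2 h3 hNd
  have hfin : 100 * (s + 1) ^ 2 * N * (q + 1) * d ^ 2 = 100 * (s + 1) ^ 2 * (q + 1) * x := by
    rw [hx]; ring
  rw [e, hfin]
  refine (Nat.add_le_add b1 (Nat.add_le_add b2 (Nat.add_le_add hNd (Nat.add_le_add b3
    (Nat.add_le_add h3 h2))))).trans ?_
  nlinarith [Nat.zero_le (q * x), Nat.zero_le (q * x * s), Nat.zero_le (q * x * s ^ 2),
    Nat.zero_le (x * s), Nat.zero_le (x * s ^ 2)]

lemma cost_unfolding_le {N T : ℕ} {σ : ℕ → ℕ} (hd : 0 < d) (hN : 0 < N)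
    (hσ : ∀ t < T, σ t < σ (t + 1)) (hs : ∀ t ≤ T, σ t ≤ s) (q : ℕ)
    (feat : (t : ℕ) → Fin 1 → ℝ → Vec (σ t) → ℝ) (data : Fin T → Fin (N * d) → ℝ × Vec d)
    (init : (t : Fin T) → Fin (σ (t + 1) - σ t) → Vec d) : ∀ (t : ℕ) (ht : t ≤ T),
    (Timed.unfolding q feat data init t ht).cost ≤
      t * (100 * (s + 1) ^ 2 * N * (q + 1) * d ^ 2)
  | 0, _ => Nat.zero_le _
  | t + 1, ht => by
    have ih := cost_unfolding_le hd hN hσ hs q feat data init t (Nat.le_of_succ_le ht)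
    have h1 := (cost_unfoldingStep_bounds hd hN (hσ t ht) (hs _ ht) q (feat t) (data ⟨t, ht⟩)
      (Timed.unfolding q feat data init t (Nat.le_of_succ_le ht)).val (init ⟨t, ht⟩)).2
    rw [Nat.succ_mul]
    exact Nat.add_le_add ih h1

lemma le_cost_unfolding {N T : ℕ} {σ : ℕ → ℕ} (hd : 0 < d) (hN : 0 < N) (hT : 0 < T)
    (hσ : ∀ t < T, σ t < σ (t + 1)) (hs : ∀ t ≤ T, σ t ≤ s) (q : ℕ)
    (feat : (t : ℕ) → Fin 1 → ℝ → Vec (σ t) → ℝ) (data : Fin T → Fin (N * d) → ℝ × Vec d)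
    (init : (t : Fin T) → Fin (σ (t + 1) - σ t) → Vec d) :
    q * d ^ 2 ≤ (Timed.unfolding q feat data init T le_rfl).cost := by
  obtain ⟨t, rfl⟩ := Nat.exists_eq_succ_of_ne_zero hT.ne'
  exact (cost_unfoldingStep_bounds hd hN (hσ t (Nat.lt_succ_self t)) (hs _ le_rfl) q (feat t)
    (data ⟨t, Nat.lt_succ_self t⟩) (Timed.unfolding q feat data init t (Nat.le_succ t)).val
      (init ⟨t, Nat.lt_succ_self t⟩)).1.trans (Nat.le_add_left _ _)

/-- With logarithmically many rounds the running time is of order `d² log d`. -/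
lemma eventually_cost_bounds {N T : ℕ} {σ : ℕ → ℕ} {κ : ℝ} (hκ : 0 < κ) (hN : 0 < N) (hT : 0 < T)
    (hσ : ∀ t < T, σ t < σ (t + 1)) (hs : ∀ t ≤ T, σ t ≤ s) :
    ∀ᶠ d : ℕ in atTop, ∀ (feat : (t : ℕ) → Fin 1 → ℝ → Vec (σ t) → ℝ)
      (data : Fin T → Fin (N * d) → ℝ × Vec d)
      (init : (t : Fin T) → Fin (σ (t + 1) - σ t) → Vec d),
      κ * (d : ℝ) ^ 2 * Real.log d ≤
        ((Timed.unfolding ⌈κ * Real.log d⌉₊ feat data init T le_rfl).cost : ℝ) ∧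
      ((Timed.unfolding ⌈κ * Real.log d⌉₊ feat data init T le_rfl).cost : ℝ) ≤
        T * (100 * (s + 1) ^ 2 * N * (κ + 2)) * (d : ℝ) ^ 2 * Real.log d := by
  have hlog : Tendsto (fun d : ℕ => Real.log d) atTop atTop :=
    Real.tendsto_log_atTop.comp tendsto_natCast_atTop_atTop
  filter_upwards [hlog.eventually_ge_atTop 1, eventually_gt_atTop 0] with d hl hd feat data init
  have h1 := le_cost_unfolding hd hN hT hσ hs ⌈κ * Real.log d⌉₊ feat data init
  have h2 := cost_unfolding_le hd hN hσ hs ⌈κ * Real.log d⌉₊ feat data init T le_rfl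
  have h3 := Nat.le_ceil (κ * Real.log d)
  have h4 := (Nat.ceil_lt_add_one (by positivity : 0 ≤ κ * Real.log d)).le
  constructor
  · refine le_trans ?_ (Nat.cast_le.2 h1)
    push_cast
    nlinarith [sq_nonneg (d : ℝ)]
  · refine (Nat.cast_le.2 h2).trans ?_
    push_cast
    have h5 : ((⌈κ * Real.log d⌉₊ : ℕ) : ℝ) + 1 ≤ (κ + 2) * Real.log d := by nlinarith
    calc (T : ℝ) * (100 * ((s : ℝ) + 1) ^ 2 * N * ((⌈κ * Real.log d⌉₊ : ℕ) + 1) * (d : ℝ) ^ 2)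
        ≤ (T : ℝ) * (100 * ((s : ℝ) + 1) ^ 2 * N * ((κ + 2) * Real.log d) * (d : ℝ) ^ 2) := by
          gcongr
      _ = _ := by ring

/-! ### Choice of the parameters -/

lemma eventually_mul_exp_neg_le (T : ℕ) : ∀ᶠ d : ℕ in atTop,
    T * ENNReal.ofReal (Real.exp (-d)) ≤ ENNReal.ofReal (Real.exp (-(d : ℝ) ^ (1 / 2 : ℝ))) := by
  filter_upwards [eventually_ge_atTop (max 4 (2 * T))] with d hd
  have h4 : (4 : ℝ) ≤ d := by exact_mod_cast (le_max_left _ _).trans hd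
  have hT : 2 * (T : ℝ) ≤ d := by exact_mod_cast (le_max_right _ _).trans hd
  rw [← Real.sqrt_eq_rpow, ← ENNReal.ofReal_natCast, ← ENNReal.ofReal_mul (Nat.cast_nonneg _)]
  refine ENNReal.ofReal_le_ofReal ?_
  have hs : √d ≤ d / 2 := by
    rw [Real.sqrt_le_left (by positivity)]
    nlinarith
  have h1 : (T : ℝ) ≤ Real.exp (d - √d) := by
    have := Real.add_one_le_exp ((d : ℝ) - √d)
    linarith
  calc (T : ℝ) * Real.exp (-d) ≤ Real.exp (d - √d) * Real.exp (-d) :=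
        mul_le_mul_of_nonneg_right h1 (Real.exp_pos _).le
    _ = _ := by rw [← Real.exp_add]; congr 1; ring

lemma eventually_failure_le (T s : ℕ) {A : ℝ} (hA : 0 < A) : ∀ᶠ d : ℕ in atTop,
    T * (ENNReal.ofReal (Real.exp (-d)) + s * (ENNReal.ofReal ((d : ℝ) ^ (-(A + 2))) +
      ENNReal.ofReal (d / ((d : ℝ) ^ (A + 2)) ^ 2))) ≤ ENNReal.ofReal ((d : ℝ) ^ (-A)) := by
  have hexp := ((tendsto_rpow_mul_exp_neg_mul_atTop_nhds_zero (A + 1) 1 one_pos).comp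
    tendsto_natCast_atTop_atTop).eventually (ge_mem_nhds (zero_lt_one' ℝ))
  filter_upwards [hexp, eventually_ge_atTop (T * (1 + 2 * s) + 1)] with d hd1 hd2
  have hd1' : (d : ℝ) ^ (A + 1) * Real.exp (-1 * d) ≤ 1 := hd1
  have hdpos : (0 : ℝ) < d := by exact_mod_cast (by omega : 0 < d)
  have hone : (1 : ℝ) ≤ d := by exact_mod_cast (by omega : 1 ≤ d)
  have e1 : Real.exp (-d) ≤ (d : ℝ) ^ (-(A + 1)) := by
    rw [Real.rpow_neg hdpos.le, ← one_div, le_div_iff₀ (by positivity), mul_comm]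
    simpa using hd1'
  have e2 : (d : ℝ) ^ (-(A + 2)) ≤ (d : ℝ) ^ (-(A + 1)) :=
    Real.rpow_le_rpow_of_exponent_le hone (by linarith)
  have e3 : (d : ℝ) / ((d : ℝ) ^ (A + 2)) ^ 2 ≤ (d : ℝ) ^ (-(A + 1)) := by
    have h : (d : ℝ) / ((d : ℝ) ^ (A + 2)) ^ 2 = (d : ℝ) ^ (1 - (A + 2) * 2) := by
      rw [Real.rpow_sub hdpos, Real.rpow_one, Real.rpow_mul hdpos.le]
      norm_num
    rw [h]
    exact Real.rpow_le_rpow_of_exponent_le hone (by linarith)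
  have e4 : (d : ℝ) ^ (-(A + 1)) * d = (d : ℝ) ^ (-A) := by
    rw [← Real.rpow_add_one hdpos.ne']
    congr 1
    ring
  have hT : (T : ℝ) * (1 + 2 * s) ≤ d := by
    exact_mod_cast (Nat.le_succ _).trans hd2
  have hx : (0 : ℝ) ≤ (d : ℝ) ^ (-(A + 1)) := by positivity
  have hs0 : (0 : ℝ) ≤ s := Nat.cast_nonneg s
  rw [← ENNReal.ofReal_natCast T, ← ENNReal.ofReal_natCast s,
    ← ENNReal.ofReal_add (by positivity) (by positivity), ← ENNReal.ofReal_mul hs0,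
    ← ENNReal.ofReal_add (by positivity) (by positivity), ← ENNReal.ofReal_mul (Nat.cast_nonneg _)]
  refine ENNReal.ofReal_le_ofReal ?_
  calc (T : ℝ) * (Real.exp (-d) + s * ((d : ℝ) ^ (-(A + 2)) + d / ((d : ℝ) ^ (A + 2)) ^ 2))
      ≤ T * ((d : ℝ) ^ (-(A + 1)) + s * ((d : ℝ) ^ (-(A + 1)) + (d : ℝ) ^ (-(A + 1)))) := by gcongr
    _ = (d : ℝ) ^ (-(A + 1)) * (T * (1 + 2 * s)) := by ring
    _ ≤ (d : ℝ) ^ (-(A + 1)) * d := mul_le_mul_of_nonneg_left hT hx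
    _ = _ := e4

lemma eventually_iteration_error_le (p : ℕ) {A b : ℝ} (hb : 0 < b) : ∀ᶠ d : ℕ in atTop,
    2 * (p : ℝ) * ((1 / 2) ^ ⌈(2 * A + 6) / Real.log 2 * Real.log d⌉₊ *
      (p * (d : ℝ) ^ (A + 2) / (d : ℝ) ^ (-(A + 2)))) ^ 2 ≤ b ^ 2 := by
  have hlim : Tendsto (fun d : ℕ => 2 * (p : ℝ) * ((d : ℝ) ^ (-2 : ℝ) * p) ^ 2) atTop
      (nhds (2 * (p : ℝ) * (0 * p) ^ 2)) :=
    ((((tendsto_rpow_neg_atTop two_pos).comp tendsto_natCast_atTop_atTop).mul_const _).pow 2).const_mul _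
  rw [zero_mul, zero_pow two_ne_zero, mul_zero] at hlim
  filter_upwards [hlim.eventually (ge_mem_nhds (by positivity : 0 < b ^ 2)),
    eventually_ge_atTop 1] with d hd hd1
  have hdpos : (0 : ℝ) < d := by exact_mod_cast hd1
  refine le_trans (mul_le_mul_of_nonneg_left (pow_le_pow_left₀ (by positivity) ?_ 2)
    (by positivity)) hd
  have hlog2 : 0 < Real.log 2 := Real.log_pos one_lt_two
  have h1 : ((1 : ℝ) / 2) ^ ⌈(2 * A + 6) / Real.log 2 * Real.log d⌉₊ ≤
      (d : ℝ) ^ (-(2 * A + 6)) := by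
    rw [← Real.rpow_natCast, Real.rpow_def_of_pos (by norm_num), Real.rpow_def_of_pos hdpos]
    refine Real.exp_le_exp.2 ?_
    have h2 := Nat.le_ceil ((2 * A + 6) / Real.log 2 * Real.log d)
    have h3 : Real.log (1 / 2) = -Real.log 2 := by rw [one_div, Real.log_inv]
    have h4 : (2 * A + 6) / Real.log 2 * Real.log d * Real.log 2 = Real.log d * (2 * A + 6) := by
      field_simp
    rw [h3]
    nlinarith [mul_le_mul_of_nonneg_right h2 hlog2.le]
  have h2 : (d : ℝ) ^ (-(2 * A + 6)) * ((d : ℝ) ^ (A + 2) / (d : ℝ) ^ (-(A + 2))) =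
      (d : ℝ) ^ (-2 : ℝ) := by
    rw [← Real.rpow_sub hdpos, ← Real.rpow_add hdpos]
    congr 1
    ring
  calc _ = (1 / 2) ^ ⌈(2 * A + 6) / Real.log 2 * Real.log d⌉₊ *
        ((d : ℝ) ^ (A + 2) / (d : ℝ) ^ (-(A + 2))) * p := by ring
    _ ≤ (d : ℝ) ^ (-(2 * A + 6)) * ((d : ℝ) ^ (A + 2) / (d : ℝ) ^ (-(A + 2))) * p := by gcongr
    _ = _ := by rw [h2]

/-- Degree two unfolding recovers the support with linearly many samples in almost quadratic
time. -/
lemma exists_unfolding_algorithm (hs : 0 < s) {f : MvPolynomial (Fin s) ℝ} (ρ : Measure ℝ)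
    [IsProbabilityMeasure ρ] (hf : DependsOnAll f) {δ A : ℝ} (hδ : 0 < δ) (hA : 0 < A) :
    ∃ (T m N : ℕ) (σ : ℕ → ℕ) (B κ c c₁ C₁ : ℝ),
      T ≤ s ∧ 0 < N ∧ 0 < κ ∧ 0 < c ∧ 0 < c₁ ∧
      σ 0 = 0 ∧ σ T = s ∧ (∀ t < T, σ t < σ (t + 1)) ∧
      ∀ᶠ d : ℕ in atTop,
        ∃ feat : (t : ℕ) → Fin m → ℝ → Vec (σ t) → ℝ,
          (∀ t < T, IsAdmissible B (feat t)) ∧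
          (∀ W : Mat d s, IsFrame W →
            dataLaw T (N * d) (polyModel f ρ W)
                {data | ¬ ((∃ U : (t : ℕ) → Mat d (σ t),
                      IsUnfoldingRun feat data U) ∧
                    ∀ U : (t : ℕ) → Mat d (σ t),
                      IsUnfoldingRun feat data U → frameDist (U T) W ≤ δ)}
              ≤ ENNReal.ofReal (Real.exp (-(d : ℝ) ^ c)) ∧
            ((dataLaw T (N * d) (polyModel f ρ W)).prod (initLaw d T σ))
                {ω | ¬ frameDist (Matrix.transpose (Matrix.of (Timed.unfolding
                      ⌈κ * Real.log d⌉₊ feat ω.1 ω.2 T le_rfl).val)) W ≤ δ}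
              ≤ ENNReal.ofReal ((d : ℝ) ^ (-A))) ∧
          ∀ (data : Fin T → Fin (N * d) → ℝ × Vec d)
            (init : (t : Fin T) → Fin (σ (t + 1) - σ t) → Vec d),
            c₁ * (d : ℝ) ^ 2 * Real.log d ≤
              ((Timed.unfolding ⌈κ * Real.log d⌉₊ feat data init T le_rfl).cost : ℝ) ∧
            ((Timed.unfolding ⌈κ * Real.log d⌉₊ feat data init T le_rfl).cost : ℝ) ≤
              C₁ * (d : ℝ) ^ 2 * Real.log d := by
  obtain ⟨T, σ, Pr, τ, θ, lam, a, η, N, hT, hN, haT, h, hB⟩ := exists_stageChain ρ hf hδ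
  have hF : Continuous fun x => MvPolynomial.eval x f := MvPolynomial.continuous_eval f
  have hlog2 : 0 < Real.log 2 := Real.log_pos one_lt_two
  have hκ : 0 < (2 * A + 6) / Real.log 2 := by positivity
  have hT0 : 0 < T := by
    rcases Nat.eq_zero_or_pos T with rfl | hT
    · have h1 := h.sigma_zero
      have h2 := h.sigma_last
      omega
    · exact hT
  have hσ : ∀ t < T, σ t < σ (t + 1) := fun t ht => (h.stage t ht).lt
  refine ⟨T, 1, N, σ, 1, (2 * A + 6) / Real.log 2, 1 / 2, (2 * A + 6) / Real.log 2,
    T * (100 * (s + 1) ^ 2 * N * ((2 * A + 6) / Real.log 2 + 2)), hT, hN, hκ, by norm_num, hκ,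
    h.sigma_zero, h.sigma_last, hσ, ?_⟩
  have hq : ∀ᶠ d : ℕ in atTop, ∀ t ∈ Finset.range T, 2 * ((σ (t + 1) - σ t : ℕ) : ℝ) *
      ((1 / 2) ^ ⌈(2 * A + 6) / Real.log 2 * Real.log d⌉₊ * (((σ (t + 1) - σ t : ℕ) : ℝ) *
        (d : ℝ) ^ (A + 2) / (d : ℝ) ^ (-(A + 2)))) ^ 2 ≤ (a (t + 1) / 3) ^ 2 :=
    (Finset.eventually_all _).2 fun t ht => eventually_iteration_error_le _
      (div_pos (h.pos (t + 1) (Finset.mem_range.1 ht)) (by norm_num))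
  filter_upwards [hB, hq, eventually_ge_atTop s, eventually_gt_atTop 0, eventually_mul_exp_neg_le T,
    eventually_failure_le T s hA,
    eventually_cost_bounds hκ hN hT0 hσ fun t ht => h.sigma_le ht] with d hB hq hd hd0 he hf' hcost
  have hdpos : (0 : ℝ) < d := by exact_mod_cast hd0
  refine ⟨fun t => radialFeature d (τ t), fun t ht => isAdmissible_radialFeature d
    (h.continuous ht).measurable (h.stage t ht).abs_le_one _, fun W hW => ⟨?_, ?_⟩, hcost _⟩
  · rw [polyModel_eq_map hd0, ← haT]
    exact (h.measure_run_le hF hW hd hB).trans he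
  · rw [polyModel_eq_map hd0, ← haT]
    exact (h.measure_implementation_le hF hW hd hB (by positivity) (by positivity)
      fun t ht => hq t (Finset.mem_range.2 ht)).trans hf'

/-! ### The second harmonic coefficient: conditional expectations and invariance -/

lemma integral_condExp_sq_le {α : Type*} {m m₀ : MeasurableSpace α} {μ : Measure α}
    [IsProbabilityMeasure μ] (hm : m ≤ m₀) {g : α → ℝ} (hg : MemLp g 2 μ) :
    Integrable (fun x => (μ[g | m]) x ^ 2) μ ∧ ∫ x, (μ[g | m]) x ^ 2 ∂μ ≤ ∫ x, g x ^ 2 ∂μ := by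
  have h1 : Integrable (fun x => (μ[g | m]) x ^ 2) μ := (hg.condExp one_le_two).integrable_sq
  refine ⟨h1, ?_⟩
  have h2 := ConvexOn.map_condExp_le_univ (μ := μ) (φ := fun x : ℝ => x ^ 2) hm
    (even_two.convexOn_pow) (continuous_pow 2).lowerSemicontinuous
    (hg.integrable one_le_two) hg.integrable_sq
  calc _ ≤ ∫ x, (μ[(fun x : ℝ => x ^ 2) ∘ g | m]) x ∂μ :=
        integral_mono_ae h1 integrable_condExp h2
    _ = _ := integral_condExp hm

lemma integral_mul_condExp {α : Type*} {m m₀ : MeasurableSpace α} {μ : Measure α}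
    [IsProbabilityMeasure μ] (hm : m ≤ m₀) {w g : α → ℝ} (hw : StronglyMeasurable[m] w)
    (hw1 : ∀ x, |w x| ≤ 1) (hg : Integrable g μ) :
    ∫ x, w x * (μ[g | m]) x ∂μ = ∫ x, w x * g x ∂μ := by
  have hi : Integrable (w * g) μ :=
    hg.bdd_mul (c := 1) (hw.mono hm).aestronglyMeasurable (Eventually.of_forall hw1)
  rw [← integral_condExp hm (f := fun x => w x * g x)]
  exact integral_congr_ae (condExp_mul_of_stronglyMeasurable_left hw hi hg).symm

/-- The reflection of `x` in the hyperplane orthogonal to the unit vector `u`. -/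
def reflect (u x : Vec d) : Vec d := x - (2 * (u ⬝ᵥ x)) • u

lemma reflect_reflect {u : Vec d} (hu : nrm u = 1) (x : Vec d) :
    reflect u (reflect u x) = x := by
  have h : u ⬝ᵥ u = 1 := by rw [dot_self_eq_nrm_sq, hu, one_pow]
  rw [reflect, reflect, dotProduct_sub, dotProduct_smul, h]
  ext i
  simp only [Pi.sub_apply, Pi.smul_apply, smul_eq_mul]
  ring

lemma reflect_dot (u x y : Vec d) : reflect u x ⬝ᵥ y = x ⬝ᵥ reflect u y := by
  rw [reflect, reflect, sub_dotProduct, dotProduct_sub, smul_dotProduct, dotProduct_smul,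
    dotProduct_comm x u]
  simp only [smul_eq_mul]
  ring

lemma nrm_reflect {u : Vec d} (hu : nrm u = 1) (x : Vec d) : nrm (reflect u x) = nrm x := by
  rw [nrm_eq_sqrt, nrm_eq_sqrt, reflect_dot, reflect_reflect hu]

lemma reflect_smul (u : Vec d) (a : ℝ) (x : Vec d) :
    reflect u (a • x) = a • reflect u x := by
  rw [reflect, reflect, dotProduct_smul, smul_sub, smul_smul, smul_eq_mul]
  ring_nf

lemma reflect_eq_mulVec (u : Vec d) :
    (reflect u : Vec d → Vec d) = fun x => (1 - (2 : ℝ) • vecMulVec u u) *ᵥ x := by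
  funext x
  ext i
  simp only [reflect, Pi.sub_apply, Pi.smul_apply, smul_eq_mul, sub_mulVec, one_mulVec,
    smul_mulVec, vecMulVec_mulVec, op_smul_eq_smul]
  ring

lemma measurable_reflect (u : Vec d) : Measurable (reflect u) := by
  rw [reflect_eq_mulVec]
  exact measurable_mulVec _

lemma mulVec_reflect {A : Mat s d} {u : Vec d} (hu : A *ᵥ u = 0)
    (x : Vec d) : A *ᵥ reflect u x = A *ᵥ x := by
  rw [reflect, mulVec_sub, mulVec_smul, hu, smul_zero, sub_zero]

lemma map_reflect_gaussianVec {u : Vec d} (hu : nrm u = 1) :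
    (gaussianVec d).map (reflect u) = gaussianVec d := by
  have h : (vecMulVec u u * vecMulVec u u : Mat d d) = vecMulVec u u := by
    rw [vecMulVec_mul_vecMulVec, dot_self_eq_nrm_sq, hu]
    simp
  have hR : IsFrame (1 - (2 : ℝ) • vecMulVec u u) := by
    rw [IsFrame, transpose_sub, transpose_smul, transpose_vecMulVec, transpose_one, Matrix.sub_mul,
      Matrix.mul_sub, Matrix.one_mul, Matrix.one_mul, Matrix.mul_sub, Matrix.smul_mul,
      Matrix.mul_smul, Matrix.smul_mul, h, Matrix.mul_one]
    module
  have := hR.map_gaussianVec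
  rwa [transpose_sub, transpose_smul, transpose_vecMulVec, transpose_one,
    ← reflect_eq_mulVec] at this

lemma direction_reflect {u : Vec d} (hu : nrm u = 1) (g : Vec d) :
    direction (reflect u g) = reflect u (direction g) := by
  rw [direction, direction, nrm_reflect hu, reflect_smul]

/-- The law of `(y, z)` is invariant under reflections which fix the support. -/
lemma map_reflect_model {F : Vec s → ℝ} (hF : Measurable F) (ρ : Measure ℝ)
    [IsProbabilityMeasure ρ] {W : Mat d s} {u : Vec d} (hu : nrm u = 1)
    (hWu : Wᵀ *ᵥ u = 0) :
    (((gaussianVec d).prod ρ).map (modelMap F W)).map (Prod.map id (reflect u)) =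
      ((gaussianVec d).prod ρ).map (modelMap F W) := by
  have hR := measurable_reflect u
  have e : Prod.map id (reflect u) ∘ modelMap F W = modelMap F W ∘ Prod.map (reflect u) id := by
    funext p
    simp only [Function.comp_apply, modelMap, Prod.map_apply, Prod.map_fst, Prod.map_snd, id_eq,
      direction_reflect hu, mulVec_reflect hWu]
  rw [Measure.map_map (measurable_id.prodMap hR) (measurable_modelMap hF W), e,
    ← Measure.map_map (measurable_modelMap hF W) (hR.prodMap measurable_id),
    ← Measure.map_prod_map _ _ hR measurable_id, map_reflect_gaussianVec hu, Measure.map_id]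

/-- A traceless symmetric form which is invariant under all reflections fixing the span of `W` is
determined by its restriction to that span. -/
lemma eq_of_reflect_invariant (hsd : s < d) {W : Mat d s}
    (hW : IsFrame W) {A : Mat d d} (hA : Aᵀ = A) (htr : A.trace = 0)
    (hinv : ∀ u : Vec d, Wᵀ *ᵥ u = 0 → nrm u = 1 → ∀ x : Vec d,
      reflect u x ⬝ᵥ (A *ᵥ reflect u x) = x ⬝ᵥ (A *ᵥ x)) :
    A = (W * Wᵀ) * A * (W * Wᵀ) -
      (((W * Wᵀ) * A * (W * Wᵀ)).trace / ((d : ℝ) - s)) • (1 - W * Wᵀ) := by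
  have horth : ∀ u y : Vec d, Wᵀ *ᵥ u = 0 → u ⬝ᵥ y = 0 → y ⬝ᵥ (A *ᵥ u) = 0 := by
    intro u y hu hy
    by_cases h0 : u = 0
    · rw [h0, mulVec_zero, dotProduct_zero]
    have hn := nrm_pos h0
    have hr : reflect (direction u) (y + u) = y - u := by
      have h1 : direction u ⬝ᵥ (y + u) = nrm u := by
        rw [direction, smul_dotProduct, dotProduct_add, hy, dot_self_eq_nrm_sq, smul_eq_mul]
        field_simp
        ring
      rw [reflect, h1, direction, smul_smul, mul_assoc, mul_inv_cancel₀ hn.ne']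
      module
    have h2 := hinv (direction u) (by rw [direction, mulVec_smul, hu, smul_zero])
      (nrm_direction h0) (y + u)
    rw [hr] at h2
    simp only [mulVec_sub, mulVec_add, dotProduct_sub, dotProduct_add, sub_dotProduct,
      add_dotProduct, dot_mulVec_comm hA u y] at h2
    linarith
  have hswap : ∀ e f : Vec d, Wᵀ *ᵥ e = 0 → Wᵀ *ᵥ f = 0 → nrm e = nrm f →
      f ⬝ᵥ (A *ᵥ f) = e ⬝ᵥ (A *ᵥ e) := by
    intro e f he hf hef
    by_cases h0 : e - f = 0
    · rw [sub_eq_zero.1 h0]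
    have hy : (e - f) ⬝ᵥ (e + f) = 0 := by
      rw [sub_dotProduct, dotProduct_add, dotProduct_add, dot_self_eq_nrm_sq, dot_self_eq_nrm_sq, hef,
        dotProduct_comm f e]
      ring
    have h1 := horth (e - f) (e + f) (by rw [mulVec_sub, he, hf, sub_zero]) hy
    simp only [mulVec_sub, dotProduct_sub, add_dotProduct, dot_mulVec_comm hA f e] at h1
    linarith
  obtain ⟨Wp, hWp⟩ := exists_isComplement hW
  have hc := hWp.add_eq_one hW
  have hWWp : Wᵀ * Wp = 0 := hWp.2
  obtain ⟨e, he⟩ : ∃ e : Vec d, e = Wp *ᵥ Pi.single ⟨0, by omega⟩ 1 := ⟨_, rfl⟩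
  have hWe : Wᵀ *ᵥ e = 0 := by rw [he, mulVec_mulVec, hWWp, zero_mulVec]
  have hne : nrm e = 1 := by
    rw [he, hWp.1.nrm_mulVec, nrm_eq_sqrt]
    simp
  obtain ⟨lam, hlam⟩ : ∃ lam, lam = e ⬝ᵥ (A *ᵥ e) := ⟨_, rfl⟩
  have hscal : ∀ q : Vec d, Wᵀ *ᵥ q = 0 → q ⬝ᵥ (A *ᵥ q) = lam * (q ⬝ᵥ q) := by
    intro q hq
    have h1 := hswap (nrm q • e) q (by rw [mulVec_smul, hWe, smul_zero]) hq
      (by rw [nrm_smul, hne, abs_of_nonneg (nrm_nonneg q), mul_one])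
    rw [h1, mulVec_smul, smul_dotProduct, dotProduct_smul, ← hlam, dot_self_eq_nrm_sq]
    simp only [smul_eq_mul]
    ring
  have hPt := proj_transpose W
  have hPP := proj_mul_self hW
  obtain ⟨P, hP⟩ : ∃ P, P = W * Wᵀ := ⟨_, rfl⟩
  rw [← hP] at hPt hPP ⊢
  have hWq : ∀ x, Wᵀ *ᵥ (x - P *ᵥ x) = 0 := fun x => by
    rw [mulVec_sub, mulVec_mulVec, hP, ← Matrix.mul_assoc, (hW : Wᵀ * W = 1),
      Matrix.one_mul, sub_self]
  have hqP : ∀ x, (x - P *ᵥ x) ⬝ᵥ (P *ᵥ x) = 0 := fun x => by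
    rw [mulVec_dot, hPt, mulVec_sub, mulVec_mulVec, hPP, sub_self, zero_dotProduct]
  have hform : ∀ x : Vec d, x ⬝ᵥ ((A - P * A * P - lam • (1 - P)) *ᵥ x) = 0 := by
    intro x
    have h1 := hscal _ (hWq x)
    have h2 := horth _ _ (hWq x) (hqP x)
    have h3 : x ⬝ᵥ (A *ᵥ x) = (P *ᵥ x + (x - P *ᵥ x)) ⬝ᵥ (A *ᵥ (P *ᵥ x + (x - P *ᵥ x))) := by
      rw [add_sub_cancel]
    have h4 : (x - P *ᵥ x) ⬝ᵥ (x - P *ᵥ x) = x ⬝ᵥ (x - P *ᵥ x) := by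
      have h5 := hqP x
      rw [dotProduct_comm] at h5
      rw [sub_dotProduct, h5, sub_zero]
    rw [mulVec_add, dotProduct_add, add_dotProduct, add_dotProduct, h1, h2,
      dot_mulVec_comm hA (x - P *ᵥ x) (P *ᵥ x), h2, h4] at h3
    rw [sub_mulVec, sub_mulVec, dotProduct_sub, dotProduct_sub, h3,
      ← mulVec_mulVec, ← mulVec_mulVec, mulVec_dot P, hPt, smul_mulVec,
      sub_mulVec, one_mulVec, dotProduct_smul, smul_eq_mul]
    ring
  have hE : A - P * A * P - lam • (1 - P) = 0 := by
    have hEt : (A - P * A * P - lam • (1 - P))ᵀ = A - P * A * P - lam • (1 - P) := by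
      rw [transpose_sub, transpose_sub, transpose_smul, transpose_sub, transpose_one,
        transpose_mul, transpose_mul, hPt, hA, Matrix.mul_assoc]
    have hq : QForm (A - P * A * P - lam • (1 - P)) 0 := fun x => by
      rw [hform x]
      simp
    ext i j
    have := hq.bilin hEt (Pi.single i 1) (Pi.single j 1)
    simpa using this
  have htrP : (1 - P).trace = (d : ℝ) - s := by
    rw [trace_sub, trace_one, hP, trace_mul_comm, (hW : Wᵀ * W = 1),
      trace_one]
    simp
  have hds : (0 : ℝ) < (d : ℝ) - s := sub_pos.2 (by exact_mod_cast hsd)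
  have h5 := congrArg Matrix.trace hE
  rw [trace_sub, trace_sub, htr, trace_smul, htrP, smul_eq_mul,
    trace_zero] at h5
  have h6 : lam = -((P * A * P).trace / ((d : ℝ) - s)) := by
    field_simp
    linarith
  rw [h6] at hE
  rw [← sub_eq_zero, ← hE]
  module

/-! ### The upper bound for the second harmonic coefficient -/

lemma IsFrame.frob_transpose_mul_le {U : Mat d k} (hU : IsFrame U)
    (A : Mat d l) : ‖Uᵀ * A‖ ≤ ‖A‖ := by
  refine (sq_le_sq₀ (norm_nonneg _) (norm_nonneg _)).1 ?_
  rw [frob_sq_eq_sum_nrm_col, frob_sq_eq_sum_nrm_col]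
  refine Finset.sum_le_sum fun j _ => ?_
  have h : nrm (Uᵀ *ᵥ fun i => A i j) ≤ nrm fun i => A i j := hU.nrm_transpose_mulVec_le _
  exact pow_le_pow_left₀ (nrm_nonneg _) h 2

lemma IsFrame.frob_conj_le {U : Mat d k} (hU : IsFrame U)
    (A : Mat d d) : ‖Uᵀ * A * U‖ ≤ ‖A‖ := by
  calc ‖Uᵀ * A * U‖ = ‖(Uᵀ * A * U)ᵀ‖ := (frobenius_norm_transpose _).symm
    _ = ‖Uᵀ * (Aᵀ * U)‖ := by rw [transpose_mul, transpose_mul, transpose_transpose]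
    _ ≤ ‖Aᵀ * U‖ := hU.frob_transpose_mul_le _
    _ = ‖(Aᵀ * U)ᵀ‖ := (frobenius_norm_transpose _).symm
    _ = ‖Uᵀ * A‖ := by rw [transpose_mul, transpose_transpose]
    _ ≤ ‖A‖ := hU.frob_transpose_mul_le _

lemma harmonicTwo_reducedInput {U : Mat d k}
    {Up : Mat d (d - k)} (hU : IsFrame U) (hUp : IsComplement U Up)
    (p : ℝ × Vec d) :
    harmonicTwo (reducedInput U Up p) = Upᵀ * redMat (U * Uᵀ) (d - k) p.2 * Up := by
  have h : Upᵀ * Up = 1 := hUp.1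
  rw [← lift_harmonicTwo hU hUp, Matrix.mul_assoc, Matrix.mul_assoc, h, Matrix.mul_one,
    ← Matrix.mul_assoc, h, Matrix.one_mul]

lemma frob_vecMulVec (u : Vec d) : ‖vecMulVec u u‖ = nrm u ^ 2 := by
  refine (sq_eq_sq₀ (norm_nonneg _) (sq_nonneg _)).1 ?_
  rw [frob_sq, ← dot_self_eq_nrm_sq, sq, dotProduct, Finset.sum_mul_sum]
  refine Finset.sum_congr rfl fun i _ => Finset.sum_congr rfl fun j _ => ?_
  rw [vecMulVec_apply]
  ring

lemma exists_norm_redMat_le {Q : Mat d d} (hQt : Qᵀ = Q) (hQ : Q * Q = Q)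
    (D : ℕ) : ∃ K : ℝ, ∀ z : Vec d, nrm z ≤ 1 → ‖redMat Q D z‖ ≤ K := by
  refine ⟨√((D : ℝ) * (D + 2) / 2) * (1 + ‖(1 / (D : ℝ)) • (1 - Q)‖), fun z hz => ?_⟩
  have h1 := nrm_sub_proj_sq hQt hQ z
  obtain ⟨b, hb⟩ : ∃ b, b = 1 - z ⬝ᵥ (Q *ᵥ z) := ⟨_, rfl⟩
  have h2 : nrm (z - Q *ᵥ z) ^ 2 ≤ b := by
    have := pow_le_one₀ (n := 2) (nrm_nonneg z) hz
    linarith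
  have hb0 : 0 ≤ b := (sq_nonneg _).trans h2
  have h3 : ‖(√b)⁻¹ ^ 2 • vecMulVec (z - Q *ᵥ z) (z - Q *ᵥ z)‖ ≤ 1 := by
    rw [norm_smul, frob_vecMulVec, inv_pow, Real.sq_sqrt hb0, Real.norm_eq_abs,
      abs_of_nonneg (inv_nonneg.2 hb0)]
    exact inv_mul_le_one_of_le₀ h2 hb0
  rw [redMat, ← hb, norm_smul, Real.norm_eq_abs, abs_of_nonneg (Real.sqrt_nonneg _)]
  gcongr
  exact (norm_sub_le _ _).trans (add_le_add h3 le_rfl)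

lemma measurable_redMat (Q : Mat d d) (D : ℕ) :
    Measurable (redMat Q D) := by
  refine measurable_matrix_iff.2 fun i j => ?_
  have h : ∀ i, Measurable fun z : Vec d => (Q *ᵥ z) i := fun i =>
    (measurable_pi_apply i).comp (measurable_mulVec Q)
  have h2 : Measurable fun z : Vec d => z ⬝ᵥ (Q *ᵥ z) :=
    Continuous.measurable (by fun_prop)
  simp only [redMat, Matrix.smul_apply, Matrix.sub_apply, vecMulVec_apply, smul_eq_mul,
    Pi.sub_apply]
  exact (((((h2.const_sub 1).sqrt.inv.pow_const 2).mul (((measurable_pi_apply i).sub (h i)).mul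
    ((measurable_pi_apply j).sub (h j)))).sub_const _).const_mul _)

lemma dot_redMat_reflect {U : Mat d k} {u : Vec d} (hu : nrm u = 1)
    (hUu : Uᵀ *ᵥ u = 0) (D : ℕ) (x z : Vec d) :
    reflect u x ⬝ᵥ (redMat (U * Uᵀ) D z *ᵥ reflect u x) =
      x ⬝ᵥ (redMat (U * Uᵀ) D (reflect u z) *ᵥ x) := by
  have hQt := proj_transpose U
  obtain ⟨Q, hQ⟩ : ∃ Q, Q = U * Uᵀ := ⟨_, rfl⟩
  have hQu : Q *ᵥ u = 0 := by rw [hQ, ← mulVec_mulVec, hUu, mulVec_zero]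
  rw [← hQ] at hQt ⊢
  have hQR := mulVec_reflect hQu
  have hRQ : ∀ y, reflect u (Q *ᵥ y) = Q *ᵥ y := fun y => by
    rw [reflect, mulVec_dot, hQt, hQu, zero_dotProduct, mul_zero, zero_smul, sub_zero]
  have h1 : ∀ y, reflect u y ⬝ᵥ (Q *ᵥ reflect u y) = y ⬝ᵥ (Q *ᵥ y) := fun y => by
    rw [hQR, reflect_dot, hRQ]
  rw [dot_redMat, dot_redMat, h1, dotProduct_sub, dotProduct_sub, h1, reflect_dot u x,
    reflect_reflect hu, hQR, sub_dotProduct, sub_dotProduct, reflect_dot u z,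
    ← reflect_dot u (Q *ᵥ z), hRQ]

/-- The part of a traceless symmetric matrix that survives averaging over the orthogonal
transformations which fix the span of `W`. -/
def supportPart (W : Mat d s) (M : Mat d d) :
    Mat d d :=
  (W * Wᵀ) * M * (W * Wᵀ) - (((W * Wᵀ) * M * (W * Wᵀ)).trace / ((d : ℝ) - s)) • (1 - W * Wᵀ)

lemma supportPart_add (W : Mat d s) (M M' : Mat d d) :
    supportPart W (M + M') = supportPart W M + supportPart W M' := by
  simp only [supportPart, Matrix.mul_add, Matrix.add_mul, trace_add, add_div]
  module

lemma supportPart_smul (W : Mat d s) (a : ℝ)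
    (M : Mat d d) : supportPart W (a • M) = a • supportPart W M := by
  simp only [supportPart, Matrix.mul_smul, Matrix.smul_mul, trace_smul, smul_eq_mul,
    mul_div_assoc]
  module

lemma norm_supportPart_le (hsd : s < d) {W : Mat d s} (hW : IsFrame W)
    (M : Mat d d) : ‖supportPart W M‖ ≤ (1 + s) * ‖Wᵀ * M * W‖ := by
  obtain ⟨B, hB⟩ : ∃ B, B = Wᵀ * M * W := ⟨_, rfl⟩
  have h1 : (W * Wᵀ) * M * (W * Wᵀ) = W * B * Wᵀ := by rw [hB]; simp only [Matrix.mul_assoc]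
  have h2 : (W * B * Wᵀ).trace = B.trace := by
    rw [trace_mul_comm, ← Matrix.mul_assoc, (hW : Wᵀ * W = 1), Matrix.one_mul]
  have h3 : |B.trace| ≤ s * ‖B‖ := by
    refine (Finset.abs_sum_le_sum_abs _ _).trans ?_
    refine (Finset.sum_le_sum fun i _ => abs_entry_le_frob B i i).trans ?_
    simp
  obtain ⟨Wp, hWp⟩ := exists_isComplement hW
  have h4 : 1 - W * Wᵀ = Wp * Wpᵀ := by rw [← hWp.add_eq_one hW, add_sub_cancel_left]
  have h5 := hWp.1.frob_proj_sq
  rw [← h4, Nat.cast_sub hsd.le] at h5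
  have hds : (1 : ℝ) ≤ (d : ℝ) - s := by
    have : (s : ℝ) + 1 ≤ d := by exact_mod_cast hsd
    linarith
  have h6 : ‖1 - W * Wᵀ‖ ≤ (d : ℝ) - s := by
    refine (sq_le_sq₀ (norm_nonneg _) (by linarith)).1 ?_
    rw [h5]
    nlinarith
  rw [supportPart, h1, h2, ← hB]
  refine (norm_sub_le _ _).trans ?_
  rw [lift_norm hW, norm_smul, Real.norm_eq_abs, abs_div, abs_of_pos (by linarith : 0 < (d : ℝ) - s),
    add_mul, one_mul]
  have h7 : |B.trace| / ((d : ℝ) - s) * ‖1 - W * Wᵀ‖ ≤ |B.trace| / ((d : ℝ) - s) * ((d : ℝ) - s) := by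
    gcongr
  rw [div_mul_cancel₀ _ (by linarith)] at h7
  linarith

lemma integral_linear_matrix {α : Type*} [MeasurableSpace α] {μ : Measure α}
    {M : α → Mat m n} (hM : ∀ i j, Integrable (fun x => M x i j) μ)
    {L : Mat m n → ℝ} (h1 : ∀ A B, L (A + B) = L A + L B)
    (h2 : ∀ (a : ℝ) A, L (a • A) = a * L A) :
    Integrable (fun x => L (M x)) μ ∧
      ∫ x, L (M x) ∂μ = L (Matrix.of fun i j => ∫ x, M x i j ∂μ) := by
  let Φ : Mat m n →ₗ[ℝ] ℝ := ⟨⟨L, h1⟩, h2⟩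
  have h : ∀ A, L A = ∑ i, ∑ j, A i j * L (single i j 1) := fun A => by
    conv_lhs => rw [Matrix.matrix_eq_sum_single A]
    change Φ _ = _
    rw [map_sum]
    refine Finset.sum_congr rfl fun i _ => ?_
    rw [map_sum]
    refine Finset.sum_congr rfl fun j _ => ?_
    rw [← mul_one (A i j), ← smul_eq_mul, ← Matrix.smul_single, map_smul, smul_eq_mul, smul_eq_mul,
      mul_one]
    rfl
  have hi : ∀ i j, Integrable (fun x => M x i j * L (single i j 1)) μ := fun i j =>
    (hM i j).mul_const _
  refine ⟨?_, ?_⟩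
  · simp only [h (M _)]
    exact integrable_finsetSum _ fun i _ => integrable_finsetSum _ fun j _ => hi i j
  · simp only [h (M _)]
    rw [h, integral_finsetSum _ fun i _ => integrable_finsetSum _ fun j _ => hi i j]
    refine Finset.sum_congr rfl fun i _ => ?_
    rw [integral_finsetSum _ fun j _ => hi i j]
    exact Finset.sum_congr rfl fun j _ => integral_mul_const _ _

lemma norm_restrict_redMat_sq_le {W : Mat d s} (hW : IsFrame W)
    {Q : Mat d d} (hQt : Qᵀ = Q) (hQ : Q * Q = Q) (D : ℕ) (hD : 0 < D)
    (c : Fin s → Vec d) (hc : ∀ j, c j = Wᵀ j) (g : Vec d) :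
    ‖Wᵀ * redMat Q D (direction g) * W‖ ^ 2 ≤
      3 * (D : ℝ) ^ 2 * s * ∑ j, redCoord Q (c j) g ^ 2 + 3 * s ^ 2 := by
  obtain ⟨b, hb⟩ : ∃ b, b = (√(1 - direction g ⬝ᵥ (Q *ᵥ direction g)))⁻¹ ^ 2 := ⟨_, rfl⟩
  obtain ⟨p, hp⟩ : ∃ p, p = direction g - Q *ᵥ direction g := ⟨_, rfl⟩
  have hb0 : 0 ≤ b := hb ▸ sq_nonneg _
  have h1 : b * nrm (Wᵀ *ᵥ p) ^ 2 = ∑ j, redCoord Q (c j) g := by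
    rw [← dot_self_eq_nrm_sq, dotProduct, Finset.mul_sum]
    refine Finset.sum_congr rfl fun j _ => ?_
    rw [← redCoord_eq hQt hQ, ← hb, ← hp, hc, dotProduct_comm, ← transpose_mulVec_apply, sq]
  have h2 : ‖Wᵀ * (1 - Q) * W‖ ≤ s := by
    have e : Wᵀ * (1 - Q) * W = ((1 - Q) * W)ᵀ * ((1 - Q) * W) := by
      have e1 : (1 - Q) * (1 - Q) = 1 - Q := by
        rw [Matrix.sub_mul, Matrix.mul_sub, Matrix.mul_sub, hQ]
        simp
      rw [transpose_mul, transpose_sub, transpose_one, hQt, Matrix.mul_assoc, Matrix.mul_assoc,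
        ← Matrix.mul_assoc (1 - Q) (1 - Q), e1]
    have h3 : ‖(1 - Q) * W‖ ^ 2 ≤ s := by
      rw [frob_sq_eq_sum_nrm_col]
      calc _ ≤ ∑ _j : Fin s, (1 : ℝ) := Finset.sum_le_sum fun j _ => by
            have h4 : nrm ((1 - Q) *ᵥ c j) ≤ 1 := by
              rw [sub_mulVec, one_mulVec]
              refine (nrm_sub_proj_le hQt hQ (c j)).trans_eq ?_
              rw [hc]
              exact hW.nrm_col j
            rw [hc] at h4
            exact pow_le_one₀ (nrm_nonneg _) h4
        _ = s := by simp
    rw [e]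
    calc _ ≤ ‖((1 - Q) * W)ᵀ‖ * ‖(1 - Q) * W‖ := frobenius_norm_mul _ _
      _ = ‖(1 - Q) * W‖ ^ 2 := by rw [frobenius_norm_transpose, sq]
      _ ≤ s := h3
  have hD1 : (1 : ℝ) ≤ D := by exact_mod_cast hD
  obtain ⟨r, hr⟩ : ∃ r, r = ∑ j, redCoord Q (c j) g := ⟨_, rfl⟩
  have hr0 : 0 ≤ r := hr ▸ Finset.sum_nonneg fun j _ => redCoord_nonneg _ _ _
  have h6 : ‖Wᵀ * redMat Q D (direction g) * W‖ ≤
      √((D : ℝ) * (D + 2) / 2) * (r + s / D) := by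
    rw [redMat, ← hb, ← hp, Matrix.mul_smul, Matrix.smul_mul, norm_smul, Real.norm_eq_abs,
      abs_of_nonneg (Real.sqrt_nonneg _)]
    gcongr
    rw [Matrix.mul_sub, Matrix.sub_mul]
    refine (norm_sub_le _ _).trans (add_le_add ?_ ?_)
    · rw [Matrix.mul_smul, Matrix.smul_mul, mul_vecMulVec, vecMulVec_mul,
        ← mulVec_transpose, norm_smul, frob_vecMulVec, Real.norm_eq_abs, abs_of_nonneg hb0,
        h1, hr]
    · rw [Matrix.mul_smul, Matrix.smul_mul, norm_smul, Real.norm_eq_abs,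
        abs_of_nonneg (by positivity), one_div, inv_mul_eq_div]
      gcongr
  have h7 : r ^ 2 ≤ s * ∑ j, redCoord Q (c j) g ^ 2 := by
    rw [hr]
    simpa using sq_sum_le_card_mul_sum_sq (s := Finset.univ) (f := fun j => redCoord Q (c j) g)
  have h8 : (D : ℝ) * (D + 2) / 2 ≤ 3 / 2 * D ^ 2 := by nlinarith
  calc _ ≤ (√((D : ℝ) * (D + 2) / 2) * (r + s / D)) ^ 2 :=
        pow_le_pow_left₀ (norm_nonneg _) h6 2
    _ = (D : ℝ) * (D + 2) / 2 * (r + s / D) ^ 2 := by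
        rw [mul_pow, Real.sq_sqrt (by positivity)]
    _ ≤ 3 / 2 * D ^ 2 * (2 * (r ^ 2 + (s / D) ^ 2)) := by
        gcongr
        exact add_sq_le
    _ = 3 * D ^ 2 * r ^ 2 + 3 * s ^ 2 := by
        field_simp
    _ ≤ 3 * D ^ 2 * (s * ∑ j, redCoord Q (c j) g ^ 2) + 3 * s ^ 2 := by gcongr
    _ = _ := by ring

lemma memLp_model {F : Vec s → ℝ} (hF : Measurable F) (ρ : Measure ℝ)
    [IsProbabilityMeasure ρ] (W : Mat d s) {φ : ℝ × Vec d → ℝ} {K : ℝ}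
    (hφ : AEStronglyMeasurable φ (((gaussianVec d).prod ρ).map (modelMap F W)))
    (hK : ∀ p, nrm p.2 ≤ 1 → |φ p| ≤ K) :
    MemLp φ 2 (((gaussianVec d).prod ρ).map (modelMap F W)) := by
  have : IsProbabilityMeasure (((gaussianVec d).prod ρ).map (modelMap F W)) :=
    Measure.isProbabilityMeasure_map (measurable_modelMap hF W).aemeasurable
  have h : ∀ᵐ p ∂((gaussianVec d).prod ρ).map (modelMap F W), nrm p.2 ≤ 1 := by
    rw [ae_map_iff (measurable_modelMap hF W).aemeasurable
      (show MeasurableSet {p : ℝ × Vec d | nrm p.2 ≤ 1} from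
        measurableSet_le (measurable_nrm.comp measurable_snd) measurable_const)]
    exact Eventually.of_forall fun p => nrm_direction_le _
  exact MemLp.of_bound hφ K (h.mono fun p hp => hK p hp)

lemma measurable_reducedResponse (U : Mat d k) :
    Measurable (reducedResponse (Y := ℝ) U) :=
  measurable_fst.prodMk ((measurable_mulVec _).comp measurable_snd)

lemma trace_redMat_direction {U : Mat d k} (hU : IsFrame U)
    {Up : Mat d (d - k)} (hUp : IsComplement U Up) (hk : k < d) {g : Vec d}
    (hg : Upᵀ *ᵥ g ≠ 0) : (redMat (U * Uᵀ) (d - k) (direction g)).trace = 0 := by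
  have h : Upᵀ * Up = 1 := hUp.1
  have hD : ((d - k : ℕ) : ℝ) ≠ 0 := by
    have : d - k ≠ 0 := by omega
    exact_mod_cast this
  have e := lift_harmonicTwo hU hUp ((0 : ℝ), direction g)
  rw [reducedInput_direction hU hUp] at e
  rw [← e, trace_mul_comm, ← Matrix.mul_assoc, h, Matrix.one_mul, harmonicTwo,
    trace_smul, trace_sub, trace_vecMulVec, trace_smul, trace_one,
    dot_self_eq_nrm_sq, nrm_direction hg]
  simp [hD]

lemma ae_complement_ne_zero (hk : k < d) {U : Mat d k}
    {Up : Mat d (d - k)} (hUp : IsComplement U Up) :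
    ∀ᵐ g ∂gaussianVec d, Upᵀ *ᵥ g ≠ 0 := by
  have h : ∀ᵐ x ∂gaussianVec (d - k), x ≠ 0 := by
    have : NullSingletonClass (gaussianReal 0 1) :=
      nullSingletonClass_gaussianReal one_ne_zero
    have h0 : ∀ᵐ t ∂gaussianReal 0 1, t ≠ 0 := by simp [ae_iff]
    have h1 : ∀ᵐ x ∂gaussianVec (d - k), x ⟨0, by omega⟩ ≠ 0 :=
      (measurePreserving_eval (fun _ : Fin (d - k) => gaussianReal 0 1)
        ⟨0, by omega⟩).quasiMeasurePreserving.ae h0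
    exact h1.mono fun x hx h0 => hx (by rw [h0]; rfl)
  rw [← hUp.1.map_gaussianVec] at h
  exact ae_of_ae_map (measurable_mulVec _).aemeasurable h

/-- The integral of the lifted harmonic over an event of the reduced response is invariant under
averaging over the rotations which fix the support. -/
lemma setIntegral_redMat (hsd : s < d) {F : Vec s → ℝ} (hF : Measurable F)
    (ρ : Measure ℝ) [IsProbabilityMeasure ρ] {W : Mat d s} (hW : IsFrame W)
    {U : Mat d k} (hU : IsFrame U) (hUW : W * Wᵀ * U = U) (hk : k < d)
    {S : Set (ℝ × Vec d)}
    (hS : MeasurableSet[MeasurableSpace.comap (reducedResponse (Y := ℝ) U) inferInstance] S)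
    (hM : ∀ i j, Integrable (fun p : ℝ × Vec d => redMat (U * Uᵀ) (d - k) p.2 i j)
      (((gaussianVec d).prod ρ).map (modelMap F W))) :
    (Matrix.of fun i j => ∫ p in S, redMat (U * Uᵀ) (d - k) p.2 i j
        ∂((gaussianVec d).prod ρ).map (modelMap F W)) =
      supportPart W (Matrix.of fun i j => ∫ p in S, redMat (U * Uᵀ) (d - k) p.2 i j
        ∂((gaussianVec d).prod ρ).map (modelMap F W)) := by
  have hmS : MeasurableSet S := (measurable_reducedResponse U).comap_le S hS
  obtain ⟨t, ht, rfl⟩ := hS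
  obtain ⟨μ, hμ⟩ : ∃ μ, μ = ((gaussianVec d).prod ρ).map (modelMap F W) := ⟨_, rfl⟩
  obtain ⟨M, hMdef⟩ : ∃ M : Vec d → Mat d d, M = redMat (U * Uᵀ) (d - k) :=
    ⟨_, rfl⟩
  have hMm : Measurable M := hMdef ▸ measurable_redMat _ _
  rw [← hμ, ← hMdef] at hM ⊢
  have hMi := fun i j => (hM i j).integrableOn (s := reducedResponse U ⁻¹' t)
  obtain ⟨Up, hUp⟩ := exists_isComplement hU
  refine eq_of_reflect_invariant hsd hW ?_ ?_ fun u hWu hu x => ?_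
  · ext i j
    have h := fun z => redMat_transpose (proj_transpose U) (d - k) z
    simp only [← hMdef] at h
    change ∫ p in _, M p.2 j i ∂μ = ∫ p in _, M p.2 i j ∂μ
    exact integral_congr_ae (Eventually.of_forall fun p => congrFun (congrFun (h p.2) i) j)
  · rw [← (integral_linear_matrix hMi (L := Matrix.trace) trace_add
      fun a A => by rw [trace_smul, smul_eq_mul]).2]
    have h0 : ∀ᵐ p ∂μ, (M p.2).trace = 0 := by
      rw [hμ, ae_map_iff (measurable_modelMap hF W).aemeasurable]
      · rw [hMdef]
        have := (Measure.quasiMeasurePreserving_fst (μ := gaussianVec d) (ν := ρ)).ae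
          (ae_complement_ne_zero hk hUp)
        exact this.mono fun p hp => trace_redMat_direction hU hUp hk hp
      · have h1 : Measurable fun p : ℝ × Vec d => (M p.2).trace := by
          simp only [Matrix.trace, Matrix.diag]
          exact Finset.measurable_sum _ fun i _ =>
            (measurable_matrix_iff.1 hMm i i).comp measurable_snd
        exact h1 (measurableSet_singleton 0)
    exact integral_eq_zero_of_ae (ae_restrict_of_ae h0)
  · have hUu : Uᵀ *ᵥ u = 0 := by
      rw [← hUW, transpose_mul, transpose_mul, transpose_transpose, ← mulVec_mulVec,
        ← mulVec_mulVec, hWu, mulVec_zero, mulVec_zero]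
    have hL : ∀ x : Vec d, Integrable (fun p : ℝ × Vec d => x ⬝ᵥ (M p.2 *ᵥ x))
        (μ.restrict (reducedResponse U ⁻¹' t)) ∧
        ∫ p in reducedResponse U ⁻¹' t, x ⬝ᵥ (M p.2 *ᵥ x) ∂μ = x ⬝ᵥ ((Matrix.of fun i j =>
          ∫ p in reducedResponse U ⁻¹' t, M p.2 i j ∂μ) *ᵥ x) := fun x =>
      integral_linear_matrix hMi (L := fun A => x ⬝ᵥ (A *ᵥ x))
        (fun A B => by rw [add_mulVec, dotProduct_add])
        (fun a A => by rw [smul_mulVec, dotProduct_smul, smul_eq_mul])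
    have hT : Measurable (Prod.map (id : ℝ → ℝ) (reflect u)) :=
      measurable_id.prodMap (measurable_reflect u)
    have hmap : μ.map (Prod.map id (reflect u)) = μ := by
      rw [hμ]
      exact map_reflect_model hF ρ hu hWu
    have hpre : Prod.map (id : ℝ → ℝ) (reflect u) ⁻¹' (reducedResponse U ⁻¹' t) =
        reducedResponse U ⁻¹' t := by
      rw [← Set.preimage_comp]
      congr 1
      funext p
      simp only [Function.comp_apply, reducedResponse, Prod.map_fst, Prod.map_snd, id_eq,
        mulVec_reflect hUu]
    rw [← (hL x).2, ← (hL _).2]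
    have h2 : ∀ p : ℝ × Vec d, reflect u x ⬝ᵥ (M p.2 *ᵥ reflect u x) =
        x ⬝ᵥ (M (Prod.map (id : ℝ → ℝ) (reflect u) p).2 *ᵥ x) := fun p => by
      rw [hMdef]
      exact dot_redMat_reflect hu hUu _ _ _
    simp only [h2]
    conv_rhs => rw [← hmap]
    have hxm : AEStronglyMeasurable (fun p : ℝ × Vec d => x ⬝ᵥ (M p.2 *ᵥ x))
        (μ.map (Prod.map id (reflect u))) := by
      have h3 : Measurable fun p : ℝ × Vec d => x ⬝ᵥ (M p.2 *ᵥ x) := by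
        change Measurable fun p : ℝ × Vec d => ∑ i, x i * ∑ j, M p.2 i j * x j
        exact Finset.measurable_sum _ fun i _ => (Finset.measurable_sum _ fun j _ =>
          ((measurable_matrix_iff.1 hMm i j).comp measurable_snd).mul_const _).const_mul _
      exact h3.aestronglyMeasurable
    rw [setIntegral_map hmS hxm hT.aemeasurable, hpre]

/-- The second harmonic coefficient of a reduced model is bounded, uniformly in the dimension. -/
theorem xiTwoNormSq_le (hsd : 2 * s < d) {F : Vec s → ℝ} (hF : Measurable F)
    (ρ : Measure ℝ) [IsProbabilityMeasure ρ] {W : Mat d s} (hW : IsFrame W)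
    {U : Mat d k} (hU : IsFrame U) (hUW : W * Wᵀ * U = U) (hks : k ≤ s)
    {Up : Mat d (d - k)} (hUp : IsComplement U Up) :
    xiTwoNormSq (((gaussianVec d).prod ρ).map (modelMap F W)) U Up ≤
      (1 + s) ^ 2 * (3 * s ^ 2 * (2 * (64 * (s + 1)) ^ 2 * (2 * s + 3)) + 3 * s ^ 2) := by
  have hk : k < d := by omega
  have hQt := proj_transpose U
  have hQ := proj_mul_self hU
  obtain ⟨μ, hμ⟩ : ∃ μ, μ = ((gaussianVec d).prod ρ).map (modelMap F W) := ⟨_, rfl⟩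
  have hprob : IsProbabilityMeasure μ := hμ ▸
    Measure.isProbabilityMeasure_map (measurable_modelMap hF W).aemeasurable
  obtain ⟨M, hMdef⟩ : ∃ M : Vec d → Mat d d, M = redMat (U * Uᵀ) (d - k) :=
    ⟨_, rfl⟩
  obtain ⟨K, hK⟩ := exists_norm_redMat_le hQt hQ (d - k)
  rw [← hMdef] at hK
  have hMm : Measurable M := hMdef ▸ measurable_redMat _ _
  have hM : ∀ i j, Integrable (fun p : ℝ × Vec d => M p.2 i j) μ := fun i j => by
    rw [hμ]
    exact (memLp_model hF ρ W ((measurable_matrix_iff.1 hMm i j).comp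
      measurable_snd).aestronglyMeasurable fun p hp =>
      (abs_entry_le_frob _ i j).trans (hK _ hp)).integrable one_le_two
  obtain ⟨G, hG⟩ : ∃ G : Vec d → Mat (d - k) (d - k),
    ∀ z, G z = Upᵀ * supportPart W (M z) * Up := ⟨_, fun _ => rfl⟩
  have hHlin : ∀ (ν : Measure (ℝ × Vec d)), (∀ i j, Integrable (fun p => M p.2 i j) ν) →
      ∀ i j, Integrable (fun p : ℝ × Vec d => (Upᵀ * M p.2 * Up) i j) ν ∧
      ∫ p, (Upᵀ * M p.2 * Up) i j ∂ν =
        (Upᵀ * (Matrix.of fun i j => ∫ p, M p.2 i j ∂ν) * Up) i j := fun ν hν i j =>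
    integral_linear_matrix hν (L := fun A => (Upᵀ * A * Up) i j)
      (fun A B => by rw [Matrix.mul_add, Matrix.add_mul, Matrix.add_apply])
      (fun a A => by rw [Matrix.mul_smul, Matrix.smul_mul, Matrix.smul_apply, smul_eq_mul])
  have hGlin : ∀ (ν : Measure (ℝ × Vec d)), (∀ i j, Integrable (fun p => M p.2 i j) ν) →
      ∀ i j, Integrable (fun p : ℝ × Vec d => G p.2 i j) ν ∧
      ∫ p, G p.2 i j ∂ν =
        (Upᵀ * supportPart W (Matrix.of fun i j => ∫ p, M p.2 i j ∂ν) * Up) i j := fun ν hν i j => by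
    simp only [hG]
    exact integral_linear_matrix hν (L := fun A => (Upᵀ * supportPart W A * Up) i j)
      (fun A B => by rw [supportPart_add, Matrix.mul_add, Matrix.add_mul, Matrix.add_apply])
      (fun a A => by rw [supportPart_smul, Matrix.mul_smul, Matrix.smul_mul, Matrix.smul_apply,
        smul_eq_mul])
  have hGb : ∀ z, ‖G z‖ ≤ (1 + s) * ‖Wᵀ * M z * W‖ := fun z => by
    rw [hG]
    exact (hUp.1.frob_conj_le _).trans (norm_supportPart_le (by omega) hW _)
  have hG2 : ∀ i j, MemLp (fun p : ℝ × Vec d => G p.2 i j) 2 μ := fun i j => by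
    have h := (hGlin μ hM i j).1.aestronglyMeasurable
    rw [hμ] at h ⊢
    refine memLp_model hF ρ W (K := (1 + s) * K) h fun p hp =>
      (abs_entry_le_frob _ i j).trans ((hGb _).trans ?_)
    gcongr
    exact (hW.frob_conj_le _).trans (hK _ hp)
  have hm := (measurable_reducedResponse U).comap_le
  have hxi : ∀ i j, (fun p => xiTwo μ U Up p i j) =ᵐ[μ] μ[fun p : ℝ × Vec d => G p.2 i j |
      MeasurableSpace.comap (reducedResponse (Y := ℝ) U) inferInstance] := fun i j => by
    have hHe : (fun p : ℝ × Vec d => harmonicTwo (reducedInput U Up p) i j) =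
        fun p => (Upᵀ * M p.2 * Up) i j := by
      funext p
      rw [harmonicTwo_reducedInput hU hUp, hMdef]
    simp only [xiTwo, hHe]
    refine ae_eq_condExp_of_forall_setIntegral_eq hm (hGlin μ hM i j).1
      (fun S _ _ => integrable_condExp.integrableOn) (fun S hS _ => ?_)
      stronglyMeasurable_condExp.aestronglyMeasurable
    have hMS := fun i j => (hM i j).integrableOn (s := S)
    rw [setIntegral_condExp hm (hHlin μ hM i j).1 hS, (hHlin _ hMS i j).2, (hGlin _ hMS i j).2]
    have h := setIntegral_redMat (by omega) hF ρ hW hU hUW hk hS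
    rw [← hμ, ← hMdef] at h
    rw [← h hM]
  have hJ : ∀ i j, Integrable (fun p => xiTwo μ U Up p i j ^ 2) μ ∧
      ∫ p, xiTwo μ U Up p i j ^ 2 ∂μ ≤ ∫ p, G p.2 i j ^ 2 ∂μ := fun i j => by
    have h := integral_condExp_sq_le hm (hG2 i j)
    have e : (fun p => xiTwo μ U Up p i j ^ 2) =ᵐ[μ] fun p => (μ[fun p : ℝ × Vec d => G p.2 i j |
        MeasurableSpace.comap (reducedResponse (Y := ℝ) U) inferInstance]) p ^ 2 :=
      (hxi i j).mono fun p hp => congrArg (· ^ 2) hp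
    exact ⟨h.1.congr e.symm, (integral_congr_ae e).trans_le h.2⟩
  have hGi : ∀ i j, Integrable (fun p : ℝ × Vec d => G p.2 i j ^ 2) μ := fun i j =>
    (hG2 i j).integrable_sq
  have h1 : xiTwoNormSq μ U Up ≤ ∫ p, ‖G p.2‖ ^ 2 ∂μ := by
    simp only [frob_sq, xiTwoNormSq]
    rw [integral_finsetSum _ fun i _ => integrable_finsetSum _ fun j _ => (hJ i j).1,
      integral_finsetSum _ fun i _ => integrable_finsetSum _ fun j _ => hGi i j]
    refine Finset.sum_le_sum fun i _ => ?_
    rw [integral_finsetSum _ fun j _ => (hJ i j).1, integral_finsetSum _ fun j _ => hGi i j]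
    exact Finset.sum_le_sum fun j _ => (hJ i j).2
  obtain ⟨c, hc⟩ : ∃ c : Fin s → Vec d, ∀ j, c j = Wᵀ j := ⟨_, fun _ => rfl⟩
  have hcn : ∀ j, nrm (c j) = 1 := fun j => by rw [hc]; exact hW.nrm_col j
  obtain ⟨D, hD⟩ : ∃ D, D = d - k := ⟨_, rfl⟩
  have hred : ∀ j, Integrable (fun g => redCoord (U * Uᵀ) (c j) g ^ 2) (gaussianVec d) := fun j =>
    integrable_of_bounded ((measurable_redCoord _ _).pow_const 2) 1 fun g => by
      have h := redCoord_le hQt (c j) g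
      rw [hcn, one_pow] at h
      rw [abs_of_nonneg (sq_nonneg _)]
      exact pow_le_one₀ (redCoord_nonneg _ _ _) h
  have hsum : Integrable (fun g => ∑ j, redCoord (U * Uᵀ) (c j) g ^ 2) (gaussianVec d) :=
    integrable_finsetSum _ fun j _ => hred j
  have hbig : Integrable (fun g => (1 + (s : ℝ)) ^ 2 * (3 * (D : ℝ) ^ 2 * s *
      ∑ j, redCoord (U * Uᵀ) (c j) g ^ 2 + 3 * s ^ 2)) (gaussianVec d) :=
    ((hsum.const_mul _).add (integrable_const _)).const_mul _
  have h2 : ∫ p, ‖G p.2‖ ^ 2 ∂μ ≤ ∫ g, (1 + (s : ℝ)) ^ 2 * (3 * (D : ℝ) ^ 2 * s *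
      ∑ j, redCoord (U * Uᵀ) (c j) g ^ 2 + 3 * s ^ 2) ∂gaussianVec d := by
    have hi : Integrable (fun p : ℝ × Vec d => ‖G p.2‖ ^ 2) μ := by
      simp only [frob_sq]
      exact integrable_finsetSum _ fun i _ => integrable_finsetSum _ fun j _ => hGi i j
    rw [hμ] at hi ⊢
    rw [integral_map (measurable_modelMap hF W).aemeasurable hi.aestronglyMeasurable]
    have e := integral_fun_fst (μ := gaussianVec d) (ν := ρ) (fun g => (1 + (s : ℝ)) ^ 2 *
      (3 * (D : ℝ) ^ 2 * s * ∑ j, redCoord (U * Uᵀ) (c j) g ^ 2 + 3 * s ^ 2))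
    rw [probReal_univ, one_smul] at e
    rw [← e]
    refine integral_mono (hi.comp_measurable (measurable_modelMap hF W))
      (hbig.comp_fst ρ) fun p => ?_
    change ‖G (direction p.1)‖ ^ 2 ≤ _
    refine (pow_le_pow_left₀ (norm_nonneg _) (hGb _) 2).trans ?_
    rw [mul_pow, hMdef, ← hD]
    gcongr
    exact norm_restrict_redMat_sq_le hW hQt hQ D (by omega) c hc p.1
  have h3 : ∀ j, ∫ g, redCoord (U * Uᵀ) (c j) g ^ 2 ∂gaussianVec d ≤
      2 * (64 * (s + 1)) ^ 2 * (2 * s + 3) / (d : ℝ) ^ 2 := fun j => by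
    refine (integral_redCoord_sq_le (by omega) hU (by rw [hcn]; norm_num)).trans ?_
    have : (k : ℝ) ≤ s := by exact_mod_cast hks
    gcongr
  rw [← hμ]
  refine (h1.trans h2).trans ?_
  rw [integral_const_mul, integral_add (hsum.const_mul _) (integrable_const _), integral_const_mul,
    integral_finsetSum _ fun j _ => hred j, integral_const, probReal_univ, one_smul]
  refine mul_le_mul_of_nonneg_left (add_le_add ?_ le_rfl) (by positivity)
  have hd0 : (0 : ℝ) < d := by exact_mod_cast (by omega : 0 < d)
  have hDd : (D : ℝ) ≤ d := by exact_mod_cast (by omega : D ≤ d)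
  have h4 := Finset.sum_le_sum fun j (_ : j ∈ Finset.univ) => h3 j
  calc _ ≤ 3 * (d : ℝ) ^ 2 * s *
        ∑ _j : Fin s, 2 * (64 * ((s : ℝ) + 1)) ^ 2 * (2 * s + 3) / (d : ℝ) ^ 2 := by gcongr
    _ = _ := by
        rw [Finset.sum_const, Finset.card_univ, Fintype.card_fin, nsmul_eq_mul]
        field_simp

/-! ### The lower bound for the second harmonic coefficient -/

lemma le_xiTwoNormSq {F : Vec s → ℝ} (hF : Measurable F)
    (ρ : Measure ℝ) [IsProbabilityMeasure ρ] (W : Mat d s)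
    {U : Mat d k} (hU : IsFrame U)
    {Up : Mat d (d - k)} (hUp : IsComplement U Up) {τ : ℝ → ℝ} (hτ : Measurable τ)
    (hτ1 : ∀ y, |τ y| ≤ 1) {v : Vec d} (hv : nrm v ≤ 1) {η : ℝ} (hη : 0 < η)
    (h : η ≤ |∫ p, v ⬝ᵥ (sampleMat τ (U * Uᵀ) (d - k) (modelMap F W p) *ᵥ v)
      ∂(gaussianVec d).prod ρ|) :
    η ^ 2 ≤ xiTwoNormSq (((gaussianVec d).prod ρ).map (modelMap F W)) U Up := by
  have hmm := measurable_modelMap hF W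
  have hvm := measurable_dot_sampleMat hτ (U * Uᵀ) (d - k) v
  rw [← integral_map (f := fun p => v ⬝ᵥ (sampleMat τ (U * Uᵀ) (d - k) p *ᵥ v)) hmm.aemeasurable
    hvm.aestronglyMeasurable] at h
  obtain ⟨K, hK⟩ := exists_norm_redMat_le (proj_transpose U) (proj_mul_self hU) (d - k)
  obtain ⟨H, hH⟩ : ∃ H : ℝ × Vec d → Mat (d - k) (d - k),
    H = fun p => harmonicTwo (reducedInput U Up p) := ⟨_, rfl⟩
  have hH2 : ∀ i j, MemLp (fun p => H p i j) 2 (((gaussianVec d).prod ρ).map (modelMap F W)) := by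
    intro i j
    have e : H = fun p => Upᵀ * redMat (U * Uᵀ) (d - k) p.2 * Up := by
      rw [hH]
      funext p
      exact harmonicTwo_reducedInput hU hUp p
    have hm : Measurable fun p => H p i j := by
      rw [e]
      simp only [Matrix.mul_apply]
      exact Finset.measurable_sum _ fun b _ => (Finset.measurable_sum _ fun a _ =>
        ((measurable_matrix_iff.1 (measurable_redMat _ _) a b).comp
          measurable_snd).const_mul _).mul_const _
    refine memLp_model hF ρ W (K := K) hm.aestronglyMeasurable fun p hp => ?_
    rw [e]
    exact (abs_entry_le_frob _ i j).trans ((hUp.1.frob_conj_le _).trans (hK _ hp))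
  have hprob : IsProbabilityMeasure (((gaussianVec d).prod ρ).map (modelMap F W)) :=
    Measure.isProbabilityMeasure_map hmm.aemeasurable
  obtain ⟨μ, hμ⟩ : ∃ μ, μ = ((gaussianVec d).prod ρ).map (modelMap F W) := ⟨_, rfl⟩
  rw [← hμ] at h hH2 hprob ⊢
  obtain ⟨w, hw⟩ : ∃ w : ℝ × Vec d → ℝ, w = sampleWeight τ (U * Uᵀ) := ⟨_, rfl⟩
  have hw1 : ∀ p, |w p| ≤ 1 := hw ▸ abs_sampleWeight_le hτ1 _
  have hm := (measurable_reducedResponse U).comap_le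
  have hwm : StronglyMeasurable[MeasurableSpace.comap (reducedResponse (Y := ℝ) U) inferInstance]
      w := by
    have e : w = (fun q : ℝ × Vec k => radialFeature d τ 0 q.1 q.2) ∘ reducedResponse U := by
      funext p
      rw [hw, sampleWeight, dot_proj]
      rfl
    rw [e]
    exact (((isAdmissible_radialFeature d hτ hτ1 k).1 0).comp
      (comap_measurable _)).stronglyMeasurable
  obtain ⟨x, hx⟩ : ∃ x, x = Upᵀ *ᵥ v := ⟨_, rfl⟩
  obtain ⟨X, hX⟩ : ∃ X : ℝ × Vec d → Mat (d - k) (d - k), X = xiTwo μ U Up :=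
    ⟨_, rfl⟩
  have hX2 : ∀ i j, Integrable (fun p => X p i j ^ 2) μ := fun i j => by
    rw [hX]
    simp only [xiTwo]
    have := (integral_condExp_sq_le hm (hH2 i j)).1
    rw [hH] at this
    exact this
  have hXi : ∀ i j, Integrable (fun p => X p i j) μ := fun i j => by
    rw [hX]
    exact integrable_condExp
  have hlin : ∀ Z : ℝ × Vec d → Mat (d - k) (d - k),
      (∀ i j, Integrable (fun p => Z p i j) μ) →
      Integrable (fun p => x ⬝ᵥ ((w p • Z p) *ᵥ x)) μ ∧ ∫ p, x ⬝ᵥ ((w p • Z p) *ᵥ x) ∂μ =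
        x ⬝ᵥ ((Matrix.of fun i j => ∫ p, w p * Z p i j ∂μ) *ᵥ x) := fun Z hZ =>
    integral_linear_matrix (M := fun p => w p • Z p) (L := fun A => x ⬝ᵥ (A *ᵥ x))
      (fun i j => (hZ i j).bdd_mul (c := 1) (hwm.mono hm).aestronglyMeasurable
        (Eventually.of_forall hw1))
      (fun A B => by rw [add_mulVec, dotProduct_add])
      (fun a A => by rw [smul_mulVec, dotProduct_smul, smul_eq_mul])
  have e1 : ∀ p, v ⬝ᵥ (sampleMat τ (U * Uᵀ) (d - k) p *ᵥ v) = x ⬝ᵥ ((w p • H p) *ᵥ x) := fun p => by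
    rw [sampleMat, ← hw, ← lift_harmonicTwo hU hUp, hH, smul_mulVec, smul_mulVec,
      ← mulVec_mulVec, ← mulVec_mulVec, dotProduct_smul, dotProduct_smul,
      mulVec_dot Up, ← hx]
  have e2 : ∀ i j, ∫ p, w p * H p i j ∂μ = ∫ p, w p * X p i j ∂μ := fun i j => by
    rw [← integral_mul_condExp hm hwm hw1 ((hH2 i j).integrable one_le_two), hX, hH]
    rfl
  have hxn : nrm x ≤ 1 := hx ▸ (hUp.1.nrm_transpose_mulVec_le v).trans hv
  have hXn : Integrable (fun p => ‖X p‖ ^ 2) μ := by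
    simp only [frob_sq]
    exact integrable_finsetSum _ fun i _ => integrable_finsetSum _ fun j _ => hX2 i j
  have hfin : xiTwoNormSq μ U Up = ∫ p, ‖X p‖ ^ 2 ∂μ := by
    simp only [frob_sq, xiTwoNormSq, hX]
  simp only [e1] at h
  rw [(hlin H fun i j => (hH2 i j).integrable one_le_two).2] at h
  simp only [e2] at h
  rw [← (hlin X hXi).2] at h
  have h2 : η ≤ ∫ p, (1 / (2 * η) * ‖X p‖ ^ 2 + η / 2) ∂μ := by
    refine h.trans ((abs_integral_le_integral_abs).trans ?_)
    refine integral_mono (hlin X hXi).1.abs ((hXn.const_mul _).add (integrable_const _)) fun p => ?_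
    have h3 := abs_dot_mulVec_le (X p) x x
    have h4 : ‖X p‖ * nrm x * nrm x ≤ ‖X p‖ := by
      have h5 := mul_le_one₀ hxn (nrm_nonneg x) hxn
      rw [mul_assoc]
      exact mul_le_of_le_one_right (norm_nonneg _) h5
    have h6 : |x ⬝ᵥ ((w p • X p) *ᵥ x)| ≤ ‖X p‖ := by
      rw [smul_mulVec, dotProduct_smul, smul_eq_mul, abs_mul]
      exact (mul_le_of_le_one_left (abs_nonneg _) (hw1 p)).trans (h3.trans h4)
    refine h6.trans ?_
    have h7 := sq_nonneg (‖X p‖ - η)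
    change ‖X p‖ ≤ 1 / (2 * η) * ‖X p‖ ^ 2 + η / 2
    rw [← sub_nonneg]
    have : 1 / (2 * η) * ‖X p‖ ^ 2 + η / 2 - ‖X p‖ = 1 / (2 * η) * (‖X p‖ - η) ^ 2 := by
      field_simp
      ring
    rw [this]
    positivity
  rw [integral_add (hXn.const_mul _) (integrable_const _), integral_const_mul, integral_const,
    probReal_univ, one_smul, ← hfin] at h2
  have h3 : η / 2 ≤ 1 / (2 * η) * xiTwoNormSq μ U Up := by linarith
  have h4 := mul_le_mul_of_nonneg_left h3 (by positivity : 0 ≤ 2 * η)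
  rw [← mul_assoc, mul_one_div_cancel (by positivity), one_mul] at h4
  linarith

lemma exists_form_ne_zero {S : Mat s s} (hS : Sᵀ = S) (h0 : S ≠ 0) :
    ∃ u : Vec s, nrm u ≤ 1 ∧ u ⬝ᵥ (S *ᵥ u) ≠ 0 := by
  by_contra! h
  refine h0 ?_
  have hq : QForm S 0 := fun x => by
    have h1 := h _ (nrm_direction_le x)
    by_cases hx : x = 0
    · simp [hx]
    rw [direction, mulVec_smul, smul_dotProduct, dotProduct_smul, smul_eq_mul, smul_eq_mul,
      mul_eq_zero, mul_eq_zero, or_iff_right (inv_ne_zero (nrm_pos hx).ne'),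
      or_iff_right (inv_ne_zero (nrm_pos hx).ne')] at h1
    simp [h1]
  ext i j
  have := hq.bilin hS (Pi.single i 1) (Pi.single j 1)
  simpa using this

/-- The lower bound for all reduced models at a frame from the set `𝒮` of frames of the support. -/
def HasXiLower (F : Vec s → ℝ) (ρ : Measure ℝ) (𝒮 : Set (Mat s k)) :
    Prop :=
  ∃ c > 0, ∀ᶠ d : ℕ in atTop, ∀ W : Mat d s, IsFrame W →
    ∀ Q ∈ 𝒮, ∀ Up : Mat d (d - k), IsFrame (W * Q) → IsComplement (W * Q) Up →
      c ≤ xiTwoNormSq (((gaussianVec d).prod ρ).map (modelMap F W)) (W * Q) Up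

lemma hasXiLower_near {F : Vec s → ℝ} (hF : Continuous F) (ρ : Measure ℝ)
    [IsProbabilityMeasure ρ] {Q : Mat s k} (hQ : IsFrame Q) {τ : ℝ → ℝ} {θ : ℝ}
    (hθ : 0 ≤ θ) (hτ1 : ∀ y, |τ y| ≤ 1) (hτL : ∀ y y', |τ y - τ y'| ≤ θ * |y - y'|)
    (ht : target F ρ τ (Q * Qᵀ) ≠ 0) :
    ∃ a > 0, HasXiLower F ρ {Q' : Mat s k | ‖Q' * Q'ᵀ - Q * Qᵀ‖ ≤ a} := by
  have hPt := proj_transpose Q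
  have hτ : Measurable τ :=
    (LipschitzWith.of_dist_le_mul (K := ⟨θ, hθ⟩) fun y y' => hτL y y').continuous.measurable
  obtain ⟨u, hu, hne⟩ := exists_form_ne_zero (target_transpose F ρ τ hPt) ht
  obtain ⟨η, hη⟩ : ∃ η, η = |u ⬝ᵥ (target F ρ τ (Q * Qᵀ) *ᵥ u)| / 2 := ⟨_, rfl⟩
  have hη0 : 0 < η := hη ▸ half_pos (abs_pos.2 hne)
  obtain ⟨a, ha, hd⟩ := exists_population_close hF ρ hτ1 hθ hτL hPt (proj_mul_self hQ) k hη0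
  refine ⟨a, ha, η ^ 2, by positivity, hd.mono fun d hd W hW Q' hQ' Up hU hUp => ?_⟩
  have hWu : nrm (W *ᵥ u) ≤ 1 := (hW.nrm_mulVec u).trans_le hu
  refine le_xiTwoNormSq hF.measurable ρ W hU hUp hτ hτ1 hWu hη0 ?_
  have e : W * Q' * (W * Q')ᵀ - W * (Q * Qᵀ) * Wᵀ = W * (Q' * Q'ᵀ - Q * Qᵀ) * Wᵀ := by
    rw [transpose_mul, Matrix.mul_sub, Matrix.sub_mul]
    simp only [Matrix.mul_assoc]
  have h := hd W hW (W * Q') hU (by rw [e, lift_norm hW]; exact hQ') (W *ᵥ u) (by linarith)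
  rw [mulVec_mulVec, (hW : Wᵀ * W = 1), one_mulVec] at h
  have h2 := abs_sub_abs_le_abs_sub (u ⬝ᵥ (target F ρ τ (Q * Qᵀ) *ᵥ u))
    (∫ p, (W *ᵥ u) ⬝ᵥ (sampleMat τ (W * Q' * (W * Q')ᵀ) (d - k) (modelMap F W p) *ᵥ (W *ᵥ u))
            ∂(gaussianVec d).prod ρ)
  rw [abs_sub_comm] at h
  linarith

lemma isCompact_frames (s k : ℕ) : IsCompact {Q : Mat s k | IsFrame Q} := by
  have h1 : IsCompact (Set.univ.pi fun _ : Fin s => Set.univ.pi fun _ : Fin k =>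
      Set.Icc (-1 : ℝ) 1) := isCompact_univ_pi fun _ => isCompact_univ_pi fun _ => isCompact_Icc
  refine h1.of_isClosed_subset ?_ fun Q hQ i _ j _ => ?_
  · exact isClosed_eq (by fun_prop : Continuous fun Q : Mat s k => Qᵀ * Q)
      continuous_const
  · have h := abs_apply_le_nrm (fun i => Q i j) i
    have h2 : nrm (fun i => Q i j) = 1 := IsFrame.nrm_col hQ j
    rw [h2] at h
    exact abs_le.1 h

theorem hasXiLower_frames {f : MvPolynomial (Fin s) ℝ} (ρ : Measure ℝ)
    [IsProbabilityMeasure ρ]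
    (hdep : ∀ Q : Mat s k, IsFrame Q →
      ¬ ∀ x, MvPolynomial.eval x f = MvPolynomial.eval ((Q * Qᵀ) *ᵥ x) f) :
    HasXiLower (fun x => MvPolynomial.eval x f) ρ {Q : Mat s k | IsFrame Q} := by
  refine (isCompact_frames s k).induction_on (p := HasXiLower (fun x => MvPolynomial.eval x f) ρ)
    ⟨1, one_pos, Eventually.of_forall fun d W _ Q hQ => hQ.elim⟩ ?_ ?_ fun Q hQ => ?_
  · rintro 𝒮 𝒯 hST ⟨c, hc, h⟩
    exact ⟨c, hc, h.mono fun d h W hW Q hQ => h W hW Q (hST hQ)⟩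
  · rintro 𝒮 𝒯 ⟨c, hc, h⟩ ⟨c', hc', h'⟩
    refine ⟨min c c', lt_min hc hc', (h.and h').mono fun d h W hW Q hQ Up hU hUp => ?_⟩
    rcases hQ with hQ | hQ
    · exact (min_le_left _ _).trans (h.1 W hW Q hQ Up hU hUp)
    · exact (min_le_right _ _).trans (h.2 W hW Q hQ Up hU hUp)
  · obtain ⟨τ, θ, hθ, hτ1, hτL, ht⟩ := exists_target_ne_zero f ρ (proj_transpose Q)
      (proj_mul_self hQ) (hdep Q hQ)
    obtain ⟨a, ha, hl⟩ := hasXiLower_near (MvPolynomial.continuous_eval f) ρ hQ hθ hτ1 hτL ht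
    refine ⟨_, mem_nhdsWithin_of_mem_nhds ?_, hl⟩
    have hc : Continuous fun Q' : Mat s k =>
        ∑ i, ∑ j, (Q' * Q'ᵀ - Q * Qᵀ) i j ^ 2 := by fun_prop
    have ho : IsOpen {Q' : Mat s k | ∑ i, ∑ j, (Q' * Q'ᵀ - Q * Qᵀ) i j ^ 2 < a ^ 2} :=
      isOpen_lt hc continuous_const
    refine mem_of_superset (ho.mem_nhds (x := Q) ?_) fun Q' hQ' => ?_
    · simpa using pow_pos ha 2
    · refine (sq_le_sq₀ (norm_nonneg _) ha.le).1 ?_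
      rw [frob_sq]
      exact le_of_lt hQ'

lemma IsStrictSubframe.spec {U : Mat d k}
    {W : Mat d s} (hW : IsFrame W) (h : IsStrictSubframe U W) :
    W * Wᵀ * U = U ∧ IsFrame (Wᵀ * U) ∧ k < s := by
  obtain ⟨hU, hlt⟩ := h
  have hWW : Wᵀ * W = 1 := hW
  have h1 : W * Wᵀ * U = U := by
    refine Matrix.ext_of_mulVec_single fun j => ?_
    obtain ⟨y, hy⟩ := hlt.le ⟨Pi.single j 1, rfl⟩
    simp only [mulVecLin_apply] at hy
    rw [← mulVec_mulVec, ← hy, mulVec_mulVec, Matrix.mul_assoc, hWW, Matrix.mul_one]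
  have h2 : IsFrame (Wᵀ * U) := by
    rw [IsFrame, transpose_mul, transpose_transpose, Matrix.mul_assoc, ← Matrix.mul_assoc W, h1]
    exact hU
  refine ⟨h1, h2, lt_of_le_of_ne h2.card_le ?_⟩
  rintro rfl
  have h3 : (Wᵀ * U) * (Wᵀ * U)ᵀ = 1 := mul_eq_one_comm.1 h2
  refine hlt.not_ge ?_
  rintro _ ⟨y, rfl⟩
  refine ⟨(Wᵀ * U)ᵀ *ᵥ y, ?_⟩
  rw [mulVecLin_apply, mulVecLin_apply, mulVec_mulVec]
  congr 1
  calc U * (Wᵀ * U)ᵀ = W * Wᵀ * U * (Wᵀ * U)ᵀ := by rw [h1]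
    _ = W * ((Wᵀ * U) * (Wᵀ * U)ᵀ) := by simp only [Matrix.mul_assoc]
    _ = W := by rw [h3, Matrix.mul_one]

/-- The second harmonic coefficients of all reduced models are bounded above and below, uniformly
in the dimension. -/
theorem exists_xiTwoNormSq_bounds (hs : 0 < s) {f : MvPolynomial (Fin s) ℝ} (ρ : Measure ℝ)
    [IsProbabilityMeasure ρ]
    (hdep : ∀ k < s, ∀ Q : Mat s k, IsFrame Q →
      ¬ ∀ x, MvPolynomial.eval x f = MvPolynomial.eval ((Q * Qᵀ) *ᵥ x) f) :
    ∃ c C : ℝ, 0 < c ∧ 0 < C ∧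
      ∀ᶠ d : ℕ in atTop, ∀ W : Mat d s, IsFrame W →
        ∀ (k : ℕ) (U : Mat d k) (Up : Mat d (d - k)),
          IsStrictSubframe U W → IsComplement U Up →
          c ≤ xiTwoNormSq (polyModel f ρ W) U Up ∧ xiTwoNormSq (polyModel f ρ W) U Up ≤ C := by
  have hlow : ∀ n ≤ s, ∃ c > 0, ∀ᶠ d : ℕ in atTop, ∀ k < n,
      ∀ W : Mat d s, IsFrame W → ∀ Q : Mat s k, IsFrame Q →
      ∀ Up : Mat d (d - k), IsComplement (W * Q) Up →
      c ≤ xiTwoNormSq (((gaussianVec d).prod ρ).map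
        (modelMap (fun x => MvPolynomial.eval x f) W)) (W * Q) Up := by
    intro n
    induction n with
    | zero => exact fun _ => ⟨1, one_pos, Eventually.of_forall fun d k hk => absurd hk (by omega)⟩
    | succ n ih =>
      intro hn
      obtain ⟨c, hc, h⟩ := ih (by omega)
      obtain ⟨c', hc', h'⟩ := hasXiLower_frames ρ (hdep n (by omega))
      refine ⟨min c c', lt_min hc hc', (h.and h').mono fun d h k hk W hW Q hQ Up hUp => ?_⟩
      rcases Nat.lt_succ_iff_lt_or_eq.1 hk with hk | rfl
      · exact (min_le_left _ _).trans (h.1 k hk W hW Q hQ Up hUp)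
      · exact (min_le_right _ _).trans (h.2 W hW Q hQ Up (hW.mul hQ) hUp)
  obtain ⟨c, hc, h⟩ := hlow s le_rfl
  refine ⟨c, (1 + s) ^ 2 * (3 * s ^ 2 * (2 * (64 * (s + 1)) ^ 2 * (2 * s + 3)) + 3 * s ^ 2), hc,
    by positivity, (h.and (eventually_gt_atTop (2 * s))).mono fun d hd W hW k U Up hU hUp => ?_⟩
  obtain ⟨h1, h2, hk⟩ := hU.spec hW
  rw [polyModel_eq_map (by omega)]
  refine ⟨?_, xiTwoNormSq_le hd.2 (MvPolynomial.continuous_eval f).measurable ρ hW hU.1 h1 hk.le hUp⟩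
  have e : W * (Wᵀ * U) = U := by rw [← Matrix.mul_assoc, h1]
  have h3 := hd.1 k hk W hW (Wᵀ * U) h2 Up (e.symm ▸ hUp)
  rwa [e] at h3

end SphericalMIM

end

theorem mainTheorem8 (s : ℕ) (f : MvPolynomial (Fin s) ℝ) (hf : ∀ a : ℝ, f ≠ MvPolynomial.C a)
    (ρ : Measure ℝ) (hρ : IsProbabilityMeasure ρ)
    (hres : ∀ᶠ d : ℕ in atTop, ∀ W : Matrix (Fin d) (Fin s) ℝ, SphericalMIM.IsFrame W →
      ∀ (k : ℕ) (U : Matrix (Fin d) (Fin k) ℝ) (Up : Matrix (Fin d) (Fin (d - k)) ℝ),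
        SphericalMIM.IsStrictSubframe U W → SphericalMIM.IsComplement U Up →
        ¬ IndepFun (SphericalMIM.reducedResponse U) (SphericalMIM.reducedInput U Up)
          (SphericalMIM.polyModel f ρ W)) :
    (∃ c C : ℝ, 0 < c ∧ 0 < C ∧
      ∀ᶠ d : ℕ in atTop, ∀ W : Matrix (Fin d) (Fin s) ℝ, SphericalMIM.IsFrame W →
        ∀ (k : ℕ) (U : Matrix (Fin d) (Fin k) ℝ) (Up : Matrix (Fin d) (Fin (d - k)) ℝ),
          SphericalMIM.IsStrictSubframe U W → SphericalMIM.IsComplement U Up →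
          c ≤ SphericalMIM.xiTwoNormSq (SphericalMIM.polyModel f ρ W) U Up ∧
          SphericalMIM.xiTwoNormSq (SphericalMIM.polyModel f ρ W) U Up ≤ C) ∧
    (∀ δ A : ℝ, 0 < δ → 0 < A →
      ∃ (T m N : ℕ) (σ : ℕ → ℕ) (B κ c c₁ C₁ : ℝ),
        T ≤ s ∧ 0 < N ∧ 0 < κ ∧ 0 < c ∧ 0 < c₁ ∧
        σ 0 = 0 ∧ σ T = s ∧ (∀ t < T, σ t < σ (t + 1)) ∧
        ∀ᶠ d : ℕ in atTop,
          ∃ feat : (t : ℕ) → Fin m → ℝ → SphericalMIM.Vec (σ t) → ℝ,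
            (∀ t < T, SphericalMIM.IsAdmissible B (feat t)) ∧
            (∀ W : Matrix (Fin d) (Fin s) ℝ, SphericalMIM.IsFrame W →
              SphericalMIM.dataLaw T (N * d) (SphericalMIM.polyModel f ρ W)
                  {data | ¬ ((∃ U : (t : ℕ) → Matrix (Fin d) (Fin (σ t)) ℝ,
                        SphericalMIM.IsUnfoldingRun feat data U) ∧
                      ∀ U : (t : ℕ) → Matrix (Fin d) (Fin (σ t)) ℝ,
                        SphericalMIM.IsUnfoldingRun feat data U →
                          SphericalMIM.frameDist (U T) W ≤ δ)}
                ≤ ENNReal.ofReal (Real.exp (-(d : ℝ) ^ c)) ∧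
              ((SphericalMIM.dataLaw T (N * d) (SphericalMIM.polyModel f ρ W)).prod
                  (SphericalMIM.initLaw d T σ))
                  {ω | ¬ SphericalMIM.frameDist
                      (Matrix.transpose (Matrix.of (SphericalMIM.Timed.unfolding
                        ⌈κ * Real.log d⌉₊ feat ω.1 ω.2 T le_rfl).val)) W ≤ δ}
                ≤ ENNReal.ofReal ((d : ℝ) ^ (-A))) ∧
            ∀ (data : Fin T → Fin (N * d) → ℝ × SphericalMIM.Vec d)
              (init : (t : Fin T) → Fin (σ (t + 1) - σ t) → SphericalMIM.Vec d),
              c₁ * (d : ℝ) ^ 2 * Real.log d ≤ ((SphericalMIM.Timed.unfolding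
                ⌈κ * Real.log d⌉₊ feat data init T le_rfl).cost : ℝ) ∧
              ((SphericalMIM.Timed.unfolding
                ⌈κ * Real.log d⌉₊ feat data init T le_rfl).cost : ℝ) ≤
                C₁ * (d : ℝ) ^ 2 * Real.log d) := by
  have hs : 0 < s := by
    rcases Nat.eq_zero_or_pos s with rfl | h
    · exact absurd (MvPolynomial.eq_C_of_isEmpty f) (hf _)
    · exact h
  refine ⟨SphericalMIM.exists_xiTwoNormSq_bounds hs ρ fun k hk Q hQ =>
    SphericalMIM.link_depends hres hk hQ, fun δ A hδ hA =>
    SphericalMIM.exists_unfolding_algorithm hs ρ ?_ hδ hA⟩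
  rintro k P hk ⟨Q, hQ, hPQ⟩
  rw [hPQ]
  exact SphericalMIM.link_depends hres hk hQ
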